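/- **Setting.** Let $L\subset\mathbb R^3$ be an oriented straight line with a base point (the origin), with cylindrical coordinates $(\rho,\varphi,\lambda)$, where $\lambda$ is the coordinate along $L$. The fibers are the half-planes $\{\varphi=\mathrm{const}\}$. A knot $K\subset\mathbb R^3-L$ is a smoothly embedded closed curve, and $m=\mathrm{lk}(K,L)$. For an ordered pair $(p,q)$ of distinct points of $K$ in one fiber (an oriented fiber secant), let $\tau(p,q)$ be the angle between $L$ and the line directed from $p$ to $q$. Let $\rho(p,q)\in\mathbb R$ be the signed distance from the origin to this directed line, positive for lines parallel to the oriented axis. The trace graph $\mathrm{TG}(K)$ is the set of all points $(\tau(p,q),\varphi,\rho(p,q))$ in the oriented thickened torus $S^1_\tau\times S^1_\varphi\times\mathbb R$. The trace graph of a tangle contained in a sector of half-planes is defined in the same way. In the projection of $K$ along the secant from $p$ to $q$, the point $p$ is the overcrossing. The sign of $(p,q)$ is the sign of this crossing, and arcs of $\mathrm{TG}(K)$ are oriented so that $\tau$ increases where the sign is $+1$ and decreases where it is $-1$. The marking of $(p,q)$ is the class in $\mathbb Z_{|m|}$ (with $\mathbb Z_0=\mathbb Z$) of the number of turns around $L$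 that $K$ makes on its way from $q$ to $p$. Project $\mathrm{TG}(K)$ to $S^1_\tau\times S^1_\varphi$, the larger third coordinate being the over one. For classes $a\ne b$, $W^u_{a,b}(K)$ is the sum of the signs of all crossings of an arc marked $a$ with an arc marked $b$, and $W^o_{a,b}(K)$ is the sum over those of them in which the arc marked $a$ is the over one. $W^c_{a,a}(K)$ is the sum of the signs of all crossings of arcs marked $a$ with arcs marked $a$. (For $m\neq\pm1$ and nonzero classes these are the usual writhes; here all classes and all $m$ are allowed.) $K$ is in general position if it meets each fiber in finitely many points and the projection of $\mathrm{TG}(K)$ has finitely many crossings, all of which are transversal double crossings away from the hanging, triple and tangent vertices. For a braid word $\beta$ on $N$ strands and $0\le k\le N/2$, the plat diagram $(\beta,k)$ is the following diagram around $L$, drawn in the plane orthogonal to $L$ and read in the direction of increasing $\varphi$. First come $k$ local minima of $\varphi$, creating the strands in the positions $(1,2),\dots,(2k-1,2k)$. Then come the crossings of $\beta$. Then come $k$ local maxima closing the same pairs of positions. The remaining $N-2k$ strands go on around $L$ to their beginning. The usual plat of a $(2n+1)$-braid is $k=n$, and $k=0$ gives the closed braid. **Lemma.** There exist a constant $C$,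 a program for a machine with integer arrays (operations: addition, subtraction, comparison, reading and storing, each at unit cost), and, for each $N$, an elementary tangle in a sector of half-planes for each possible crossing $\sigma_i^{\pm1}$ of $N$ strands and for each possible local extremum, whose diagram is exactly this crossing or extremum, such that the following holds. The trace graph of the tangle of a crossing has exactly $2(N-2)$ triple vertices, and that of an extremum has none. Let $N=2n+1$ or $N=2n$, let $\beta$ be a braid word on $N$ strands of length $l\ge1$, and let $0\le k\le N/2$ be such that the plat diagram $(\beta,k)$ is the diagram of a knot. Then: 1. gluing the elementary tangles of the successive crossings and extrema of the diagram, in equal sectors around $L$, yields a smooth knot $K_\beta\subset\mathbb R^3-L$ in general position; 2. $\mathrm{TG}(K_\beta)$ is obtained by gluing the trace graphs of these tangles (the elementary blocks) in the same order, one block per crossing or local extremum; 3. given $(N,k,\beta)$, the program computes $|m|$ and all writhes $W^u_{a,b}(K_\beta)$, $W^o_{a,b}(K_\beta)$ ($a\neq b$) and $W^c_{a,a}(K_\beta)$ in at most $C\,l\,n^2$ steps, storing only integers (and indices) of absolute value at most $C\,l\,n^2$. -/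

import Mathlib

open scoped ContDiff

noncomputable section

/-! ## Knots in the complement of the axis, fiber secants and the trace graph

The axis `L` is the third coordinate axis of `ℝ³`, and points off `L` are written in cylindrical
coordinates `(θ, ρ, ℓ)`, standing for `(ρ cos θ, ρ sin θ, ℓ)` with `0 < ρ`.  The fibers of
`ℝ³ - L → S¹` are the half-planes `θ = const`, with coordinates `(ρ, ℓ)`. -/

/-- An oriented smooth knot in `ℝ³ - L`: a regular smooth closed curve of period `1`, injective
modulo the period, in cylindrical coordinates (`theta` is a continuous lift of the angle).
The integer `lk` is the linking number of the knot with the axis, i.e. the number of turns. -/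
structure AxisKnot where
  rho : ℝ → ℝ
  ell : ℝ → ℝ
  theta : ℝ → ℝ
  lk : ℤ
  smooth_rho : ContDiff ℝ ∞ rho
  smooth_ell : ContDiff ℝ ∞ ell
  smooth_theta : ContDiff ℝ ∞ theta
  rho_pos : ∀ t, 0 < rho t
  rho_period : ∀ t, rho (t + 1) = rho t
  ell_period : ∀ t, ell (t + 1) = ell t
  theta_period : ∀ t, theta (t + 1) = theta t + 2 * Real.pi * lk
  regular : ∀ t, deriv rho t ≠ 0 ∨ deriv ell t ≠ 0 ∨ deriv theta t ≠ 0
  injective : ∀ s t, rho s = rho t → ell s = ell t →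
    (theta s : Real.Angle) = (theta t : Real.Angle) → ∃ z : ℤ, s = t + z

/-- For points `P`, `Q` of a half-plane, given by their coordinates `(ρ, ℓ)`: the angle between the
oriented axis and the line passing first through `P` and then through `Q`. -/
def secantAngle (P Q : ℝ × ℝ) : Real.Angle :=
  ((Complex.arg ⟨Q.2 - P.2, Q.1 - P.1⟩ : ℝ) : Real.Angle)

/-- The signed distance from the origin of the axis to the oriented line through `P` and then `Q`;
it is `ρ` for a line parallel to the oriented axis at distance `ρ` from it, and changes sign when
the line is reversed. -/
def secantHeight (P Q : ℝ × ℝ) : ℝ :=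
  ((Q.2 - P.2) * P.1 - (Q.1 - P.1) * P.2) / Real.sqrt ((Q.2 - P.2) ^ 2 + (Q.1 - P.1) ^ 2)

namespace AxisKnot

variable (K : AxisKnot)

/-- The point of the half-plane `θ = theta t` in which the knot is at time `t`. -/
def planePt (t : ℝ) : ℝ × ℝ := (K.rho t, K.ell t)

/-- The point of `ℝ³` in which the knot is at time `t`. -/
def pt (t : ℝ) : Fin 3 → ℝ :=
  ![K.rho t * Real.cos (K.theta t), K.rho t * Real.sin (K.theta t), K.ell t]

/-- The knot as a set, in cylindrical coordinates `(θ, ρ, ℓ)`. -/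
def carrier : Set (Real.Angle × ℝ × ℝ) :=
  Set.range fun t => ((K.theta t : Real.Angle), K.rho t, K.ell t)

/-- Ordered pairs of distinct points of the knot in a common fiber, i.e. oriented fiber secants;
the points of the knot are represented by their parameters in `[0, 1)`. -/
def secants : Set (ℝ × ℝ) :=
  {A | A.1 ∈ Set.Ico (0 : ℝ) 1 ∧ A.2 ∈ Set.Ico (0 : ℝ) 1 ∧ A.1 ≠ A.2 ∧
    (K.theta A.1 : Real.Angle) = (K.theta A.2 : Real.Angle)}

/-- The coordinate `τ` of a secant. -/
def tau (A : ℝ × ℝ) : Real.Angle := secantAngle (K.planePt A.1) (K.planePt A.2)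

/-- The coordinate `φ` of a secant, the angle of the fiber that contains it. -/
def phi (A : ℝ × ℝ) : Real.Angle := (K.theta A.1 : Real.Angle)

/-- The third coordinate of a secant. -/
def height (A : ℝ × ℝ) : ℝ := secantHeight (K.planePt A.1) (K.planePt A.2)

/-- The trace graph, a subset of the thickened torus with coordinates `(τ, φ, height)`. -/
def traceGraph : Set (Real.Angle × Real.Angle × ℝ) :=
  (fun A => (K.tau A, K.phi A, K.height A)) '' K.secants

/-- The homological marking of the secant from `p` to `q`: in the projection along the secant `p`
is the overcrossing and `q` the undercrossing, and the marking is the class modulo `|lk|` of the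
number of turns around the axis that the knot makes on its way from `q` to `p`. -/
def marking (A : ℝ × ℝ) : ZMod K.lk.natAbs :=
  ((round ((K.theta A.1 - K.theta A.2) / (2 * Real.pi)) : ℤ) : ZMod K.lk.natAbs)

/-- The sign of the crossing into which `p` and `q` are projected along the secant, i.e. the sign of
the determinant of the tangent vector at `p`, the tangent vector at `q`, and `p - q`.  It is `0`
when the secant and the two tangents are coplanar (a tangent vertex). -/
def secantSign (A : ℝ × ℝ) : ℤ :=
  (SignType.sign
    (Matrix.det (Matrix.of ![deriv K.pt A.1, deriv K.pt A.2, K.pt A.1 - K.pt A.2])) : ℤ)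

/-- The derivative `dτ/dφ` along the arc of the trace graph through a secant both of whose end
points are points where the knot is transversal to the fibers. -/
def slope (A : ℝ × ℝ) : ℝ :=
  let dRho := deriv K.rho A.2 / deriv K.theta A.2 - deriv K.rho A.1 / deriv K.theta A.1
  let dEll := deriv K.ell A.2 / deriv K.theta A.2 - deriv K.ell A.1 / deriv K.theta A.1
  let x := K.ell A.2 - K.ell A.1
  let y := K.rho A.2 - K.rho A.1
  (x * dRho - y * dEll) / (x ^ 2 + y ^ 2)

/-- The orientation of the arc of the trace graph through a secant.  Arcs are oriented so that `τ`
increases if `secantSign` is `1` and decreases if it is `-1`; hence the oriented direction of the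
arc in the `(τ, φ)`-torus is `arcDirection • (slope, 1)`. -/
def arcDirection (A : ℝ × ℝ) : ℤ := K.secantSign A * (SignType.sign (K.slope A) : ℤ)

/-- The crossings of the projection of the trace graph to the `(τ, φ)`-torus, as pairs
`(overcrossing secant, undercrossing secant)`: parallel secants in a common fiber, the first of
which is the higher one. -/
def crossings : Set ((ℝ × ℝ) × (ℝ × ℝ)) :=
  {c | c.1 ∈ K.secants ∧ c.2 ∈ K.secants ∧ K.phi c.1 = K.phi c.2 ∧ K.tau c.1 = K.tau c.2 ∧
    K.height c.2 < K.height c.1}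

/-- The usual sign of a crossing of the oriented arcs in the oriented `(τ, φ)`-torus: the sign of
the determinant of (direction of the over arc, direction of the under arc). -/
def crossingSign (c : (ℝ × ℝ) × (ℝ × ℝ)) : ℤ :=
  K.arcDirection c.1 * K.arcDirection c.2 * (SignType.sign (K.slope c.1 - K.slope c.2) : ℤ)

/-- The unordered writhe (for `a ≠ b`). -/
def unorderedWrithe (a b : ZMod K.lk.natAbs) : ℤ :=
  ∑ᶠ c ∈ {c | c ∈ K.crossings ∧ ((K.marking c.1 = a ∧ K.marking c.2 = b) ∨
    (K.marking c.1 = b ∧ K.marking c.2 = a))}, K.crossingSign c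

/-- The ordered writhe (for `a ≠ b`): the trace `a` overcrosses the trace `b`. -/
def orderedWrithe (a b : ZMod K.lk.natAbs) : ℤ :=
  ∑ᶠ c ∈ {c | c ∈ K.crossings ∧ K.marking c.1 = a ∧ K.marking c.2 = b}, K.crossingSign c

/-- The coordinated writhe. -/
def coordinatedWrithe (a : ZMod K.lk.natAbs) : ℤ :=
  ∑ᶠ c ∈ {c | c ∈ K.crossings ∧ K.marking c.1 = a ∧ K.marking c.2 = a}, K.crossingSign c

/-- General position of the knot, as needed for the trace graph and its writhes: the knot meets each
fiber in finitely many points, the projected trace graph has finitely many crossings, and each of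
them is a transversal double crossing away from the vertices of the trace graph.  (A third secant
over the same point of the torus would give a triple point of the projection, or a trisecant.) -/
structure InGeneralPosition : Prop where
  finite_fibers : ∀ φ : Real.Angle, {t ∈ Set.Ico (0 : ℝ) 1 | (K.theta t : Real.Angle) = φ}.Finite
  finite_crossings : K.crossings.Finite
  transversal_to_fibers : ∀ c ∈ K.crossings, deriv K.theta c.1.1 ≠ 0 ∧ deriv K.theta c.1.2 ≠ 0 ∧
    deriv K.theta c.2.1 ≠ 0 ∧ deriv K.theta c.2.2 ≠ 0
  not_tangent : ∀ c ∈ K.crossings, K.secantSign c.1 ≠ 0 ∧ K.secantSign c.2 ≠ 0 ∧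
    K.slope c.1 ≠ 0 ∧ K.slope c.2 ≠ 0
  transversal : ∀ c ∈ K.crossings, K.slope c.1 ≠ K.slope c.2
  double : ∀ c ∈ K.crossings, ∀ A ∈ K.secants, K.phi A = K.phi c.1 → K.tau A = K.tau c.1 →
    A = c.1 ∨ A = c.2

end AxisKnot

/-! ## Elementary tangles and their trace graphs

A tangle is a subset of a sector `0 ≤ x ≤ 1` of half-planes, in coordinates `(x, ρ, ℓ)`.  Its diagram
is its projection along the axis, so that the strands are ordered by `ρ` and the coordinate `ℓ`
tells over from under.  Positions are counted from `0`, from the axis outwards. -/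

/-- The parts of a plat diagram with one crossing or one local extremum each.
`birth c`: a local minimum of the angle, after which the positions `2c, 2c+1` are occupied
(all positions from `2c+2` on are occupied throughout);
`cross i s`: the positions `i, i+1` cross, positively if `s = true` and negatively otherwise;
`death c`: a local maximum joining the positions `2c, 2c+1`. -/
inductive PlatLetter : Type
  | birth (c : ℕ)
  | cross (i : ℕ) (s : Bool)
  | death (c : ℕ)

/-- `N` strands, monotonic in `x`, whose diagram has exactly one crossing, formed by the strands
that start at the positions `i` and `i + 1`. The crossing is positive if `s = true`. -/
def IsCrossTangle (N i : ℕ) (s : Bool) (E : Set (ℝ × ℝ × ℝ)) : Prop :=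
  ∃ r h : ℕ → ℝ → ℝ,
    (∀ a < N, ContDiff ℝ ∞ (r a) ∧ ContDiff ℝ ∞ (h a)) ∧
    E = {q | ∃ a < N, ∃ x ∈ Set.Icc (0 : ℝ) 1, q = (x, r a x, h a x)} ∧
    (∀ a < N, ∀ x ∈ Set.Icc (0 : ℝ) 1, 0 < r a x) ∧
    (∀ a b, a < b → b < N → ¬(a = i ∧ b = i + 1) → ∀ x ∈ Set.Icc (0 : ℝ) 1, r a x < r b x) ∧
    ∃ x₀ ∈ Set.Ioo (0 : ℝ) 1,
      (∀ x ∈ Set.Ico 0 x₀, r i x < r (i + 1) x) ∧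
      r i x₀ = r (i + 1) x₀ ∧
      (∀ x ∈ Set.Ioc x₀ 1, r (i + 1) x < r i x) ∧
      deriv (r i) x₀ ≠ deriv (r (i + 1)) x₀ ∧
      (if s = true then h (i + 1) x₀ < h i x₀ else h i x₀ < h (i + 1) x₀)

/-- A tangle without crossings, consisting of strands in the positions `a` with `2c+2 ≤ a < N` and
of an arc that has a single nondegenerate minimum of `x` and ends in the positions `2c, 2c+1`. -/
def IsBirthTangle (N c : ℕ) (E : Set (ℝ × ℝ × ℝ)) : Prop :=
  ∃ (r h : ℕ → ℝ → ℝ) (X R H : ℝ → ℝ),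
    (∀ a, 2 * c + 2 ≤ a → a < N → ContDiff ℝ ∞ (r a) ∧ ContDiff ℝ ∞ (h a)) ∧
    ContDiff ℝ ∞ X ∧ ContDiff ℝ ∞ R ∧ ContDiff ℝ ∞ H ∧
    E = {q | ∃ a, 2 * c + 2 ≤ a ∧ a < N ∧ ∃ x ∈ Set.Icc (0 : ℝ) 1, q = (x, r a x, h a x)} ∪
        {q | ∃ u ∈ Set.Icc (-1 : ℝ) 1, q = (X u, R u, H u)} ∧
    (∀ a, 2 * c + 2 ≤ a → a < N → ∀ x ∈ Set.Icc (0 : ℝ) 1, 0 < r a x) ∧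
    (∀ a b, 2 * c + 2 ≤ a → a < b → b < N → ∀ x ∈ Set.Icc (0 : ℝ) 1, r a x < r b x) ∧
    X (-1) = 1 ∧ X 1 = 1 ∧ 0 < X 0 ∧
    (∀ u ∈ Set.Ico (-1 : ℝ) 0, deriv X u < 0) ∧
    (∀ u ∈ Set.Ioc (0 : ℝ) 1, 0 < deriv X u) ∧
    0 < iteratedDeriv 2 X 0 ∧ 0 < deriv R 0 ∧
    (∀ u ∈ Set.Icc (-1 : ℝ) 1, 0 < R u) ∧
    (∀ u ∈ Set.Icc (-1 : ℝ) 1, ∀ v ∈ Set.Icc (-1 : ℝ) 1, u < v → X u = X v → R u < R v) ∧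
    (∀ a, 2 * c + 2 ≤ a → a < N → ∀ u ∈ Set.Icc (-1 : ℝ) 1, R u < r a (X u))

/-- The mirror image of a birth tangle under `x ↦ 1 - x`. -/
def IsDeathTangle (N c : ℕ) (E : Set (ℝ × ℝ × ℝ)) : Prop :=
  IsBirthTangle N c ((fun q => (1 - q.1, q.2)) '' E)

/-- The letters that can occur in a diagram with at most `N` strands. -/
def PlatLetter.Valid (N : ℕ) : PlatLetter → Prop
  | .birth c => 2 * c + 2 ≤ N
  | .cross i _ => i + 2 ≤ N
  | .death c => 2 * c + 2 ≤ N

/-- The diagram of the tangle `E` is the elementary diagram described by the letter. -/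
def IsElementaryTangle (N : ℕ) : PlatLetter → Set (ℝ × ℝ × ℝ) → Prop
  | .birth c => IsBirthTangle N c
  | .cross i s => IsCrossTangle N i s
  | .death c => IsDeathTangle N c

/-- The trace graph of a tangle, with coordinates `(τ, x, height)`. -/
def traceBlock (E : Set (ℝ × ℝ × ℝ)) : Set (Real.Angle × ℝ × ℝ) :=
  {v | ∃ p ∈ E, ∃ q ∈ E, p ≠ q ∧ p.1 = q.1 ∧
    v = (secantAngle p.2 q.2, p.1, secantHeight p.2 q.2)}

/-- The triple vertices of the trace graph of a tangle: the points given by fiber trisecants. -/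
def tripleVertices (E : Set (ℝ × ℝ × ℝ)) : Set (Real.Angle × ℝ × ℝ) :=
  {v | ∃ p ∈ E, ∃ q ∈ E, ∃ r ∈ E, p ≠ q ∧ q ≠ r ∧ p ≠ r ∧ p.1 = q.1 ∧ q.1 = r.1 ∧
    secantAngle p.2 q.2 = secantAngle q.2 r.2 ∧
    v = (secantAngle p.2 q.2, p.1, secantHeight p.2 q.2)}

/-- The angle of the point `x` of the sector number `j`, if `S¹` is divided into `M` equal sectors. -/
def sectorAngle (M j : ℕ) (x : ℝ) : Real.Angle :=
  ((2 * Real.pi * ((j + x) / M) : ℝ) : Real.Angle)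

/-- Put the tangles of a list into consecutive sectors around the axis; the result is given in
cylindrical coordinates `(θ, ρ, ℓ)`. -/
def glueTangles (D : List (Set (ℝ × ℝ × ℝ))) : Set (Real.Angle × ℝ × ℝ) :=
  {P | ∃ j : Fin D.length, ∃ q ∈ D.get j, P = (sectorAngle D.length j q.1, q.2)}

/-- Put trace graphs of tangles into consecutive sectors of the thickened torus. -/
def glueBlocks (D : List (Set (Real.Angle × ℝ × ℝ))) : Set (Real.Angle × Real.Angle × ℝ) :=
  {P | ∃ j : Fin D.length, ∃ v ∈ D.get j, P = (v.1, sectorAngle D.length j v.2.1, v.2.2)}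

/-! ## Plat diagrams of braids -/

/-- The plat diagram with `k` minima and `k` maxima of a braid word: `k` minima create the positions
`2c, 2c+1` for `c < k`, then the crossings of the braid follow, then `k` maxima close the same
positions, and the strands in the remaining positions go on around the axis to their beginning.
In a braid word `(i, s)` is the generator crossing the positions `i, i+1`, or its inverse. -/
def platLetters (k : ℕ) (w : List (ℕ × Bool)) : List PlatLetter :=
  (List.range k).reverse.map PlatLetter.birth ++ w.map (fun g => PlatLetter.cross g.1 g.2) ++
    (List.range k).map PlatLetter.death

/-- The permutation of a braid word: the position where a strand ends, in terms of its beginning. -/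
def braidPerm : List (ℕ × Bool) → Equiv.Perm ℕ
  | [] => 1
  | g :: w => braidPerm w * Equiv.swap g.1 (g.1 + 1)

/-- The strands beginning in `a` and `b` are joined by a minimum, by a maximum, or around the axis. -/
def PlatJoined (k : ℕ) (w : List (ℕ × Bool)) (a b : ℕ) : Prop :=
  (∃ c < k, a = 2 * c ∧ b = 2 * c + 1) ∨
  (∃ c < k, braidPerm w a = 2 * c ∧ braidPerm w b = 2 * c + 1) ∨
  (2 * k ≤ braidPerm w a ∧ b = braidPerm w a)

/-- The plat diagram of the braid word on `N` strands has a single component. -/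
def IsKnotPlat (N k : ℕ) (w : List (ℕ × Bool)) : Prop :=
  ∀ a < N, ∀ b < N, Relation.EqvGen (PlatJoined k w) a b

/-! ## A machine model with a step count

Programs over two-dimensional integer arrays with unit cost for each operation.  The only arithmetic
operations are addition and subtraction, and every number that is stored or used as the index of a
store has to be at most `B` in absolute value, so that the words of the machine have `O(log B)`
bits. -/

/-- A memory: the entries of the arrays with names `0, 1, 2, …`. -/
abbrev Memory := ℕ → ℤ → ℤ → ℤ

/-- Integer expressions. -/
inductive IntExpr : Type
  | const (z : ℤ)
  | read (name : ℕ) (i j : IntExpr)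
  | plus (e f : IntExpr)
  | minus (e f : IntExpr)

/-- The value of an expression. -/
def IntExpr.value (σ : Memory) : IntExpr → ℤ
  | .const z => z
  | .read name i j => σ name (i.value σ) (j.value σ)
  | .plus e f => e.value σ + f.value σ
  | .minus e f => e.value σ - f.value σ

/-- The number of operations needed to evaluate an expression. -/
def IntExpr.cost : IntExpr → ℕ
  | .const _ => 1
  | .read _ i j => i.cost + j.cost + 1
  | .plus e f => e.cost + f.cost + 1
  | .minus e f => e.cost + f.cost + 1

/-- Programs; `branch e f` and `loop e f` test whether `e < f`. -/
inductive Program : Type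
  | skip
  | store (name : ℕ) (i j e : IntExpr)
  | seq (p q : Program)
  | branch (e f : IntExpr) (p q : Program)
  | loop (e f : IntExpr) (p : Program)

/-- The memory after the entry `(i, j)` of the array `name` has been set to `v`. -/
def Memory.write (σ : Memory) (name : ℕ) (i j v : ℤ) : Memory :=
  fun a x y => if a = name ∧ x = i ∧ y = j then v else σ a x y

/-- `Runs B p σ T σ'`: the program `p`, started with the memory `σ`, halts after exactly `T` steps
with the memory `σ'`, and respects the bound `B` on stored numbers and on their indices. -/
inductive Runs (B : ℤ) : Program → Memory → ℕ → Memory → Prop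
  | skip (σ : Memory) : Runs B .skip σ 1 σ
  | store (σ : Memory) (name : ℕ) (i j e : IntExpr)
      (hi : |i.value σ| ≤ B) (hj : |j.value σ| ≤ B) (he : |e.value σ| ≤ B) :
      Runs B (.store name i j e) σ (i.cost + j.cost + e.cost + 1)
        (σ.write name (i.value σ) (j.value σ) (e.value σ))
  | seq {p q : Program} {σ σ₁ σ₂ : Memory} {T₁ T₂ : ℕ}
      (hp : Runs B p σ T₁ σ₁) (hq : Runs B q σ₁ T₂ σ₂) : Runs B (.seq p q) σ (T₁ + T₂) σ₂
  | branch_true {e f : IntExpr} {p q : Program} {σ σ₁ : Memory} {T : ℕ}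
      (h : e.value σ < f.value σ) (hp : Runs B p σ T σ₁) :
      Runs B (.branch e f p q) σ (e.cost + f.cost + 1 + T) σ₁
  | branch_false {e f : IntExpr} {p q : Program} {σ σ₁ : Memory} {T : ℕ}
      (h : ¬ e.value σ < f.value σ) (hq : Runs B q σ T σ₁) :
      Runs B (.branch e f p q) σ (e.cost + f.cost + 1 + T) σ₁
  | loop_true {e f : IntExpr} {p : Program} {σ σ₁ σ₂ : Memory} {T₁ T₂ : ℕ}
      (h : e.value σ < f.value σ) (hp : Runs B p σ T₁ σ₁) (hl : Runs B (.loop e f p) σ₁ T₂ σ₂) :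
      Runs B (.loop e f p) σ (e.cost + f.cost + 1 + T₁ + T₂) σ₂
  | loop_false {e f : IntExpr} {p : Program} {σ : Memory} (h : ¬ e.value σ < f.value σ) :
      Runs B (.loop e f p) σ (e.cost + f.cost + 1) σ

/-- The code of a braid generator: `i + 1` for the positive crossing of the positions `i, i + 1`, and
`-(i + 1)` for the negative one. -/
def generatorCode (g : ℕ × Bool) : ℤ := if g.2 = true then (g.1 : ℤ) + 1 else -((g.1 : ℤ) + 1)

/-- The initial memory for a plat diagram: in the array `0`, the row `0` holds the number of strands,
the number of maxima and the length of the braid word, the row `1` holds the braid word, and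
everything else is `0`. -/
def platInput (N k : ℕ) (w : List (ℕ × Bool)) : Memory := fun name x y =>
  if name = 0 ∧ x = 0 ∧ y = 0 then (N : ℤ)
  else if name = 0 ∧ x = 0 ∧ y = 1 then (k : ℤ)
  else if name = 0 ∧ x = 0 ∧ y = 2 then (w.length : ℤ)
  else if name = 0 ∧ x = 1 ∧ 0 ≤ y then (w.map generatorCode).getD y.toNat 0
  else 0

/-- The memory holds the modulus `|lk|` and all writhes of the knot: the unordered, ordered and
coordinated writhes are in the arrays `1`, `2` and `3`, in the places of the standard
representatives of the classes (all integers if `lk = 0`). -/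
def HoldsWrithes (K : AxisKnot) (σ : Memory) : Prop :=
  σ 4 0 0 = |K.lk| ∧
  (∀ a b : ℤ, (K.lk ≠ 0 → (0 ≤ a ∧ a < |K.lk|) ∧ (0 ≤ b ∧ b < |K.lk|)) → a ≠ b →
    σ 1 a b = K.unorderedWrithe a b ∧ σ 2 a b = K.orderedWrithe a b) ∧
  (∀ a : ℤ, (K.lk ≠ 0 → 0 ≤ a ∧ a < |K.lk|) → σ 3 a a = K.coordinatedWrithe a)

end

noncomputable section

namespace PlatTrace

open Set Filter Topology

section

/-! ## A smooth step function and concatenations of smooth maps -/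

/-- A smooth monotone step from `0` (on `x ≤ 1/4`) to `1` (on `3/4 ≤ x`). -/
def smoothStep (x : ℝ) : ℝ := Real.smoothTransition (2 * x - 1 / 2)

theorem contDiff_smoothStep : ContDiff ℝ ∞ smoothStep :=
  (Real.smoothTransition.contDiff (n := ⊤)).comp (by fun_prop)

theorem differentiable_smoothStep : Differentiable ℝ smoothStep :=
  contDiff_smoothStep.differentiable (by simp)

theorem smoothStep_of_le {x : ℝ} (h : x ≤ 1 / 4) : smoothStep x = 0 :=
  Real.smoothTransition.zero_of_nonpos (by linarith)

theorem smoothStep_of_ge {x : ℝ} (h : 3 / 4 ≤ x) : smoothStep x = 1 :=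
  Real.smoothTransition.one_of_one_le (by linarith)

theorem smoothStep_nonneg (x : ℝ) : 0 ≤ smoothStep x := Real.smoothTransition.nonneg _

theorem smoothStep_le_one (x : ℝ) : smoothStep x ≤ 1 := Real.smoothTransition.le_one _

theorem smoothStep_one_sub (x : ℝ) : smoothStep (1 - x) = 1 - smoothStep x := by
  have h := Real.smoothTransition.pos_denom (2 * x - 1 / 2)
  have e : 2 * (1 - x) - 1 / 2 = 1 - (2 * x - 1 / 2) := by ring
  unfold smoothStep Real.smoothTransition
  rw [e, sub_sub_cancel, eq_sub_iff_add_eq, add_comm (expNegInvGlue (1 - (2 * x - 1 / 2))),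
    ← add_div, add_comm (expNegInvGlue (1 - (2 * x - 1 / 2))), div_self h.ne']

theorem deriv_expNegInvGlue_pos {x : ℝ} (h : 0 < x) : 0 < deriv expNegInvGlue x := by
  have h1 : expNegInvGlue =ᶠ[𝓝 x] fun y => Real.exp (-y⁻¹) := by
    filter_upwards [lt_mem_nhds h] with y hy
    simp [expNegInvGlue, not_le.2 hy]
  have h2 : HasDerivAt (fun y : ℝ => Real.exp (-y⁻¹)) (Real.exp (-x⁻¹) * -(-(x ^ 2)⁻¹)) x :=
    ((hasDerivAt_inv h.ne').neg).exp
  rw [h1.deriv_eq, h2.deriv]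
  have : 0 < (x ^ 2)⁻¹ := by positivity
  have := Real.exp_pos (-x⁻¹)
  rw [neg_neg]
  positivity

theorem deriv_smoothTransition_pos {x : ℝ} (h0 : 0 < x) (h1 : x < 1) :
    0 < deriv Real.smoothTransition x := by
  have hd : ∀ y, HasDerivAt expNegInvGlue (deriv expNegInvGlue y) y := fun y =>
    ((expNegInvGlue.contDiff (n := 1)).differentiable (by simp) y).hasDerivAt
  have hx := hd x
  have hy : HasDerivAt (fun y => expNegInvGlue (1 - y)) (-deriv expNegInvGlue (1 - x)) x :=
    (hd (1 - x)).comp_const_sub 1 x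
  have key := hx.div (hx.add hy) (Real.smoothTransition.pos_denom x).ne'
  have e : deriv Real.smoothTransition x = _ := key.deriv
  rw [e]
  have a1 := expNegInvGlue.pos_of_pos h0
  have a2 := expNegInvGlue.pos_of_pos (sub_pos.2 h1)
  have a3 := deriv_expNegInvGlue_pos h0
  have a4 := deriv_expNegInvGlue_pos (sub_pos.2 h1)
  apply div_pos
  · simp only [Pi.add_apply]
    nlinarith [mul_pos a3 a2, mul_pos a1 a4]
  · simp only [Pi.add_apply]
    positivity

theorem deriv_smoothStep_pos {x : ℝ} (h0 : 1 / 4 < x) (h1 : x < 3 / 4) :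
    0 < deriv smoothStep x := by
  have hd : HasDerivAt Real.smoothTransition _ (2 * x - 1 / 2) :=
    ((Real.smoothTransition.contDiff (n := 1)).differentiable (by simp) _).hasDerivAt
  have h2 : HasDerivAt (fun y : ℝ => 2 * y - 1 / 2) 2 x := by
    simpa using ((hasDerivAt_id x).const_mul 2).sub_const (1 / 2)
  have e : deriv smoothStep x = _ := (hd.comp x h2).deriv
  rw [e]
  have := deriv_smoothTransition_pos (x := 2 * x - 1 / 2) (by linarith) (by linarith)
  positivity

theorem smoothStep_monotone : Monotone smoothStep := fun x y h =>
  Real.smoothTransition.monotone (by linarith)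

theorem deriv_smoothStep_nonneg (x : ℝ) : 0 ≤ deriv smoothStep x :=
  smoothStep_monotone.deriv_nonneg

theorem smoothStep_strictMonoOn : StrictMonoOn smoothStep (Icc (1 / 4) (3 / 4)) := by
  apply strictMonoOn_of_deriv_pos (convex_Icc _ _) differentiable_smoothStep.continuous.continuousOn
  intro x hx
  rw [interior_Icc] at hx
  exact deriv_smoothStep_pos hx.1 hx.2

theorem smoothStep_half : smoothStep (1 / 2) = 1 / 2 := by
  have := smoothStep_one_sub (1 / 2)
  norm_num at this ⊢
  linarith

theorem smoothStep_pos {x : ℝ} (h : 1 / 4 < x) : 0 < smoothStep x :=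
  Real.smoothTransition.pos_of_pos (by linarith)

theorem smoothStep_lt_one {x : ℝ} (h : x < 3 / 4) : smoothStep x < 1 :=
  Real.smoothTransition.lt_one_of_lt_one (by linarith)

/-- The odd smooth step from `-1` (on `u ≤ -1/4`) to `1` (on `1/4 ≤ u`). -/
def oddStep (u : ℝ) : ℝ := 2 * smoothStep (u + 1 / 2) - 1

theorem contDiff_oddStep : ContDiff ℝ ∞ oddStep := by
  have := contDiff_smoothStep
  unfold oddStep
  fun_prop

theorem differentiable_oddStep : Differentiable ℝ oddStep :=
  contDiff_oddStep.differentiable (by simp)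

theorem oddStep_neg (u : ℝ) : oddStep (-u) = -oddStep u := by
  have := smoothStep_one_sub (u + 1 / 2)
  have e : 1 - (u + 1 / 2) = -u + 1 / 2 := by ring
  rw [e] at this
  unfold oddStep
  linarith

theorem oddStep_zero : oddStep 0 = 0 := by
  have := oddStep_neg 0
  rw [neg_zero] at this
  linarith

theorem oddStep_of_ge {u : ℝ} (h : 1 / 4 ≤ u) : oddStep u = 1 := by
  unfold oddStep
  rw [smoothStep_of_ge (by linarith)]
  norm_num

theorem oddStep_le_one (u : ℝ) : oddStep u ≤ 1 := by
  have := smoothStep_le_one (u + 1 / 2)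
  unfold oddStep
  linarith

theorem oddStep_monotone : Monotone oddStep := fun u v h => by
  have := smoothStep_monotone (add_le_add_left h (1 / 2))
  unfold oddStep
  linarith

theorem oddStep_pos {u : ℝ} (h : 0 < u) : 0 < oddStep u := by
  rcases le_or_gt (1 / 4) u with h1 | h1
  · rw [oddStep_of_ge h1]; norm_num
  · have := smoothStep_strictMonoOn (a := 1 / 2) (b := u + 1 / 2) ⟨by norm_num, by norm_num⟩
      ⟨by linarith, by linarith⟩ (by linarith)
    rw [smoothStep_half] at this
    unfold oddStep
    linarith

theorem deriv_oddStep (u : ℝ) : deriv oddStep u = 2 * deriv smoothStep (u + 1 / 2) := by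
  have h : HasDerivAt oddStep (2 * (deriv smoothStep (u + 1 / 2) * 1)) u :=
    (((differentiable_smoothStep _).hasDerivAt.comp u
      ((hasDerivAt_id u).add_const (1 / 2))).const_mul 2).sub_const 1
  rw [h.deriv, mul_one]

theorem deriv_oddStep_zero_pos : 0 < deriv oddStep 0 := by
  rw [deriv_oddStep]
  have := deriv_smoothStep_pos (x := 0 + 1 / 2) (by norm_num) (by norm_num)
  positivity

theorem deriv_oddStep_nonneg (u : ℝ) : 0 ≤ deriv oddStep u := by
  rw [deriv_oddStep]
  have := deriv_smoothStep_nonneg (u + 1 / 2)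
  positivity

/-- A smooth even function with a nondegenerate minimum at `0`, equal to `1/4 + 3/4 |u|` for
`1/4 ≤ |u|`. -/
def fold (u : ℝ) : ℝ := 1 / 4 + 3 / 4 * (u * oddStep u)

theorem contDiff_fold : ContDiff ℝ ∞ fold := by
  have := contDiff_oddStep
  unfold fold
  fun_prop

theorem fold_neg (u : ℝ) : fold (-u) = fold u := by
  unfold fold
  rw [oddStep_neg]
  ring

theorem fold_of_ge {u : ℝ} (h : 1 / 4 ≤ u) : fold u = 1 / 4 + 3 / 4 * u := by
  unfold fold
  rw [oddStep_of_ge h, mul_one]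

theorem fold_one : fold 1 = 1 := by
  rw [fold_of_ge (by norm_num)]
  norm_num

theorem fold_zero : fold 0 = 1 / 4 := by
  unfold fold
  ring

theorem hasDerivAt_fold (u : ℝ) :
    HasDerivAt fold (3 / 4 * (oddStep u + u * deriv oddStep u)) u := by
  have h := (((hasDerivAt_id u).mul (differentiable_oddStep u).hasDerivAt).const_mul
    (3 / 4)).const_add (1 / 4)
  simp only [one_mul, id] at h
  exact h

theorem deriv_fold_pos {u : ℝ} (h : 0 < u) : 0 < deriv fold u := by
  rw [(hasDerivAt_fold u).deriv]
  have := oddStep_pos h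
  have := deriv_oddStep_nonneg u
  positivity

theorem deriv_fold_neg {u : ℝ} (h : u < 0) : deriv fold u < 0 := by
  rw [(hasDerivAt_fold u).deriv]
  have h1 := oddStep_pos (u := -u) (by linarith)
  rw [oddStep_neg] at h1
  linarith [mul_nonneg (neg_nonneg.2 h.le) (deriv_oddStep_nonneg u)]

theorem iteratedDeriv_two_fold_pos : 0 < iteratedDeriv 2 fold 0 := by
  rw [iteratedDeriv_succ, iteratedDeriv_one]
  have e : deriv fold = fun u => 3 / 4 * (oddStep u + u * deriv oddStep u) :=
    funext fun u => (hasDerivAt_fold u).deriv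
  rw [e]
  have hd : ContDiff ℝ ∞ (deriv oddStep) := by
    have := contDiff_oddStep.iterate_deriv 1
    simpa using this
  have h := (((differentiable_oddStep 0).hasDerivAt).add ((hasDerivAt_id (0 : ℝ)).mul
    ((hd.differentiable (by simp) 0).hasDerivAt))).const_mul (3 / 4)
  have h2 : deriv (fun u => 3 / 4 * (oddStep u + u * deriv oddStep u)) 0 = _ := h.deriv
  rw [h2]
  have := deriv_oddStep_zero_pos
  simp only [id, one_mul, zero_mul, add_zero]
  linarith

theorem fold_strictMonoOn : StrictMonoOn fold (Ici 0) := by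
  apply strictMonoOn_of_deriv_pos (convex_Ici _) contDiff_fold.continuous.continuousOn
  intro x hx
  rw [interior_Ici] at hx
  exact deriv_fold_pos hx

theorem fold_mem_Icc {u : ℝ} (h0 : 0 ≤ u) (h1 : u ≤ 1) : fold u ∈ Icc (1 / 4 : ℝ) 1 := by
  rw [← fold_zero, ← fold_one]
  exact ⟨fold_strictMonoOn.monotoneOn (by simp) h0 h0,
    fold_strictMonoOn.monotoneOn h0 (by simp) h1⟩

theorem fold_abs (u : ℝ) : fold |u| = fold u := by
  rcases abs_choice u with h | h <;> rw [h]
  exact fold_neg u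

theorem fold_eq_fold {u v : ℝ} (h : fold u = fold v) : |u| = |v| := by
  rw [← fold_abs u, ← fold_abs v] at h
  exact fold_strictMonoOn.injOn (abs_nonneg u) (abs_nonneg v) h

/-- A smooth map `[0, 1] → [0, T]` with derivative `1` near both ends. -/
def stretch (T u : ℝ) : ℝ := u + (T - 1) * smoothStep u

theorem contDiff_stretch (T : ℝ) : ContDiff ℝ ∞ (stretch T) := by
  have := contDiff_smoothStep
  unfold stretch
  fun_prop

theorem stretch_of_le (T : ℝ) {u : ℝ} (h : u ≤ 1 / 4) : stretch T u = u := by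
  simp [stretch, smoothStep_of_le h]

theorem stretch_of_ge (T : ℝ) {u : ℝ} (h : 3 / 4 ≤ u) : stretch T u = T + (u - 1) := by
  simp only [stretch, smoothStep_of_ge h]
  ring

theorem hasDerivAt_stretch (T u : ℝ) :
    HasDerivAt (stretch T) (1 + (T - 1) * deriv smoothStep u) u :=
  (hasDerivAt_id u).add ((differentiable_smoothStep u).hasDerivAt.const_mul _)

theorem deriv_stretch_pos {T : ℝ} (hT : 1 ≤ T) (u : ℝ) : 0 < deriv (stretch T) u := by
  rw [(hasDerivAt_stretch T u).deriv]
  linarith [mul_nonneg (sub_nonneg.2 hT) (deriv_smoothStep_nonneg u)]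

theorem stretch_strictMono {T : ℝ} (hT : 1 ≤ T) : StrictMono (stretch T) :=
  strictMono_of_deriv_pos (deriv_stretch_pos hT)

theorem stretch_zero (T : ℝ) : stretch T 0 = 0 := stretch_of_le T (by norm_num)

theorem stretch_one (T : ℝ) : stretch T 1 = T := by
  rw [stretch_of_ge T (by norm_num)]
  ring

theorem exists_stretch_eq {T z : ℝ} (hz : z ∈ Icc 0 T) :
    ∃ u ∈ Icc (0 : ℝ) 1, stretch T u = z := by
  have h := intermediate_value_Icc (zero_le_one' ℝ) (contDiff_stretch T).continuous.continuousOn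
  rw [stretch_zero, stretch_one] at h
  exact h hz

theorem concat_eventuallyEq {E : Type*} {f : ℤ → ℝ → E} {t : ℝ}
    (hg : t = ⌊t⌋ → f (⌊t⌋ - 1) =ᶠ[𝓝 t] f ⌊t⌋) : (fun s : ℝ => f ⌊s⌋ s) =ᶠ[𝓝 t] f ⌊t⌋ := by
  have h1 : ∀ᶠ s : ℝ in 𝓝 t, s < (⌊t⌋ : ℝ) + 1 := gt_mem_nhds (Int.lt_floor_add_one t)
  by_cases h : t = ⌊t⌋
  · have h2 : ∀ᶠ s : ℝ in 𝓝 t, (⌊t⌋ : ℝ) - 1 < s := lt_mem_nhds (by linarith)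
    filter_upwards [h1, h2, hg h] with s a1 a2 a3
    rcases le_or_gt (⌊t⌋ : ℝ) s with h3 | h3
    · rw [Int.floor_eq_iff.2 ⟨h3, a1⟩]
    · have : ⌊s⌋ = ⌊t⌋ - 1 := by
        rw [Int.floor_eq_iff]
        push_cast
        exact ⟨a2.le, by linarith⟩
      rw [this, a3]
  · have h2 : ∀ᶠ s : ℝ in 𝓝 t, (⌊t⌋ : ℝ) < s :=
      lt_mem_nhds (lt_of_le_of_ne (Int.floor_le t) (Ne.symm h))
    filter_upwards [h1, h2] with s a1 a2
    rw [Int.floor_eq_iff.2 ⟨a2.le, a1⟩]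

end

section

/-! ## Directions and heights of planar secants -/

/-- The cross product of the vectors from `P` to `Q` and from `R` to `S`. -/
def crossProd (P Q R S : ℝ × ℝ) : ℝ :=
  (Q.1 - P.1) * (S.2 - R.2) - (Q.2 - P.2) * (S.1 - R.1)

theorem secantAngle_eq_iff_exists {P Q R S : ℝ × ℝ} (h : P ≠ Q) (h' : R ≠ S) :
    secantAngle P Q = secantAngle R S ↔
      ∃ c : ℝ, 0 < c ∧ S.1 - R.1 = c * (Q.1 - P.1) ∧ S.2 - R.2 = c * (Q.2 - P.2) := by
  have n1 : (⟨Q.2 - P.2, Q.1 - P.1⟩ : ℂ) ≠ 0 := by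
    intro e
    rw [Complex.ext_iff] at e
    simp only [Complex.zero_re, Complex.zero_im] at e
    exact h (Prod.ext (by linarith [e.2]) (by linarith [e.1]))
  have n2 : (⟨S.2 - R.2, S.1 - R.1⟩ : ℂ) ≠ 0 := by
    intro e
    rw [Complex.ext_iff] at e
    simp only [Complex.zero_re, Complex.zero_im] at e
    exact h' (Prod.ext (by linarith [e.2]) (by linarith [e.1]))
  unfold secantAngle
  rw [Complex.arg_coe_angle_eq_iff, Complex.arg_eq_arg_iff n1 n2]
  constructor
  · intro e
    refine ⟨_, div_pos (norm_pos_iff.2 n2) (norm_pos_iff.2 n1), ?_, ?_⟩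
    · have := congrArg Complex.im e
      rw [← Complex.ofReal_div, Complex.im_ofReal_mul] at this
      exact this.symm
    · have := congrArg Complex.re e
      rw [← Complex.ofReal_div, Complex.re_ofReal_mul] at this
      exact this.symm
  · rintro ⟨c, hc, e1, e2⟩
    have e : (⟨S.2 - R.2, S.1 - R.1⟩ : ℂ) = c * ⟨Q.2 - P.2, Q.1 - P.1⟩ := by
      apply Complex.ext
      · rw [Complex.re_ofReal_mul]; exact e2
      · rw [Complex.im_ofReal_mul]; exact e1
    rw [e, norm_mul, Complex.norm_real, Real.norm_of_nonneg hc.le,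
      Complex.ofReal_mul, mul_div_assoc, div_self, mul_one]
    exact_mod_cast (norm_pos_iff.2 n1).ne'

theorem secantAngle_eq_iff {P Q R S : ℝ × ℝ} (h : Q.1 - P.1 ≠ 0) (h' : R ≠ S) :
    secantAngle P Q = secantAngle R S ↔ crossProd P Q R S = 0 ∧ 0 < (Q.1 - P.1) * (S.1 - R.1) := by
  have hPQ : P ≠ Q := by rintro rfl; simp at h
  rw [secantAngle_eq_iff_exists hPQ h']
  unfold crossProd
  constructor
  · rintro ⟨c, hc, e1, e2⟩
    rw [e1, e2]
    refine ⟨by ring, ?_⟩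
    have := mul_self_pos.2 h
    nlinarith [mul_pos hc this]
  · rintro ⟨e1, e2⟩
    refine ⟨(S.1 - R.1) / (Q.1 - P.1), ?_, ?_, ?_⟩
    · have := mul_self_pos.2 h
      rw [show (S.1 - R.1) / (Q.1 - P.1) = (Q.1 - P.1) * (S.1 - R.1) / ((Q.1 - P.1) * (Q.1 - P.1))
        by field_simp]
      positivity
    · field_simp
    · field_simp
      linarith

theorem secantAngle_swap_eq {P Q R S : ℝ × ℝ} (h : P ≠ Q) (h' : R ≠ S)
    (e : secantAngle P Q = secantAngle R S) : secantAngle Q P = secantAngle S R := by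
  rw [secantAngle_eq_iff_exists h h'] at e
  rw [secantAngle_eq_iff_exists h.symm h'.symm]
  obtain ⟨c, hc, e1, e2⟩ := e
  exact ⟨c, hc, by linarith, by linarith⟩

theorem secantHeight_swap (P Q : ℝ × ℝ) : secantHeight Q P = -secantHeight P Q := by
  unfold secantHeight
  rw [← neg_div, show (P.2 - Q.2) ^ 2 + (P.1 - Q.1) ^ 2 = (Q.2 - P.2) ^ 2 + (Q.1 - P.1) ^ 2 by ring]
  congr 1
  ring

theorem sqrt_secant_pos {P Q : ℝ × ℝ} (h : P ≠ Q) :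
    0 < Real.sqrt ((Q.2 - P.2) ^ 2 + (Q.1 - P.1) ^ 2) := by
  apply Real.sqrt_pos.2
  by_contra hn
  have h1 := sq_nonneg (Q.2 - P.2)
  have h2 := sq_nonneg (Q.1 - P.1)
  have h3 : (Q.2 - P.2) ^ 2 = 0 := by linarith
  have h4 : (Q.1 - P.1) ^ 2 = 0 := by linarith
  exact h (Prod.ext (by nlinarith [pow_eq_zero_iff (two_ne_zero) |>.1 h4])
    (by nlinarith [pow_eq_zero_iff (two_ne_zero) |>.1 h3]))

theorem secantHeight_sub {P Q R S : ℝ × ℝ} (h : P ≠ Q) (h' : R ≠ S)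
    (e : secantAngle P Q = secantAngle R S) :
    secantHeight P Q - secantHeight R S = ((Q.2 - P.2) * (P.1 - R.1) - (Q.1 - P.1) * (P.2 - R.2)) /
        Real.sqrt ((Q.2 - P.2) ^ 2 + (Q.1 - P.1) ^ 2) := by
  rw [secantAngle_eq_iff_exists h h'] at e
  obtain ⟨c, hc, e1, e2⟩ := e
  have hp := (sqrt_secant_pos h).ne'
  unfold secantHeight
  rw [e1, e2, show (c * (Q.2 - P.2)) ^ 2 + (c * (Q.1 - P.1)) ^ 2 =
    c ^ 2 * ((Q.2 - P.2) ^ 2 + (Q.1 - P.1) ^ 2) by ring, Real.sqrt_mul (sq_nonneg c),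
    Real.sqrt_sq hc.le]
  field_simp
  ring

theorem secantHeight_lt_iff {P Q R S : ℝ × ℝ} (h : P ≠ Q) (h' : R ≠ S)
    (e : secantAngle P Q = secantAngle R S) :
    secantHeight R S < secantHeight P Q ↔
      0 < (Q.2 - P.2) * (P.1 - R.1) - (Q.1 - P.1) * (P.2 - R.2) := by
  rw [← sub_pos, secantHeight_sub h h' e, div_pos_iff_of_pos_right (sqrt_secant_pos h)]

theorem secantHeight_eq_iff {P Q R S : ℝ × ℝ} (h : P ≠ Q) (h' : R ≠ S)
    (e : secantAngle P Q = secantAngle R S) :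
    secantHeight P Q = secantHeight R S ↔
      (Q.2 - P.2) * (P.1 - R.1) - (Q.1 - P.1) * (P.2 - R.2) = 0 := by
  rw [← sub_eq_zero, secantHeight_sub h h' e, div_eq_zero_iff]
  simp [(sqrt_secant_pos h).ne']

/-- The vertical shear of the half-plane that fixes the line `ρ = 1`. -/
def shear (ε : ℝ) (P : ℝ × ℝ) : ℝ × ℝ := (P.1, P.2 + ε * (1 - P.1))

theorem crossProd_shear (ε : ℝ) (P Q R S : ℝ × ℝ) :
    crossProd (shear ε P) (shear ε Q) (shear ε R) (shear ε S) = crossProd P Q R S := by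
  simp only [crossProd, shear]
  ring

theorem shear_injective (ε : ℝ) : Function.Injective (shear ε) := by
  intro P Q h
  simp only [shear, Prod.mk.injEq] at h
  refine Prod.ext h.1 ?_
  have := h.2
  rw [h.1] at this
  linarith

theorem shear_zero (P : ℝ × ℝ) : shear 0 P = P := by simp [shear]

end

section

/-! ## Steep configurations -/

/-- The base of the exponential growth of the standard configuration. -/
def base (N : ℕ) : ℝ := 2 * N + 4

/-- The path from the position `i` to the position `i + 1`, with a bump of height `κ`;
it starts at `s = -1` and ends at `s = 1`. -/
def movPt (N i : ℕ) (κ s : ℝ) : ℝ × ℝ :=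
  (i + 1 + (1 + s) / 2, base N ^ i + (base N ^ (i + 1) - base N ^ i) * (1 + s) / 2 + κ * (1 - s ^ 2))

/-- The standard configuration in which the points in the positions `i`, `i + 1` are moved. -/
def basePt (N i : ℕ) (κ s : ℝ) (b : ℕ) : ℝ × ℝ :=
  if b = i then movPt N i κ s else if b = i + 1 then movPt N i (-κ) (-s)
  else ((b : ℝ) + 1, base N ^ b)

/-- The standard configuration. -/
def stdPt (N b : ℕ) : ℝ × ℝ := ((b : ℝ) + 1, base N ^ b)

theorem basePt_self (N i : ℕ) (κ s : ℝ) : basePt N i κ s i = movPt N i κ s := by simp [basePt]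

theorem basePt_succ (N i : ℕ) (κ s : ℝ) : basePt N i κ s (i + 1) = movPt N i (-κ) (-s) := by
  simp [basePt]

theorem basePt_other {N i b : ℕ} (κ s : ℝ) (h : b ≠ i) (h' : b ≠ i + 1) :
    basePt N i κ s b = stdPt N b := by simp [basePt, h, h', stdPt]

theorem basePt_neg_one (N i : ℕ) (κ : ℝ) (b : ℕ) : basePt N i κ (-1) b = stdPt N b := by
  unfold basePt
  split_ifs with h h'
  · subst h; simp [movPt, stdPt]
  · subst h'; simp [movPt, stdPt]
    ring
  · rfl

theorem basePt_one (N i : ℕ) (κ : ℝ) (b : ℕ) :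
    basePt N i κ 1 b = stdPt N (Equiv.swap i (i + 1) b) := by
  unfold basePt
  split_ifs with h h'
  · subst h; simp [movPt, stdPt]
    ring
  · subst h'; simp [movPt, stdPt]
  · rw [Equiv.swap_apply_of_ne_of_ne h h']; rfl

/-- The points with numbers less than `N` proceed outwards and grow steeply, except possibly for the
mutual position of the points `i` and `i + 1`. -/
def Steep (N i : ℕ) (Z : ℕ → ℝ × ℝ) : Prop :=
  ∀ a b, a < b → b < N → ¬(a = i ∧ b = i + 1) →
    1 ≤ (Z b).1 - (Z a).1 ∧ (Z b).1 - (Z a).1 ≤ N ∧ 0 < (Z a).2 ∧ (N + 1) * (Z a).2 < (Z b).2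

theorem one_le_base_pow (N b : ℕ) : 1 ≤ base N ^ b := by
  apply one_le_pow₀
  unfold base
  have : (0 : ℝ) ≤ N := Nat.cast_nonneg N
  linarith

theorem base_pow_mul_le {N a b : ℕ} (h : a < b) : (2 * (N : ℝ) + 4) * base N ^ a ≤ base N ^ b := by
  have h1 : base N ^ (a + 1) ≤ base N ^ b := by
    apply pow_le_pow_right₀ _ h
    simpa using one_le_base_pow N 1
  rw [pow_succ'] at h1
  exact h1

theorem movPt_bounds (N i : ℕ) {κ s : ℝ} (hκ : |κ| ≤ 1 / 8) (hs : |s| ≤ 1) :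
    (i : ℝ) + 1 ≤ (movPt N i κ s).1 ∧ (movPt N i κ s).1 ≤ i + 2 ∧
    base N ^ i - 1 / 8 ≤ (movPt N i κ s).2 ∧ (movPt N i κ s).2 ≤ base N ^ (i + 1) + 1 / 8 := by
  obtain ⟨s1, s2⟩ := abs_le.1 hs
  obtain ⟨k1, k2⟩ := abs_le.1 hκ
  have hB := one_le_base_pow N i
  have hB' := base_pow_mul_le (N := N) (lt_add_one i)
  have hN : (0 : ℝ) ≤ N := Nat.cast_nonneg N
  have hD : 0 ≤ base N ^ (i + 1) - base N ^ i := by nlinarith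
  have q0 : 0 ≤ 1 - s ^ 2 := by nlinarith
  have q1 : 1 - s ^ 2 ≤ 1 := by nlinarith
  have e1 : κ * (1 - s ^ 2) ≤ 1 / 8 := by nlinarith
  have e2 : -(1 / 8) ≤ κ * (1 - s ^ 2) := by nlinarith
  have e3 : 0 ≤ (base N ^ (i + 1) - base N ^ i) * (1 + s) / 2 := by
    have : 0 ≤ (base N ^ (i + 1) - base N ^ i) * (1 + s) := mul_nonneg hD (by linarith)
    linarith
  have e4 : (base N ^ (i + 1) - base N ^ i) * (1 + s) / 2 ≤ base N ^ (i + 1) - base N ^ i := by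
    have : 0 ≤ (base N ^ (i + 1) - base N ^ i) * (1 - s) := mul_nonneg hD (by linarith)
    linarith
  unfold movPt
  refine ⟨?_, ?_, ?_, ?_⟩ <;> simp only <;> linarith

theorem steep_basePt {N i : ℕ} {κ s : ℝ} (hκ : |κ| ≤ 1 / 8) (hs : |s| ≤ 1) :
    Steep N i (basePt N i κ s) := by
  intro a b hab hb hne
  have hN : (0 : ℝ) ≤ N := Nat.cast_nonneg N
  have hab' : (a : ℝ) + 1 ≤ b := by exact_mod_cast hab
  have hb' : (b : ℝ) + 1 ≤ N := by exact_mod_cast hb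
  have ha' : (0 : ℝ) ≤ a := Nat.cast_nonneg a
  have hP := one_le_base_pow N a
  have hab2 := base_pow_mul_le (N := N) hab
  -- the moving points
  have hmov : ∀ c, (c = i ∨ c = i + 1) →
      (i : ℝ) + 1 ≤ (basePt N i κ s c).1 ∧ (basePt N i κ s c).1 ≤ i + 2 ∧
      base N ^ i - 1 / 8 ≤ (basePt N i κ s c).2 ∧
      (basePt N i κ s c).2 ≤ base N ^ (i + 1) + 1 / 8 := by
    rintro c (rfl | rfl)
    · rw [basePt_self]; exact movPt_bounds N c hκ hs
    · rw [basePt_succ]; exact movPt_bounds N i (by rwa [abs_neg]) (by rwa [abs_neg])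
  by_cases ha : a = i ∨ a = i + 1
  · have hb1 : i + 1 < b := by
      rcases ha with rfl | rfl
      · rcases Nat.lt_or_ge (a + 1) b with h | h
        · exact h
        · exact absurd ⟨rfl, by omega⟩ hne
      · exact hab
    obtain ⟨m1, m2, m3, m4⟩ := hmov a ha
    rw [basePt_other κ s (b := b) (by omega) (by omega)]
    have hi := one_le_base_pow N i
    have hi1 := one_le_base_pow N (i + 1)
    have hbi := base_pow_mul_le (N := N) hb1
    have hbi' : (i : ℝ) + 2 ≤ b := by exact_mod_cast hb1
    have : (0 : ℝ) ≤ i := Nat.cast_nonneg i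
    refine ⟨?_, ?_, by linarith, ?_⟩
    · simp only [stdPt]; linarith
    · simp only [stdPt]; linarith
    · simp only [stdPt]
      nlinarith
  · push Not at ha
    rw [basePt_other κ s ha.1 ha.2]
    by_cases hbm : b = i ∨ b = i + 1
    · obtain ⟨m1, m2, m3, m4⟩ := hmov b hbm
      have hai : a < i := by rcases hbm with rfl | rfl <;> omega
      have hai' : (a : ℝ) + 1 ≤ i := by exact_mod_cast hai
      have hbi : (i : ℝ) ≤ b := by rcases hbm with rfl | rfl <;> simp
      have h2 := base_pow_mul_le (N := N) hai
      by_cases hN2 : (i : ℝ) + 2 ≤ N + 1 + a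
      · refine ⟨?_, ?_, ?_, ?_⟩ <;> simp only [stdPt] <;> nlinarith
      · exfalso; linarith
    · push Not at hbm
      rw [basePt_other κ s hbm.1 hbm.2]
      refine ⟨?_, ?_, ?_, ?_⟩ <;> simp only [stdPt] <;> nlinarith

namespace Steep

variable {N i : ℕ} {Z : ℕ → ℝ × ℝ}

theorem crossProd_pos (hZ : Steep N i Z) {a b c d : ℕ} (hab : a < b) (hcd : c < d) (hbd : b < d)
    (hd : d < N) (h1 : ¬(a = i ∧ b = i + 1)) (h2 : ¬(c = i ∧ d = i + 1))
    (h3 : ¬(b = i ∧ d = i + 1)) : 0 < crossProd (Z a) (Z b) (Z c) (Z d) := by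
  obtain ⟨a1, a2, a3, a4⟩ := hZ a b hab (hbd.trans hd) h1
  obtain ⟨b1, b2, b3, b4⟩ := hZ c d hcd hd h2
  obtain ⟨c1, c2, c3, c4⟩ := hZ b d hbd hd h3
  have hN : (0 : ℝ) ≤ N := Nat.cast_nonneg N
  have key : N * (Z b).2 < (Z d).2 - (Z c).2 := by
    rcases le_total (Z c).2 (Z b).2 with h | h <;> nlinarith
  unfold crossProd
  have e1 : (Z d).2 - (Z c).2 ≤ ((Z b).1 - (Z a).1) * ((Z d).2 - (Z c).2) := by
    have : 0 ≤ N * (Z b).2 := by positivity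
    nlinarith
  have e2 : ((Z b).2 - (Z a).2) * ((Z d).1 - (Z c).1) ≤ (Z b).2 * N := by nlinarith
  linarith

theorem crossProd_top (hZ : Steep N i Z) {a c d : ℕ} (hac : a < c) (hcd : c < d)
    (hd : d < N) (h1 : ¬(a = i ∧ c = i + 1)) (h2 : ¬(c = i ∧ d = i + 1)) :
    0 < crossProd (Z a) (Z d) (Z c) (Z d) := by
  have := hZ.crossProd_pos hac (hac.trans hcd) hcd hd h1 (by omega) h2
  unfold crossProd at *
  linarith

/-- The possible pairs of parallel secants, except for those with the secant from `i` to `i + 1`. -/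
theorem parallel_cases (hZ : Steep N i Z) {a b c d : ℕ} (hab : a < b) (hcd : c < d)
    (hb : b < N) (hd : d < N) (h1 : ¬(a = i ∧ b = i + 1)) (h2 : ¬(c = i ∧ d = i + 1))
    (h0 : crossProd (Z a) (Z b) (Z c) (Z d) = 0) :
    (a = c ∧ b = d) ∨
    (b = d ∧ ((a = i ∧ c = i + 1) ∨ (a = i + 1 ∧ c = i))) ∨
    (a < i ∧ c < i ∧ ((b = i ∧ d = i + 1) ∨ (b = i + 1 ∧ d = i))) := by
  rcases lt_trichotomy b d with h | h | h
  · by_cases h3 : b = i ∧ d = i + 1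
    · right; right; omega
    · exact absurd h0 (hZ.crossProd_pos hab hcd h hd h1 h2 h3).ne'
  · subst h
    rcases lt_trichotomy a c with h4 | h4 | h4
    · by_cases h5 : a = i ∧ c = i + 1
      · right; left; exact ⟨rfl, Or.inl h5⟩
      · have := hZ.crossProd_top h4 hcd hd h5 h2
        unfold crossProd at *
        linarith
    · left; exact ⟨h4, rfl⟩
    · by_cases h5 : c = i ∧ a = i + 1
      · right; left; exact ⟨rfl, Or.inr h5.symm⟩
      · have := hZ.crossProd_top h4 hab hd h5 h1
        unfold crossProd at *
        linarith
  · by_cases h3 : d = i ∧ b = i + 1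
    · right; right; omega
    · have := hZ.crossProd_pos hcd hab h hb h2 h1 h3
      unfold crossProd at *
      linarith

end Steep

end

section

/-! ## Parallel secants in a crossing of two strands -/

theorem steep_stdPt (N : ℕ) : Steep N N (stdPt N) := by
  have h := steep_basePt (N := N) (i := N) (κ := 0) (s := -1) (by norm_num) (by norm_num)
  have e : basePt N N 0 (-1) = stdPt N := funext fun b => basePt_neg_one N N 0 b
  rwa [e] at h

theorem stdPt_crossProd_pos {N a b c d : ℕ} (hab : a < b) (hcd : c < d) (hbd : b < d)
    (hd : d < N) : 0 < crossProd (stdPt N a) (stdPt N b) (stdPt N c) (stdPt N d) :=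
  (steep_stdPt N).crossProd_pos hab hcd hbd hd (by omega) (by omega) (by omega)

/-- The slope of the edge from the position `i` to the position `i + 1`. -/
def edge (N i : ℕ) : ℝ := base N ^ (i + 1) - base N ^ i

/-- The midpoint of the edge from the position `i` to the position `i + 1`. -/
def midPt (N i : ℕ) : ℝ × ℝ := (i + 3 / 2, (base N ^ i + base N ^ (i + 1)) / 2)

theorem edge_lt_of_lt {N i c d : ℕ} (hcd : c < d) (hd : d < i) :
    (stdPt N d).2 - (stdPt N c).2 < edge N i * ((stdPt N d).1 - (stdPt N c).1) := by
  have h1 := one_le_base_pow N c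
  have h2 := one_le_base_pow N d
  have h3 := base_pow_mul_le (N := N) hd
  have h4 := base_pow_mul_le (N := N) (lt_add_one i)
  have hN : (0 : ℝ) ≤ N := Nat.cast_nonneg N
  have hcd' : (c : ℝ) + 1 ≤ d := by exact_mod_cast hcd
  have h6 : base N ^ d ≤ base N ^ i := by nlinarith
  have h5 : base N ^ d ≤ edge N i := by unfold edge; nlinarith
  simp only [stdPt]
  nlinarith

theorem edge_lt_of_gt {N i c d : ℕ} {κ s : ℝ} (hκ : |κ| ≤ 1 / 8) (hs : |s| ≤ 1)
    (hcd : c < d) (hd : i + 1 < d) (hN : d < N) :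
    edge N i * ((basePt N i κ s d).1 - (basePt N i κ s c).1) <
      (basePt N i κ s d).2 - (basePt N i κ s c).2 := by
  obtain ⟨a1, a2, a3, a4⟩ := steep_basePt (N := N) (i := i) hκ hs c d hcd hN (by omega)
  have e : (basePt N i κ s d).2 = base N ^ d := by
    rw [basePt_other κ s (by omega) (by omega)]; rfl
  have h1 := one_le_base_pow N i
  have h2 := one_le_base_pow N (i + 1)
  have h3 := base_pow_mul_le (N := N) hd
  have h4 := base_pow_mul_le (N := N) (lt_add_one i)
  have hN2 : (2 : ℝ) ≤ N := by exact_mod_cast (by omega : 2 ≤ N)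
  have h5 : edge N i ≤ base N ^ (i + 1) := by unfold edge; linarith
  have h6 : 0 ≤ edge N i := by unfold edge; nlinarith
  have h7 : edge N i * ((basePt N i κ s d).1 - (basePt N i κ s c).1) ≤ base N ^ (i + 1) * N := by
    nlinarith
  have h8 : 3 * (basePt N i κ s c).2 ≤ (basePt N i κ s d).2 := by nlinarith
  rw [e] at *
  nlinarith

theorem midPt_above {N i r : ℕ} (hr : r ≠ i) (hr' : r ≠ i + 1) (hN : r < N) :
    0 < ((stdPt N r).2 - (midPt N i).2) - edge N i * ((stdPt N r).1 - (midPt N i).1) := by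
  have h0 := one_le_base_pow N r
  have h1 := one_le_base_pow N i
  have h2 := one_le_base_pow N (i + 1)
  have h4 := base_pow_mul_le (N := N) (lt_add_one i)
  have hN0 : (0 : ℝ) ≤ N := Nat.cast_nonneg N
  have h6 : 0 ≤ edge N i := by unfold edge; nlinarith
  rcases Nat.lt_or_ge r i with h | h
  · have hri : (r : ℝ) + 1 ≤ i := by exact_mod_cast h
    have : edge N i * (3 / 2) ≤ edge N i * ((i : ℝ) + 3 / 2 - (r + 1)) := by
      apply mul_le_mul_of_nonneg_left _ h6
      linarith
    simp only [stdPt, midPt]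
    unfold edge at *
    nlinarith
  · have hri : i + 1 < r := by omega
    have h3 := base_pow_mul_le (N := N) hri
    have hr1 : (r : ℝ) + 1 ≤ N := by exact_mod_cast hN
    have hi0 : (0 : ℝ) ≤ i := Nat.cast_nonneg i
    have : edge N i * ((r : ℝ) + 1 - (i + 3 / 2)) ≤ base N ^ (i + 1) * N := by
      have : edge N i ≤ base N ^ (i + 1) := by unfold edge; linarith
      have hri' : (i : ℝ) + 2 ≤ r := by exact_mod_cast hri
      apply mul_le_mul this (by linarith) (by linarith) (by linarith)
    simp only [stdPt, midPt]
    nlinarith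

theorem crossProd_movPt (N i : ℕ) (κ s : ℝ) (R S : ℝ × ℝ) :
    crossProd (movPt N i κ s) (movPt N i (-κ) (-s)) R S =
      -(s * ((S.2 - R.2) - edge N i * (S.1 - R.1)) - 2 * κ * (1 - s ^ 2) * (S.1 - R.1)) := by
  unfold crossProd movPt edge
  simp only
  ring

theorem crossProd_movPt_mid (N i : ℕ) (κ s : ℝ) (R : ℝ × ℝ) :
    crossProd (movPt N i κ s) (movPt N i (-κ) (-s)) (movPt N i κ s) R =
      crossProd (movPt N i κ s) (movPt N i (-κ) (-s)) (midPt N i) R := by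
  unfold crossProd movPt midPt
  simp only
  ring

theorem exists_quadratic_root {F : ℝ} (hF : F ≠ 0) (G κ : ℝ) :
    ∃ s ∈ Ioo (-1 : ℝ) 1, s * F - 2 * κ * (1 - s ^ 2) * G = 0 := by
  have hc : ContinuousOn (fun s : ℝ => s * F - 2 * κ * (1 - s ^ 2) * G) (Icc (-1) 1) := by fun_prop
  rcases lt_or_gt_of_ne hF with h | h
  · have := intermediate_value_Ioo' (by norm_num : (-1 : ℝ) ≤ 1) hc
    obtain ⟨s, hs, e⟩ := this (show (0 : ℝ) ∈ Ioo _ _ by constructor <;> norm_num <;> linarith)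
    exact ⟨s, hs, e⟩
  · have := intermediate_value_Ioo (by norm_num : (-1 : ℝ) ≤ 1) hc
    obtain ⟨s, hs, e⟩ := this (show (0 : ℝ) ∈ Ioo _ _ by constructor <;> norm_num <;> linarith)
    exact ⟨s, hs, e⟩

theorem quadratic_root_unique {F G κ s t : ℝ} (hF : F ≠ 0) (hs : s ∈ Ioo (-1 : ℝ) 1)
    (ht : t ∈ Ioo (-1 : ℝ) 1) (h : s * F - 2 * κ * (1 - s ^ 2) * G = 0)
    (h' : t * F - 2 * κ * (1 - t ^ 2) * G = 0) : s = t := by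
  have e : F * ((s - t) * (1 + s * t)) = 0 := by
    linear_combination (1 - t ^ 2) * h - (1 - s ^ 2) * h'
  have h1 : 0 < 1 + s * t := by nlinarith [hs.1, hs.2, ht.1, ht.2]
  rcases mul_eq_zero.1 e with h2 | h2
  · exact absurd h2 hF
  · rcases mul_eq_zero.1 h2 with h3 | h3
    · linarith
    · linarith

/-- The velocity of `movPt` with respect to `s`. -/
def movVel (N i : ℕ) (κ s : ℝ) : ℝ × ℝ := (1 / 2, edge N i / 2 - 2 * κ * s)

theorem hasDerivAt_movPt_fst (N i : ℕ) (κ s : ℝ) :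
    HasDerivAt (fun s => (movPt N i κ s).1) (movVel N i κ s).1 s := by
  have h := (((hasDerivAt_id s).const_add 1).div_const 2).const_add ((i : ℝ) + 1)
  exact h

theorem hasDerivAt_movPt_snd (N i : ℕ) (κ s : ℝ) :
    HasDerivAt (fun s => (movPt N i κ s).2) (movVel N i κ s).2 s := by
  have h := (((((hasDerivAt_id s).const_add 1).const_mul (edge N i)).div_const 2).const_add
    (base N ^ i)).add ((((hasDerivAt_id s).pow 2).const_sub 1).const_mul κ)
  refine h.congr_deriv ?_
  simp only [movVel, id]
  push_cast
  ring

/-- The slope of the secant from the fixed point `r` to the moving point. -/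
def slopeTo (N i r : ℕ) (κ s : ℝ) : ℝ :=
  ((movPt N i κ s).2 - (stdPt N r).2) / ((movPt N i κ s).1 - (stdPt N r).1)

/-- The determinant of the secant from the fixed point `r` to the moving point and its velocity. -/
def turnTo (N i r : ℕ) (κ s : ℝ) : ℝ :=
  (movVel N i κ s).2 * ((movPt N i κ s).1 - (stdPt N r).1) -
    ((movPt N i κ s).2 - (stdPt N r).2) * (movVel N i κ s).1

theorem gap_bounds {N i r : ℕ} {κ s : ℝ} (hr : r < i) (hi : i + 2 ≤ N) (hs : |s| ≤ 1) :
    1 ≤ (movPt N i κ s).1 - (stdPt N r).1 ∧ (movPt N i κ s).1 - (stdPt N r).1 < N := by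
  obtain ⟨s1, s2⟩ := abs_le.1 hs
  have hri : (r : ℝ) + 1 ≤ i := by exact_mod_cast hr
  have hiN : (i : ℝ) + 2 ≤ N := by exact_mod_cast hi
  have h0 : (0 : ℝ) ≤ r := Nat.cast_nonneg r
  simp only [movPt, stdPt]
  constructor <;> linarith

theorem one_le_turnTo {N i r : ℕ} {κ s : ℝ} (hr : r < i) (hκ : |κ| ≤ 1 / 8) (hs : |s| ≤ 1) :
    1 ≤ turnTo N i r κ s := by
  obtain ⟨s1, s2⟩ := abs_le.1 hs
  have hri : (r : ℝ) + 1 ≤ i := by exact_mod_cast hr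
  have h1 := one_le_base_pow N i
  have h0 := one_le_base_pow N r
  have h4 := base_pow_mul_le (N := N) (lt_add_one i)
  have hN0 : (0 : ℝ) ≤ N := Nat.cast_nonneg N
  have hks : |κ * s| ≤ 1 / 8 := by
    rw [abs_mul]
    nlinarith [abs_nonneg κ, abs_nonneg s]
  obtain ⟨k1, k2⟩ := abs_le.1 hks
  obtain ⟨k3, k4⟩ := abs_le.1 hκ
  have q0 : 0 ≤ 1 - s ^ 2 := by nlinarith
  have q1 : 1 - s ^ 2 ≤ 1 := by nlinarith
  have e1 : κ * (1 - s ^ 2) ≤ 1 / 8 := by nlinarith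
  have hD : 3 * base N ^ i ≤ edge N i := by unfold edge; nlinarith
  have e : turnTo N i r κ s = edge N i / 2 * ((i : ℝ) - r)
      - 2 * (κ * s) * ((i : ℝ) - r + (1 + s) / 2) - (base N ^ i - base N ^ r) / 2
      - κ * (1 - s ^ 2) / 2 := by
    unfold turnTo movVel movPt stdPt edge
    simp only
    ring
  rw [e]
  have f0 : 4 ≤ base N ^ i := by nlinarith [base_pow_mul_le (N := N) hr]
  have f1 : 2 * (κ * s) * ((i : ℝ) - r + (1 + s) / 2) ≤ 1 / 4 * ((i : ℝ) - r + 1) := by nlinarith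
  have f2 : edge N i / 2 * ((i : ℝ) - r) ≥ (edge N i / 2 - 1 / 4) + 1 / 4 * ((i : ℝ) - r) := by
    nlinarith
  linarith

theorem hasDerivAt_slopeTo {N i r : ℕ} {κ s : ℝ} (hr : r < i) (hi : i + 2 ≤ N) (hs : |s| ≤ 1) :
    HasDerivAt (slopeTo N i r κ)
      (turnTo N i r κ s / ((movPt N i κ s).1 - (stdPt N r).1) ^ 2) s := by
  have hg := gap_bounds (κ := κ) hr hi hs
  exact ((hasDerivAt_movPt_snd N i κ s).sub_const _).div
    ((hasDerivAt_movPt_fst N i κ s).sub_const _) (by linarith [hg.1])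

theorem slopeTo_strictMonoOn {N i r : ℕ} {κ : ℝ} (hr : r < i) (hi : i + 2 ≤ N)
    (hκ : |κ| ≤ 1 / 8) : StrictMonoOn (slopeTo N i r κ) (Icc (-1) 1) := by
  apply strictMonoOn_of_deriv_pos (convex_Icc _ _)
  · intro s hs
    exact (hasDerivAt_slopeTo hr hi (abs_le.2 hs)).continuousAt.continuousWithinAt
  · intro s hs
    rw [interior_Icc] at hs
    have hs' : |s| ≤ 1 := abs_le.2 ⟨hs.1.le, hs.2.le⟩
    rw [(hasDerivAt_slopeTo hr hi hs').deriv]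
    have h1 := one_le_turnTo (N := N) hr hκ hs'
    have hg := (gap_bounds (κ := κ) hr hi hs').1
    apply div_pos <;> nlinarith

/-- The difference of the slopes of the secants from `r` and `t` to the two moving points. -/
def slopeDiff (N i r t : ℕ) (κ s : ℝ) : ℝ := slopeTo N i r κ s - slopeTo N i t (-κ) (-s)

theorem slopeDiff_strictMonoOn {N i r t : ℕ} {κ : ℝ} (hr : r < i) (ht : t < i) (hi : i + 2 ≤ N)
    (hκ : |κ| ≤ 1 / 8) : StrictMonoOn (slopeDiff N i r t κ) (Icc (-1) 1) := by
  intro a ha b hb hab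
  have h1 := slopeTo_strictMonoOn hr hi hκ ha hb hab
  have h2 := slopeTo_strictMonoOn ht hi (κ := -κ) (by rwa [abs_neg])
    (a := -b) (b := -a) ⟨by linarith [hb.2], by linarith [hb.1]⟩
    ⟨by linarith [ha.2], by linarith [ha.1]⟩ (by linarith)
  unfold slopeDiff
  linarith

theorem crossProd_eq_slopeDiff {N i r t : ℕ} {κ s : ℝ} (hr : r < i) (ht : t < i) (hi : i + 2 ≤ N)
    (hs : |s| ≤ 1) :
    crossProd (stdPt N t) (movPt N i (-κ) (-s)) (stdPt N r) (movPt N i κ s) =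
      ((movPt N i (-κ) (-s)).1 - (stdPt N t).1) * ((movPt N i κ s).1 - (stdPt N r).1) *
        slopeDiff N i r t κ s := by
  have g1 := (gap_bounds (κ := κ) hr hi hs).1
  have g2 := (gap_bounds (κ := -κ) (s := -s) ht hi (by rwa [abs_neg])).1
  have g1' : (movPt N i κ s).1 - (stdPt N r).1 ≠ 0 := by linarith
  have g2' : (movPt N i (-κ) (-s)).1 - (stdPt N t).1 ≠ 0 := by linarith
  unfold crossProd slopeDiff slopeTo
  field_simp

theorem exists_slopeDiff_root {N i r t : ℕ} {κ : ℝ} (hr : r < i) (ht : t < i) (hi : i + 2 ≤ N)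
    : ∃ s ∈ Ioo (-1 : ℝ) 1, slopeDiff N i r t κ s = 0 := by
  have hc : ContinuousOn (slopeDiff N i r t κ) (Icc (-1) 1) := by
    intro s hs
    have h1 := (hasDerivAt_slopeTo (κ := κ) hr hi (abs_le.2 hs)).continuousAt
    have h2 := (hasDerivAt_slopeTo (κ := -κ) (s := -s) ht hi
      (by rw [abs_neg]; exact abs_le.2 hs)).continuousAt
    exact (h1.sub (h2.comp (f := fun s : ℝ => -s) continuous_neg.continuousAt)).continuousWithinAt
  have key := intermediate_value_Ioo (by norm_num : (-1 : ℝ) ≤ 1) hc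
  have b0 : (movPt N i κ (-1)) = stdPt N i := by
    rw [← basePt_self N i κ, basePt_neg_one]
  have b1 : ∀ κ, (movPt N i κ 1) = stdPt N (i + 1) := fun κ => by
    rw [← basePt_self N i κ, basePt_one, Equiv.swap_apply_left]
  have b0' : ∀ κ, (movPt N i κ (-1)) = stdPt N i := fun κ => by
    rw [← basePt_self N i κ, basePt_neg_one]
  have l0 : slopeDiff N i r t κ (-1) < 0 := by
    have e := crossProd_eq_slopeDiff (κ := κ) (s := -1) hr ht hi (by norm_num)
    have g1 := (gap_bounds (κ := κ) (s := -1) hr hi (by norm_num)).1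
    have g2 := (gap_bounds (κ := -κ) (s := - -1) ht hi (by norm_num)).1
    rw [neg_neg] at e g2
    rw [b0', b1] at e
    have := stdPt_crossProd_pos (N := N) (a := r) (b := i) (c := t) (d := i + 1) hr (by omega)
      (by omega) (by omega)
    rw [b0'] at g1
    rw [b1] at g2
    have hp := mul_pos (by linarith : 0 < (stdPt N (i + 1)).1 - (stdPt N t).1)
      (by linarith : 0 < (stdPt N i).1 - (stdPt N r).1)
    by_contra hn
    have := mul_nonneg hp.le (not_lt.1 hn)
    rw [← e] at this
    unfold crossProd at *
    linarith
  have l1 : 0 < slopeDiff N i r t κ 1 := by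
    have e := crossProd_eq_slopeDiff (κ := κ) (s := 1) hr ht hi (by norm_num)
    have g1 := (gap_bounds (κ := κ) (s := 1) hr hi (by norm_num)).1
    have g2 := (gap_bounds (κ := -κ) (s := -1) ht hi (by norm_num)).1
    rw [b0', b1] at e
    have := stdPt_crossProd_pos (N := N) (a := t) (b := i) (c := r) (d := i + 1) ht (by omega)
      (by omega) (by omega)
    rw [e] at this
    rw [b1] at g1
    rw [b0'] at g2
    exact (mul_pos_iff_of_pos_left (mul_pos (by linarith) (by linarith))).1 this
  obtain ⟨s, hs, e⟩ := key ⟨l0, l1⟩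
  exact ⟨s, hs, e⟩

end

section

/-! ## Enumeration of the crossings of the trace graph of a crossing -/

/-- The height of the bump by which the two moving strands avoid each other. -/
def bump (pos : Bool) : ℝ := if pos then 1 / 8 else -(1 / 8)

theorem abs_bump (pos : Bool) : |bump pos| ≤ 1 / 8 := by
  cases pos <;> norm_num [bump, abs_le]

theorem bump_ne_zero (pos : Bool) : bump pos ≠ 0 := by
  cases pos <;> norm_num [bump]

/-- The points of the numbered configuration `Z` form a crossing of the projected trace graph, with
the over secant `c.1` and the under secant `c.2`. -/
def Crosses (Z : ℕ → ℝ × ℝ) (c : (ℕ × ℕ) × (ℕ × ℕ)) : Prop :=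
  secantAngle (Z c.1.1) (Z c.1.2) = secantAngle (Z c.2.1) (Z c.2.2) ∧
    secantHeight (Z c.2.1) (Z c.2.2) < secantHeight (Z c.1.1) (Z c.1.2)

/-- The crossing formed by the reversed secants. -/
def flip (c : (ℕ × ℕ) × (ℕ × ℕ)) : (ℕ × ℕ) × (ℕ × ℕ) := (c.2.swap, c.1.swap)

theorem Crosses.flip {Z : ℕ → ℝ × ℝ} {c : (ℕ × ℕ) × (ℕ × ℕ)} (h : Crosses Z c)
    (h1 : Z c.1.1 ≠ Z c.1.2) (h2 : Z c.2.1 ≠ Z c.2.2) : Crosses Z (flip c) := by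
  refine ⟨(secantAngle_swap_eq h1 h2 h.1).symm, ?_⟩
  have e1 := secantHeight_swap (Z c.1.1) (Z c.1.2)
  have e2 := secantHeight_swap (Z c.2.1) (Z c.2.2)
  have := h.2
  simp only [PlatTrace.flip, Prod.fst_swap, Prod.snd_swap]
  linarith

theorem crosses_shear_iff {Z : ℕ → ℝ × ℝ} {c : (ℕ × ℕ) × (ℕ × ℕ)} (ε : ℝ)
    (h1 : (Z c.1.1).1 < (Z c.1.2).1) (h2 : Z c.2.1 ≠ Z c.2.2) :
    Crosses (fun b => shear ε (Z b)) c ↔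
      crossProd (Z c.1.1) (Z c.1.2) (Z c.2.1) (Z c.2.2) = 0 ∧ (Z c.2.1).1 < (Z c.2.2).1 ∧
        crossProd (Z c.1.1) (Z c.1.2) (Z c.2.1) (Z c.1.1) < 0 := by
  have h1' : Z c.1.1 ≠ Z c.1.2 := by
    intro e; rw [e] at h1; exact lt_irrefl _ h1
  have n1 := (shear_injective ε).ne h1'
  have n2 := (shear_injective ε).ne h2
  have hpos : 0 < (Z c.1.2).1 - (Z c.1.1).1 := sub_pos.2 h1
  have ha := secantAngle_eq_iff (P := shear ε (Z c.1.1)) (Q := shear ε (Z c.1.2)) hpos.ne' n2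
  rw [crossProd_shear] at ha
  have hb : 0 < ((shear ε (Z c.1.2)).1 - (shear ε (Z c.1.1)).1) *
      ((shear ε (Z c.2.2)).1 - (shear ε (Z c.2.1)).1) ↔ (Z c.2.1).1 < (Z c.2.2).1 := by
    exact (mul_pos_iff_of_pos_left hpos).trans sub_pos
  rw [hb] at ha
  have hc : (0 < ((shear ε (Z c.1.2)).2 - (shear ε (Z c.1.1)).2) *
      ((shear ε (Z c.1.1)).1 - (shear ε (Z c.2.1)).1) -
      ((shear ε (Z c.1.2)).1 - (shear ε (Z c.1.1)).1) *
      ((shear ε (Z c.1.1)).2 - (shear ε (Z c.2.1)).2)) ↔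
      crossProd (Z c.1.1) (Z c.1.2) (Z c.2.1) (Z c.1.1) < 0 := by
    rw [← crossProd_shear ε]
    unfold crossProd
    constructor <;> intro h <;> linarith
  constructor
  · rintro ⟨e1, e2⟩
    exact ⟨(ha.1 e1).1, (ha.1 e1).2, hc.1 ((secantHeight_lt_iff n1 n2 e1).1 e2)⟩
  · rintro ⟨e1, e2, e3⟩
    have e := ha.2 ⟨e1, e2⟩
    exact ⟨e, (secantHeight_lt_iff n1 n2 e).2 (hc.2 e3)⟩

/-- The three kinds of crossings for a pair of positions `r < s` of fixed strands: the secants of the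
two fixed and the two moving strands, or two secants from a fixed to a moving strand. -/
inductive CrossKind : Type
  | fixed | straight | skew
  deriving DecidableEq

/-- The positions of the over and the under secant, directed outwards, of a crossing. -/
def crossQuad (i : ℕ) (pos : Bool) (r s : ℕ) : CrossKind → (ℕ × ℕ) × (ℕ × ℕ)
  | .fixed =>
    let m := if (s < i) ↔ pos then (i, i + 1) else (i + 1, i)
    if s < i ∨ i + 1 < r then ((r, s), m) else (m, (r, s))
  | .straight => ((s, i + 1), (r, i))
  | .skew => ((s, i), (r, i + 1))

/-- Validity of the data describing a crossing. -/
def ValidCross (N i r s : ℕ) (k : CrossKind) : Prop :=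
  r < s ∧ s < N ∧ r ≠ i ∧ r ≠ i + 1 ∧ s ≠ i ∧ s ≠ i + 1 ∧ (k ≠ .fixed → s < i)

/-- The function of the parameter which vanishes when the crossing occurs. -/
def crossRoot (N i : ℕ) (pos : Bool) (r s : ℕ) : CrossKind → ℝ → ℝ
  | .fixed => fun x => x * (((stdPt N s).2 - (stdPt N r).2) -
      edge N i * ((stdPt N s).1 - (stdPt N r).1)) -
      2 * bump pos * (1 - x ^ 2) * ((stdPt N s).1 - (stdPt N r).1)
  | .straight => slopeDiff N i r s (bump pos)
  | .skew => slopeDiff N i s r (bump pos)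

theorem fixed_slope {N i r s : ℕ} (hr : r < s) (hs : s < N)
    (h4 : s ≠ i + 1) :
    (s < i → ((stdPt N s).2 - (stdPt N r).2) - edge N i * ((stdPt N s).1 - (stdPt N r).1) < 0) ∧
    (i < s → 0 < ((stdPt N s).2 - (stdPt N r).2) - edge N i * ((stdPt N s).1 - (stdPt N r).1)) := by
  constructor
  · intro h
    linarith [edge_lt_of_lt (N := N) hr h]
  · intro h
    have := edge_lt_of_gt (N := N) (i := i) (κ := 0) (s := -1) (by norm_num) (by norm_num) hr
      (by omega) hs
    rw [basePt_neg_one, basePt_neg_one] at this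
    linarith

theorem fixed_gap_pos {N r s : ℕ} (hr : r < s) : 0 < (stdPt N s).1 - (stdPt N r).1 := by
  have : (r : ℝ) < s := by exact_mod_cast hr
  simp only [stdPt]
  linarith

theorem exists_crossRoot {N i r s : ℕ} {k : CrossKind} (pos : Bool) (hi : i + 2 ≤ N)
    (h : ValidCross N i r s k) : ∃ x ∈ Ioo (-1 : ℝ) 1, crossRoot N i pos r s k x = 0 := by
  obtain ⟨h1, h2, h3, h4, h5, h6, h7⟩ := h
  cases k with
  | fixed =>
    apply exists_quadratic_root
    have := fixed_slope h1 h2 h6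
    rcases Nat.lt_or_ge s i with hs | hs
    · exact (this.1 hs).ne
    · exact (this.2 (by omega)).ne'
  | straight => exact exists_slopeDiff_root (by have := h7 (by simp); omega) (h7 (by simp)) hi
  | skew => exact exists_slopeDiff_root (h7 (by simp)) (by have := h7 (by simp); omega) hi

theorem crossRoot_unique {N i r s : ℕ} {k : CrossKind} {pos : Bool} (hi : i + 2 ≤ N)
    (h : ValidCross N i r s k) {x y : ℝ} (hx : x ∈ Icc (-1 : ℝ) 1) (hy : y ∈ Ioo (-1 : ℝ) 1)
    (ex : crossRoot N i pos r s k x = 0) (ey : crossRoot N i pos r s k y = 0) : x = y := by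
  obtain ⟨h1, h2, h3, h4, h5, h6, h7⟩ := h
  have hy' : y ∈ Icc (-1 : ℝ) 1 := ⟨hy.1.le, hy.2.le⟩
  cases k with
  | fixed =>
    have hF : ((stdPt N s).2 - (stdPt N r).2) - edge N i * ((stdPt N s).1 - (stdPt N r).1) ≠ 0 := by
      have := fixed_slope h1 h2 h6
      rcases Nat.lt_or_ge s i with hs | hs
      · exact (this.1 hs).ne
      · exact (this.2 (by omega)).ne'
    refine quadratic_root_unique hF ⟨lt_of_le_of_ne hx.1 ?_, lt_of_le_of_ne hx.2 ?_⟩ hy ex ey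
    · rintro rfl
      apply hF
      simp only [crossRoot] at ex
      linarith
    · rintro rfl
      apply hF
      simp only [crossRoot] at ex
      linarith
  | straight =>
    exact (slopeDiff_strictMonoOn (by have := h7 (by simp); omega) (h7 (by simp)) hi
      (abs_bump pos)).injOn hx hy' (ex.trans ey.symm)
  | skew =>
    exact (slopeDiff_strictMonoOn (h7 (by simp)) (by have := h7 (by simp); omega) hi
      (abs_bump pos)).injOn hx hy' (ex.trans ey.symm)

/-- The point `midPt` lies above the line through two fixed points, unless it is between them. -/
theorem midPt_side {N i r s : ℕ} (hi : i + 2 ≤ N) (hr : r < s) (hs : s < N)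
    (h3 : s ≠ i) (h4 : s ≠ i + 1) (h1 : r ≠ i) (h2 : r ≠ i + 1) :
    ((s < i ∨ i + 1 < r) → 0 < crossProd (stdPt N r) (stdPt N s) (stdPt N r) (midPt N i)) ∧
    (¬(s < i ∨ i + 1 < r) → crossProd (stdPt N r) (stdPt N s) (stdPt N r) (midPt N i) < 0) := by
  have hZ := steep_basePt (N := N) (i := i) (κ := 0) (s := 0) (by norm_num) (by norm_num)
  have e0 : basePt N i 0 0 i = midPt N i := by
    rw [basePt_self]
    simp only [movPt, midPt, Prod.mk.injEq]
    constructor <;> ring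
  have e1 : basePt N i 0 0 r = stdPt N r := basePt_other _ _ h1 h2
  have e2 : basePt N i 0 0 s = stdPt N s := basePt_other _ _ h3 h4
  constructor
  · rintro (h | h)
    · have := hZ.crossProd_pos (a := r) (b := s) (c := r) (d := i) hr (by omega) h (by omega)
        (by omega) (by omega) (by omega)
      rwa [e0, e1, e2] at this
    · have := hZ.crossProd_pos (a := i) (b := r) (c := r) (d := s) (by omega) hr hr hs
        (by omega) (by omega) (by omega)
      rw [e0, e1, e2] at this
      unfold crossProd at *
      linarith
  · intro h
    push Not at h
    have := hZ.crossProd_pos (a := r) (b := i) (c := r) (d := s) (by omega) hr (by omega) hs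
      (by omega) (by omega) (by omega)
    rw [e0, e1, e2] at this
    unfold crossProd at *
    linarith

theorem basePt_ne {N i : ℕ} {κ s : ℝ} (hκ : |κ| ≤ 1 / 8) (hs : |s| ≤ 1) (h0 : s ≠ 0 ∨ κ ≠ 0)
    {a b : ℕ} (ha : a < N) (hb : b < N) (hab : a ≠ b) : basePt N i κ s a ≠ basePt N i κ s b := by
  have hpq : basePt N i κ s i ≠ basePt N i κ s (i + 1) := by
    rw [basePt_self, basePt_succ]
    intro e
    have e1 := congrArg Prod.fst e
    have e2 := congrArg Prod.snd e
    simp only [movPt] at e1 e2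
    have s0 : s = 0 := by linarith
    subst s0
    rcases h0 with h0 | h0
    · exact h0 rfl
    · apply h0
      norm_num at e2
      linarith
  have key : ∀ a b, a < b → b < N → basePt N i κ s a ≠ basePt N i κ s b := by
    intro a b hab hb
    by_cases h : a = i ∧ b = i + 1
    · rw [h.1, h.2]; exact hpq
    · intro e
      have := (steep_basePt (N := N) (i := i) hκ hs a b hab hb h).1
      rw [e] at this
      linarith
  rcases Nat.lt_or_gt_of_ne hab with h | h
  · exact key a b h hb
  · exact (key b a h ha).symm

theorem crossProd_third (P Q R S : ℝ × ℝ) (h : crossProd P Q R S = 0) :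
    crossProd P Q R P = crossProd P Q S P := by
  unfold crossProd at *
  linarith

theorem crossProd_same (P Q R : ℝ × ℝ) : crossProd P Q R R = 0 := by
  unfold crossProd
  ring

theorem crossProd_rev (P Q : ℝ × ℝ) : crossProd P Q Q P = 0 := by
  unfold crossProd
  ring

end

section

theorem fixed_root_sign {N i r s : ℕ} {pos : Bool} (h : ValidCross N i r s .fixed) {x : ℝ}
    (hx : x ∈ Ioo (-1 : ℝ) 1) (e : crossRoot N i pos r s .fixed x = 0) :
    x ≠ 0 ∧ (x < 0 ↔ ((s < i) ↔ pos = true)) := by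
  obtain ⟨h1, h2, h3, h4, h5, h6, h7⟩ := h
  have hG := fixed_gap_pos (N := N) h1
  have hF := fixed_slope h1 h2 h6
  simp only [crossRoot] at e
  set G := (stdPt N s).1 - (stdPt N r).1
  set F := ((stdPt N s).2 - (stdPt N r).2) - edge N i * G
  have hq : 0 < (1 - x ^ 2) * G := by
    apply mul_pos _ hG
    nlinarith [hx.1, hx.2]
  have e' : x * F = 2 * bump pos * ((1 - x ^ 2) * G) := by linarith
  have hlt : s < i ∨ i < s := Nat.lt_or_gt_of_ne h5
  cases pos
  · simp only [bump, Bool.false_eq_true, if_false, iff_false, not_lt] at e' ⊢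
    have e2 : x * F < 0 := by linarith
    refine ⟨by rintro rfl; simp at e2, ?_⟩
    rcases hlt with h | h
    · have := hF.1 h
      constructor
      · intro hx; nlinarith
      · intro hx; omega
    · have := hF.2 h
      constructor
      · intro hx; omega
      · intro hx; by_contra hn; nlinarith
  · simp only [bump, if_true, iff_true] at e' ⊢
    have e2 : 0 < x * F := by linarith
    refine ⟨by rintro rfl; simp at e2, ?_⟩
    rcases hlt with h | h
    · have := hF.1 h
      constructor
      · intro hx; exact h
      · intro hx; by_contra hn; nlinarith
    · have := hF.2 h
      constructor
      · intro hx; nlinarith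
      · intro hx; omega

/-- The pair of the moving points that is directed outwards at the parameter `x`. -/
def outward (i : ℕ) (x : ℝ) : ℕ × ℕ := if x < 0 then (i, i + 1) else (i + 1, i)

theorem movPt_diff_fst (N i : ℕ) (κ x : ℝ) :
    (movPt N i (-κ) (-x)).1 - (movPt N i κ x).1 = -x := by
  simp only [movPt]
  ring

theorem crossProd_movPt_rev (N i : ℕ) (κ x : ℝ) (R : ℝ × ℝ) (P : ℝ × ℝ)
    (h : crossProd (movPt N i κ x) (movPt N i (-κ) (-x)) R P = 0) :
    crossProd R P (movPt N i κ x) R = crossProd R P (midPt N i) R ∧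
    crossProd R P (movPt N i (-κ) (-x)) R = crossProd R P (midPt N i) R := by
  have e1 : (midPt N i).1 = ((movPt N i κ x).1 + (movPt N i (-κ) (-x)).1) / 2 := by
    simp only [movPt, midPt]; ring
  have e2 : (midPt N i).2 = ((movPt N i κ x).2 + (movPt N i (-κ) (-x)).2) / 2 := by
    simp only [movPt, midPt]; ring
  unfold crossProd at *
  rw [e1, e2]
  constructor <;> linarith

theorem crossProd_swap_eq_zero {P Q R S : ℝ × ℝ} (h : crossProd P Q R S = 0) :
    crossProd R S P Q = 0 ∧ crossProd Q P R S = 0 ∧ crossProd P Q S R = 0 := by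
  unfold crossProd at *
  refine ⟨?_, ?_, ?_⟩ <;> linarith

variable {N i : ℕ} {pos : Bool} {x : ℝ}

/-- The configuration at the parameter `x` of a crossing of the strands `i` and `i + 1`. -/
abbrev config (N i : ℕ) (pos : Bool) (x : ℝ) : ℕ → ℝ × ℝ := basePt N i (bump pos) x

local notation "cfg" => config N i pos x

theorem config_ne (hx : |x| ≤ 1) {a b : ℕ} (ha : a < N) (hb : b < N) (hab : a ≠ b) :
    cfg a ≠ cfg b :=
  basePt_ne (abs_bump pos) hx (Or.inr (bump_ne_zero pos)) ha hb hab

theorem config_fst_lt (hx : |x| ≤ 1) {a b : ℕ} (ha : a < N) (hb : b < N)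
    (hn : ¬(a = i ∧ b = i + 1)) (hn' : ¬(a = i + 1 ∧ b = i)) :
    (cfg a).1 < (cfg b).1 ↔ a < b := by
  have hZ := steep_basePt (N := N) (i := i) (abs_bump pos) hx
  rcases lt_trichotomy a b with h | h | h
  · have := (hZ a b h hb hn).1
    simp only [h, iff_true]
    linarith
  · subst h; simp
  · have := (hZ b a h ha (by omega)).1
    simp only [h.asymm, iff_false, not_lt]
    linarith

theorem config_moving_fst_lt :
    ((cfg i).1 < (cfg (i + 1)).1 ↔ x < 0) ∧
    ((cfg (i + 1)).1 < (cfg i).1 ↔ 0 < x) := by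
  have := movPt_diff_fst N i (bump pos) x
  simp only [config, basePt_self, basePt_succ]
  constructor <;> constructor <;> intro h <;> linarith

/-- The secant of the moving strands crosses a fixed secant exactly at the root. -/
theorem crossProd_config_fixed {r s : ℕ} (h : ValidCross N i r s .fixed) :
    crossProd (cfg i) (cfg (i + 1)) (cfg r)
      (cfg s) = -crossRoot N i pos r s .fixed x := by
  obtain ⟨h1, h2, h3, h4, h5, h6, h7⟩ := h
  rw [config, basePt_self, basePt_succ, basePt_other _ _ h3 h4, basePt_other _ _ h5 h6,
    crossProd_movPt]
  rfl

theorem validCross_fixed {c d : ℕ} (hcd : c < d) (hd : d < N) (h1 : c ≠ i) (h2 : c ≠ i + 1)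
    (h3 : d ≠ i) (h4 : d ≠ i + 1) : ValidCross N i c d .fixed :=
  ⟨hcd, hd, h1, h2, h3, h4, fun h => absurd rfl h⟩

theorem root_mem_Ioo {r s : ℕ} {k : CrossKind} (hi : i + 2 ≤ N) (h : ValidCross N i r s k)
    (hx : x ∈ Icc (-1 : ℝ) 1) (e : crossRoot N i pos r s k x = 0) : x ∈ Ioo (-1 : ℝ) 1 := by
  obtain ⟨y, hy, ey⟩ := exists_crossRoot pos hi h
  rwa [crossRoot_unique hi h hx hy e ey]

theorem moving_pair {A B : ℕ} (hAB : (A = i ∧ B = i + 1) ∨ (A = i + 1 ∧ B = i))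
    (hlt : (cfg A).1 < (cfg B).1) : (A, B) = outward i x := by
  unfold outward
  rcases hAB with ⟨rfl, rfl⟩ | ⟨rfl, rfl⟩
  · rw [config_moving_fst_lt.1] at hlt
    rw [if_pos hlt]
  · rw [config_moving_fst_lt.2] at hlt
    rw [if_neg hlt.le.not_gt]

theorem outward_eq {r s : ℕ} (h : ValidCross N i r s .fixed)
    (hx : x ∈ Ioo (-1 : ℝ) 1) (e : crossRoot N i pos r s .fixed x = 0) :
    outward i x = if (s < i) ↔ pos = true then (i, i + 1) else (i + 1, i) := by
  unfold outward
  have := (fixed_root_sign h hx e).2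
  by_cases hc : x < 0
  · rw [if_pos hc, if_pos (this.1 hc)]
  · rw [if_neg hc, if_neg (fun h' => hc (this.2 h'))]

/-- The position of a moving strand with respect to a fixed secant that is parallel to the secant of
the moving strands. -/
theorem crossProd_config_moving {r s A B : ℕ} (hv : ValidCross N i r s .fixed)
    (hAB : (A = i ∧ B = i + 1) ∨ (A = i + 1 ∧ B = i))
    (h0 : crossProd (cfg r) (cfg s) (cfg A) (cfg B) = 0) : crossRoot N i pos r s .fixed x = 0 ∧
      crossProd (cfg r) (cfg s) (cfg A) (cfg r) =
        -crossProd (stdPt N r) (stdPt N s) (stdPt N r) (midPt N i) := by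
  have h0' : crossProd (cfg i) (cfg (i + 1)) (cfg r) (cfg s) = 0 := by
    rcases hAB with ⟨rfl, rfl⟩ | ⟨rfl, rfl⟩
    · exact (crossProd_swap_eq_zero h0).1
    · exact (crossProd_swap_eq_zero (crossProd_swap_eq_zero h0).1).2.1
  refine ⟨by rw [crossProd_config_fixed hv] at h0'; linarith, ?_⟩
  have e2 : cfg r = stdPt N r := basePt_other _ _ hv.2.2.1 hv.2.2.2.1
  have e3 : cfg s = stdPt N s := basePt_other _ _ hv.2.2.2.2.1 hv.2.2.2.2.2.1
  rw [e2, e3, config, basePt_self, basePt_succ] at h0'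
  have e4 := crossProd_movPt_rev N i (bump pos) x (stdPt N r) (stdPt N s) h0'
  have e5 : crossProd (stdPt N r) (stdPt N s) (midPt N i) (stdPt N r) =
    -crossProd (stdPt N r) (stdPt N s) (stdPt N r) (midPt N i) := by unfold crossProd; ring
  rw [e2, e3, ← e5]
  rcases hAB with ⟨rfl, rfl⟩ | ⟨rfl, rfl⟩
  · rw [config, basePt_self]; exact e4.1
  · rw [config, basePt_succ]; exact e4.2

/-- Every outward crossing is one of the enumerated ones. -/
theorem exists_code (hi : i + 2 ≤ N) (hx : x ∈ Icc (-1 : ℝ) 1) {A B C D : ℕ}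
    (hA : A < N) (hB : B < N) (hC : C < N) (hD : D < N)
    (h0 : crossProd (cfg A) (cfg B) (cfg C) (cfg D) = 0)
    (h1 : (cfg A).1 < (cfg B).1)
    (h2 : (cfg C).1 < (cfg D).1)
    (h3 : crossProd (cfg A) (cfg B) (cfg C) (cfg A) < 0) :
    ∃ r s k, ValidCross N i r s k ∧ crossQuad i pos r s k = ((A, B), (C, D)) ∧
      crossRoot N i pos r s k x = 0 := by
  have hx' : |x| ≤ 1 := abs_le.2 hx
  have hZ := steep_basePt (N := N) (i := i) (abs_bump pos) hx'
  have nAC : A ≠ C := by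
    rintro rfl
    rw [crossProd_same] at h3
    exact lt_irrefl _ h3
  have nBC : B ≠ C := by
    rintro rfl
    rw [crossProd_rev] at h3
    exact lt_irrefl _ h3
  have h3' := h3
  rw [crossProd_third _ _ _ _ h0] at h3'
  have nAD : A ≠ D := by
    rintro rfl
    rw [crossProd_same] at h3'
    exact lt_irrefl _ h3'
  have nBD : B ≠ D := by
    rintro rfl
    rw [crossProd_rev] at h3'
    exact lt_irrefl _ h3'
  by_cases p1 : (A = i ∧ B = i + 1) ∨ (A = i + 1 ∧ B = i)
  · have hCD : C < D := (config_fst_lt hx' hC hD (by omega) (by omega)).1 h2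
    have hv := validCross_fixed (i := i) hCD hD (by omega) (by omega) (by omega) (by omega)
    obtain ⟨-, -, v1, v2, v3, v4, -⟩ := id hv
    obtain ⟨hr, e1⟩ := crossProd_config_moving hv p1 (crossProd_swap_eq_zero h0).1
    have hxo := root_mem_Ioo hi hv hx hr
    refine ⟨C, D, .fixed, hv, ?_, hr⟩
    have hm := moving_pair p1 h1
    rw [outward_eq hv hxo hr] at hm
    have side := midPt_side hi hCD hD v3 v4 v1 v2
    have hn : ¬(D < i ∨ i + 1 < C) := by
      intro hc
      have e6 : 0 < (cfg B).1 - (cfg A).1 := sub_pos.2 h1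
      have e7 : 0 < crossProd (cfg C) (cfg D) (cfg C) (cfg A) := by
        have s1 := side.1 hc
        unfold crossProd at *
        linarith
      have e8 : ((cfg B).1 - (cfg A).1) * crossProd (cfg C) (cfg D) (cfg C) (cfg A) =
          ((cfg D).1 - (cfg C).1) * crossProd (cfg A) (cfg B) (cfg C) (cfg A) := by
        unfold crossProd at *
        linear_combination (-((cfg A).1 - (cfg C).1)) * h0
      nlinarith [mul_pos e6 e7, sub_pos.2 h2]
    simp only [crossQuad, if_neg hn]
    rw [← hm]
  · by_cases p2 : (C = i ∧ D = i + 1) ∨ (C = i + 1 ∧ D = i)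
    · have hAB : A < B := (config_fst_lt hx' hA hB (by omega) (by omega)).1 h1
      have hv := validCross_fixed (i := i) hAB hB (by omega) (by omega) (by omega) (by omega)
      obtain ⟨-, -, v1, v2, v3, v4, -⟩ := id hv
      obtain ⟨hr, e1⟩ := crossProd_config_moving hv p2 h0
      have hxo := root_mem_Ioo hi hv hx hr
      refine ⟨A, B, .fixed, hv, ?_, hr⟩
      have hm := moving_pair p2 h2
      rw [outward_eq hv hxo hr] at hm
      have side := midPt_side hi hAB hB v3 v4 v1 v2
      have hn : B < i ∨ i + 1 < A := by
        by_contra hc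
        linarith [side.2 hc]
      simp only [crossQuad, if_pos hn]
      rw [← hm]
    · have hAB : A < B := (config_fst_lt hx' hA hB (by omega) (by omega)).1 h1
      have hCD : C < D := (config_fst_lt hx' hC hD (by omega) (by omega)).1 h2
      rcases hZ.parallel_cases hAB hCD hB hD (by omega) (by omega) h0 with h | h | h
      · exact absurd h.1 nAC
      · exact absurd h.1 nBD
      · obtain ⟨hAi, hCi, hbd⟩ := h
        have hCA : C < A := by
          rcases Nat.lt_or_gt_of_ne nAC with h | h
          · exfalso
            have := hZ.crossProd_pos (a := A) (b := C) (c := A) (d := B) h hAB (by omega) hB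
              (by omega) (by omega) (by omega)
            unfold crossProd at *
            linarith
          · exact h
        have hsame : ∀ R, R < i → cfg R = stdPt N R := fun R hR =>
          basePt_other _ _ (by omega) (by omega)
        have hv : ∀ k, ValidCross N i C A k := fun k =>
          ⟨hCA, hA, by omega, by omega, by omega, by omega, fun _ => hAi⟩
        rcases hbd with ⟨rfl, rfl⟩ | ⟨rfl, rfl⟩
        · refine ⟨C, A, .skew, hv _, rfl, ?_⟩
          have e := crossProd_eq_slopeDiff (N := N) (κ := bump pos) hAi hCi hi hx'
          have g1 := (gap_bounds (N := N) (κ := bump pos) hAi hi hx').1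
          have g2 := (gap_bounds (N := N) (κ := -bump pos) (s := -x) hCi hi (by rwa [abs_neg])).1
          rw [hsame A hAi, hsame C hCi, config, basePt_self, basePt_succ] at h0
          rw [(crossProd_swap_eq_zero h0).1] at e
          rcases mul_eq_zero.1 e.symm with h | h
          · rcases mul_eq_zero.1 h with h | h <;> linarith
          · exact h
        · refine ⟨C, A, .straight, hv _, rfl, ?_⟩
          have e := crossProd_eq_slopeDiff (N := N) (κ := bump pos) hCi hAi hi hx'
          have g1 := (gap_bounds (N := N) (κ := bump pos) hCi hi hx').1
          have g2 := (gap_bounds (N := N) (κ := -bump pos) (s := -x) hAi hi (by rwa [abs_neg])).1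
          rw [hsame A hAi, hsame C hCi, config, basePt_self, basePt_succ] at h0
          rw [h0] at e
          rcases mul_eq_zero.1 e.symm with h | h
          · rcases mul_eq_zero.1 h with h | h <;> linarith
          · exact h

end

section

variable {N i : ℕ} {pos : Bool} {x : ℝ}

local notation "cfg" => config N i pos x

theorem outward_cases (i : ℕ) (x : ℝ) : outward i x = (i, i + 1) ∨ outward i x = (i + 1, i) := by
  unfold outward
  split_ifs <;> simp

/-- The conditions of an outward crossing, stated without reference to angles. -/
def BaseCrosses (N i : ℕ) (pos : Bool) (x : ℝ) (c : (ℕ × ℕ) × (ℕ × ℕ)) : Prop :=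
  (c.1.1 < N ∧ c.1.2 < N ∧ c.2.1 < N ∧ c.2.2 < N) ∧
  crossProd (config N i pos x c.1.1) (config N i pos x c.1.2) (config N i pos x c.2.1)
      (config N i pos x c.2.2) = 0 ∧
  (config N i pos x c.1.1).1 < (config N i pos x c.1.2).1 ∧
  (config N i pos x c.2.1).1 < (config N i pos x c.2.2).1 ∧
  crossProd (config N i pos x c.1.1) (config N i pos x c.1.2) (config N i pos x c.2.1)
      (config N i pos x c.1.1) < 0

theorem outward_lt (hx : x ≠ 0) :
    (cfg (outward i x).1).1 < (cfg (outward i x).2).1 := by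
  unfold outward
  split_ifs with h
  · exact config_moving_fst_lt.1.2 h
  · exact config_moving_fst_lt.2.2 (lt_of_le_of_ne (not_lt.1 h) hx.symm)

theorem code_baseCrosses (hi : i + 2 ≤ N) {r s : ℕ} {k : CrossKind} (h : ValidCross N i r s k)
    (hx : x ∈ Ioo (-1 : ℝ) 1) (e : crossRoot N i pos r s k x = 0) :
    BaseCrosses N i pos x (crossQuad i pos r s k) := by
  have hx' : |x| ≤ 1 := abs_le.2 ⟨hx.1.le, hx.2.le⟩
  have hZ := steep_basePt (N := N) (i := i) (abs_bump pos) hx'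
  obtain ⟨h1, h2, h3, h4, h5, h6, h7⟩ := id h
  have er : cfg r = stdPt N r := basePt_other _ _ h3 h4
  have es : cfg s = stdPt N s := basePt_other _ _ h5 h6
  have ei : cfg i = movPt N i (bump pos) x := basePt_self _ _ _ _
  have ei' : cfg (i + 1) = movPt N i (-bump pos) (-x) := basePt_succ _ _ _ _
  cases k with
  | fixed =>
    have hx0 := (fixed_root_sign h hx e).1
    have hlt := outward_lt (N := N) (i := i) (pos := pos) hx0
    have hrs : (cfg r).1 < (cfg s).1 :=
      (config_fst_lt hx' (h1.trans h2) h2 (by omega) (by omega)).2 h1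
    have side := midPt_side hi h1 h2 h5 h6 h3 h4
    have c0 := crossProd_config_fixed (pos := pos) (x := x) h
    rw [e, neg_zero] at c0
    have c1 : crossProd (cfg (outward i x).1) (cfg (outward i x).2)
        (cfg r) (cfg s) = 0 := by
      rcases outward_cases i x with h | h <;> rw [h]
      · exact c0
      · exact (crossProd_swap_eq_zero c0).2.1
    have c4 := (crossProd_config_moving h (by rcases outward_cases i x with h | h <;> rw [h] <;> simp)
      (crossProd_swap_eq_zero c1).1).2
    have ho : (outward i x).1 < N ∧ (outward i x).2 < N := by
      rcases outward_cases i x with h | h <;> rw [h] <;> simp only <;> omega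
    simp only [crossQuad]
    rw [← outward_eq h hx e]
    by_cases hs : s < i ∨ i + 1 < r
    · rw [if_pos hs]
      refine ⟨⟨h1.trans h2, h2, ho.1, ho.2⟩, (crossProd_swap_eq_zero c1).1, hrs, hlt, ?_⟩
      simp only
      rw [c4]
      linarith [side.1 hs]
    · rw [if_neg hs]
      refine ⟨⟨ho.1, ho.2, h1.trans h2, h2⟩, c1, hlt, hrs, ?_⟩
      simp only
      have e8 : ((cfg (outward i x).2).1 - (cfg (outward i x).1).1) * crossProd (cfg r) (cfg s)
            (cfg (outward i x).1) (cfg r) =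
          -((cfg s).1 - (cfg r).1) *
          crossProd (cfg (outward i x).1) (cfg (outward i x).2)
            (cfg r) (cfg (outward i x).1) := by
        unfold crossProd at *
        linear_combination
          ((cfg (outward i x).1).1 - (cfg r).1) * c1
      rw [c4] at e8
      have f1 := side.2 hs
      by_contra hn
      have f2 := mul_pos (sub_pos.2 hlt) (neg_pos.2 f1)
      rw [e8] at f2
      have f3 := mul_nonneg (sub_pos.2 hrs).le (not_lt.1 hn)
      linarith
  | straight =>
    have hsi := h7 (by simp)
    have hri := h1.trans hsi
    have e1 := crossProd_eq_slopeDiff (N := N) (κ := bump pos) hri hsi hi hx'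
    simp only [crossRoot] at e
    rw [e, mul_zero] at e1
    have c0 : crossProd (cfg s) (cfg (i + 1)) (cfg r)
        (cfg i) = 0 := by rw [er, es, ei, ei']; exact e1
    simp only [BaseCrosses, crossQuad]
    refine ⟨⟨h2, by omega, h1.trans h2, by omega⟩,
      c0, ?_, ?_, ?_⟩
    · exact (config_fst_lt hx' h2 (by omega) (by omega)
        (by omega)).2 (by omega)
    · exact (config_fst_lt hx' (h1.trans h2) (by omega)
        (by omega) (by omega)).2
        (by omega)
    · have := hZ.crossProd_pos (a := r) (b := s) (c := s) (d := i + 1) h1 (by omega) (by omega)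
        (by omega) (by omega) (by omega) (by omega)
      unfold crossProd at *
      linarith
  | skew =>
    have hsi := h7 (by simp)
    have hri := h1.trans hsi
    have e1 := crossProd_eq_slopeDiff (N := N) (κ := bump pos) hsi hri hi hx'
    simp only [crossRoot] at e
    rw [e, mul_zero] at e1
    have c0 : crossProd (cfg s) (cfg i) (cfg r)
        (cfg (i + 1)) = 0 := by
      rw [er, es, ei, ei']; exact (crossProd_swap_eq_zero e1).1
    simp only [BaseCrosses, crossQuad]
    refine ⟨⟨h2, by omega, h1.trans h2, by omega⟩,
      c0, ?_, ?_, ?_⟩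
    · exact (config_fst_lt hx' h2 (by omega) (by omega)
        (by omega)).2 (by omega)
    · exact (config_fst_lt hx' (h1.trans h2) (by omega)
        (by omega) (by omega)).2
        (by omega)
    · have := hZ.crossProd_pos (a := r) (b := s) (c := s) (d := i) h1 (by omega) (by omega)
        (by omega) (by omega) (by omega) (by omega)
      unfold crossProd at *
      linarith

/-- The two secants of an enumerated crossing, up to their order. -/
def QuadShape (i : ℕ) (x : ℝ) (X Y : ℕ × ℕ) : Prop :=
  (X = outward i x ∧ Y.1 < Y.2 ∧ Y.1 ≠ i ∧ Y.1 ≠ i + 1 ∧ Y.2 ≠ i ∧ Y.2 ≠ i + 1) ∨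
  (Y = outward i x ∧ X.1 < X.2 ∧ X.1 ≠ i ∧ X.1 ≠ i + 1 ∧ X.2 ≠ i ∧ X.2 ≠ i + 1) ∨
  (X.1 < i ∧ Y.1 < i ∧ X.2 = i ∧ Y.2 = i + 1) ∨ (X.1 < i ∧ Y.1 < i ∧ X.2 = i + 1 ∧ Y.2 = i)

theorem QuadShape.symm {X Y : ℕ × ℕ} (h : QuadShape i x X Y) : QuadShape i x Y X := by
  unfold QuadShape at *
  tauto

theorem BaseCrosses.quadShape (hi : i + 2 ≤ N) (hx : x ∈ Icc (-1 : ℝ) 1)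
    {c : (ℕ × ℕ) × (ℕ × ℕ)} (h : BaseCrosses N i pos x c) : QuadShape i x c.1 c.2 := by
  obtain ⟨⟨a1, a2, a3, a4⟩, h0, h1, h2, h3⟩ := h
  obtain ⟨r, s, k, hv, hq, hr⟩ := exists_code hi hx a1 a2 a3 a4 h0 h1 h2 h3
  have hxo := root_mem_Ioo hi hv hx hr
  have e1 : c = crossQuad i pos r s k := hq.symm
  obtain ⟨v1, v2, v3, v4, v5, v6, v7⟩ := id hv
  rw [e1]
  cases k with
  | fixed =>
    simp only [crossQuad]
    rw [← outward_eq hv hxo hr]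
    split_ifs
    · right; left; exact ⟨rfl, v1, v3, v4, v5, v6⟩
    · left; exact ⟨rfl, v1, v3, v4, v5, v6⟩
  | straight =>
    have := v7 (by simp)
    right; right; right; exact ⟨this, v1.trans this, rfl, rfl⟩
  | skew =>
    have := v7 (by simp)
    right; right; left; exact ⟨this, v1.trans this, rfl, rfl⟩

/-- In an outward crossing each of the secants determines the other one. -/
theorem quadShape_unique (hx : x ∈ Icc (-1 : ℝ) 1) {X Y Z : ℕ × ℕ}
    (hX : X.2 < N) (hY : Y.2 < N)
    (h : QuadShape i x X Z) (h' : QuadShape i x Y Z)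
    (h0 : crossProd (cfg X.1) (cfg X.2) (cfg Y.1) (cfg Y.2) = 0) : X = Y := by
  have hx' : |x| ≤ 1 := abs_le.2 hx
  have hZ := steep_basePt (N := N) (i := i) (abs_bump pos) hx'
  have key : X.1 < X.2 → Y.1 < Y.2 → ¬(X.1 = i ∧ X.2 = i + 1) → ¬(Y.1 = i ∧ Y.2 = i + 1) →
      ¬(X.1 = i ∧ Y.1 = i + 1) → ¬(X.1 = i + 1 ∧ Y.1 = i) →
      ¬(X.2 = i ∧ Y.2 = i + 1) → ¬(X.2 = i + 1 ∧ Y.2 = i) → X = Y := by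
    intro a1 a2 a3 a4 a5 a6 a7 a8
    rcases hZ.parallel_cases a1 a2 hX hY a3 a4 h0 with h | h | h
    · exact Prod.ext h.1 h.2
    · omega
    · omega
  rcases h with ⟨rfl, b⟩ | ⟨b, c⟩ | b | b <;> rcases h' with ⟨rfl, b'⟩ | ⟨b', c'⟩ | b' | b'
  · rfl
  · rcases outward_cases i x with h | h <;> rw [h] at b' <;> subst b' <;> simp only at b <;> omega
  · omega
  · omega
  · rcases outward_cases i x with h | h <;> rw [h] at b <;> subst b <;> simp only at b' <;> omega
  · exact key c.1 c'.1 (by omega) (by omega) (by omega) (by omega) (by omega) (by omega)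
  · rcases outward_cases i x with h | h <;> rw [h] at b <;> subst b <;> simp only at b' <;> omega
  · rcases outward_cases i x with h | h <;> rw [h] at b <;> subst b <;> simp only at b' <;> omega
  · omega
  · rcases outward_cases i x with h | h <;> rw [h] at b' <;> subst b' <;> simp only at b <;> omega
  · exact key (by omega) (by omega) (by omega) (by omega) (by omega) (by omega) (by omega) (by omega)
  · omega
  · omega
  · rcases outward_cases i x with h | h <;> rw [h] at b' <;> subst b' <;> simp only at b <;> omega
  · omega
  · exact key (by omega) (by omega) (by omega) (by omega) (by omega) (by omega) (by omega) (by omega)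

/-! ### The crossings of the sheared configuration -/

/-- A crossing, or the crossing of the reversed secants. -/
def orientedQuad (i : ℕ) (pos : Bool) (r s : ℕ) (k : CrossKind) (f : Bool) :
    (ℕ × ℕ) × (ℕ × ℕ) :=
  if f then flip (crossQuad i pos r s k) else crossQuad i pos r s k

theorem sheared_ne (ε : ℝ) (hx : x ∈ Icc (-1 : ℝ) 1) {a b : ℕ} (ha : a < N) (hb : b < N)
    (hab : a ≠ b) : shear ε (cfg a) ≠ shear ε (cfg b) :=
  (shear_injective ε).ne (config_ne (abs_le.2 hx) ha hb hab)

theorem BaseCrosses.crosses (ε : ℝ) {c : (ℕ × ℕ) × (ℕ × ℕ)}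
    (h : BaseCrosses N i pos x c) : Crosses (fun b => shear ε (cfg b)) c := by
  obtain ⟨-, h0, h1, h2, h3⟩ := h
  exact (crosses_shear_iff ε h1 (by intro e; rw [e] at h2; exact lt_irrefl _ h2)).2 ⟨h0, h2, h3⟩

theorem BaseCrosses.ne {c : (ℕ × ℕ) × (ℕ × ℕ)} (h : BaseCrosses N i pos x c) :
    c.1.1 ≠ c.1.2 ∧ c.2.1 ≠ c.2.2 := by
  obtain ⟨-, h0, h1, h2, h3⟩ := h
  constructor
  · intro e; rw [e] at h1; exact lt_irrefl _ h1
  · intro e; rw [e] at h2; exact lt_irrefl _ h2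

theorem orientedQuad_crosses (ε : ℝ) (hi : i + 2 ≤ N) {r s : ℕ} {k : CrossKind}
    (h : ValidCross N i r s k) (hx : x ∈ Icc (-1 : ℝ) 1) (e : crossRoot N i pos r s k x = 0)
    (f : Bool) :
    Crosses (fun b => shear ε (cfg b)) (orientedQuad i pos r s k f) := by
  have hb := code_baseCrosses hi h (root_mem_Ioo hi h hx e) e
  have hc := hb.crosses ε
  cases f
  · exact hc
  · exact hc.flip (sheared_ne ε hx hb.1.1 hb.1.2.1 hb.ne.1)
      (sheared_ne ε hx hb.1.2.2.1 hb.1.2.2.2 hb.ne.2)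

theorem vertical_pair (hx : x ∈ Icc (-1 : ℝ) 1) {a b : ℕ} (ha : a < N) (hb : b < N) (hab : a ≠ b)
    (e : (cfg a).1 = (cfg b).1) :
    (a = i ∧ b = i + 1) ∨ (a = i + 1 ∧ b = i) := by
  by_contra hn
  push Not at hn
  have h1 := config_fst_lt (pos := pos) (i := i) (abs_le.2 hx) ha hb (by tauto) (by tauto)
  have h2 := config_fst_lt (pos := pos) (i := i) (abs_le.2 hx) hb ha (by tauto) (by tauto)
  rcases Nat.lt_or_gt_of_ne hab with h | h
  · have := h1.2 h; linarith
  · have := h2.2 h; linarith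

/-- A crossing of the sheared configuration is an outward one or the reverse of an outward one. -/
theorem Crosses.baseCrosses (ε : ℝ) (hx : x ∈ Icc (-1 : ℝ) 1)
    {c : (ℕ × ℕ) × (ℕ × ℕ)} (hN : c.1.1 < N ∧ c.1.2 < N ∧ c.2.1 < N ∧ c.2.2 < N)
    (h1 : c.1.1 ≠ c.1.2) (h2 : c.2.1 ≠ c.2.2)
    (h : Crosses (fun b => shear ε (cfg b)) c) :
    BaseCrosses N i pos x c ∨ BaseCrosses N i pos x (PlatTrace.flip c) := by
  obtain ⟨n1, n2, n3, n4⟩ := hN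
  have d1 := config_ne (pos := pos) (i := i) (abs_le.2 hx) n1 n2 h1
  have d2 := config_ne (pos := pos) (i := i) (abs_le.2 hx) n3 n4 h2
  rcases lt_trichotomy (cfg c.1.1).1 (cfg c.1.2).1 with l | l | l
  · left
    have := (crosses_shear_iff ε l d2).1 h
    exact ⟨⟨n1, n2, n3, n4⟩, this.1, l, this.2⟩
  · exfalso
    have s1 := sheared_ne (pos := pos) (i := i) ε hx n1 n2 h1
    have s2 := sheared_ne (pos := pos) (i := i) ε hx n3 n4 h2
    by_cases l2 : (cfg c.2.1).1 = (cfg c.2.2).1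
    · have v1 := vertical_pair hx n1 n2 h1 l
      have v2 := vertical_pair hx n3 n4 h2 l2
      have hor : c.1 = c.2 ∨ c.1 = c.2.swap := by
        rcases v1 with v1 | v1 <;> rcases v2 with v2 | v2
        · left; exact Prod.ext (by omega) (by omega)
        · right; exact Prod.ext (by simp only [Prod.fst_swap]; omega) (by simp only [Prod.snd_swap]; omega)
        · right; exact Prod.ext (by simp only [Prod.fst_swap]; omega) (by simp only [Prod.snd_swap]; omega)
        · left; exact Prod.ext (by omega) (by omega)
      rcases hor with hor | hor
      · have := h.2
        rw [hor] at this
        exact lt_irrefl _ this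
      · have := h.1
        rw [hor] at this
        simp only [Prod.fst_swap, Prod.snd_swap] at this
        rw [secantAngle_eq_iff_exists s2.symm s2] at this
        obtain ⟨t, ht, e1, e2⟩ := this
        apply s2
        have f1 : (1 + t) * ((shear ε (cfg c.2.2)).1 - (shear ε (cfg c.2.1)).1) = 0 := by linarith
        have f2 : (1 + t) * ((shear ε (cfg c.2.2)).2 - (shear ε (cfg c.2.1)).2) = 0 := by linarith
        have ht' : (1 + t) ≠ 0 := by linarith
        exact Prod.ext (by linarith [(mul_eq_zero.1 f1).resolve_left ht'])
          (by linarith [(mul_eq_zero.1 f2).resolve_left ht'])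
    · have := ((secantAngle_eq_iff (P := shear ε (cfg c.2.1)) (Q := shear ε (cfg c.2.2))
        (sub_ne_zero.2 (Ne.symm l2)) s1).1 h.1.symm).2
      simp only [shear] at this
      rw [l, sub_self, mul_zero] at this
      exact lt_irrefl _ this
  · right
    have s1 := sheared_ne (pos := pos) (i := i) ε hx n1 n2 h1
    have s2 := sheared_ne (pos := pos) (i := i) ε hx n3 n4 h2
    have hf := h.flip s1 s2
    have hf2 := (secantAngle_eq_iff (P := shear ε (cfg c.1.2))
      (Q := shear ε (cfg c.1.1)) (by simp only [shear]; linarith) s2.symm).1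
      (secantAngle_swap_eq s1 s2 h.1)
    have hpos : (cfg c.2.2).1 < (cfg c.2.1).1 := by
      have e := hf2.2
      simp only [shear] at e
      linarith [(mul_pos_iff_of_pos_left (sub_pos.2 l)).1 e]
    have := (crosses_shear_iff (c := PlatTrace.flip c) ε hpos d1.symm).1 hf
    exact ⟨⟨n4, n3, n2, n1⟩, this.1, hpos, this.2⟩

theorem Crosses.exists_code (ε : ℝ) (hi : i + 2 ≤ N) (hx : x ∈ Icc (-1 : ℝ) 1)
    {c : (ℕ × ℕ) × (ℕ × ℕ)} (hN : c.1.1 < N ∧ c.1.2 < N ∧ c.2.1 < N ∧ c.2.2 < N)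
    (h1 : c.1.1 ≠ c.1.2) (h2 : c.2.1 ≠ c.2.2)
    (h : Crosses (fun b => shear ε (cfg b)) c) :
    ∃ r s k f, ValidCross N i r s k ∧ orientedQuad i pos r s k f = c ∧
      crossRoot N i pos r s k x = 0 := by
  rcases h.baseCrosses ε hx hN h1 h2 with h | h
  · obtain ⟨⟨a1, a2, a3, a4⟩, h0, l1, l2, l3⟩ := h
    obtain ⟨r, s, k, hv, hq, hr⟩ := PlatTrace.exists_code hi hx a1 a2 a3 a4 h0 l1 l2 l3
    exact ⟨r, s, k, false, hv, hq, hr⟩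
  · obtain ⟨⟨a1, a2, a3, a4⟩, h0, l1, l2, l3⟩ := h
    obtain ⟨r, s, k, hv, hq, hr⟩ := PlatTrace.exists_code hi hx a1 a2 a3 a4 h0 l1 l2 l3
    refine ⟨r, s, k, true, hv, ?_, hr⟩
    simp only [orientedQuad, if_true, hq]
    rfl

/-- If two secants cross a third one at the same parameter in the same place, they coincide. -/
theorem Crosses.unique (ε : ℝ) (hi : i + 2 ≤ N) (hx : x ∈ Icc (-1 : ℝ) 1) {X Y Z : ℕ × ℕ}
    (hX : X.1 < N ∧ X.2 < N) (hY : Y.1 < N ∧ Y.2 < N) (hZ : Z.1 < N ∧ Z.2 < N)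
    (nX : X.1 ≠ X.2) (nY : Y.1 ≠ Y.2) (nZ : Z.1 ≠ Z.2)
    (h : Crosses (fun b => shear ε (cfg b)) (X, Z) ∨
      Crosses (fun b => shear ε (cfg b)) (Z, X))
    (h' : Crosses (fun b => shear ε (cfg b)) (Y, Z) ∨
      Crosses (fun b => shear ε (cfg b)) (Z, Y)) : X = Y := by
  -- all secants are directed outwards, or all inwards
  have shape : ∀ X : ℕ × ℕ, X.1 < N ∧ X.2 < N → X.1 ≠ X.2 →
      (Crosses (fun b => shear ε (cfg b)) (X, Z) ∨
      Crosses (fun b => shear ε (cfg b)) (Z, X)) →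
      (QuadShape i x X Z ∧ (cfg Z.1).1 < (cfg Z.2).1 ∧ crossProd (cfg Z.1) (cfg Z.2) (cfg X.1)
          (cfg X.2) = 0 ∧
        (cfg X.1).1 < (cfg X.2).1) ∨
      (QuadShape i x X.swap Z.swap ∧ (cfg Z.2).1 < (cfg Z.1).1 ∧
        crossProd (cfg Z.2) (cfg Z.1) (cfg X.2)
          (cfg X.1) = 0 ∧
        (cfg X.2).1 < (cfg X.1).1) := by
    intro X hX nX h
    rcases h with h | h
    · rcases h.baseCrosses ε hx ⟨hX.1, hX.2, hZ.1, hZ.2⟩ nX nZ with h | h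
      · left
        exact ⟨h.quadShape hi hx, h.2.2.2.1, (crossProd_swap_eq_zero h.2.1).1, h.2.2.1⟩
      · right
        exact ⟨(h.quadShape hi hx).symm, h.2.2.1, h.2.1, h.2.2.2.1⟩
    · rcases h.baseCrosses ε hx ⟨hZ.1, hZ.2, hX.1, hX.2⟩ nZ nX with h | h
      · left
        exact ⟨(h.quadShape hi hx).symm, h.2.2.1, h.2.1, h.2.2.2.1⟩
      · right
        exact ⟨h.quadShape hi hx, h.2.2.2.1, (crossProd_swap_eq_zero h.2.1).1, h.2.2.1⟩
  have par : ∀ P Q R S R' S' : ℝ × ℝ, P.1 < Q.1 → crossProd P Q R S = 0 →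
      crossProd P Q R' S' = 0 → crossProd R S R' S' = 0 := by
    intro P Q R S R' S' h1 h2 h3
    have h1' : Q.1 - P.1 ≠ 0 := (sub_pos.2 h1).ne'
    unfold crossProd at *
    apply mul_left_cancel₀ h1'
    rw [mul_zero]
    linear_combination (S.1 - R.1) * h3 - (S'.1 - R'.1) * h2
  rcases shape X hX nX h with ⟨a1, a2, a3, a4⟩ | ⟨a1, a2, a3, a4⟩ <;>
    rcases shape Y hY nY h' with ⟨b1, b2, b3, b4⟩ | ⟨b1, b2, b3, b4⟩
  · exact quadShape_unique hx hX.2 hY.2 a1 b1 (par _ _ _ _ _ _ a2 a3 b3)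
  · linarith
  · linarith
  · exact Prod.swap_injective (quadShape_unique (X := X.swap) (Y := Y.swap) hx hX.1 hY.1 a1 b1
      (par _ _ _ _ _ _ a2 a3 b3))

end

section

/-! ## Signs of the crossings -/

/-- The Wronskian of the secant from `P` to `Q`, whose ends have the velocities `u` and `v`. -/
def wronskian (P u Q v : ℝ × ℝ) : ℝ := (Q.1 - P.1) * (v.2 - u.2) - (Q.2 - P.2) * (v.1 - u.1)

/-- The determinant giving the sign of a secant, in terms of the planar velocities of its ends. -/
def skewDet (P u Q v : ℝ × ℝ) : ℝ :=
  Q.1 * (u.1 * (P.2 - Q.2) - u.2 * (P.1 - Q.1)) - P.1 * (v.1 * (P.2 - Q.2) - v.2 * (P.1 - Q.1))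

/-- The angular velocity of the secant from `P` to `Q`. -/
def turn (P u Q v : ℝ × ℝ) : ℝ := wronskian P u Q v / ((Q.2 - P.2) ^ 2 + (Q.1 - P.1) ^ 2)

theorem wronskian_symm (P u Q v : ℝ × ℝ) : wronskian Q v P u = wronskian P u Q v := by
  unfold wronskian; ring

theorem skewDet_symm (P u Q v : ℝ × ℝ) : skewDet Q v P u = skewDet P u Q v := by
  unfold skewDet; ring

theorem turn_symm (P u Q v : ℝ × ℝ) : turn Q v P u = turn P u Q v := by
  unfold turn
  rw [wronskian_symm]
  congr 1
  ring

/-- The velocity of a sheared point, if the shear parameter is `t * x`. -/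
def shearVel (t x : ℝ) (P u : ℝ × ℝ) : ℝ × ℝ := (u.1, u.2 + t * (1 - P.1) - t * x * u.1)

theorem wronskian_shear (t x : ℝ) (P u Q v : ℝ × ℝ) :
    wronskian (shear (t * x) P) (shearVel t x P u) (shear (t * x) Q) (shearVel t x Q v) =
      wronskian P u Q v - t * (Q.1 - P.1) ^ 2 := by
  simp only [wronskian, shear, shearVel]
  ring

theorem skewDet_shear (t x : ℝ) (P u Q v : ℝ × ℝ) :
    skewDet (shear (t * x) P) (shearVel t x P u) (shear (t * x) Q) (shearVel t x Q v) =
      skewDet P u Q v + t * (Q.1 - P.1) ^ 2 := by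
  simp only [skewDet, shear, shearVel]
  ring

theorem turn_sub_turn {P u Q v R u' S v' : ℝ × ℝ} (hPQ : Q.1 - P.1 ≠ 0) (hRS : S.1 - R.1 ≠ 0)
    (h : crossProd P Q R S = 0) :
    turn R u' S v' - turn P u Q v = (Q.1 - P.1) ^ 2 / ((Q.2 - P.2) ^ 2 + (Q.1 - P.1) ^ 2) *
      (wronskian R u' S v' / (S.1 - R.1) ^ 2 - wronskian P u Q v / (Q.1 - P.1) ^ 2) := by
  have hS : S.2 - R.2 = (S.1 - R.1) / (Q.1 - P.1) * (Q.2 - P.2) := by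
    unfold crossProd at h
    field_simp
    linarith
  have p1 : 0 < (Q.1 - P.1) ^ 2 := by positivity
  have p2 : (Q.2 - P.2) ^ 2 + (Q.1 - P.1) ^ 2 ≠ 0 := by positivity
  have e : (S.2 - R.2) ^ 2 + (S.1 - R.1) ^ 2 =
      (S.1 - R.1) ^ 2 / (Q.1 - P.1) ^ 2 * ((Q.2 - P.2) ^ 2 + (Q.1 - P.1) ^ 2) := by
    rw [hS]
    field_simp
  unfold turn
  rw [e]
  field_simp

/-- The speed with which the sheared configuration is tilted. -/
def tilt (N : ℕ) (pos : Bool) : ℝ := 4 * bump pos / N ^ 2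

/-- The velocity of the configuration with respect to its parameter. -/
def configVel (N i : ℕ) (pos : Bool) (x : ℝ) (b : ℕ) : ℝ × ℝ :=
  if b = i then movVel N i (bump pos) x else if b = i + 1 then -movVel N i (bump pos) x else 0

/-- The sheared configuration. -/
def shPt (N i : ℕ) (pos : Bool) (x : ℝ) (b : ℕ) : ℝ × ℝ :=
  shear (tilt N pos * x) (config N i pos x b)

/-- The velocity of the sheared configuration. -/
def shVel (N i : ℕ) (pos : Bool) (x : ℝ) (b : ℕ) : ℝ × ℝ :=
  shearVel (tilt N pos) x (config N i pos x b) (configVel N i pos x b)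

/-- The sign of the secant of the strands `a` and `b` agrees with the direction of its rotation. -/
def Coherent (N i : ℕ) (pos : Bool) (x : ℝ) (c : ℕ × ℕ) : Prop :=
  wronskian (shPt N i pos x c.1) (shVel N i pos x c.1) (shPt N i pos x c.2) (shVel N i pos x c.2) *
    skewDet (shPt N i pos x c.1) (shVel N i pos x c.1) (shPt N i pos x c.2) (shVel N i pos x c.2) < 0

variable {N i : ℕ} {pos : Bool} {x : ℝ}

local notation "cfg" => config N i pos x

theorem Coherent.swap {c : ℕ × ℕ} (h : Coherent N i pos x c) : Coherent N i pos x c.swap := by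
  unfold Coherent at *
  rw [Prod.fst_swap, Prod.snd_swap, wronskian_symm, skewDet_symm]
  exact h

theorem tilt_bounds (hN : 2 ≤ N) : |tilt N pos| * N ^ 2 = 1 / 2 ∧ tilt N pos ≠ 0 := by
  have hN' : (0 : ℝ) < N := by exact_mod_cast (by omega : 0 < N)
  have hb : |bump pos| = 1 / 8 := by
    cases pos <;> norm_num [bump, abs_of_neg, abs_of_pos]
  constructor
  · unfold tilt
    rw [abs_div, abs_mul, hb, abs_of_pos (pow_pos hN' 2)]
    field_simp
    norm_num
  · unfold tilt
    have := bump_ne_zero pos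
    positivity

/-- The wronskian of two of the unsheared points. -/
def baseWronskian (N i : ℕ) (pos : Bool) (x : ℝ) (c : ℕ × ℕ) : ℝ :=
  wronskian (config N i pos x c.1) (configVel N i pos x c.1) (config N i pos x c.2)
    (configVel N i pos x c.2)

theorem configVel_self : configVel N i pos x i = movVel N i (bump pos) x := by simp [configVel]

theorem configVel_succ : configVel N i pos x (i + 1) = -movVel N i (bump pos) x := by
  simp [configVel]

theorem configVel_other {b : ℕ} (h : b ≠ i) (h' : b ≠ i + 1) : configVel N i pos x b = 0 := by
  simp [configVel, h, h']

theorem baseWronskian_fixed {r s : ℕ} (h3 : r ≠ i) (h4 : r ≠ i + 1) (h5 : s ≠ i)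
    (h6 : s ≠ i + 1) : baseWronskian N i pos x (r, s) = 0 := by
  simp [baseWronskian, configVel_other h3 h4, configVel_other h5 h6, wronskian]

theorem baseWronskian_moving : baseWronskian N i pos x (i, i + 1) = -2 * bump pos * (1 + x ^ 2) := by
  unfold baseWronskian
  rw [configVel_self, configVel_succ, config, basePt_self, basePt_succ]
  simp only [wronskian, movVel, movPt, Prod.fst_neg, Prod.snd_neg]
  unfold edge
  ring

theorem baseWronskian_to_first {r : ℕ} (hr : r < i) :
    baseWronskian N i pos x (r, i) = turnTo N i r (bump pos) x := by
  unfold baseWronskian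
  rw [configVel_self, configVel_other (by omega) (by omega), config, basePt_self,
    basePt_other _ _ (by omega) (by omega)]
  simp only [wronskian, turnTo, Prod.fst_zero, Prod.snd_zero]
  ring

theorem baseWronskian_to_second {r : ℕ} (hr : r < i) :
    baseWronskian N i pos x (r, i + 1) = -turnTo N i r (-bump pos) (-x) := by
  unfold baseWronskian
  rw [configVel_succ, configVel_other (by omega) (by omega), config, basePt_succ,
    basePt_other _ _ (by omega) (by omega)]
  simp only [wronskian, turnTo, Prod.fst_zero, Prod.snd_zero, movVel, Prod.fst_neg, Prod.snd_neg]
  ring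

theorem coherent_iff {c : ℕ × ℕ} : Coherent N i pos x c ↔ (baseWronskian N i pos x c -
      tilt N pos * ((cfg c.2).1 - (cfg c.1).1) ^ 2) *
    (skewDet (cfg c.1) (configVel N i pos x c.1) (cfg c.2) (configVel N i pos x c.2) +
      tilt N pos * ((cfg c.2).1 - (cfg c.1).1) ^ 2) < 0 := by
  unfold Coherent shPt shVel
  rw [wronskian_shear, skewDet_shear]
  rfl

theorem coherent_fixed (hN : 2 ≤ N) {r s : ℕ} (hrs : r < s) (h3 : r ≠ i) (h4 : r ≠ i + 1)
    (h5 : s ≠ i) (h6 : s ≠ i + 1) : Coherent N i pos x (r, s) := by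
  rw [coherent_iff, baseWronskian_fixed h3 h4 h5 h6]
  have hg := fixed_gap_pos (N := N) hrs
  have e1 : cfg r = stdPt N r := basePt_other _ _ h3 h4
  have e2 : cfg s = stdPt N s := basePt_other _ _ h5 h6
  simp only [configVel_other h3 h4, configVel_other h5 h6, skewDet, e1, e2, Prod.fst_zero,
    Prod.snd_zero, zero_mul, sub_self, mul_zero, zero_add, zero_sub]
  have := (tilt_bounds (pos := pos) hN).2
  have h1 : 0 < (tilt N pos * ((stdPt N s).1 - (stdPt N r).1) ^ 2) ^ 2 := by
    have := hg.ne'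
    positivity
  nlinarith

theorem coherent_moving : Coherent N i pos x (i, i + 1) := by
  rw [coherent_iff, baseWronskian_moving, configVel_self, configVel_succ, config, basePt_self,
    basePt_succ]
  have e : skewDet (movPt N i (bump pos) x) (movVel N i (bump pos) x)
      (movPt N i (-bump pos) (-x)) (-movVel N i (bump pos) x) =
      (2 * i + 3) * (bump pos * (1 + x ^ 2)) := by
    simp only [skewDet, movVel, movPt, Prod.fst_neg, Prod.snd_neg]
    unfold edge
    ring
  simp only [e, movPt_diff_fst]
  unfold tilt
  have hi : (0 : ℝ) ≤ i := Nat.cast_nonneg i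
  have hb : 0 < bump pos * bump pos := mul_self_pos.2 (bump_ne_zero pos)
  have hq : 0 ≤ 4 / (N : ℝ) ^ 2 * x ^ 2 := by positivity
  have f1 : -2 * bump pos * (1 + x ^ 2) - 4 * bump pos / N ^ 2 * (-x) ^ 2 =
      bump pos * -(2 * (1 + x ^ 2) + 4 / (N : ℝ) ^ 2 * x ^ 2) := by ring
  have f2 : (2 * (i : ℝ) + 3) * (bump pos * (1 + x ^ 2)) + 4 * bump pos / N ^ 2 * (-x) ^ 2 =
      bump pos * ((2 * i + 3) * (1 + x ^ 2) + 4 / (N : ℝ) ^ 2 * x ^ 2) := by ring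
  rw [f1, f2]
  have g1 : 0 < 2 * (1 + x ^ 2) + 4 / (N : ℝ) ^ 2 * x ^ 2 := by positivity
  have g2 : 0 < (2 * (i : ℝ) + 3) * (1 + x ^ 2) + 4 / (N : ℝ) ^ 2 * x ^ 2 := by positivity
  nlinarith [mul_pos hb (mul_pos g1 g2)]

theorem tilt_gap_le (hN : 2 ≤ N) {g : ℝ} (h0 : 1 ≤ g) (h1 : g < N) :
    -(1 / 2) ≤ tilt N pos * g ^ 2 ∧ tilt N pos * g ^ 2 ≤ 1 / 2 := by
  have ht := (tilt_bounds (N := N) (pos := pos) hN).1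
  have : |tilt N pos * g ^ 2| ≤ 1 / 2 := by
    rw [abs_mul, abs_of_pos (by positivity : 0 < g ^ 2), ← ht]
    apply mul_le_mul_of_nonneg_left _ (abs_nonneg _)
    nlinarith
  exact abs_le.1 this

theorem coherent_to_first (hi : i + 2 ≤ N) (hx : |x| ≤ 1) {r : ℕ} (hr : r < i) :
    Coherent N i pos x (r, i) := by
  rw [coherent_iff, baseWronskian_to_first hr, configVel_self,
    configVel_other (by omega) (by omega), config, basePt_self,
    basePt_other _ _ (by omega) (by omega)]
  have hT := one_le_turnTo (N := N) hr (abs_bump pos) hx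
  have hg := gap_bounds (N := N) (κ := bump pos) hr hi hx
  have ht := tilt_gap_le (N := N) (pos := pos) (by omega) hg.1 hg.2
  have e : skewDet (stdPt N r) 0 (movPt N i (bump pos) x) (movVel N i (bump pos) x) =
      -((r + 1) * turnTo N i r (bump pos) x) := by
    simp only [skewDet, turnTo, stdPt, Prod.fst_zero, Prod.snd_zero]
    ring
  have hr0 : (0 : ℝ) ≤ r := Nat.cast_nonneg r
  simp only [e]
  apply mul_neg_of_pos_of_neg
  · linarith
  · nlinarith

theorem coherent_to_second (hi : i + 2 ≤ N) (hx : |x| ≤ 1) {r : ℕ} (hr : r < i) :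
    Coherent N i pos x (r, i + 1) := by
  rw [coherent_iff, baseWronskian_to_second hr, configVel_succ,
    configVel_other (by omega) (by omega), config, basePt_succ,
    basePt_other _ _ (by omega) (by omega)]
  have hT := one_le_turnTo (N := N) (κ := -bump pos) (s := -x) hr
    (by rw [abs_neg]; exact abs_bump pos) (by rwa [abs_neg])
  have hg := gap_bounds (N := N) (κ := -bump pos) (s := -x) hr hi (by rwa [abs_neg])
  have ht := tilt_gap_le (N := N) (pos := pos) (by omega) hg.1 hg.2
  have e : skewDet (stdPt N r) 0 (movPt N i (-bump pos) (-x)) (-movVel N i (bump pos) x) =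
      (r + 1) * turnTo N i r (-bump pos) (-x) := by
    simp only [skewDet, turnTo, stdPt, Prod.fst_zero, Prod.snd_zero, movVel, Prod.fst_neg,
      Prod.snd_neg]
    ring
  have hr0 : (0 : ℝ) ≤ r := Nat.cast_nonneg r
  simp only [e]
  apply mul_neg_of_neg_of_pos
  · linarith
  · nlinarith

/-- The sign of an enumerated crossing, up to the orientations of the four strands. -/
def crossSgn (i : ℕ) (pos : Bool) (r s : ℕ) (k : CrossKind) (f : Bool) : ℤ :=
  (if f then -1 else 1) * match k with
    | .fixed => (if s < i ∨ i + 1 < r then -1 else 1) * (if pos then 1 else -1)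
    | .straight => 1
    | .skew => -1

theorem outward_coherent : Coherent N i pos x (outward i x) := by
  rcases outward_cases i x with h | h <;> rw [h]
  · exact coherent_moving
  · exact coherent_moving.swap

theorem baseWronskian_outward :
    baseWronskian N i pos x (outward i x) = -2 * bump pos * (1 + x ^ 2) := by
  rw [← baseWronskian_moving (N := N) (i := i)]
  rcases outward_cases i x with h | h <;> rw [h]
  unfold baseWronskian
  exact wronskian_symm _ _ _ _

/-- The turning speed of the secant of two sheared points. -/
def shTurn (N i : ℕ) (pos : Bool) (x : ℝ) (c : ℕ × ℕ) : ℝ :=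
  turn (shPt N i pos x c.1) (shVel N i pos x c.1) (shPt N i pos x c.2) (shVel N i pos x c.2)

theorem shTurn_swap (c : ℕ × ℕ) : shTurn N i pos x c.swap = shTurn N i pos x c :=
  turn_symm _ _ _ _

theorem sign_shTurn_sub {c : (ℕ × ℕ) × (ℕ × ℕ)} (h : BaseCrosses N i pos x c) :
    SignType.sign (shTurn N i pos x c.2 - shTurn N i pos x c.1) =
      SignType.sign (baseWronskian N i pos x c.2 / ((cfg c.2.2).1 - (cfg c.2.1).1) ^ 2 -
        baseWronskian N i pos x c.1 / ((cfg c.1.2).1 - (cfg c.1.1).1) ^ 2) := by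
  obtain ⟨-, h0, h1, h2, -⟩ := h
  have d1 : (shPt N i pos x c.1.2).1 - (shPt N i pos x c.1.1).1 ≠ 0 := (sub_pos.2 h1).ne'
  have d2 : (shPt N i pos x c.2.2).1 - (shPt N i pos x c.2.1).1 ≠ 0 := (sub_pos.2 h2).ne'
  have h0' : crossProd (shPt N i pos x c.1.1) (shPt N i pos x c.1.2) (shPt N i pos x c.2.1)
      (shPt N i pos x c.2.2) = 0 := by
    unfold shPt
    rw [crossProd_shear, h0]
  have key := turn_sub_turn (u := shVel N i pos x c.1.1) (v := shVel N i pos x c.1.2)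
    (u' := shVel N i pos x c.2.1) (v' := shVel N i pos x c.2.2) d1 d2 h0'
  unfold shTurn
  rw [key, sign_mul]
  have hp : 0 < ((shPt N i pos x c.1.2).1 - (shPt N i pos x c.1.1).1) ^ 2 /
      (((shPt N i pos x c.1.2).2 - (shPt N i pos x c.1.1).2) ^ 2 +
      ((shPt N i pos x c.1.2).1 - (shPt N i pos x c.1.1).1) ^ 2) := by positivity
  rw [sign_pos hp, one_mul]
  congr 1
  unfold shPt shVel
  rw [wronskian_shear, wronskian_shear]
  have e1 : (cfg c.1.2).1 - (cfg c.1.1).1 ≠ 0 := (sub_pos.2 h1).ne'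
  have e2 : (cfg c.2.2).1 - (cfg c.2.1).1 ≠ 0 := (sub_pos.2 h2).ne'
  simp only [shear]
  unfold baseWronskian
  rw [sub_div, sub_div, mul_div_assoc, mul_div_assoc, div_self (pow_ne_zero 2 e1),
    div_self (pow_ne_zero 2 e2)]
  ring

theorem crossQuad_signs (hi : i + 2 ≤ N) {r s : ℕ} {k : CrossKind}
    (h : ValidCross N i r s k) (hx : x ∈ Icc (-1 : ℝ) 1) (e : crossRoot N i pos r s k x = 0) :
    Coherent N i pos x (crossQuad i pos r s k).1 ∧ Coherent N i pos x (crossQuad i pos r s k).2 ∧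
    (SignType.sign (shTurn N i pos x (crossQuad i pos r s k).2 -
      shTurn N i pos x (crossQuad i pos r s k).1) : ℤ) = crossSgn i pos r s k false := by
  have hx' : |x| ≤ 1 := abs_le.2 hx
  have hxo := root_mem_Ioo hi h hx e
  have hb := code_baseCrosses hi h hxo e
  rw [sign_shTurn_sub hb]
  obtain ⟨-, -, l1, l2, -⟩ := hb
  obtain ⟨h1, h2, h3, h4, h5, h6, h7⟩ := id h
  cases k with
  | fixed =>
    simp only [crossQuad] at *
    rw [← outward_eq h hxo e] at *
    have hw := baseWronskian_outward (N := N) (i := i) (pos := pos) (x := x)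
    have hf := baseWronskian_fixed (N := N) (pos := pos) (x := x) h3 h4 h5 h6
    have hq : 0 < 1 + x ^ 2 := by positivity
    by_cases hs : s < i ∨ i + 1 < r
    · simp only [if_pos hs] at *
      refine ⟨coherent_fixed (by omega) h1 h3 h4 h5 h6, outward_coherent, ?_⟩
      rw [hf, hw, zero_div, sub_zero]
      have hd := sub_pos.2 l2
      cases pos
      · have : 0 < -2 * bump false * (1 + x ^ 2) /
          ((config N i false x (outward i x).2).1 - (config N i false x (outward i x).1).1) ^ 2 := by
          have : 0 < -2 * bump false := by norm_num [bump]
          positivity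
        rw [sign_pos this]
        simp [crossSgn, hs]
      · have : -2 * bump true * (1 + x ^ 2) /
          ((config N i true x (outward i x).2).1 - (config N i true x (outward i x).1).1) ^ 2 < 0 := by
          apply div_neg_of_neg_of_pos _ (by positivity)
          have : -2 * bump true < 0 := by norm_num [bump]
          exact mul_neg_of_neg_of_pos this hq
        rw [sign_neg this]
        simp [crossSgn, hs]
    · simp only [if_neg hs] at *
      refine ⟨outward_coherent, coherent_fixed (by omega) h1 h3 h4 h5 h6, ?_⟩
      rw [hf, hw, zero_div, zero_sub]
      have hd := sub_pos.2 l1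
      cases pos
      · have : -(-2 * bump false * (1 + x ^ 2) /
          ((config N i false x (outward i x).2).1 - (config N i false x (outward i x).1).1) ^ 2)
            < 0 := by
          have : 0 < -2 * bump false := by norm_num [bump]
          rw [neg_lt_zero]
          positivity
        rw [sign_neg this]
        simp [crossSgn, hs]
      · have : 0 < -(-2 * bump true * (1 + x ^ 2) /
          ((config N i true x (outward i x).2).1 - (config N i true x (outward i x).1).1) ^ 2) := by
          rw [neg_pos]
          apply div_neg_of_neg_of_pos _ (by positivity)
          have : -2 * bump true < 0 := by norm_num [bump]
          exact mul_neg_of_neg_of_pos this hq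
        rw [sign_pos this]
        simp [crossSgn, hs]
  | straight =>
    have hsi := h7 (by simp)
    have hri := h1.trans hsi
    simp only [crossQuad] at *
    refine ⟨coherent_to_second hi hx' hsi, coherent_to_first hi hx' hri, ?_⟩
    rw [baseWronskian_to_first hri, baseWronskian_to_second hsi]
    have t1 := one_le_turnTo (N := N) hri (abs_bump pos) hx'
    have t2 := one_le_turnTo (N := N) (κ := -bump pos) (s := -x) hsi
      (by rw [abs_neg]; exact abs_bump pos) (by rwa [abs_neg])
    have d1 := sub_pos.2 l1
    have d2 := sub_pos.2 l2
    rw [neg_div, sub_neg_eq_add, sign_pos (by positivity)]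
    simp [crossSgn]
  | skew =>
    have hsi := h7 (by simp)
    have hri := h1.trans hsi
    simp only [crossQuad] at *
    refine ⟨coherent_to_first hi hx' hsi, coherent_to_second hi hx' hri, ?_⟩
    rw [baseWronskian_to_first hsi, baseWronskian_to_second hri]
    have t1 := one_le_turnTo (N := N) hsi (abs_bump pos) hx'
    have t2 := one_le_turnTo (N := N) (κ := -bump pos) (s := -x) hri
      (by rw [abs_neg]; exact abs_bump pos) (by rwa [abs_neg])
    have d1 := sub_pos.2 l1
    have d2 := sub_pos.2 l2
    rw [neg_div, ← neg_add', sign_neg (by rw [neg_lt_zero]; positivity)]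
    simp [crossSgn]

theorem orientedQuad_signs (hi : i + 2 ≤ N) {r s : ℕ} {k : CrossKind}
    (h : ValidCross N i r s k) (hx : x ∈ Icc (-1 : ℝ) 1) (e : crossRoot N i pos r s k x = 0)
    (f : Bool) :
    Coherent N i pos x (orientedQuad i pos r s k f).1 ∧
    Coherent N i pos x (orientedQuad i pos r s k f).2 ∧
    (SignType.sign (shTurn N i pos x (orientedQuad i pos r s k f).2 -
      shTurn N i pos x (orientedQuad i pos r s k f).1) : ℤ) = crossSgn i pos r s k f := by
  obtain ⟨a, b, c⟩ := crossQuad_signs hi h hx e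
  cases f
  · exact ⟨a, b, c⟩
  · refine ⟨b.swap, a.swap, ?_⟩
    simp only [orientedQuad, if_true, flip, shTurn_swap]
    rw [← neg_sub, Left.sign_neg, SignType.coe_neg, c]
    simp [crossSgn]

theorem crossSgn_cases (i : ℕ) (pos : Bool) (r s : ℕ) (k : CrossKind) (f : Bool) :
    crossSgn i pos r s k f = 1 ∨ crossSgn i pos r s k f = -1 := by
  unfold crossSgn
  cases f <;> cases k <;> cases pos <;> by_cases h : s < i ∨ i + 1 < r <;> simp [h]

theorem orientedQuad_mem (hi : i + 2 ≤ N) {r s : ℕ} {k : CrossKind} (h : ValidCross N i r s k)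
    (pos f : Bool) :
    ((orientedQuad i pos r s k f).1.1 < N ∧ (orientedQuad i pos r s k f).1.2 < N ∧
      (orientedQuad i pos r s k f).2.1 < N ∧ (orientedQuad i pos r s k f).2.2 < N) ∧
      (orientedQuad i pos r s k f).1.1 ≠ (orientedQuad i pos r s k f).1.2 ∧
      (orientedQuad i pos r s k f).2.1 ≠ (orientedQuad i pos r s k f).2.2 := by
  obtain ⟨x, hx, e⟩ := exists_crossRoot pos hi h
  have hb := code_baseCrosses hi h hx e
  have hn := hb.ne
  obtain ⟨⟨a1, a2, a3, a4⟩, -⟩ := hb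
  cases f
  · exact ⟨⟨a1, a2, a3, a4⟩, hn⟩
  · exact ⟨⟨a4, a3, a2, a1⟩, hn.2.symm, hn.1.symm⟩

end

section

theorem crossQuad_fixed (i : ℕ) (pos : Bool) (r s : ℕ) :
    ∃ a b, ((a = i ∧ b = i + 1) ∨ (a = i + 1 ∧ b = i)) ∧
      (((s < i ∨ i + 1 < r) ∧ crossQuad i pos r s .fixed = ((r, s), (a, b))) ∨
      (¬(s < i ∨ i + 1 < r) ∧ crossQuad i pos r s .fixed = ((a, b), (r, s)))) := by
  simp only [crossQuad]
  by_cases h : (s < i ↔ pos = true)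
  · refine ⟨i, i + 1, Or.inl ⟨rfl, rfl⟩, ?_⟩
    rw [if_pos h]
    by_cases h2 : s < i ∨ i + 1 < r
    · left; exact ⟨h2, by rw [if_pos h2]⟩
    · right; exact ⟨h2, by rw [if_neg h2]⟩
  · refine ⟨i + 1, i, Or.inr ⟨rfl, rfl⟩, ?_⟩
    rw [if_neg h]
    by_cases h2 : s < i ∨ i + 1 < r
    · left; exact ⟨h2, by rw [if_pos h2]⟩
    · right; exact ⟨h2, by rw [if_neg h2]⟩

/-- An enumerated crossing determines its data. -/
theorem orientedQuad_injective {N i : ℕ} {pos : Bool} {r s r' s' : ℕ} {k k' : CrossKind}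
    {f f' : Bool} (h : ValidCross N i r s k) (h' : ValidCross N i r' s' k')
    (e : orientedQuad i pos r s k f = orientedQuad i pos r' s' k' f') :
    r = r' ∧ s = s' ∧ k = k' ∧ f = f' := by
  obtain ⟨h1, h2, h3, h4, h5, h6, h7⟩ := h
  obtain ⟨g1, g2, g3, g4, g5, g6, g7⟩ := h'
  obtain ⟨a, b, hab, hq⟩ := crossQuad_fixed i pos r s
  obtain ⟨a', b', hab', hq'⟩ := crossQuad_fixed i pos r' s'
  have e1 : (crossQuad i pos r s .straight) = ((s, i + 1), (r, i)) := rfl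
  have e2 : (crossQuad i pos r s .skew) = ((s, i), (r, i + 1)) := rfl
  have e1' : (crossQuad i pos r' s' .straight) = ((s', i + 1), (r', i)) := rfl
  have e2' : (crossQuad i pos r' s' .skew) = ((s', i), (r', i + 1)) := rfl
  have hk : k ≠ .fixed → s < i := h7
  have hk' : k' ≠ .fixed → s' < i := g7
  clear h7 g7
  cases k <;> cases k' <;> cases f <;> cases f' <;>
    simp only [orientedQuad, if_true, Bool.false_eq_true, if_false, e1, e2, e1', e2', ne_eq,
      not_true_eq_false, not_false_eq_true, forall_true_left, reduceCtorEq, IsEmpty.forall_iff,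
      and_true, and_false] at e hk hk' ⊢ <;>
    rcases hq with ⟨c, hq⟩ | ⟨c, hq⟩ <;> rcases hq' with ⟨c', hq'⟩ | ⟨c', hq'⟩ <;>
    simp only [hq, hq', flip, Prod.mk.injEq, Prod.swap_prod_mk] at e <;> omega

/-! ## Planar sets without parallel secants -/

/-- No two different oriented secants of the set have the same direction. -/
def NoParallel (S : Set (ℝ × ℝ)) : Prop :=
  ∀ A ∈ S, ∀ B ∈ S, ∀ C ∈ S, ∀ D ∈ S, A ≠ B → C ≠ D →
    secantAngle A B = secantAngle C D → A = C ∧ B = D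

theorem NoParallel.mono {S T : Set (ℝ × ℝ)} (h : NoParallel T) (hs : S ⊆ T) : NoParallel S :=
  fun A hA B hB C hC D hD => h A (hs hA) B (hs hB) C (hs hC) D (hs hD)

theorem noParallel_image {J : Set ℕ} {Z : ℕ → ℝ × ℝ}
    (hm : ∀ a ∈ J, ∀ b ∈ J, a < b → (Z a).1 < (Z b).1)
    (hp : ∀ a ∈ J, ∀ b ∈ J, ∀ c ∈ J, ∀ d ∈ J, a < b → c < d →
      crossProd (Z a) (Z b) (Z c) (Z d) = 0 → a = c ∧ b = d) : NoParallel (Z '' J) := by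
  have hlt : ∀ a ∈ J, ∀ b ∈ J, (Z a).1 < (Z b).1 → a < b := by
    intro a ha b hb h
    rcases lt_trichotomy a b with l | l | l
    · exact l
    · subst l; exact absurd h (lt_irrefl _)
    · linarith [hm b hb a ha l]
  rintro _ ⟨a, ha, rfl⟩ _ ⟨b, hb, rfl⟩ _ ⟨c, hc, rfl⟩ _ ⟨d, hd, rfl⟩ hab hcd e
  have hab' : a ≠ b := by rintro rfl; exact hab rfl
  have hcd' : c ≠ d := by rintro rfl; exact hcd rfl
  have hne : (Z b).1 - (Z a).1 ≠ 0 := by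
    rcases Nat.lt_or_gt_of_ne hab' with h | h
    · have := hm a ha b hb h; linarith
    · have := hm b hb a ha h; linarith
  obtain ⟨e1, e2⟩ := (secantAngle_eq_iff hne hcd).1 e
  rcases Nat.lt_or_gt_of_ne hab' with h | h
  · have h1 := hm a ha b hb h
    have h2 := (mul_pos_iff_of_pos_left (sub_pos.2 h1)).1 e2
    have := hp a ha b hb c hc d hd h (hlt c hc d hd (by linarith)) e1
    rw [this.1, this.2]
    exact ⟨rfl, rfl⟩
  · have h1 := hm b hb a ha h
    have h2 : (Z d).1 < (Z c).1 := by nlinarith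
    have := hp b hb a ha d hd c hc h (hlt d hd c hc h2)
      (crossProd_swap_eq_zero (crossProd_swap_eq_zero e1).2.1).2.2
    rw [this.1, this.2]
    exact ⟨rfl, rfl⟩

theorem noParallel_stdPt (N : ℕ) : NoParallel (stdPt N '' {b | b < N}) := by
  apply noParallel_image
  · intro a _ b _ h
    linarith [fixed_gap_pos (N := N) h]
  · intro a ha b hb c hc d hd hab hcd h
    have hb' : b < N := hb
    have hd' : d < N := hd
    rcases (steep_stdPt N).parallel_cases hab hcd hb hd (by omega) (by omega) h with h | h | h
    · exact h
    · omega
    · omega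

/-- While the strands `i` and `i + 1` move along their common edge and there are no strands in the
positions before `i`, there are no parallel secants. -/
theorem noParallel_edge {N i : ℕ} {x : ℝ} (hi : i + 2 ≤ N) (h0 : -1 ≤ x) (h1 : x ≤ 0) :
    NoParallel (basePt N i 0 x '' {b | i ≤ b ∧ b < N}) := by
  have hx : |x| ≤ 1 := abs_le.2 ⟨h0, h1.trans zero_le_one⟩
  have hZ := steep_basePt (N := N) (i := i) (κ := 0) (by norm_num) hx
  -- at the beginning the two strands coincide
  have gen : ∀ j, (j = i ∧ x < 0 ∨ j = i + 1) →
      NoParallel (basePt N i 0 x '' {b | j ≤ b ∧ b < N}) := by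
    intro j hj
    apply noParallel_image
    · rintro a ⟨ha, ha'⟩ b ⟨hb, hb'⟩ hab
      by_cases hs : a = i ∧ b = i + 1
      · obtain ⟨rfl, rfl⟩ := hs
        rw [basePt_self, basePt_succ]
        have := movPt_diff_fst N a 0 x
        have hx0 : x < 0 := by
          rcases hj with hj | hj
          · exact hj.2
          · omega
        linarith
      · linarith [(hZ a b hab hb' hs).1]
    · rintro a ⟨ha, ha'⟩ b ⟨hb, hb'⟩ c ⟨hc, hc'⟩ d ⟨hd, hd'⟩ hab hcd h
      have special : ∀ c d, i ≤ c → c < d → d < N → i + 1 < d → x < 0 →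
          crossProd (basePt N i 0 x i) (basePt N i 0 x (i + 1)) (basePt N i 0 x c)
            (basePt N i 0 x d) ≠ 0 := by
        intro c d hc hcd hd hd' hx0
        have hs := edge_lt_of_gt (κ := 0) (by norm_num) hx hcd hd' hd
        rw [basePt_self, basePt_succ, crossProd_movPt]
        intro e
        have : x * (((basePt N i 0 x d).2 - (basePt N i 0 x c).2) -
            edge N i * ((basePt N i 0 x d).1 - (basePt N i 0 x c).1)) = 0 := by
          simp only [mul_zero, zero_mul, sub_zero, neg_eq_zero] at e
          exact e
        rcases mul_eq_zero.1 this with h | h <;> linarith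
      have hxj : j = i → x < 0 := by
        intro e
        rcases hj with hj | hj
        · exact hj.2
        · omega
      by_cases s1 : a = i ∧ b = i + 1
      · by_cases s2 : c = i ∧ d = i + 1
        · omega
        · exfalso
          obtain ⟨rfl, rfl⟩ := s1
          exact special c d (by omega) hcd hd' (by omega) (hxj (by omega)) h
      · by_cases s2 : c = i ∧ d = i + 1
        · exfalso
          obtain ⟨rfl, rfl⟩ := s2
          exact special a b (by omega) hab hb' (by omega) (hxj (by omega))
            (crossProd_swap_eq_zero h).1
        · rcases hZ.parallel_cases hab hcd hb' hd' s1 s2 h with h' | h' | h'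
          · exact h'
          · exfalso
            obtain ⟨rfl, hac⟩ := h'
            have key : crossProd (basePt N i 0 x i) (basePt N i 0 x (i + 1)) (basePt N i 0 x i)
                (basePt N i 0 x b) = 0 := by
              rcases hac with ⟨rfl, rfl⟩ | ⟨rfl, rfl⟩ <;> unfold crossProd at * <;> linarith
            exact special i b le_rfl (by omega) hb' (by omega) (hxj (by omega)) key
          · exfalso
            omega
  rcases lt_or_eq_of_le h1 with h | h
  · exact gen i (Or.inl ⟨rfl, h⟩)
  · have hs : basePt N i 0 x '' {b | i ≤ b ∧ b < N} ⊆ basePt N i 0 x '' {b | i + 1 ≤ b ∧ b < N} := by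
      rintro _ ⟨b, ⟨hb, hb'⟩, rfl⟩
      rcases Nat.lt_or_ge i b with hib | hib
      · exact ⟨b, ⟨hib, hb'⟩, rfl⟩
      · have : b = i := by omega
        subst this
        refine ⟨b + 1, ⟨le_rfl, by omega⟩, ?_⟩
        rw [basePt_self, basePt_succ, h, neg_zero]
    exact (gen (i + 1) (Or.inr rfl)).mono hs

/-! ## Fiber trisecants in a crossing -/

variable {N i : ℕ} {pos : Bool} {x : ℝ}

local notation "cfg" => config N i pos x

/-- The function vanishing when the strand `r` is collinear with the two moving ones. -/
def triRoot (N i : ℕ) (pos : Bool) (r : ℕ) (x : ℝ) : ℝ :=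
  x * (((stdPt N r).2 - (midPt N i).2) - edge N i * ((stdPt N r).1 - (midPt N i).1)) -
    2 * bump pos * (1 - x ^ 2) * ((stdPt N r).1 - (midPt N i).1)

theorem exists_triRoot (pos : Bool) {r : ℕ} (h1 : r ≠ i) (h2 : r ≠ i + 1) (hr : r < N) :
    ∃ x ∈ Ioo (-1 : ℝ) 1, triRoot N i pos r x = 0 :=
  exists_quadratic_root (midPt_above h1 h2 hr).ne' _ _

theorem triRoot_unique {r : ℕ} (h1 : r ≠ i) (h2 : r ≠ i + 1) (hr : r < N) {y : ℝ}
    (hx : x ∈ Icc (-1 : ℝ) 1) (hy : y ∈ Ioo (-1 : ℝ) 1) (ex : triRoot N i pos r x = 0)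
    (ey : triRoot N i pos r y = 0) : x = y := by
  have hF := (midPt_above h1 h2 hr).ne'
  refine quadratic_root_unique hF ⟨lt_of_le_of_ne hx.1 ?_, lt_of_le_of_ne hx.2 ?_⟩ hy ex ey
  · rintro rfl
    apply hF
    unfold triRoot at ex
    linarith
  · rintro rfl
    apply hF
    unfold triRoot at ex
    linarith

theorem crossProd_config_tri {r : ℕ} (h1 : r ≠ i) (h2 : r ≠ i + 1) :
    crossProd (cfg i) (cfg (i + 1)) (cfg i)
      (cfg r) = -triRoot N i pos r x := by
  rw [config, basePt_self, basePt_succ, basePt_other _ _ h1 h2, crossProd_movPt_mid, crossProd_movPt]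
  rfl

/-- Three collinear points include both moving ones. -/
theorem collinear_cases (hx : x ∈ Icc (-1 : ℝ) 1) {A B C : ℕ} (hA : A < N) (hB : B < N) (hC : C < N)
    (hAB : A ≠ B) (hBC : B ≠ C) (hAC : A ≠ C)
    (h : crossProd (cfg A) (cfg B) (cfg B) (cfg C) = 0) :
    ∃ r, r < N ∧ r ≠ i ∧ r ≠ i + 1 ∧ triRoot N i pos r x = 0 ∧
      ((A = r ∧ B = i ∧ C = i + 1) ∨ (A = r ∧ B = i + 1 ∧ C = i) ∨
      (A = i ∧ B = r ∧ C = i + 1) ∨ (A = i + 1 ∧ B = r ∧ C = i) ∨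
      (A = i ∧ B = i + 1 ∧ C = r) ∨ (A = i + 1 ∧ B = i ∧ C = r)) := by
  have hx' : |x| ≤ 1 := abs_le.2 hx
  have hZ := steep_basePt (N := N) (i := i) (abs_bump pos) hx'
  have key : ∀ a b c, a < b → b < c → c < N → crossProd (cfg a) (cfg b)
      (cfg b) (cfg c) = 0 →
      (a = i ∧ b = i + 1) ∨ (b = i ∧ c = i + 1) := by
    intro a b c h1 h2 h3 h4
    by_contra hn
    push Not at hn
    have := hZ.crossProd_top h1 h2 h3 (by tauto) (by tauto)
    unfold crossProd at *
    linarith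
  have ex : ((A = i ∨ B = i ∨ C = i) ∧ (A = i + 1 ∨ B = i + 1 ∨ C = i + 1)) := by
    rcases Nat.lt_or_gt_of_ne hAB with l1 | l1 <;> rcases Nat.lt_or_gt_of_ne hBC with l2 | l2 <;>
      rcases Nat.lt_or_gt_of_ne hAC with l3 | l3
    · have := key A B C l1 l2 hC h; omega
    · omega
    · have := key A C B l3 l2 hB (by unfold crossProd at *; linarith); omega
    · have := key C A B l3 l1 hB (by unfold crossProd at *; linarith); omega
    · have := key B A C l1 l3 hC (by unfold crossProd at *; linarith); omega
    · have := key B C A l2 l3 hA (by unfold crossProd at *; linarith); omega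
    · omega
    · have := key C B A l2 l1 hA (by unfold crossProd at *; linarith); omega
  have tri : ∀ r, r ≠ i → r ≠ i + 1 → crossProd (cfg i) (cfg (i + 1))
      (cfg i) (cfg r) = 0 → triRoot N i pos r x = 0 := by
    intro r h1 h2 h3
    rw [crossProd_config_tri h1 h2] at h3
    linarith
  obtain ⟨e1, e2⟩ := ex
  rcases e1 with e1 | e1 | e1 <;> rcases e2 with e2 | e2 | e2 <;> subst e1
  · omega
  · exact ⟨C, hC, by omega, by omega,
      tri C (by omega) (by omega) (by subst e2; unfold crossProd at *; linarith), by omega⟩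
  · exact ⟨B, hB, by omega, by omega,
      tri B (by omega) (by omega) (by subst e2; unfold crossProd at *; linarith), by omega⟩
  · exact ⟨C, hC, by omega, by omega,
      tri C (by omega) (by omega) (by subst e2; unfold crossProd at *; linarith), by omega⟩
  · omega
  · exact ⟨A, hA, by omega, by omega,
      tri A (by omega) (by omega) (by subst e2; unfold crossProd at *; linarith), by omega⟩
  · exact ⟨B, hB, by omega, by omega,
      tri B (by omega) (by omega) (by subst e2; unfold crossProd at *; linarith), by omega⟩
  · exact ⟨A, hA, by omega, by omega,
      tri A (by omega) (by omega) (by subst e2; unfold crossProd at *; linarith), by omega⟩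
  · omega

theorem triRoot_distinct (hx : x ∈ Icc (-1 : ℝ) 1) {r t : ℕ} (h1 : r ≠ i) (h2 : r ≠ i + 1)
    (h3 : t ≠ i) (h4 : t ≠ i + 1) (hr : r < N) (ht : t < N) (hi : i + 2 ≤ N)
    (e1 : triRoot N i pos r x = 0) (e2 : triRoot N i pos t x = 0) : r = t := by
  by_contra hne
  have c1 := crossProd_config_tri (N := N) (pos := pos) (x := x) h1 h2
  have c2 := crossProd_config_tri (N := N) (pos := pos) (x := x) h3 h4
  rw [e1, neg_zero] at c1
  rw [e2, neg_zero] at c2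
  have hne2 := config_ne (N := N) (pos := pos) (i := i) (abs_le.2 hx) (a := i) (b := i + 1) (by omega)
    (by omega) (by omega)
  have c3 : crossProd (cfg r) (cfg i) (cfg i)
      (cfg t) = 0 := by
    by_cases hd : (cfg (i + 1)).1 - (cfg i).1 = 0
    · have hd2 : (cfg (i + 1)).2 - (cfg i).2 ≠ 0 := by
        intro hd2
        exact hne2 (Prod.ext (by linarith) (by linarith))
      apply mul_left_cancel₀ hd2
      unfold crossProd at *
      linear_combination ((cfg t).2 - (cfg i).2) * c1 - ((cfg r).2 - (cfg i).2) * c2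
    · apply mul_left_cancel₀ hd
      unfold crossProd at *
      linear_combination ((cfg t).1 - (cfg i).1) * c1 - ((cfg r).1 - (cfg i).1) * c2
  obtain ⟨u, -, hu1, hu2, -, hu⟩ := collinear_cases hx hr (by omega) ht h1 (Ne.symm h3) hne c3
  omega

end

section

/-! ## The elementary tangles -/

/-- The parameter of the configuration at the place `v` of the sector of a crossing. -/
def crossParam (v : ℝ) : ℝ := 2 * smoothStep v - 1

/-- The shear at the place `v` of the sector of a crossing. -/
def shearAmount (N : ℕ) (pos : Bool) (v : ℝ) : ℝ :=
  tilt N pos * (-smoothStep (4 * v) + 2 * smoothStep v - smoothStep (4 * v - 3))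

/-- The strand that starts at the position `b` of a crossing. -/
def crossCurve (N i : ℕ) (pos : Bool) (b : ℕ) (v : ℝ) : ℝ × ℝ :=
  shear (shearAmount N pos v) (config N i pos (crossParam v) b)

/-- The strands of a local minimum. -/
def birthCurve (N c b : ℕ) (v : ℝ) : ℝ × ℝ × ℝ :=
  if b = 2 * c ∨ b = 2 * c + 1 then
    (fold ((v - 1 / 4) * (4 / 3)), basePt N (2 * c) 0 (-oddStep ((v - 1 / 4) * (4 / 3))) b)
  else (v, stdPt N b)

/-- The strands of the elementary tangles. -/
def letterCurve (N : ℕ) : PlatLetter → ℕ → ℝ → ℝ × ℝ × ℝ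
  | .cross i s, b, v => (v, crossCurve N i s b v)
  | .birth c, b, v => birthCurve N c b v
  | .death c, b, v => (1 - (birthCurve N c b (1 - v)).1, (birthCurve N c b (1 - v)).2)

/-- The interval on which a strand of a local minimum is defined. -/
def birthLifetime (c b : ℕ) : Set ℝ :=
  if b < 2 * c then ∅ else if b < 2 * c + 2 then Icc (1 / 4) 1 else Icc 0 1

/-- The interval on which a strand of an elementary tangle is defined. -/
def lifetime : PlatLetter → ℕ → Set ℝ
  | .cross _ _, _ => Icc 0 1
  | .birth c, b => birthLifetime c b
  | .death c, b => {v | 1 - v ∈ birthLifetime c b}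

/-- The elementary tangles. -/
def elemTangle (N : ℕ) (x : PlatLetter) : Set (ℝ × ℝ × ℝ) :=
  {q | ∃ b < N, ∃ v ∈ lifetime x b, q = letterCurve N x b v}

theorem crossParam_mem (v : ℝ) : crossParam v ∈ Icc (-1 : ℝ) 1 := by
  have h1 := smoothStep_nonneg v
  have h2 := smoothStep_le_one v
  unfold crossParam
  constructor <;> linarith

theorem abs_crossParam (v : ℝ) : |crossParam v| ≤ 1 := abs_le.2 (crossParam_mem v)

theorem mem_of_crossParam {v : ℝ} (h : crossParam v ∈ Ioo (-1 : ℝ) 1) :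
    v ∈ Ioo (1 / 4 : ℝ) (3 / 4) := by
  unfold crossParam at h
  constructor
  · by_contra hn
    rw [smoothStep_of_le (not_lt.1 hn)] at h
    linarith [h.1]
  · by_contra hn
    rw [smoothStep_of_ge (not_lt.1 hn)] at h
    linarith [h.2]

theorem crossParam_inj {v w : ℝ} (h : crossParam v ∈ Ioo (-1 : ℝ) 1)
    (e : crossParam v = crossParam w) : v = w := by
  have h1 := mem_of_crossParam h
  have h2 := mem_of_crossParam (e ▸ h)
  apply smoothStep_strictMonoOn.injOn ⟨h1.1.le, h1.2.le⟩ ⟨h2.1.le, h2.2.le⟩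
  unfold crossParam at e
  linarith

theorem exists_crossParam {s : ℝ} (h : s ∈ Ioo (-1 : ℝ) 1) :
    ∃ v ∈ Ioo (1 / 4 : ℝ) (3 / 4), crossParam v = s := by
  have hc : ContinuousOn smoothStep (Icc 0 1) := contDiff_smoothStep.continuous.continuousOn
  have key := intermediate_value_Icc (zero_le_one' ℝ) hc
  rw [smoothStep_of_le (by norm_num), smoothStep_of_ge (by norm_num)] at key
  obtain ⟨v, -, hv⟩ := key (show (s + 1) / 2 ∈ Icc (0 : ℝ) 1 by
    constructor <;> linarith [h.1, h.2])
  have e : crossParam v = s := by unfold crossParam; linarith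
  exact ⟨v, mem_of_crossParam (e.symm ▸ h), e⟩

theorem shearAmount_window {N : ℕ} {pos : Bool} {v : ℝ} (h : v ∈ Icc (1 / 4 : ℝ) (3 / 4)) :
    shearAmount N pos v = tilt N pos * crossParam v := by
  unfold shearAmount crossParam
  rw [smoothStep_of_ge (x := 4 * v) (by linarith [h.1]),
    smoothStep_of_le (x := 4 * v - 3) (by linarith [h.2])]
  ring

theorem crossCurve_window {N i : ℕ} {pos : Bool} {v : ℝ} (h : v ∈ Icc (1 / 4 : ℝ) (3 / 4))
    (b : ℕ) : crossCurve N i pos b v = shPt N i pos (crossParam v) b := by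
  rw [crossCurve, shearAmount_window h]
  rfl

theorem crossCurve_of_le {N i : ℕ} {pos : Bool} {v : ℝ} (h : v ≤ 1 / 16) (b : ℕ) :
    crossCurve N i pos b v = stdPt N b := by
  unfold crossCurve shearAmount crossParam
  rw [smoothStep_of_le (x := v) (by linarith), smoothStep_of_le (x := 4 * v) (by linarith),
    smoothStep_of_le (x := 4 * v - 3) (by linarith)]
  norm_num
  rw [shear_zero, config, basePt_neg_one]

theorem crossCurve_of_ge {N i : ℕ} {pos : Bool} {v : ℝ} (h : 15 / 16 ≤ v) (b : ℕ) :
    crossCurve N i pos b v = stdPt N (Equiv.swap i (i + 1) b) := by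
  unfold crossCurve shearAmount crossParam
  rw [smoothStep_of_ge (x := v) (by linarith), smoothStep_of_ge (x := 4 * v) (by linarith),
    smoothStep_of_ge (x := 4 * v - 3) (by linarith)]
  norm_num
  rw [shear_zero, config, basePt_one]

theorem contDiff_crossParam : ContDiff ℝ ∞ crossParam := by
  have := contDiff_smoothStep
  unfold crossParam
  fun_prop

theorem contDiff_shearAmount (N : ℕ) (pos : Bool) : ContDiff ℝ ∞ (shearAmount N pos) := by
  have := contDiff_smoothStep
  unfold shearAmount
  fun_prop

theorem contDiff_movPt_comp (N i : ℕ) (κ : ℝ) {f : ℝ → ℝ} (hf : ContDiff ℝ ∞ f) :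
    ContDiff ℝ ∞ fun v => movPt N i κ (f v) := by
  unfold movPt
  fun_prop

theorem contDiff_basePt_comp (N i : ℕ) (κ : ℝ) (b : ℕ) {f : ℝ → ℝ} (hf : ContDiff ℝ ∞ f) :
    ContDiff ℝ ∞ fun v => basePt N i κ (f v) b := by
  unfold basePt
  split_ifs
  · exact contDiff_movPt_comp N i κ hf
  · exact contDiff_movPt_comp N i (-κ) hf.neg
  · exact contDiff_const

theorem contDiff_crossCurve (N i : ℕ) (pos : Bool) (b : ℕ) :
    ContDiff ℝ ∞ (crossCurve N i pos b) := by
  have h1 := contDiff_basePt_comp N i (bump pos) b contDiff_crossParam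
  have h2 := contDiff_shearAmount N pos
  unfold crossCurve shear config
  fun_prop

theorem contDiff_birthCurve (N c b : ℕ) : ContDiff ℝ ∞ (birthCurve N c b) := by
  have ha : ContDiff ℝ ∞ fun v : ℝ => (v - 1 / 4) * (4 / 3) := by fun_prop
  have h1 := contDiff_fold.comp ha
  have h2 := contDiff_basePt_comp N (2 * c) 0 b (contDiff_oddStep.comp ha).neg
  unfold birthCurve
  split_ifs
  · exact h1.prodMk h2
  · fun_prop

theorem contDiff_letterCurve (N : ℕ) (x : PlatLetter) (b : ℕ) :
    ContDiff ℝ ∞ (letterCurve N x b) := by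
  cases x with
  | birth c => exact contDiff_birthCurve N c b
  | cross i s => exact contDiff_id.prodMk (contDiff_crossCurve N i s b)
  | death c =>
    have := (contDiff_birthCurve N c b).comp (f := fun v : ℝ => 1 - v) (by fun_prop)
    exact (contDiff_const.sub this.fst).prodMk this.snd

theorem crossCurve_fst (N i : ℕ) (pos : Bool) (b : ℕ) (v : ℝ) :
    (crossCurve N i pos b v).1 = (config N i pos (crossParam v) b).1 := rfl

theorem crossParam_half : crossParam (1 / 2) = 0 := by
  rw [crossParam, smoothStep_half]
  norm_num

theorem crossParam_monotone : Monotone crossParam := fun v w h => by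
  have := smoothStep_monotone h
  unfold crossParam
  linarith

theorem crossParam_lt {v : ℝ} (h : v < 1 / 2) : crossParam v < 0 := by
  refine lt_of_le_of_ne (crossParam_half ▸ crossParam_monotone h.le) fun e => ?_
  have := crossParam_inj (v := v) (w := 1 / 2) (by rw [e]; norm_num) (by rw [e, crossParam_half])
  linarith

theorem crossParam_gt {v : ℝ} (h : 1 / 2 < v) : 0 < crossParam v := by
  refine lt_of_le_of_ne (crossParam_half ▸ crossParam_monotone h.le) fun e => ?_
  have := crossParam_inj (v := v) (w := 1 / 2) (by rw [← e]; norm_num) (by rw [← e, crossParam_half])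
  linarith

theorem hasDerivAt_crossParam (v : ℝ) : HasDerivAt crossParam (2 * deriv smoothStep v) v :=
  ((differentiable_smoothStep v).hasDerivAt.const_mul 2).sub_const 1

theorem config_fst_pos {N i : ℕ} {pos : Bool} {x : ℝ} (hx : |x| ≤ 1) (b : ℕ) :
    0 < (config N i pos x b).1 := by
  have hi : (0 : ℝ) ≤ i := Nat.cast_nonneg i
  have hb : (0 : ℝ) ≤ b := Nat.cast_nonneg b
  unfold config basePt
  split_ifs
  · have := (movPt_bounds N i (abs_bump pos) hx).1; linarith
  · have := (movPt_bounds N i (κ := -bump pos) (s := -x) (by rw [abs_neg]; exact abs_bump pos)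
      (by rwa [abs_neg])).1
    linarith
  · simp only; linarith

theorem hasDerivAt_config_fst (N i : ℕ) (pos : Bool) (x : ℝ) (b : ℕ) :
    HasDerivAt (fun x => (config N i pos x b).1) (configVel N i pos x b).1 x := by
  unfold config basePt configVel
  split_ifs
  · exact hasDerivAt_movPt_fst N i (bump pos) x
  · have h := (hasDerivAt_movPt_fst N i (-bump pos) (-x)).comp x (hasDerivAt_neg x)
    refine h.congr_deriv ?_
    simp [movVel]
  · exact hasDerivAt_const _ _

theorem hasDerivAt_config_snd (N i : ℕ) (pos : Bool) (x : ℝ) (b : ℕ) :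
    HasDerivAt (fun x => (config N i pos x b).2) (configVel N i pos x b).2 x := by
  unfold config basePt configVel
  split_ifs
  · exact hasDerivAt_movPt_snd N i (bump pos) x
  · have h := (hasDerivAt_movPt_snd N i (-bump pos) (-x)).comp x (hasDerivAt_neg x)
    refine h.congr_deriv ?_
    simp [movVel]
  · exact hasDerivAt_const _ _

theorem hasDerivAt_crossCurve_fst (N i : ℕ) (pos : Bool) (b : ℕ) (v : ℝ) :
    HasDerivAt (fun v => (crossCurve N i pos b v).1)
      ((configVel N i pos (crossParam v) b).1 * (2 * deriv smoothStep v)) v :=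
  (hasDerivAt_config_fst N i pos _ b).comp v (hasDerivAt_crossParam v)

/-- The strands of a crossing have the velocities of the sheared configuration. -/
theorem hasDerivAt_crossCurve_window {N i : ℕ} {pos : Bool} (b : ℕ) {v : ℝ}
    (h : v ∈ Ioo (1 / 4 : ℝ) (3 / 4)) :
    HasDerivAt (fun v => (crossCurve N i pos b v).1)
      ((shVel N i pos (crossParam v) b).1 * (2 * deriv smoothStep v)) v ∧
    HasDerivAt (fun v => (crossCurve N i pos b v).2)
      ((shVel N i pos (crossParam v) b).2 * (2 * deriv smoothStep v)) v := by
  refine ⟨hasDerivAt_crossCurve_fst N i pos b v, ?_⟩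
  have e : (fun v => (crossCurve N i pos b v).2) =ᶠ[𝓝 v]
      (fun x => (shPt N i pos x b).2) ∘ crossParam := by
    filter_upwards [Ioo_mem_nhds h.1 h.2] with w hw
    rw [crossCurve_window ⟨hw.1.le, hw.2.le⟩]
    rfl
  refine HasDerivAt.congr_of_eventuallyEq ?_ e
  refine HasDerivAt.comp v ?_ (hasDerivAt_crossParam v)
  have h1 := hasDerivAt_config_fst N i pos (crossParam v) b
  have h2 := hasDerivAt_config_snd N i pos (crossParam v) b
  have h3 := h2.add (((hasDerivAt_id (crossParam v)).const_mul (tilt N pos)).mul (h1.const_sub 1))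
  refine h3.congr_deriv ?_
  simp only [shVel, shearVel, id]
  ring

theorem isCrossTangle_elemTangle {N i : ℕ} (s : Bool) :
    IsCrossTangle N i s (elemTangle N (.cross i s)) := by
  refine ⟨fun b v => (crossCurve N i s b v).1, fun b v => (crossCurve N i s b v).2, ?_, ?_, ?_, ?_,
    1 / 2, ⟨by norm_num, by norm_num⟩, ?_, ?_, ?_, ?_, ?_⟩
  · intro b _
    exact ⟨(contDiff_crossCurve N i s b).fst, (contDiff_crossCurve N i s b).snd⟩
  · ext q
    rfl
  · intro b _ v _
    exact config_fst_pos (abs_crossParam v) b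
  · intro a b hab hb hne v _
    have := (steep_basePt (N := N) (i := i) (abs_bump s) (abs_crossParam v) a b hab hb hne).1
    simp only [crossCurve_fst, config]
    linarith
  · intro v hv
    exact config_moving_fst_lt.1.2 (crossParam_lt hv.2)
  · have := movPt_diff_fst N i (bump s) 0
    simp only [crossCurve_fst, crossParam_half, config, basePt_self, basePt_succ]
    linarith
  · intro v hv
    exact config_moving_fst_lt.2.2 (crossParam_gt hv.1)
  · have d1 := (hasDerivAt_crossCurve_fst N i s i (1 / 2)).deriv
    have d2 := (hasDerivAt_crossCurve_fst N i s (i + 1) (1 / 2)).deriv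
    rw [configVel_self] at d1
    rw [configVel_succ] at d2
    have hp := deriv_smoothStep_pos (x := 1 / 2) (by norm_num) (by norm_num)
    rw [d1, d2]
    simp only [movVel, Prod.fst_neg]
    intro e
    linarith
  · simp only [crossCurve, crossParam_half, config, basePt_self, basePt_succ, shear, movPt]
    cases s
    · simp only [Bool.false_eq_true, if_false, bump]
      norm_num
    · simp only [if_true, bump]
      norm_num

theorem birthArc_eq (N c : ℕ) (u : ℝ) :
    basePt N (2 * c) 0 (-oddStep u) (2 * c) = movPt N (2 * c) 0 (oddStep (-u)) ∧
    basePt N (2 * c) 0 (-oddStep u) (2 * c + 1) = movPt N (2 * c) 0 (oddStep u) := by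
  rw [basePt_self, basePt_succ, oddStep_neg, neg_zero, neg_neg]
  exact ⟨rfl, rfl⟩

theorem isBirthTangle_elemTangle {N c : ℕ} (hc : 2 * c + 2 ≤ N) :
    IsBirthTangle N c (elemTangle N (.birth c)) := by
  have hm : ∀ u, |oddStep u| ≤ 1 := fun u => by
    rw [abs_le]
    have := oddStep_le_one (-u)
    rw [oddStep_neg] at this
    exact ⟨by linarith, oddStep_le_one u⟩
  refine ⟨fun a _ => (stdPt N a).1, fun a _ => (stdPt N a).2, fold,
    fun u => (movPt N (2 * c) 0 (oddStep u)).1, fun u => (movPt N (2 * c) 0 (oddStep u)).2,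
    fun _ _ _ => ⟨contDiff_const, contDiff_const⟩, contDiff_fold,
    (contDiff_movPt_comp N (2 * c) 0 contDiff_oddStep).fst,
    (contDiff_movPt_comp N (2 * c) 0 contDiff_oddStep).snd, ?_, ?_, ?_, ?_, ?_, ?_, ?_, ?_, ?_, ?_,
    ?_, ?_, ?_⟩
  · ext q
    constructor
    · rintro ⟨b, hb, v, hv, rfl⟩
      simp only [lifetime, birthLifetime] at hv
      split_ifs at hv with h1 h2
      · exact absurd hv (notMem_empty v)
      · right
        have hu0 : 0 ≤ (v - 1 / 4) * (4 / 3) := by linarith [hv.1]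
        have hu1 : (v - 1 / 4) * (4 / 3) ≤ 1 := by linarith [hv.2]
        have hb' : b = 2 * c ∨ b = 2 * c + 1 := by omega
        rcases hb' with rfl | rfl
        · refine ⟨-((v - 1 / 4) * (4 / 3)), ⟨by linarith, by linarith⟩, ?_⟩
          simp only [letterCurve, birthCurve, true_or, if_true, (birthArc_eq N c _).1, fold_neg]
        · refine ⟨(v - 1 / 4) * (4 / 3), ⟨by linarith, by linarith⟩, ?_⟩
          simp only [letterCurve, birthCurve, or_true, if_true, (birthArc_eq N c _).2]
      · left
        refine ⟨b, by omega, hb, v, hv, ?_⟩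
        simp only [letterCurve, birthCurve]
        rw [if_neg (by omega)]
    · rintro (⟨a, ha, haN, x, hx, rfl⟩ | ⟨u, hu, rfl⟩)
      · refine ⟨a, haN, x, ?_, ?_⟩
        · simp only [lifetime, birthLifetime]
          rw [if_neg (by omega), if_neg (by omega)]
          exact hx
        · simp only [letterCurve, birthCurve]
          rw [if_neg (by omega)]
      · rcases le_total 0 u with h | h
        · refine ⟨2 * c + 1, by omega, 1 / 4 + 3 / 4 * u, ?_, ?_⟩
          · simp only [lifetime, birthLifetime]
            rw [if_neg (by omega), if_pos (by omega)]
            constructor <;> linarith [hu.2]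
          · have e : (1 / 4 + 3 / 4 * u - 1 / 4) * (4 / 3) = u := by ring
            simp only [letterCurve, birthCurve, or_true, if_true, (birthArc_eq N c _).2, e]
        · refine ⟨2 * c, by omega, 1 / 4 + 3 / 4 * (-u), ?_, ?_⟩
          · simp only [lifetime, birthLifetime]
            rw [if_neg (by omega), if_pos (by omega)]
            constructor <;> linarith [hu.1]
          · have e : (1 / 4 + 3 / 4 * (-u) - 1 / 4) * (4 / 3) = -u := by ring
            simp only [letterCurve, birthCurve, true_or, if_true, (birthArc_eq N c _).1, e, neg_neg,
              fold_neg]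
  · intro a _ _ x _
    simp only [stdPt]
    positivity
  · intro a b _ hab _ x _
    have := fixed_gap_pos (N := N) hab
    simp only
    linarith
  · rw [fold_neg, fold_one]
  · exact fold_one
  · rw [fold_zero]; norm_num
  · intro u hu
    exact deriv_fold_neg hu.2
  · intro u hu
    exact deriv_fold_pos hu.1
  · exact iteratedDeriv_two_fold_pos
  · have h := (hasDerivAt_movPt_fst N (2 * c) 0 (oddStep 0)).comp 0
      (differentiable_oddStep 0).hasDerivAt
    have e : deriv (fun u => (movPt N (2 * c) 0 (oddStep u)).1) 0 = _ := h.deriv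
    rw [e]
    have := deriv_oddStep_zero_pos
    simp only [movVel]
    linarith
  · intro u _
    have := (movPt_bounds N (2 * c) (κ := 0) (by norm_num) (hm u)).1
    have h0 : (0 : ℝ) ≤ ((2 * c : ℕ) : ℝ) := Nat.cast_nonneg _
    simp only
    linarith
  · intro u hu v hv huv e
    have h1 := fold_eq_fold e
    have hv0 : 0 < v := by
      by_contra hn
      rw [abs_of_neg (by linarith), abs_of_nonpos (not_lt.1 hn)] at h1
      linarith
    have hu0 : u < 0 := by
      by_contra hn
      rw [abs_of_nonneg (not_lt.1 hn), abs_of_pos hv0] at h1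
      linarith
    have p1 := oddStep_pos hv0
    have p2 := oddStep_pos (neg_pos.2 hu0)
    rw [oddStep_neg] at p2
    simp only [movPt]
    linarith
  · intro a ha _ u _
    have := (movPt_bounds N (2 * c) (κ := 0) (by norm_num) (hm u)).2.1
    have ha' : ((2 * c : ℕ) : ℝ) + 2 ≤ a := by exact_mod_cast ha
    simp only [stdPt]
    linarith

theorem mirror_elemTangle (N c : ℕ) :
    (fun q : ℝ × ℝ × ℝ => (1 - q.1, q.2)) '' elemTangle N (.death c) = elemTangle N (.birth c) := by
  ext q
  constructor
  · rintro ⟨_, ⟨b, hb, v, hv, rfl⟩, rfl⟩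
    refine ⟨b, hb, 1 - v, hv, ?_⟩
    simp only [letterCurve, sub_sub_cancel]
  · rintro ⟨b, hb, v, hv, rfl⟩
    refine ⟨_, ⟨b, hb, 1 - v, ?_, rfl⟩, ?_⟩
    · simpa only [lifetime, Set.mem_ofPred_eq, sub_sub_cancel] using hv
    · simp only [letterCurve, sub_sub_cancel]

theorem isElementaryTangle_elemTangle (N : ℕ) (x : PlatLetter) (h : x.Valid N) :
    IsElementaryTangle N x (elemTangle N x) := by
  cases x with
  | birth c => exact isBirthTangle_elemTangle h
  | cross i s => exact isCrossTangle_elemTangle s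
  | death c =>
    have := isBirthTangle_elemTangle h
    rw [← mirror_elemTangle] at this
    exact this

end

section

/-! ## Fibers of local extrema -/

theorem basePt_of_ge {N c b : ℕ} (x : ℝ) (hb : 2 * c + 2 ≤ b) :
    basePt N (2 * c) 0 x b = stdPt N b := basePt_other _ _ (by omega) (by omega)

theorem noParallel_birth {N c : ℕ} (hc : 2 * c + 2 ≤ N) (x : ℝ) :
    NoParallel {P | (x, P) ∈ elemTangle N (.birth c)} := by
  have key : ∀ P, (x, P) ∈ elemTangle N (.birth c) → (∃ b, 2 * c + 2 ≤ b ∧ b < N ∧ P = stdPt N b) ∨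
      ∃ u, 0 ≤ u ∧ fold u = x ∧ ∃ b, 2 * c ≤ b ∧ b < N ∧ P = basePt N (2 * c) 0 (-oddStep u) b := by
    rintro P ⟨b, hb, v, hv, e⟩
    simp only [lifetime, birthLifetime] at hv
    split_ifs at hv with h1 h2
    · exact absurd hv (notMem_empty v)
    · right
      simp only [letterCurve, birthCurve] at e
      rw [if_pos (by omega)] at e
      rw [Prod.mk.injEq] at e
      exact ⟨(v - 1 / 4) * (4 / 3), by linarith [hv.1], e.1.symm, b, by omega, hb, e.2⟩
    · left
      simp only [letterCurve, birthCurve] at e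
      rw [if_neg (by omega)] at e
      rw [Prod.mk.injEq] at e
      exact ⟨b, by omega, hb, e.2⟩
  by_cases hu : ∃ u, 0 ≤ u ∧ fold u = x
  · obtain ⟨u, hu0, hux⟩ := hu
    have h1 := oddStep_monotone hu0
    rw [oddStep_zero] at h1
    have h2 := oddStep_le_one u
    refine (noParallel_edge hc (x := -oddStep u) (by linarith) (by linarith)).mono fun P hP => ?_
    rcases key P hP with ⟨b, h3, h4, rfl⟩ | ⟨u', h3, h4, b, h5, h6, rfl⟩
    · exact ⟨b, ⟨by omega, h4⟩, basePt_of_ge _ h3⟩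
    · have : u' = u := fold_strictMonoOn.injOn h3 hu0 (h4.trans hux.symm)
      subst this
      exact ⟨b, ⟨h5, h6⟩, rfl⟩
  · refine (noParallel_stdPt N).mono fun P hP => ?_
    rcases key P hP with ⟨b, -, h4, rfl⟩ | ⟨u', h3, h4, -⟩
    · exact ⟨b, h4, rfl⟩
    · exact absurd ⟨u', h3, h4⟩ hu

theorem noParallel_death {N c : ℕ} (hc : 2 * c + 2 ≤ N) (x : ℝ) :
    NoParallel {P | (x, P) ∈ elemTangle N (.death c)} := by
  refine (noParallel_birth hc (1 - x)).mono fun P hP => ?_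
  show (1 - x, P) ∈ elemTangle N (.birth c)
  rw [← mirror_elemTangle]
  exact ⟨_, hP, rfl⟩

theorem tripleVertices_eq_empty {E : Set (ℝ × ℝ × ℝ)} (h : ∀ x, NoParallel {P | (x, P) ∈ E}) :
    tripleVertices E = ∅ := by
  rw [eq_empty_iff_forall_notMem]
  rintro _ ⟨⟨x, P⟩, hp, ⟨y, Q⟩, hq, ⟨z, R⟩, hr, h1, h2, -, e1, e2, e3, -⟩
  simp only at e1 e2 e3
  subst e1 e2
  have h1' : P ≠ Q := fun e => h1 (by rw [e])
  have h2' : Q ≠ R := fun e => h2 (by rw [e])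
  exact h1' (h x P hp Q hq Q hq R hr h1' h2' e3).1

/-! ## Fiber trisecants -/

theorem secant_chain {P Q R : ℝ × ℝ} (h1 : P ≠ Q) (h2 : Q ≠ R)
    (e : secantAngle P Q = secantAngle Q R) :
    P ≠ R ∧ secantAngle P R = secantAngle P Q ∧ secantHeight P R = secantHeight P Q ∧
      secantHeight Q R = secantHeight P Q := by
  obtain ⟨c, hc, e1, e2⟩ := (secantAngle_eq_iff_exists h1 h2).1 e
  have h3 : P ≠ R := by
    rintro rfl
    apply h1
    have a1 : (1 + c) * (Q.1 - P.1) = 0 := by linarith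
    have a2 : (1 + c) * (Q.2 - P.2) = 0 := by linarith
    have hc' : (1 + c) ≠ 0 := by positivity
    have b1 := (mul_eq_zero.1 a1).resolve_left hc'
    have b2 := (mul_eq_zero.1 a2).resolve_left hc'
    exact Prod.ext (by linarith) (by linarith)
  have e3 : secantAngle P Q = secantAngle P R :=
    (secantAngle_eq_iff_exists h1 h3).2 ⟨1 + c, by positivity, by linarith, by linarith⟩
  refine ⟨h3, e3.symm, ?_, ?_⟩
  · exact ((secantHeight_eq_iff h1 h3 e3).2 (by ring)).symm
  · exact ((secantHeight_eq_iff h1 h2 e).2 (by ring)).symm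

theorem secantAngle_ne_reverse {P Q : ℝ × ℝ} (h : P ≠ Q) : secantAngle P Q ≠ secantAngle Q P := by
  intro e
  exact (secant_chain h h.symm e).1 rfl

theorem mem_tripleVertices {E : Set (ℝ × ℝ × ℝ)} {x : ℝ} {P Q R : ℝ × ℝ} (hP : (x, P) ∈ E)
    (hQ : (x, Q) ∈ E) (hR : (x, R) ∈ E) (h1 : P ≠ Q) (h2 : P ≠ R) (h3 : Q ≠ R)
    (h : crossProd P Q P R = 0) : (secantAngle P Q, x, secantHeight P Q) ∈ tripleVertices E := by
  have lift : ∀ {A B : ℝ × ℝ}, A ≠ B → (x, A) ≠ (x, B) := fun hne e => hne (Prod.mk.inj e).2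
  set D := (Q.1 - P.1) ^ 2 + (Q.2 - P.2) ^ 2 with hD
  have hD0 : D ≠ 0 := by
    intro e
    apply h1
    exact Prod.ext (by nlinarith [sq_nonneg (Q.1 - P.1), sq_nonneg (Q.2 - P.2)])
      (by nlinarith [sq_nonneg (Q.1 - P.1), sq_nonneg (Q.2 - P.2)])
  obtain ⟨t, ht1, ht2⟩ : ∃ t, R.1 - P.1 = t * (Q.1 - P.1) ∧ R.2 - P.2 = t * (Q.2 - P.2) := by
    refine ⟨((R.1 - P.1) * (Q.1 - P.1) + (R.2 - P.2) * (Q.2 - P.2)) / D, ?_, ?_⟩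
    · unfold crossProd at h
      field_simp
      linear_combination (-(Q.2 - P.2)) * h + (R.1 - P.1) * hD
    · unfold crossProd at h
      field_simp
      linear_combination (Q.1 - P.1) * h + (R.2 - P.2) * hD
  have ht0 : t ≠ 0 := by
    rintro rfl
    exact h2 (Prod.ext (by linarith) (by linarith))
  have ht3 : t ≠ 1 := by
    rintro rfl
    exact h3 (Prod.ext (by linarith) (by linarith))
  rcases lt_or_gt_of_ne ht3 with l | l
  · rcases lt_or_gt_of_ne ht0 with l' | l'
    · -- `P` is between
      have e : secantAngle R P = secantAngle P Q :=
        ((secantAngle_eq_iff_exists h1 h2.symm).2 ⟨-t, by linarith, by linarith, by linarith⟩).symm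
      refine ⟨_, hR, _, hP, _, hQ, lift h2.symm, lift h1, lift h3.symm, rfl, rfl, e, ?_⟩
      have := secant_chain h2.symm h1 e
      rw [← this.2.2.2, e]
    · have e : secantAngle P R = secantAngle R Q := by
        apply (secantAngle_eq_iff_exists h2 h3.symm).2
        refine ⟨(1 - t) / t, div_pos (by linarith) l', ?_, ?_⟩
        · rw [ht1]; field_simp; linarith
        · rw [ht2]; field_simp; linarith
      refine ⟨_, hP, _, hR, _, hQ, lift h2, lift h3.symm, lift h1, rfl, rfl, e, ?_⟩
      have := secant_chain h2 h3.symm e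
      rw [← this.2.2.1, this.2.1]
  · have e : secantAngle P Q = secantAngle Q R :=
      (secantAngle_eq_iff_exists h1 h3).2 ⟨t - 1, by linarith, by linarith, by linarith⟩
    exact ⟨_, hP, _, hQ, _, hR, lift h1, lift h3, lift h2, rfl, rfl, e, rfl⟩

theorem crossCurve_mem {N i b : ℕ} {pos : Bool} {v : ℝ} (hb : b < N) (hv : v ∈ Icc (0 : ℝ) 1) :
    (v, crossCurve N i pos b v) ∈ elemTangle N (.cross i pos) := ⟨b, hb, v, hv, rfl⟩

theorem exists_of_mem_cross {N i : ℕ} {pos : Bool} {q : ℝ × ℝ × ℝ}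
    (h : q ∈ elemTangle N (.cross i pos)) :
    q.1 ∈ Icc (0 : ℝ) 1 ∧ ∃ b < N, q.2 = crossCurve N i pos b q.1 := by
  obtain ⟨b, hb, v, hv, rfl⟩ := h
  exact ⟨hv, b, hb, rfl⟩

theorem crossCurve_ne {N i a b : ℕ} {pos : Bool} {v : ℝ} (ha : a < N) (hb : b < N) (hab : a ≠ b) :
    crossCurve N i pos a v ≠ crossCurve N i pos b v := sheared_ne _ (crossParam_mem v) ha hb hab

theorem tripleVertices_cross {N i : ℕ} (hi : i + 2 ≤ N) (pos : Bool) :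
    (tripleVertices (elemTangle N (.cross i pos))).encard = ((2 * (N - 2) : ℕ) : ℕ∞) := by
  have ex : ∀ r, r < N ∧ r ≠ i ∧ r ≠ i + 1 →
      ∃ v ∈ Ioo (1 / 4 : ℝ) (3 / 4), triRoot N i pos r (crossParam v) = 0 := by
    rintro r ⟨h1, h2, h3⟩
    obtain ⟨x, hx, e⟩ := exists_triRoot (N := N) pos h2 h3 h1
    obtain ⟨v, hv, rfl⟩ := exists_crossParam hx
    exact ⟨v, hv, e⟩
  choose! V hV hroot using ex
  set e : ℕ × Bool → ℕ × ℕ := fun p => if p.2 then (i, i + 1) else (i + 1, i) with he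
  have he1 : ∀ p, (e p).1 < N ∧ (e p).2 < N ∧ (e p).1 ≠ (e p).2 := by
    rintro ⟨r, f⟩
    cases f <;> simp [he] <;> omega
  set F : ℕ × Bool → Real.Angle × ℝ × ℝ := fun p =>
    (secantAngle (crossCurve N i pos (e p).1 (V p.1)) (crossCurve N i pos (e p).2 (V p.1)), V p.1,
      secantHeight (crossCurve N i pos (e p).1 (V p.1)) (crossCurve N i pos (e p).2 (V p.1)))
    with hF
  set S : Finset (ℕ × Bool) := (((Finset.range N).erase i).erase (i + 1)) ×ˢ Finset.univ with hS
  have memS : ∀ p, p ∈ S ↔ (p.1 < N ∧ p.1 ≠ i ∧ p.1 ≠ i + 1) := by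
    intro p
    simp only [hS, Finset.mem_product, Finset.mem_erase, Finset.mem_range, Finset.mem_univ, and_true]
    tauto
  have hcard : (S : Set (ℕ × Bool)).encard = ((2 * (N - 2) : ℕ) : ℕ∞) := by
    rw [Set.encard_coe_eq_coe_finsetCard, hS, Finset.card_product, Finset.card_erase_of_mem,
      Finset.card_erase_of_mem, Finset.card_range, Finset.card_univ, Fintype.card_bool]
    · congr 1; omega
    · simp; omega
    · simp; omega
  have hinj : InjOn F S := by
    rintro ⟨r, f⟩ hp ⟨r', f'⟩ hp' h
    rw [Finset.mem_coe, memS] at hp hp'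
    simp only at hp hp'
    simp only [hF, Prod.mk.injEq] at h
    obtain ⟨h1, h2, -⟩ := h
    have hr : r = r' := by
      have t1 := hroot r hp
      have t2 := hroot r' hp'
      rw [← h2] at t2
      exact triRoot_distinct (crossParam_mem _) hp.2.1 hp.2.2 hp'.2.1 hp'.2.2 hp.1 hp'.1 hi t1 t2
    subst hr
    have hne := crossCurve_ne (N := N) (i := i) (a := i) (b := i + 1) (pos := pos) (v := V r)
      (by omega) (by omega) (by omega)
    cases f <;> cases f'
    · rfl
    · exact absurd h1 (secantAngle_ne_reverse hne).symm
    · exact absurd h1 (secantAngle_ne_reverse hne)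
    · rfl
  have himg : F '' S = tripleVertices (elemTangle N (.cross i pos)) := by
    ext q
    constructor
    · rintro ⟨⟨r, f⟩, hp, rfl⟩
      rw [Finset.mem_coe, memS] at hp
      obtain ⟨h1, h2, h3⟩ := hp
      simp only at h1 h2 h3
      have hv := hV r ⟨h1, h2, h3⟩
      have hv' : V r ∈ Icc (0 : ℝ) 1 := ⟨by linarith [hv.1], by linarith [hv.2]⟩
      have hc := crossProd_config_tri (N := N) (pos := pos) (x := crossParam (V r)) h2 h3
      rw [hroot r ⟨h1, h2, h3⟩, neg_zero, ← crossProd_shear (shearAmount N pos (V r))] at hc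
      have hc' : crossProd (crossCurve N i pos i (V r)) (crossCurve N i pos (i + 1) (V r))
        (crossCurve N i pos i (V r)) (crossCurve N i pos r (V r)) = 0 := hc
      have hi1 : i < N := by omega
      have hi2 : i + 1 < N := by omega
      cases f
      · refine mem_tripleVertices (R := crossCurve N i pos r (V r)) (crossCurve_mem hi2 hv')
          (crossCurve_mem hi1 hv') (crossCurve_mem h1 hv')
          (crossCurve_ne hi2 hi1 i.succ_ne_self) (crossCurve_ne hi2 h1 h3.symm)
          (crossCurve_ne hi1 h1 h2.symm) ?_
        simp only [he, Bool.false_eq_true, if_false]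
        unfold crossProd at *
        linarith
      · exact mem_tripleVertices (R := crossCurve N i pos r (V r)) (crossCurve_mem hi1 hv')
          (crossCurve_mem hi2 hv') (crossCurve_mem h1 hv')
          (crossCurve_ne hi1 hi2 i.succ_ne_self.symm) (crossCurve_ne hi1 h1 h2.symm)
          (crossCurve_ne hi2 h1 h3.symm) hc'
    · rintro ⟨⟨x, P⟩, hp, ⟨y, Q⟩, hq, ⟨z, R⟩, hr, h1, h2, h3, e1, e2, e3, rfl⟩
      simp only at e1 e2
      subst e1 e2
      obtain ⟨hx, a, ha, ea⟩ := exists_of_mem_cross hp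
      obtain ⟨-, b, hb, eb⟩ := exists_of_mem_cross hq
      obtain ⟨-, c, hc, ec⟩ := exists_of_mem_cross hr
      simp only at ea eb ec hx e3 ⊢
      subst ea eb ec
      have nab : a ≠ b := by rintro rfl; exact h1 rfl
      have nbc : b ≠ c := by rintro rfl; exact h2 rfl
      have nac : a ≠ c := by rintro rfl; exact h3 rfl
      have m1 := crossCurve_ne (i := i) (pos := pos) (v := x) ha hb nab
      have m2 := crossCurve_ne (i := i) (pos := pos) (v := x) hb hc nbc
      obtain ⟨-, c1, c2, c3⟩ := secant_chain m1 m2 e3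
      have hcol : crossProd (config N i pos (crossParam x) a) (config N i pos (crossParam x) b)
          (config N i pos (crossParam x) b) (config N i pos (crossParam x) c) = 0 := by
        rw [← crossProd_shear (shearAmount N pos x)]
        obtain ⟨t, -, t1, t2⟩ := (secantAngle_eq_iff_exists m1 m2).1 e3
        show crossProd (crossCurve N i pos a x) (crossCurve N i pos b x) (crossCurve N i pos b x)
          (crossCurve N i pos c x) = 0
        unfold crossProd
        rw [t1, t2]
        ring
      obtain ⟨r, r1, r2, r3, r4, hcase⟩ :=
        collinear_cases (crossParam_mem x) ha hb hc nab nbc nac hcol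
      have hxr : x = V r := by
        have hv := hV r ⟨r1, r2, r3⟩
        have hin : crossParam (V r) ∈ Ioo (-1 : ℝ) 1 := by
          constructor
          · have := smoothStep_pos hv.1
            unfold crossParam; linarith
          · have := smoothStep_lt_one hv.2
            unfold crossParam; linarith
        have := triRoot_unique r2 r3 r1 (crossParam_mem x) hin r4 (hroot r ⟨r1, r2, r3⟩)
        exact (crossParam_inj hin this.symm).symm
      subst hxr
      have hin : ∀ f, (r, f) ∈ (S : Set (ℕ × Bool)) := fun f => by
        rw [Finset.mem_coe, memS]; exact ⟨r1, r2, r3⟩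
      rcases hcase with ⟨rfl, rfl, rfl⟩ | ⟨rfl, rfl, rfl⟩ | ⟨rfl, rfl, rfl⟩ | ⟨rfl, rfl, rfl⟩ |
        ⟨rfl, rfl, rfl⟩ | ⟨rfl, rfl, rfl⟩
      · exact ⟨_, hin true, by simp [hF, he, e3, c3]⟩
      · exact ⟨_, hin false, by simp [hF, he, e3, c3]⟩
      · exact ⟨_, hin true, by simp [hF, he, c1, c2]⟩
      · exact ⟨_, hin false, by simp [hF, he, c1, c2]⟩
      · exact ⟨_, hin true, by simp [hF, he]⟩
      · exact ⟨_, hin false, by simp [hF, he]⟩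
  rw [← himg, hinj.encard_image, hcard]

end

section

/-! ## Traversing a plat diagram -/

/-- The position joined to the position `b` by a minimum or a maximum. -/
def mate (b : ℕ) : ℕ := if b % 2 = 0 then b + 1 else b - 1

theorem mate_mate (b : ℕ) : mate (mate b) = b := by unfold mate; split_ifs <;> omega

theorem mate_ne (b : ℕ) : mate b ≠ b := by unfold mate; split_ifs <;> omega

theorem mate_div (b : ℕ) : mate b / 2 = b / 2 := by unfold mate; split_ifs <;> omega

theorem mate_lt {b k : ℕ} : mate b < 2 * k ↔ b < 2 * k := by unfold mate; split_ifs <;> omega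

/-- A state consists of a strand, the information whether it is run through upwards, and the number
of turns made around the axis.  This is the passage to the next strand. -/
def stepFun (k : ℕ) (p : Equiv.Perm ℕ) : ℕ × Bool × ℤ → ℕ × Bool × ℤ
  | (a, true, L) => if p a < 2 * k then (p.symm (mate (p a)), false, L) else (p a, true, L + 1)
  | (a, false, L) => if a < 2 * k then (mate a, true, L) else (p.symm a, false, L - 1)

/-- The state of a strand which is run through in the opposite direction. -/
def reverse (x : ℕ × Bool × ℤ) : ℕ × Bool × ℤ := (x.1, !x.2.1, x.2.2)

/-- The state after some more turns. -/
def addLevel (d : ℤ) (x : ℕ × Bool × ℤ) : ℕ × Bool × ℤ := (x.1, x.2.1, x.2.2 + d)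

theorem reverse_reverse (x : ℕ × Bool × ℤ) : reverse (reverse x) = x := by
  obtain ⟨a, o, L⟩ := x
  simp [reverse]

variable (k : ℕ) (p : Equiv.Perm ℕ)

theorem stepFun_reverse (x : ℕ × Bool × ℤ) :
    stepFun k p (reverse (stepFun k p x)) = reverse x := by
  obtain ⟨a, o, L⟩ := x
  cases o
  · by_cases h : a < 2 * k
    · simp [stepFun, reverse, h, mate_lt, mate_mate]
    · simp [stepFun, reverse, h]
  · by_cases h : p a < 2 * k
    · simp [stepFun, reverse, h, mate_lt, mate_mate]
    · simp [stepFun, reverse, h]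

theorem stepFun_addLevel (d : ℤ) (x : ℕ × Bool × ℤ) :
    stepFun k p (addLevel d x) = addLevel d (stepFun k p x) := by
  obtain ⟨a, o, L⟩ := x
  cases o
  · by_cases h : a < 2 * k <;> simp [stepFun, addLevel, h]; ring
  · by_cases h : p a < 2 * k <;> simp [stepFun, addLevel, h]; ring

/-- The passage to the next strand, as a permutation. -/
def step : Equiv.Perm (ℕ × Bool × ℤ) where
  toFun := stepFun k p
  invFun x := reverse (stepFun k p (reverse x))
  left_inv x := by
    change reverse (stepFun k p (reverse (stepFun k p x))) = x
    rw [stepFun_reverse, reverse_reverse]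
  right_inv x := by
    change stepFun k p (reverse (stepFun k p (reverse x))) = x
    rw [stepFun_reverse, reverse_reverse]

/-- The states in the order in which the diagram is run through. -/
def trav (i : ℤ) : ℕ × Bool × ℤ := (step k p ^ i) (0, true, 0)

theorem trav_zero : trav k p 0 = (0, true, 0) := rfl

theorem trav_succ (i : ℤ) : trav k p (i + 1) = stepFun k p (trav k p i) := by
  unfold trav
  rw [add_comm, zpow_one_add]
  rfl

theorem trav_pred (i : ℤ) : trav k p (i - 1) = reverse (stepFun k p (reverse (trav k p i))) := by
  have h := trav_succ k p (i - 1)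
  rw [sub_add_cancel] at h
  rw [h, stepFun_reverse, reverse_reverse]

variable {k p}

theorem zpow_step_addLevel (i d : ℤ) (x : ℕ × Bool × ℤ) :
    (step k p ^ i) (addLevel d x) = addLevel d ((step k p ^ i) x) := by
  have h1 : ∀ y, step k p (addLevel d y) = addLevel d (step k p y) := stepFun_addLevel k p d
  induction i with
  | zero => rfl
  | succ i ih =>
    rw [add_comm, zpow_one_add, Equiv.Perm.mul_apply, Equiv.Perm.mul_apply, ih, h1]
  | pred i ih =>
    apply (step k p).injective
    rw [h1, ← Equiv.Perm.mul_apply, ← Equiv.Perm.mul_apply, ← zpow_one_add]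
    have : 1 + (-(i : ℤ) - 1) = -i := by ring
    rw [this, ih]

theorem addLevel_of_eq {x y : ℕ × Bool × ℤ} (h1 : x.1 = y.1) (h2 : x.2.1 = y.2.1) :
    y = addLevel (y.2.2 - x.2.2) x := by
  obtain ⟨a, o, L⟩ := x
  obtain ⟨a', o', L'⟩ := y
  simp only at h1 h2
  subst h1 h2
  simp [addLevel]

theorem trav_add_of_eq {m : ℤ} {d : ℤ} (h : trav k p m = (0, true, d)) (i : ℤ) :
    trav k p (i + m) = addLevel d (trav k p i) := by
  have e : ((0, true, d) : ℕ × Bool × ℤ) = addLevel d (0, true, 0) := by simp [addLevel]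
  unfold trav at *
  rw [zpow_add, Equiv.Perm.mul_apply, h, e, zpow_step_addLevel]

theorem trav_sub {i j : ℤ} (h1 : (trav k p i).1 = (trav k p j).1)
    (h2 : (trav k p i).2.1 = (trav k p j).2.1) : ∃ d, trav k p (j - i) = (0, true, d) := by
  have h := addLevel_of_eq h1 h2
  refine ⟨(trav k p j).2.2 - (trav k p i).2.2, ?_⟩
  set d := (trav k p j).2.2 - (trav k p i).2.2
  have e : ((0, true, d) : ℕ × Bool × ℤ) = addLevel d (0, true, 0) := by simp [addLevel]
  apply (step k p ^ i).injective
  rw [e, zpow_step_addLevel]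
  unfold trav at *
  rw [← Equiv.Perm.mul_apply, ← zpow_add, add_sub_cancel, ← h]

/-- A strand is never run through in both directions. -/
theorem trav_ne_reverse (i j : ℤ) : ¬((trav k p i).1 = (trav k p j).1 ∧
    (trav k p i).2.1 = !(trav k p j).2.1) := by
  have base1 : ∀ i : ℤ, ¬((trav k p i).1 = (trav k p (i + 1)).1 ∧
      (trav k p i).2.1 = !(trav k p (i + 1)).2.1) := by
    intro i
    rw [trav_succ]
    obtain ⟨a, o, L⟩ := trav k p i
    cases o
    · by_cases h : a < 2 * k
      · simp [stepFun, h, (mate_ne a).symm]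
      · simp [stepFun, h]
    · by_cases h : p a < 2 * k
      · simp only [stepFun, h, if_true, Bool.not_false, and_true]
        intro e
        exact mate_ne (p a) (p.symm_apply_eq.1 e.symm).symm.symm
      · simp [stepFun, h]
  have key : ∀ n : ℕ, ∀ i : ℤ, ¬((trav k p i).1 = (trav k p (i + n)).1 ∧
      (trav k p i).2.1 = !(trav k p (i + n)).2.1) := by
    intro n
    induction n using Nat.strong_induction_on with
    | _ n ih =>
      intro i h
      match n, ih, h with
      | 0, _, h => simp at h
      | 1, _, h => exact base1 i (by simpa using h)
      | n + 2, ih, h =>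
        apply ih n (by omega) (i + 1)
        have e1 : i + ((n + 2 : ℕ) : ℤ) = (i + 1 + n) + 1 := by push_cast; ring
        rw [e1] at h
        have e2 := addLevel_of_eq (x := reverse (trav k p (i + 1 + n + 1))) (y := trav k p i)
          h.1.symm h.2.symm
        have e3 := trav_succ k p i
        rw [e2, stepFun_addLevel, trav_succ k p (i + 1 + n), stepFun_reverse] at e3
        rw [e3]
        exact ⟨rfl, rfl⟩
  rcases le_total i j with h | h
  · have := key (j - i).toNat i
    rwa [Int.toNat_of_nonneg (by omega), add_sub_cancel] at this
  · have := key (i - j).toNat j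
    rw [Int.toNat_of_nonneg (by omega), add_sub_cancel] at this
    rintro ⟨h1, h2⟩
    exact this ⟨h1.symm, by rw [h2, Bool.not_not]⟩

theorem trav_orientation_eq {i j : ℤ} (h : (trav k p i).1 = (trav k p j).1) :
    (trav k p i).2.1 = (trav k p j).2.1 := by
  by_contra hn
  apply trav_ne_reverse (k := k) (p := p) i j ⟨h, ?_⟩
  cases h1 : (trav k p i).2.1 <;> cases h2 : (trav k p j).2.1 <;> simp_all

variable {N : ℕ}

theorem stepFun_lt (hp : ∀ a, p a < N ↔ a < N) (hk : 2 * k ≤ N) {x : ℕ × Bool × ℤ} (hx : x.1 < N) :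
    (stepFun k p x).1 < N := by
  have hs : ∀ a, p.symm a < N ↔ a < N := fun a => by rw [← hp, p.apply_symm_apply]
  obtain ⟨a, o, L⟩ := x
  simp only at hx
  cases o
  · by_cases h : a < 2 * k
    · simp only [stepFun, h, if_true]
      exact (mate_lt.2 h).trans_le hk
    · simp only [stepFun, h, if_false]
      exact (hs a).2 hx
  · by_cases h : p a < 2 * k
    · simp only [stepFun, h, if_true]
      exact (hs _).2 ((mate_lt.2 h).trans_le hk)
    · simp only [stepFun, h, if_false]
      exact (hp a).2 hx

theorem trav_lt (hp : ∀ a, p a < N ↔ a < N) (hk : 2 * k ≤ N) (hN : 0 < N) (i : ℤ) :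
    (trav k p i).1 < N := by
  induction i with
  | zero => exact hN
  | succ i ih => rw [trav_succ]; exact stepFun_lt hp hk ih
  | pred i ih =>
    rw [trav_pred]
    exact stepFun_lt (x := reverse (trav k p (-i))) hp hk ih

/-- The strands visited are closed under passing to neighbours. -/
theorem visited_stepFun {i : ℤ} (o : Bool) :
    ∃ j, (trav k p j).1 = (stepFun k p ((trav k p i).1, o, 0)).1 := by
  have lev : ∀ (y : ℕ × Bool × ℤ), (stepFun k p (y.1, y.2.1, 0)).1 = (stepFun k p y).1 := by
    intro y
    have := stepFun_addLevel k p y.2.2 (y.1, y.2.1, 0)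
    have e : addLevel y.2.2 (y.1, y.2.1, 0) = y := by simp [addLevel]
    rw [e] at this
    rw [this]
    rfl
  by_cases h : o = (trav k p i).2.1
  · refine ⟨i + 1, ?_⟩
    rw [trav_succ, h, lev]
  · refine ⟨i - 1, ?_⟩
    rw [trav_pred]
    have : o = (reverse (trav k p i)).2.1 := by
      cases o <;> cases h2 : (trav k p i).2.1 <;> simp_all [reverse]
    rw [this]
    exact (lev (reverse (trav k p i))).symm

theorem visited {w : List (ℕ × Bool)} (hN : 0 < N) (h : IsKnotPlat N k w) {a : ℕ} (ha : a < N) :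
    ∃ i, (trav k (braidPerm w) i).1 = a := by
  set q := braidPerm w with hq
  have nb : ∀ a b, PlatJoined k w a b →
      (∃ o, b = (stepFun k q (a, o, 0)).1) ∧ ∃ o, a = (stepFun k q (b, o, 0)).1 := by
    rintro a b (⟨c, hc, rfl, rfl⟩ | ⟨c, hc, h1, h2⟩ | ⟨h1, h2⟩)
    · refine ⟨⟨false, ?_⟩, ⟨false, ?_⟩⟩
      · simp only [stepFun]
        rw [if_pos (by omega)]
        unfold mate
        rw [if_pos (by omega)]
      · simp only [stepFun]
        rw [if_pos (by omega)]
        unfold mate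
        rw [if_neg (by omega)]
        rfl
    · refine ⟨⟨true, ?_⟩, ⟨true, ?_⟩⟩
      · simp only [stepFun]
        rw [if_pos (by rw [hq, h1]; omega)]
        apply q.injective
        rw [q.apply_symm_apply, hq, h2, h1]
        unfold mate
        rw [if_pos (by omega)]
      · simp only [stepFun]
        rw [if_pos (by rw [hq, h2]; omega)]
        apply q.injective
        rw [q.apply_symm_apply, hq, h2, h1]
        unfold mate
        rw [if_neg (by omega)]
        rfl
    · subst h2
      refine ⟨⟨true, ?_⟩, ⟨false, ?_⟩⟩
      · simp only [stepFun]
        rw [if_neg (by rw [hq]; omega)]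
      · simp only [stepFun]
        rw [if_neg (by omega), ← hq, q.symm_apply_apply]
  have inv : ∀ a b, Relation.EqvGen (PlatJoined k w) a b →
      ((∃ i, (trav k q i).1 = a) ↔ ∃ i, (trav k q i).1 = b) := by
    intro a b hab
    induction hab with
    | rel a b h =>
      obtain ⟨⟨o1, h1⟩, ⟨o2, h2⟩⟩ := nb a b h
      constructor
      · rintro ⟨i, rfl⟩
        rw [h1]
        exact visited_stepFun o1
      · rintro ⟨i, rfl⟩
        rw [h2]
        exact visited_stepFun o2
    | refl a => exact Iff.rfl
    | symm a b _ ih => exact ih.symm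
    | trans a b c _ _ ih1 ih2 => exact ih1.trans ih2
  exact (inv 0 a (h 0 hN a ha)).1 ⟨0, rfl⟩

/-- The traversal of a knot diagram visits each strand once and returns after `N` steps. -/
theorem trav_period (hp : ∀ a, p a < N ↔ a < N) (hk : 2 * k ≤ N) (hN : 0 < N)
    (hv : ∀ a < N, ∃ i, (trav k p i).1 = a) :
    (∃ d, trav k p N = (0, true, d)) ∧
      ∀ i j, (trav k p i).1 = (trav k p j).1 → (N : ℤ) ∣ j - i := by
  have ex : ∃ n : ℕ, 0 < n ∧ ∃ d, trav k p n = (0, true, d) := by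
    have hf : Set.Finite {a : ℕ | a < N} := Set.finite_lt_nat N
    obtain ⟨i, j, hij, e⟩ := Set.Finite.exists_lt_map_eq_of_forall_mem (t := {a : ℕ | a < N})
      (f := fun i : ℕ => (trav k p i).1) (fun i => trav_lt hp hk hN i) hf
    obtain ⟨d, hd⟩ := trav_sub (k := k) (p := p) e (trav_orientation_eq e)
    refine ⟨j - i, by omega, d, ?_⟩
    rw [← hd]
    congr 1
    omega
  classical
  set n := Nat.find ex with hn
  obtain ⟨hn0, d, hd⟩ := Nat.find_spec ex
  rw [← hn] at hn0 hd
  have hmul : ∀ (i m : ℤ), (trav k p (i + n * m)).1 = (trav k p i).1 := by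
    intro i m
    induction m with
    | zero => simp
    | succ m ih =>
      rw [show i + (n : ℤ) * ((m : ℤ) + 1) = (i + n * m) + n by ring, trav_add_of_eq hd]
      exact ih
    | pred m ih =>
      rw [← ih, show i + (n : ℤ) * (-m : ℤ) = (i + n * (-(m : ℤ) - 1)) + n by ring,
        trav_add_of_eq hd]
      rfl
  have hdvd : ∀ i j, (trav k p i).1 = (trav k p j).1 → (n : ℤ) ∣ j - i := by
    intro i j e
    obtain ⟨d', hd'⟩ := trav_sub (k := k) (p := p) e (trav_orientation_eq e)
    have hm := Int.emod_nonneg (j - i) (by omega : (n : ℤ) ≠ 0)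
    have hm2 := Int.emod_lt_of_pos (j - i) (by omega : (0 : ℤ) < n)
    by_contra hnd
    have hm3 : 0 < (j - i) % n := lt_of_le_of_ne hm (fun e => hnd (Int.dvd_of_emod_eq_zero e.symm))
    have e2 := hmul ((j - i) % n) ((j - i) / n)
    rw [Int.emod_add_mul_ediv, hd'] at e2
    have e3 : ∃ d, trav k p ((j - i) % n).toNat = (0, true, d) := by
      rw [Int.toNat_of_nonneg hm]
      refine ⟨(trav k p ((j - i) % n)).2.2, ?_⟩
      have o := trav_orientation_eq (k := k) (p := p) (i := (j - i) % n) (j := 0) e2.symm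
      exact Prod.ext e2.symm (Prod.ext o rfl)
    have := Nat.find_min ex (m := ((j - i) % n).toNat) (by omega)
    exact this ⟨by omega, e3⟩
  have hcard : n = N := by
    have hb : Finset.image (fun i : ℕ => (trav k p i).1) (Finset.range n) = Finset.range N := by
      ext a
      simp only [Finset.mem_image, Finset.mem_range]
      constructor
      · rintro ⟨i, -, rfl⟩
        exact trav_lt hp hk hN i
      · intro ha
        obtain ⟨i, hi⟩ := hv a ha
        have hm := Int.emod_nonneg i (by omega : (n : ℤ) ≠ 0)
        have hm2 := Int.emod_lt_of_pos i (by omega : (0 : ℤ) < n)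
        refine ⟨(i % n).toNat, by omega, ?_⟩
        rw [Int.toNat_of_nonneg hm, ← hmul _ (i / n), Int.emod_add_mul_ediv, hi]
    have := congrArg Finset.card hb
    rwa [Finset.card_image_of_injOn, Finset.card_range, Finset.card_range] at this
    intro i hi j hj e
    have h1 := hdvd i j e
    simp only [Finset.coe_range, mem_Iio] at hi hj
    obtain ⟨c, hc⟩ := h1
    have : c = 0 := by
      by_contra hc0
      rcases lt_or_gt_of_ne hc0 with h | h <;> nlinarith
    rw [this] at hc
    omega
  rw [← hcard]
  exact ⟨⟨d, hd⟩, hdvd⟩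

/-! ## The permutation of a braid word -/

theorem braidPerm_append (u v : List (ℕ × Bool)) :
    braidPerm (u ++ v) = braidPerm v * braidPerm u := by
  induction u with
  | nil => simp [braidPerm]
  | cons g u ih => rw [List.cons_append, braidPerm, braidPerm, ih, mul_assoc]

theorem swap_lt {i : ℕ} (hi : i + 2 ≤ N) (a : ℕ) : Equiv.swap i (i + 1) a < N ↔ a < N := by
  rw [Equiv.swap_apply_def]
  split_ifs <;> omega

theorem braidPerm_lt {w : List (ℕ × Bool)} (hw : ∀ g ∈ w, g.1 + 2 ≤ N) (a : ℕ) :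
    braidPerm w a < N ↔ a < N := by
  induction w generalizing a with
  | nil => rfl
  | cons g w ih =>
    rw [braidPerm, Equiv.Perm.mul_apply, ih fun x hx => hw x (List.mem_cons_of_mem _ hx)]
    exact swap_lt (hw g List.mem_cons_self) a

theorem braidPerm_take_succ (w : List (ℕ × Bool)) {t : ℕ} (ht : t < w.length) :
    braidPerm (w.take (t + 1)) = Equiv.swap (w[t]).1 ((w[t]).1 + 1) * braidPerm (w.take t) := by
  rw [List.take_succ_eq_append_getElem ht, braidPerm_append]
  rfl

end

section

/-! ## The strands of a plat diagram -/

/-- The positions before and after a letter. -/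
def letterPerm : PlatLetter → Equiv.Perm ℕ
  | .cross i _ => Equiv.swap i (i + 1)
  | .birth _ => 1
  | .death _ => 1

theorem birthCurve_own {N b : ℕ} {v : ℝ} (h : 7 / 16 ≤ v) :
    birthCurve N (b / 2) b v = (v, stdPt N b) := by
  unfold birthCurve
  rw [if_pos (by omega), fold_of_ge (by linarith), oddStep_of_ge (by linarith), basePt_neg_one]
  rw [Prod.mk.injEq]
  exact ⟨by ring, rfl⟩

theorem birthCurve_other {N b c : ℕ} (v : ℝ) (h : c ≠ b / 2) :
    birthCurve N c b v = (v, stdPt N b) := by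
  unfold birthCurve
  rw [if_neg (by omega)]

theorem birthCurve_late {N b c : ℕ} {v : ℝ} (h : 7 / 16 ≤ v) :
    birthCurve N c b v = (v, stdPt N b) := by
  by_cases hc : c = b / 2
  · subst hc
    exact birthCurve_own h
  · exact birthCurve_other v hc

theorem letterCurve_entry {N b : ℕ} {x : PlatLetter} {v : ℝ} (h : x ≠ .birth (b / 2))
    (hv : v ≤ 1 / 16) : letterCurve N x b v = (v, stdPt N b) := by
  cases x with
  | birth c => exact birthCurve_other v fun e => h (by rw [e])
  | cross i s => simp only [letterCurve, crossCurve_of_le hv]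
  | death c => simp only [letterCurve, birthCurve_late (v := 1 - v) (by linarith), sub_sub_cancel]

theorem letterCurve_exit {N b : ℕ} {x : PlatLetter} {v : ℝ} (h : x ≠ .death (b / 2))
    (hv : 15 / 16 ≤ v) : letterCurve N x b v = (v, stdPt N (letterPerm x b)) := by
  cases x with
  | birth c => exact birthCurve_late (by linarith)
  | cross i s => simp only [letterCurve, crossCurve_of_ge hv, letterPerm]
  | death c =>
    have hc : c ≠ b / 2 := fun e => h (by rw [e])
    simp only [letterCurve, birthCurve_other _ hc, sub_sub_cancel]
    rfl

theorem birthCurve_mate (N b : ℕ) (v : ℝ) :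
    birthCurve N (b / 2) (mate b) (1 / 2 - v) = birthCurve N (b / 2) b v := by
  unfold birthCurve
  have e : (1 / 2 - v - 1 / 4) * (4 / 3) = -((v - 1 / 4) * (4 / 3)) := by ring
  have hm := mate_div b
  rw [if_pos (by omega), if_pos (by omega), e, fold_neg, oddStep_neg, neg_neg]
  congr 1
  unfold mate
  split_ifs with h
  · obtain ⟨c, rfl⟩ : ∃ c, b = 2 * c := ⟨b / 2, by omega⟩
    rw [show 2 * (2 * c / 2) = 2 * c by omega, basePt_self, basePt_succ, neg_zero]
  · obtain ⟨c, rfl⟩ : ∃ c, b = 2 * c + 1 := ⟨b / 2, by omega⟩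
    rw [show 2 * ((2 * c + 1) / 2) = 2 * c by omega, Nat.add_sub_cancel, basePt_self, basePt_succ,
      neg_zero, neg_neg]

theorem birthCurve_regular (N c b : ℕ) (v : ℝ) :
    deriv (fun v => (birthCurve N c b v).1) v ≠ 0 ∨
      deriv (fun v => (birthCurve N c b v).2.1) v ≠ 0 := by
  by_cases h : c = b / 2
  · subst h
    have hb : b = 2 * (b / 2) ∨ b = 2 * (b / 2) + 1 := by omega
    have e1 : (fun v => (birthCurve N (b / 2) b v).1) = fun v => fold ((v - 1 / 4) * (4 / 3)) := by
      funext v; unfold birthCurve; rw [if_pos hb]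
    have e2 : (fun v => (birthCurve N (b / 2) b v).2.1) = fun v =>
        (basePt N (2 * (b / 2)) 0 (-oddStep ((v - 1 / 4) * (4 / 3))) b).1 := by
      funext v; unfold birthCurve; rw [if_pos hb]
    have ha : HasDerivAt (fun v : ℝ => (v - 1 / 4) * (4 / 3)) (4 / 3) v :=
      (((hasDerivAt_id v).sub_const (1 / 4)).mul_const (4 / 3)).congr_deriv (one_mul _)
    rcases lt_trichotomy ((v - 1 / 4) * (4 / 3)) 0 with h | h | h
    · left
      have := (contDiff_fold.differentiable (by simp) ((v - 1 / 4) * (4 / 3))).hasDerivAt.comp v ha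
      rw [e1, show deriv (fun v => fold ((v - 1 / 4) * (4 / 3))) v = _ from this.deriv]
      exact mul_ne_zero (deriv_fold_neg h).ne (by norm_num)
    · right
      rw [e2]
      have h1 := ((differentiable_oddStep ((v - 1 / 4) * (4 / 3))).hasDerivAt.comp v ha).neg
      have hp := deriv_oddStep_zero_pos
      rcases hb with hb | hb
      · have h2 := (hasDerivAt_movPt_fst N (2 * (b / 2)) 0
          (-oddStep ((v - 1 / 4) * (4 / 3)))).comp v h1
        have e3 : (fun v => (basePt N (2 * (b / 2)) 0 (-oddStep ((v - 1 / 4) * (4 / 3))) b).1) =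
            fun v => (movPt N (2 * (b / 2)) 0 (-oddStep ((v - 1 / 4) * (4 / 3)))).1 := by
          funext v
          conv_lhs => rw [hb]
          rw [show 2 * (2 * (b / 2) / 2) = 2 * (b / 2) by omega, basePt_self]
        rw [e3]
        intro e0
        have h4 := h2.deriv.symm.trans e0
        rw [h] at h4
        revert h4
        simp only [movVel]
        refine mul_ne_zero (by norm_num) ?_
        rw [neg_ne_zero]
        exact mul_ne_zero hp.ne' (by norm_num)
      · have h2 := (hasDerivAt_movPt_fst N (2 * (b / 2)) (-0)
          (- -oddStep ((v - 1 / 4) * (4 / 3)))).comp v h1.neg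
        have e3 : (fun v => (basePt N (2 * (b / 2)) 0 (-oddStep ((v - 1 / 4) * (4 / 3))) b).1) =
            fun v => (movPt N (2 * (b / 2)) (-0) (- -oddStep ((v - 1 / 4) * (4 / 3)))).1 := by
          funext v
          conv_lhs => rw [hb]
          rw [show 2 * ((2 * (b / 2) + 1) / 2) = 2 * (b / 2) by omega, basePt_succ]
        rw [e3]
        intro e0
        have h4 := h2.deriv.symm.trans e0
        rw [h] at h4
        revert h4
        simp only [movVel]
        refine mul_ne_zero (by norm_num) ?_
        rw [neg_neg]
        exact mul_ne_zero hp.ne' (by norm_num)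
    · left
      have := (contDiff_fold.differentiable (by simp) ((v - 1 / 4) * (4 / 3))).hasDerivAt.comp v ha
      rw [e1, show deriv (fun v => fold ((v - 1 / 4) * (4 / 3))) v = _ from this.deriv]
      exact mul_ne_zero (deriv_fold_pos h).ne' (by norm_num)
  · left
    simp only [birthCurve_other _ h, deriv_id'']
    exact one_ne_zero

theorem letterCurve_regular (N : ℕ) (x : PlatLetter) (b : ℕ) (v : ℝ) :
    deriv (fun v => (letterCurve N x b v).1) v ≠ 0 ∨
      deriv (fun v => (letterCurve N x b v).2.1) v ≠ 0 := by
  cases x with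
  | birth c => exact birthCurve_regular N c b v
  | cross i s => left; simp only [letterCurve, deriv_id'']; exact one_ne_zero
  | death c =>
    simp only [letterCurve]
    rw [deriv_const_sub, deriv_comp_const_sub (f := fun v => (birthCurve N c b v).1),
      deriv_comp_const_sub (f := fun v => (birthCurve N c b v).2.1), neg_neg, neg_ne_zero]
    exact birthCurve_regular N c b (1 - v)

variable (N k : ℕ) (w : List (ℕ × Bool))

/-- The letter in the sector number `j`; outside of the diagram all strands are straight. -/
def letterAt (j : ℤ) : PlatLetter :=
  if j < 0 ∨ w.length + 2 * k ≤ j then .birth N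
  else if j < k then .birth (k - 1 - j).toNat
  else if j < k + w.length then
    .cross (w.getD (j - k).toNat (0, true)).1 (w.getD (j - k).toNat (0, true)).2
  else .death (j - k - w.length).toNat

/-- The position at the beginning of the sector number `j` of the strand `a`. -/
def posAt (a : ℕ) (j : ℤ) : ℕ := braidPerm (w.take (j - k).toNat) a

/-- The formula for the strand `a` in the sector number `j`. -/
def segCurve (a : ℕ) (j : ℤ) (z : ℝ) : ℝ × ℝ × ℝ :=
  (j + (letterCurve N (letterAt N k w j) (posAt k w a j) (z - j)).1,
    (letterCurve N (letterAt N k w j) (posAt k w a j) (z - j)).2)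

/-- The strand `a`, where the coordinate along the diagram comes first. -/
def strandCurve (a : ℕ) (z : ℝ) : ℝ × ℝ × ℝ := segCurve N k w a ⌊z⌋ z

/-- The sector in which the strand `a` begins. -/
def startAt (a : ℕ) : ℤ := if a < 2 * k then k - 1 - (a / 2 : ℕ) else -1

/-- The sector before which the strand with the last position `b` ends. -/
def stopAt (b : ℕ) : ℤ :=
  if b < 2 * k then k + w.length + (b / 2 : ℕ) + 1 else w.length + 2 * k + 1

/-- The parameter at the beginning of the strand `a`. -/
def startPar (a : ℕ) : ℝ := if a < 2 * k then (startAt k a : ℝ) + 1 / 4 else 0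

/-- The parameter at the end of the strand with the last position `b`. -/
def stopPar (b : ℕ) : ℝ :=
  if b < 2 * k then (stopAt k w b : ℝ) - 1 / 4 else ((w.length + 2 * k : ℕ) : ℝ)

variable {N k} {w}

local notation "sectorCount" => ((w.length + 2 * k : ℕ) : ℝ)

theorem posAt_of_le {j : ℤ} (h : j ≤ k) (a : ℕ) : posAt k w a j = a := by
  unfold posAt
  rw [Int.toNat_of_nonpos (by omega)]
  rfl

theorem posAt_of_ge {j : ℤ} (h : k + w.length ≤ j) (a : ℕ) : posAt k w a j = braidPerm w a := by
  unfold posAt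
  rw [List.take_of_length_le (by omega)]

theorem letterAt_outside {j : ℤ} (h : j < 0 ∨ w.length + 2 * k ≤ j) :
    letterAt N k w j = .birth N := by
  unfold letterAt; rw [if_pos h]

theorem letterAt_birth {j : ℤ} (h0 : 0 ≤ j) (h1 : j < k) :
    letterAt N k w j = .birth (k - 1 - j).toNat := by
  unfold letterAt; rw [if_neg (by omega), if_pos h1]

theorem letterAt_cross {t : ℕ} (h : t < w.length) :
    letterAt N k w (k + t) = .cross (w[t]).1 (w[t]).2 := by
  unfold letterAt
  rw [if_neg (by omega), if_neg (by omega), if_pos (by omega), add_sub_cancel_left, Int.toNat_natCast,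
    List.getD_eq_getElem _ _ h]

theorem letterAt_death {j : ℤ} (h0 : k + w.length ≤ j) (h1 : j < w.length + 2 * k) :
    letterAt N k w j = .death (j - k - w.length).toNat := by
  unfold letterAt; rw [if_neg (by omega), if_neg (by omega), if_neg (by omega)]

theorem posAt_succ (a : ℕ) (j : ℤ) :
    posAt k w a (j + 1) = letterPerm (letterAt N k w j) (posAt k w a j) := by
  rcases lt_or_ge j k with h | h
  · rw [posAt_of_le (by omega), posAt_of_le (by omega)]
    rcases lt_or_ge j 0 with h' | h'
    · rw [letterAt_outside (Or.inl h')]; rfl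
    · rw [letterAt_birth h' h]; rfl
  · rcases lt_or_ge j (k + w.length) with h' | h'
    · obtain ⟨t, rfl⟩ : ∃ t : ℕ, j = k + t := ⟨(j - k).toNat, by omega⟩
      have ht : t < w.length := by omega
      rw [letterAt_cross ht]
      unfold posAt
      rw [show ((k : ℤ) + t + 1 - k).toNat = t + 1 by omega,
        show ((k : ℤ) + t - k).toNat = t by omega, braidPerm_take_succ w ht]
      rfl
    · rw [posAt_of_ge (by omega), posAt_of_ge h']
      rcases lt_or_ge j (w.length + 2 * k) with h2 | h2
      · rw [letterAt_death h' h2]; rfl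
      · rw [letterAt_outside (Or.inr h2)]; rfl

theorem posAt_lt (hw : ∀ g ∈ w, g.1 + 2 ≤ N) (a : ℕ) (j : ℤ) : posAt k w a j < N ↔ a < N :=
  braidPerm_lt (fun g hg => hw g (List.mem_of_mem_take hg)) a

theorem letterAt_ne_birth (hw : ∀ g ∈ w, g.1 + 2 ≤ N) {a : ℕ} (ha : a < N) {j : ℤ}
    (hj : startAt k a < j) : letterAt N k w j ≠ .birth (posAt k w a j / 2) := by
  have hp := (posAt_lt (k := k) hw a j).2 ha
  intro e
  unfold letterAt at e
  unfold startAt at hj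
  split_ifs at e with h1 h2 h3
  · rw [PlatLetter.birth.injEq] at e
    omega
  · rw [PlatLetter.birth.injEq, posAt_of_le (by omega)] at e
    split_ifs at hj <;> omega

theorem letterAt_ne_death {a : ℕ} {j : ℤ}
    (hj : j + 1 < stopAt k w (braidPerm w a)) : letterAt N k w j ≠ .death (posAt k w a j / 2) := by
  intro e
  unfold letterAt at e
  unfold stopAt at hj
  split_ifs at e with h1 h2 h3
  rw [PlatLetter.death.injEq, posAt_of_ge (by omega)] at e
  split_ifs at hj <;> omega

theorem segCurve_entry (hw : ∀ g ∈ w, g.1 + 2 ≤ N) {a : ℕ} (ha : a < N) {j : ℤ}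
    (hj : startAt k a < j) {z : ℝ} (hz : z - j ≤ 1 / 16) :
    segCurve N k w a j z = (z, stdPt N (posAt k w a j)) := by
  unfold segCurve
  rw [letterCurve_entry (letterAt_ne_birth hw ha hj) hz, add_sub_cancel]

theorem segCurve_exit {a : ℕ} {j : ℤ}
    (hj : j + 1 < stopAt k w (braidPerm w a)) {z : ℝ} (hz : 15 / 16 ≤ z - j) :
    segCurve N k w a j z = (z, stdPt N (posAt k w a (j + 1))) := by
  unfold segCurve
  rw [letterCurve_exit (letterAt_ne_death hj) hz, add_sub_cancel, posAt_succ (N := N)]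

theorem strandCurve_eventuallyEq (hw : ∀ g ∈ w, g.1 + 2 ≤ N) {a : ℕ} (ha : a < N) {z : ℝ}
    (h1 : (startAt k a : ℝ) < z) (h2 : z < stopAt k w (braidPerm w a)) :
    strandCurve N k w a =ᶠ[𝓝 z] segCurve N k w a ⌊z⌋ := by
  apply concat_eventuallyEq
  intro hz
  have i1 : startAt k a < ⌊z⌋ := by rw [hz] at h1; exact_mod_cast h1
  have i2 : ⌊z⌋ - 1 + 1 < stopAt k w (braidPerm w a) := by
    rw [hz] at h2; rw [sub_add_cancel]; exact_mod_cast h2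
  filter_upwards [lt_mem_nhds (show z - 1 / 16 < z by linarith),
    gt_mem_nhds (show z < z + 1 / 16 by linarith)] with s s1 s2
  rw [segCurve_exit i2 (by push_cast; linarith), segCurve_entry hw ha i1 (by linarith),
    sub_add_cancel]

theorem contDiff_segCurve (a : ℕ) (j : ℤ) : ContDiff ℝ ∞ (segCurve N k w a j) := by
  have h := (contDiff_letterCurve N (letterAt N k w j) (posAt k w a j)).comp
    (f := fun z : ℝ => z - j) (by fun_prop)
  exact (contDiff_const.add h.fst).prodMk h.snd

theorem contDiffAt_strandCurve (hw : ∀ g ∈ w, g.1 + 2 ≤ N) {a : ℕ} (ha : a < N) {z : ℝ}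
    (h1 : (startAt k a : ℝ) < z) (h2 : z < stopAt k w (braidPerm w a)) :
    ContDiffAt ℝ ∞ (strandCurve N k w a) z :=
  (contDiff_segCurve a ⌊z⌋).contDiffAt.congr_of_eventuallyEq
    (strandCurve_eventuallyEq hw ha h1 h2)

theorem strandCurve_regular (hw : ∀ g ∈ w, g.1 + 2 ≤ N) {a : ℕ} (ha : a < N) {z : ℝ}
    (h1 : (startAt k a : ℝ) < z) (h2 : z < stopAt k w (braidPerm w a)) :
    deriv (fun z => (strandCurve N k w a z).1) z ≠ 0 ∨
      deriv (fun z => (strandCurve N k w a z).2.1) z ≠ 0 := by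
  have h := strandCurve_eventuallyEq hw ha h1 h2
  have e2 : (fun z => (strandCurve N k w a z).2.1) =ᶠ[𝓝 z] fun z' => (segCurve N k w a ⌊z⌋ z').2.1 := by
    filter_upwards [h] with s hs using by rw [hs]
  have e1 : (fun z => (strandCurve N k w a z).1) =ᶠ[𝓝 z] fun z' => (segCurve N k w a ⌊z⌋ z').1 := by
    filter_upwards [h] with s hs using by rw [hs]
  rw [e1.deriv_eq, e2.deriv_eq]
  simp only [segCurve]
  rw [deriv_const_add, deriv_comp_sub_const (f := fun v => (letterCurve N _ _ v).1),
    deriv_comp_sub_const (f := fun v => (letterCurve N _ _ v).2.1)]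
  exact letterCurve_regular _ _ _ _

theorem letterCurve_fst_pos (N : ℕ) (x : PlatLetter) (b : ℕ) (v : ℝ) :
    0 < (letterCurve N x b v).2.1 := by
  have hb : ∀ c v, 0 < (birthCurve N c b v).2.1 := by
    intro c v
    unfold birthCurve
    have hm : ∀ u, |oddStep u| ≤ 1 := fun u => by
      rw [abs_le]
      have := oddStep_le_one (-u)
      rw [oddStep_neg] at this
      exact ⟨by linarith, oddStep_le_one u⟩
    have hi : (0 : ℝ) ≤ ((2 * c : ℕ) : ℝ) := Nat.cast_nonneg _
    split_ifs with h
    · simp only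
      set u := (v - 1 / 4) * (4 / 3)
      rcases h with rfl | rfl
      · rw [(birthArc_eq N c u).1]
        linarith [(movPt_bounds N (2 * c) (κ := 0) (by norm_num) (hm (-u))).1]
      · rw [(birthArc_eq N c u).2]
        linarith [(movPt_bounds N (2 * c) (κ := 0) (by norm_num) (hm u)).1]
    · simp only [stdPt]
      positivity
  cases x with
  | birth c => exact hb c v
  | cross i s => exact config_fst_pos (abs_crossParam v) b
  | death c => exact hb c (1 - v)

/-! ### Parameters of the strands -/

theorem startPar_bounds (a : ℕ) : (startAt k a : ℝ) < startPar k a ∧ 0 ≤ startPar k a ∧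
    startPar k a ≤ k := by
  unfold startPar startAt
  split_ifs with h
  · have : ((a / 2 : ℕ) : ℝ) + 1 ≤ k := by exact_mod_cast (by omega : a / 2 + 1 ≤ k)
    have h0 : (0 : ℝ) ≤ ((a / 2 : ℕ) : ℝ) := Nat.cast_nonneg _
    simp only [Int.cast_sub, Int.cast_natCast, Int.cast_one]
    refine ⟨by linarith, by linarith, by linarith⟩
  · norm_num

theorem stopPar_bounds (b : ℕ) : stopPar k w b < stopAt k w b ∧
    ((k + w.length : ℕ) : ℝ) ≤ stopPar k w b ∧ stopPar k w b ≤ sectorCount := by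
  have hk : (0 : ℝ) ≤ k := Nat.cast_nonneg _
  unfold stopPar stopAt
  split_ifs with h
  · have : ((b / 2 : ℕ) : ℝ) + 1 ≤ k := by exact_mod_cast (by omega : b / 2 + 1 ≤ k)
    have h0 : (0 : ℝ) ≤ ((b / 2 : ℕ) : ℝ) := Nat.cast_nonneg _
    simp only [Int.cast_add, Int.cast_natCast, Int.cast_one, Nat.cast_add, Nat.cast_mul,
      Nat.cast_ofNat]
    refine ⟨by linarith, by linarith, by linarith⟩
  · push_cast
    refine ⟨by linarith, by linarith, by linarith⟩

/-- The length of the parameter interval of the strand `a`. -/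
def strandLength (k : ℕ) (w : List (ℕ × Bool)) (a : ℕ) : ℝ :=
  stopPar k w (braidPerm w a) - startPar k a

theorem one_le_strandLength (hne : w ≠ []) (a : ℕ) : 1 ≤ strandLength k w a := by
  have h1 := (startPar_bounds (k := k) a).2.2
  have h2 := (stopPar_bounds (k := k) (w := w) (braidPerm w a)).2.1
  have h3 : (1 : ℝ) ≤ w.length := by exact_mod_cast List.length_pos_of_ne_nil hne
  unfold strandLength
  push_cast at h2
  linarith

theorem mem_lifetime_iff {a j : ℕ} (hj : j < w.length + 2 * k) {v : ℝ}
    (hv : v ∈ Icc (0 : ℝ) 1) :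
    v ∈ lifetime (letterAt N k w j) (posAt k w a j) ↔
      (j : ℝ) + v ∈ Icc (startPar k a) (stopPar k w (braidPerm w a)) := by
  have hs := startPar_bounds (k := k) a
  have ht := stopPar_bounds (k := k) (w := w) (braidPerm w a)
  obtain ⟨v0, v1⟩ := hv
  rcases lt_or_ge j k with h | h
  · have hj' : (j : ℝ) + 1 ≤ k := by exact_mod_cast h
    have hl : (0 : ℝ) ≤ w.length := Nat.cast_nonneg _
    rw [letterAt_birth (by omega) (by omega), posAt_of_le (by omega)]
    have hup : (j : ℝ) + v ≤ stopPar k w (braidPerm w a) := by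
      refine le_trans ?_ ht.2.1
      simp only [Nat.cast_add]
      linarith
    rw [mem_Icc, and_iff_left hup]
    simp only [lifetime, birthLifetime]
    unfold startPar startAt
    split_ifs with h1 h2 h3 h4 h5
    · simp only [mem_empty_iff_false, false_iff, not_le]
      have : (j : ℝ) + (a / 2 : ℕ) + 2 ≤ k := by exact_mod_cast (by omega : j + a / 2 + 2 ≤ k)
      simp only [Int.cast_sub, Int.cast_natCast, Int.cast_one]
      linarith
    · omega
    · have : (j : ℝ) + (a / 2 : ℕ) + 1 = k := by exact_mod_cast (by omega : j + a / 2 + 1 = k)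
      simp only [Int.cast_sub, Int.cast_natCast, Int.cast_one]
      rw [mem_Icc]
      constructor
      · rintro ⟨e1, -⟩; linarith
      · intro e1; exact ⟨by linarith, v1⟩
    · omega
    · have : (k : ℝ) ≤ (j : ℝ) + (a / 2 : ℕ) := by exact_mod_cast (by omega : k ≤ j + a / 2)
      simp only [Int.cast_sub, Int.cast_natCast, Int.cast_one]
      refine ⟨fun _ => by linarith, fun _ => ⟨v0, v1⟩⟩
    · refine ⟨fun _ => by positivity, fun _ => ⟨v0, v1⟩⟩
  · have hj' : (k : ℝ) ≤ j := by exact_mod_cast h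
    have hlow : startPar k a ≤ (j : ℝ) + v := by linarith [hs.2.2]
    rw [mem_Icc, and_iff_right hlow]
    rcases lt_or_ge j (k + w.length) with h' | h'
    · obtain ⟨t, rfl⟩ : ∃ t : ℕ, j = k + t := ⟨j - k, by omega⟩
      rw [Nat.cast_add, letterAt_cross (by omega : t < w.length)]
      have : ((k + t : ℕ) : ℝ) + 1 ≤ ((k + w.length : ℕ) : ℝ) := by exact_mod_cast h'
      refine ⟨fun _ => ?_, fun _ => ⟨v0, v1⟩⟩
      push_cast at *
      linarith [ht.2.1]
    · rw [letterAt_death (by omega) (by omega), posAt_of_ge (by omega)]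
      simp only [lifetime, birthLifetime, Set.mem_ofPred_eq]
      unfold stopPar stopAt
      set b := braidPerm w a
      split_ifs with h1 h2 h3 h4 h5
      · simp only [mem_empty_iff_false, false_iff, not_le]
        have : (k : ℝ) + w.length + (b / 2 : ℕ) + 1 ≤ j := by
          exact_mod_cast (by omega : k + w.length + b / 2 + 1 ≤ j)
        simp only [Int.cast_add, Int.cast_natCast, Int.cast_one]
        linarith
      · omega
      · have : (k : ℝ) + w.length + (b / 2 : ℕ) = j := by
          exact_mod_cast (by omega : k + w.length + b / 2 = j)
        simp only [Int.cast_add, Int.cast_natCast, Int.cast_one]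
        rw [mem_Icc]
        constructor
        · rintro ⟨e1, -⟩; linarith
        · intro e1; exact ⟨by linarith, by linarith⟩
      · omega
      · have : (j : ℝ) + 1 ≤ (k : ℝ) + w.length + (b / 2 : ℕ) := by
          exact_mod_cast (by omega : j + 1 ≤ k + w.length + b / 2)
        simp only [Int.cast_add, Int.cast_natCast, Int.cast_one]
        refine ⟨fun _ => by linarith, fun _ => ⟨by linarith, by linarith⟩⟩
      · have : (j : ℝ) + 1 ≤ sectorCount := by exact_mod_cast hj
        refine ⟨fun _ => by linarith, fun _ => ⟨by linarith, by linarith⟩⟩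

/-- A strand is composed of its parts in the sectors. -/
theorem strandCurve_eq_letterCurve (hw : ∀ g ∈ w, g.1 + 2 ≤ N) {a : ℕ} (ha : a < N) {j : ℕ} {v : ℝ}
    (hv : v ∈ Icc (0 : ℝ) 1)
    (hz : (j : ℝ) + v ∈ Icc (startPar k a) (stopPar k w (braidPerm w a))) :
    strandCurve N k w a (j + v) = (j + (letterCurve N (letterAt N k w j) (posAt k w a j) v).1,
      (letterCurve N (letterAt N k w j) (posAt k w a j) v).2) := by
  rcases lt_or_eq_of_le hv.2 with h | rfl
  · have : ⌊(j : ℝ) + v⌋ = j := by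
      rw [Int.floor_eq_iff]
      push_cast
      exact ⟨by linarith [hv.1], by linarith⟩
    unfold strandCurve segCurve
    rw [this, Int.cast_natCast, add_sub_cancel_left]
  · have e : ⌊(j : ℝ) + 1⌋ = (j : ℤ) + 1 := by
      rw [Int.floor_eq_iff]
      push_cast
      exact ⟨le_rfl, by linarith⟩
    have s1 : startAt k a < (j : ℤ) + 1 := by
      have := lt_of_lt_of_le (startPar_bounds a).1 hz.1
      exact_mod_cast this
    have s2 : (j : ℤ) + 1 < stopAt k w (braidPerm w a) := by
      have := lt_of_le_of_lt hz.2 (stopPar_bounds _).1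
      exact_mod_cast this
    have h1 : strandCurve N k w a ((j : ℝ) + 1) = segCurve N k w a j ((j : ℝ) + 1) := by
      unfold strandCurve
      rw [e, segCurve_entry hw ha s1 (by push_cast; linarith),
        segCurve_exit s2 (by push_cast; linarith)]
    rw [h1]
    unfold segCurve
    rw [Int.cast_natCast, add_sub_cancel_left]

theorem exists_letterCurve (hne : w ≠ []) {a : ℕ} {z : ℝ}
    (hz : z ∈ Icc (startPar k a) (stopPar k w (braidPerm w a))) :
    ∃ j < w.length + 2 * k, ∃ v ∈ Icc (0 : ℝ) 1, z = (j : ℝ) + v := by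
  have hl := List.length_pos_of_ne_nil hne
  have h0 : 0 ≤ z := (startPar_bounds a).2.1.trans hz.1
  have h1 : z ≤ sectorCount := hz.2.trans (stopPar_bounds _).2.2
  rcases lt_or_eq_of_le h1 with h | h
  · refine ⟨⌊z⌋₊, (Nat.floor_lt h0).2 h, z - ⌊z⌋₊, ⟨?_, ?_⟩, by ring⟩
    · linarith [Nat.floor_le h0]
    · linarith [Nat.lt_floor_add_one z]
  · refine ⟨w.length + 2 * k - 1, by omega, 1, ⟨zero_le_one, le_rfl⟩, ?_⟩
    rw [h, ← Nat.cast_add_one, Nat.sub_add_cancel (by omega)]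

theorem length_platLetters : (platLetters k w).length = w.length + 2 * k := by
  simp only [platLetters, List.length_append, List.length_map, List.length_reverse, List.length_range]
  ring

theorem platLetters_get (j : Fin (platLetters k w).length) :
    (platLetters k w).get j = letterAt N k w (j : ℕ) := by
  obtain ⟨j, hj⟩ := j
  have hj' := hj
  rw [length_platLetters] at hj'
  simp only [List.get_eq_getElem, platLetters]
  rcases lt_or_ge j k with h | h
  · rw [List.getElem_append_left (by simp; omega), List.getElem_append_left (by simpa using h),
      letterAt_birth (by omega) (by omega)]
    simp
  · rcases lt_or_ge j (k + w.length) with h' | h'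
    · rw [List.getElem_append_left (by simp; omega), List.getElem_append_right (by simpa using h)]
      obtain ⟨t, rfl⟩ : ∃ t : ℕ, j = k + t := ⟨j - k, by omega⟩
      rw [Nat.cast_add, letterAt_cross (by omega : t < w.length)]
      simp
    · rw [List.getElem_append_right (by simp; omega), letterAt_death (by omega) (by omega)]
      simp
      omega

theorem letterAt_valid (hk : 2 * k ≤ N) (hw : ∀ g ∈ w, g.1 + 2 ≤ N) {j : ℕ}
    (hj : j < w.length + 2 * k) : (letterAt N k w j).Valid N := by
  rcases lt_or_ge j k with h | h
  · rw [letterAt_birth (by omega) (by omega)]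
    simp only [PlatLetter.Valid]
    omega
  · rcases lt_or_ge j (k + w.length) with h' | h'
    · obtain ⟨t, rfl⟩ : ∃ t : ℕ, j = k + t := ⟨j - k, by omega⟩
      rw [Nat.cast_add, letterAt_cross (by omega : t < w.length)]
      exact hw _ (List.getElem_mem _)
    · rw [letterAt_death (by omega) (by omega)]
      simp only [PlatLetter.Valid]
      omega

end

section

/-! ## Composing the strands -/

variable {N k : ℕ} {w : List (ℕ × Bool)}

local notation "sectorCount" => ((w.length + 2 * k : ℕ) : ℝ)

theorem strandCurve_floor (a : ℕ) (j : ℤ) {v : ℝ} (h0 : 0 ≤ v) (h1 : v < 1) :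
    strandCurve N k w a (j + v) = (j + (letterCurve N (letterAt N k w j) (posAt k w a j) v).1,
      (letterCurve N (letterAt N k w j) (posAt k w a j) v).2) := by
  have : ⌊(j : ℝ) + v⌋ = j := by
    rw [Int.floor_eq_iff]
    exact ⟨by linarith, by linarith⟩
  unfold strandCurve segCurve
  rw [this, add_sub_cancel_left]

theorem startAt_mate {a : ℕ} : startAt k (mate a) = startAt k a := by
  unfold startAt
  simp only [mate_lt, mate_div]

theorem startPar_mate {a : ℕ} : startPar k (mate a) = startPar k a := by
  unfold startPar
  simp only [mate_lt, startAt_mate]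

theorem stopAt_mate {b : ℕ} : stopAt k w (mate b) = stopAt k w b := by
  unfold stopAt
  simp only [mate_lt, mate_div]

theorem stopPar_mate {b : ℕ} : stopPar k w (mate b) = stopPar k w b := by
  unfold stopPar
  simp only [mate_lt, stopAt_mate]

theorem strandCurve_birth {a : ℕ} (ha : a < 2 * k) {ε : ℝ} (h : |ε| ≤ 1 / 16) :
    strandCurve N k w a (startPar k a + ε) = (startAt k a + (birthCurve N (a / 2) a (1 / 4 + ε)).1,
        (birthCurve N (a / 2) a (1 / 4 + ε)).2) := by
  rw [abs_le] at h
  have e : startPar k a = (startAt k a : ℤ) + 1 / 4 := by unfold startPar; rw [if_pos ha]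
  have hs : startAt k a = k - 1 - (a / 2 : ℕ) := by unfold startAt; rw [if_pos ha]
  rw [e, add_assoc, strandCurve_floor _ _ (by linarith) (by linarith),
    letterAt_birth (by omega) (by omega), posAt_of_le (by omega)]
  have : (k - 1 - startAt k a).toNat = a / 2 := by omega
  rw [this]
  rfl

theorem strandCurve_death {a : ℕ} (ha : braidPerm w a < 2 * k) {ε : ℝ} (h : |ε| ≤ 1 / 16) :
    strandCurve N k w a (stopPar k w (braidPerm w a) + ε) = ((stopAt k w (braidPerm w a) : ℤ) - 1 +
        (1 - (birthCurve N (braidPerm w a / 2) (braidPerm w a) (1 / 4 - ε)).1),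
        (birthCurve N (braidPerm w a / 2) (braidPerm w a) (1 / 4 - ε)).2) := by
  rw [abs_le] at h
  set b := braidPerm w a with hb
  have e : stopPar k w b = ((stopAt k w b - 1 : ℤ) : ℝ) + 3 / 4 := by
    unfold stopPar; rw [if_pos ha]; push_cast; ring
  have hs : stopAt k w b = k + w.length + (b / 2 : ℕ) + 1 := by unfold stopAt; rw [if_pos ha]
  rw [e, add_assoc, strandCurve_floor _ _ (by linarith) (by linarith),
    letterAt_death (by omega) (by omega), posAt_of_ge (by omega)]
  have : (stopAt k w b - 1 - k - w.length).toNat = b / 2 := by omega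
  rw [this, ← hb]
  simp only [letterCurve]
  rw [show 1 - (3 / 4 + ε) = 1 / 4 - ε by ring]
  push_cast
  rfl

theorem strandCurve_first (hw : ∀ g ∈ w, g.1 + 2 ≤ N) {a : ℕ} (haN : a < N) (ha : ¬ a < 2 * k)
    {ε : ℝ} (h : |ε| ≤ 1 / 16) : strandCurve N k w a ε = (ε, stdPt N a) := by
  rw [abs_le] at h
  have hs : startAt k a = -1 := by unfold startAt; rw [if_neg ha]
  unfold strandCurve
  rcases lt_or_ge ε 0 with h' | h'
  · have : ⌊ε⌋ = -1 := by
      rw [Int.floor_eq_iff]; push_cast; exact ⟨by linarith, by linarith⟩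
    rw [this, segCurve_exit _ (by push_cast; linarith), posAt_of_le (by omega)]
    unfold stopAt
    split_ifs <;> omega
  · have : ⌊ε⌋ = 0 := by
      rw [Int.floor_eq_iff]; push_cast; exact ⟨by linarith, by linarith⟩
    rw [this, segCurve_entry hw haN (by omega) (by push_cast; linarith), posAt_of_le (by omega)]

theorem strandCurve_last (hw : ∀ g ∈ w, g.1 + 2 ≤ N) {a : ℕ} (haN : a < N)
    (ha : ¬ braidPerm w a < 2 * k) {ε : ℝ} (h : |ε| ≤ 1 / 16) :
    strandCurve N k w a (sectorCount + ε) = (sectorCount + ε, stdPt N (braidPerm w a)) := by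
  rw [abs_le] at h
  have hs : stopAt k w (braidPerm w a) = w.length + 2 * k + 1 := by unfold stopAt; rw [if_neg ha]
  unfold strandCurve
  rcases lt_or_ge ε 0 with h' | h'
  · have : ⌊sectorCount + ε⌋ = (w.length + 2 * k : ℕ) - 1 := by
      rw [Int.floor_eq_iff]; push_cast; exact ⟨by linarith, by linarith⟩
    rw [this, segCurve_exit (by rw [hs]; push_cast; omega) (by push_cast; linarith),
      posAt_of_ge (by push_cast; omega)]
  · have : ⌊sectorCount + ε⌋ = (w.length + 2 * k : ℕ) := by
      rw [Int.floor_eq_iff]; push_cast; exact ⟨by linarith, by linarith⟩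
    have hst : startAt k a < (w.length + 2 * k : ℕ) := by
      unfold startAt
      split_ifs <;> omega
    rw [this, segCurve_entry hw haN hst (by push_cast; linarith),
      posAt_of_ge (by push_cast; omega)]

variable (N k w) in
/-- The parameter on its strand of a point running through the strand in the direction given by the
state `x`. -/
def statePar (x : ℕ × Bool × ℤ) (u : ℝ) : ℝ :=
  startPar k x.1 + stretch (strandLength k w x.1) (if x.2.1 then u else 1 - u)

variable (N k w) in
/-- The curve, in cylindrical coordinates, of the strand and the direction given by a state. -/
def stateCurve (x : ℕ × Bool × ℤ) (u : ℝ) : ℝ × ℝ × ℝ :=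
  (2 * Real.pi * (x.2.2 + (strandCurve N k w x.1 (statePar k w x u)).1 /
    ((w.length + 2 * k : ℕ) : ℝ)), (strandCurve N k w x.1 (statePar k w x u)).2)

variable (N k w) in
/-- The whole curve, with one unit of time for each strand. -/
def travCurve (s : ℝ) : ℝ × ℝ × ℝ :=
  stateCurve N k w (trav k (braidPerm w) ⌊s⌋) (s - ⌊s⌋)

/-- The parameter of the end of a strand which is reached in the given direction. -/
def endPar (k : ℕ) (w : List (ℕ × Bool)) (a : ℕ) (o : Bool) : ℝ :=
  if o then stopPar k w (braidPerm w a) else startPar k a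

theorem statePar_one_add (x : ℕ × Bool × ℤ) {ε : ℝ} (h : |ε| ≤ 1 / 16) :
    statePar k w x (1 + ε) = endPar k w x.1 x.2.1 + (if x.2.1 then ε else -ε) := by
  rw [abs_le] at h
  obtain ⟨a, o, L⟩ := x
  unfold statePar endPar
  cases o
  · simp only [Bool.false_eq_true, if_false]
    rw [stretch_of_le _ (by linarith)]
    ring
  · simp only [if_true]
    rw [stretch_of_ge _ (by linarith), strandLength]
    ring

theorem statePar_of_small (x : ℕ × Bool × ℤ) {ε : ℝ} (h : |ε| ≤ 1 / 16) :
    statePar k w x ε = endPar k w x.1 (!x.2.1) + (if x.2.1 then ε else -ε) := by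
  rw [abs_le] at h
  obtain ⟨a, o, L⟩ := x
  unfold statePar endPar
  cases o
  · simp only [Bool.false_eq_true, if_false, Bool.not_false, if_true]
    rw [stretch_of_ge _ (by linarith), strandLength]
    ring
  · simp only [Bool.not_true, if_true, Bool.false_eq_true, if_false]
    rw [stretch_of_le _ (by linarith)]

theorem stateCurve_step (hw : ∀ g ∈ w, g.1 + 2 ≤ N) (hne : w ≠ []) {x : ℕ × Bool × ℤ}
    (hx : x.1 < N) {ε : ℝ} (h : |ε| ≤ 1 / 16) :
    stateCurve N k w x (1 + ε) = stateCurve N k w (stepFun k (braidPerm w) x) ε := by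
  have hM : sectorCount ≠ 0 := by
    have := List.length_pos_of_ne_nil hne
    exact_mod_cast (by omega : w.length + 2 * k ≠ 0)
  have h' : |-ε| ≤ 1 / 16 := by rwa [abs_neg]
  have hp := fun a => braidPerm_lt (N := N) hw a
  unfold stateCurve
  rw [statePar_one_add x h, statePar_of_small _ h]
  obtain ⟨a, o, L⟩ := x
  simp only at hx
  cases o
  · by_cases hb : a < 2 * k
    · have e : stepFun k (braidPerm w) (a, false, L) = (mate a, true, L) := by simp [stepFun, hb]
      rw [e]
      simp only [endPar, Bool.false_eq_true, if_false, if_true, Bool.not_true]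
      rw [strandCurve_birth hb h', strandCurve_birth (mate_lt.2 hb) h, startAt_mate, mate_div]
      have := birthCurve_mate N a (1 / 4 + -ε)
      rw [show 1 / 2 - (1 / 4 + -ε) = 1 / 4 + ε by ring] at this
      rw [this]
    · have e : stepFun k (braidPerm w) (a, false, L) = ((braidPerm w).symm a, false, L - 1) := by
        simp [stepFun, hb]
      rw [e]
      have hb' : (braidPerm w).symm a < N := by rw [← hp, Equiv.apply_symm_apply]; exact hx
      have e1 : startPar k a = 0 := by unfold startPar; rw [if_neg hb]
      have hb2 : ¬ braidPerm w ((braidPerm w).symm a) < 2 * k := by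
        rwa [Equiv.apply_symm_apply]
      have e2 : stopPar k w (braidPerm w ((braidPerm w).symm a)) = sectorCount := by
        unfold stopPar; rw [if_neg hb2]
      simp only [endPar, Bool.false_eq_true, if_false, if_true, Bool.not_false]
      rw [e1, zero_add, strandCurve_first hw hx hb h', e2, strandCurve_last hw hb' hb2 h',
        Equiv.apply_symm_apply]
      push_cast at hM ⊢
      rw [Prod.mk.injEq]
      refine ⟨?_, rfl⟩
      field_simp
      ring
  · by_cases hb : braidPerm w a < 2 * k
    · have e : stepFun k (braidPerm w) (a, true, L) =
          ((braidPerm w).symm (mate (braidPerm w a)), false, L) := by simp [stepFun, hb]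
      rw [e]
      have hb2 : braidPerm w ((braidPerm w).symm (mate (braidPerm w a))) < 2 * k := by
        rw [Equiv.apply_symm_apply]; exact mate_lt.2 hb
      simp only [endPar, Bool.false_eq_true, if_false, if_true, Bool.not_false]
      rw [strandCurve_death hb h, strandCurve_death hb2 h', Equiv.apply_symm_apply, stopAt_mate,
        mate_div]
      have := birthCurve_mate N (braidPerm w a) (1 / 4 - ε)
      rw [show 1 / 2 - (1 / 4 - ε) = 1 / 4 - -ε by ring] at this
      rw [this]
    · have e : stepFun k (braidPerm w) (a, true, L) = (braidPerm w a, true, L + 1) := by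
        simp [stepFun, hb]
      rw [e]
      have e1 : startPar k (braidPerm w a) = 0 := by unfold startPar; rw [if_neg hb]
      have e2 : stopPar k w (braidPerm w a) = sectorCount := by
        unfold stopPar; rw [if_neg hb]
      simp only [endPar, Bool.false_eq_true, if_false, if_true, Bool.not_true]
      rw [e1, zero_add, strandCurve_first hw ((hp a).2 hx) hb h, e2, strandCurve_last hw hx hb h]
      push_cast at hM ⊢
      rw [Prod.mk.injEq]
      refine ⟨?_, rfl⟩
      field_simp
      ring

theorem statePar_mem (hne : w ≠ []) (x : ℕ × Bool × ℤ) {u : ℝ} (hu : u ∈ Icc (0 : ℝ) 1) :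
    statePar k w x u ∈ Icc (startPar k x.1) (stopPar k w (braidPerm w x.1)) := by
  have hT := one_le_strandLength (k := k) hne x.1
  have hm := (stretch_strictMono hT).monotone
  have key : ∀ v ∈ Icc (0 : ℝ) 1, 0 ≤ stretch (strandLength k w x.1) v ∧
      stretch (strandLength k w x.1) v ≤ strandLength k w x.1 := by
    intro v hv
    have h0 := hm hv.1
    have h1 := hm hv.2
    rw [stretch_zero] at h0
    rw [stretch_one] at h1
    exact ⟨h0, h1⟩
  have := key (if x.2.1 then u else 1 - u) (by
    split_ifs
    · exact hu
    · exact ⟨by linarith [hu.2], by linarith [hu.1]⟩)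
  unfold statePar
  have e : strandLength k w x.1 = stopPar k w (braidPerm w x.1) - startPar k x.1 := rfl
  rw [e] at this ⊢
  constructor <;> linarith [this.1, this.2]

theorem exists_statePar {x : ℕ × Bool × ℤ} {z : ℝ}
    (hz : z ∈ Icc (startPar k x.1) (stopPar k w (braidPerm w x.1))) :
    ∃ u ∈ Icc (0 : ℝ) 1, statePar k w x u = z := by
  obtain ⟨u, hu, e⟩ := exists_stretch_eq (T := strandLength k w x.1) (z := z - startPar k x.1)
    ⟨by linarith [hz.1], by unfold strandLength; linarith [hz.2]⟩
  refine ⟨if x.2.1 then u else 1 - u, ?_, ?_⟩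
  · split_ifs
    · exact hu
    · exact ⟨by linarith [hu.2], by linarith [hu.1]⟩
  · unfold statePar
    rw [show (if x.2.1 = true then (if x.2.1 = true then u else 1 - u) else
      1 - (if x.2.1 = true then u else 1 - u)) = u by split_ifs <;> ring, e]
    ring

theorem statePar_injective (hne : w ≠ []) (x : ℕ × Bool × ℤ) :
    Function.Injective (statePar k w x) := by
  intro u v h
  unfold statePar at h
  have h2 := (stretch_strictMono (one_le_strandLength (k := k) hne x.1)).injective
    (add_left_cancel h)
  split_ifs at h2 <;> linarith

theorem hasDerivAt_statePar (hne : w ≠ []) (x : ℕ × Bool × ℤ) (u : ℝ) :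
    ∃ c : ℝ, 0 < c ∧ HasDerivAt (statePar k w x) (if x.2.1 then c else -c) u := by
  have hT := one_le_strandLength (k := k) hne x.1
  refine ⟨_, deriv_stretch_pos hT (if x.2.1 then u else 1 - u), ?_⟩
  have hd := ((contDiff_stretch (strandLength k w x.1)).differentiable (by simp)
    (if x.2.1 then u else 1 - u)).hasDerivAt
  unfold statePar
  split_ifs at hd ⊢
  · exact hd.const_add _
  · exact ((hd.scomp u ((hasDerivAt_id u).const_sub 1)).const_add _).congr_deriv (by simp)

theorem contDiff_statePar (x : ℕ × Bool × ℤ) : ContDiff ℝ ∞ (statePar k w x) := by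
  have := contDiff_stretch (strandLength k w x.1)
  unfold statePar
  split_ifs
  · fun_prop
  · fun_prop

theorem mem_interior_of_mem {a : ℕ} {z : ℝ}
    (hz : z ∈ Icc (startPar k a) (stopPar k w (braidPerm w a))) :
    (startAt k a : ℝ) < z ∧ z < stopAt k w (braidPerm w a) :=
  ⟨(startPar_bounds a).1.trans_le hz.1, hz.2.trans_lt (stopPar_bounds _).1⟩

theorem contDiffAt_stateCurve (hw : ∀ g ∈ w, g.1 + 2 ≤ N) (hne : w ≠ []) {x : ℕ × Bool × ℤ}
    (hx : x.1 < N) {u : ℝ} (hu : u ∈ Icc (0 : ℝ) 1) : ContDiffAt ℝ ∞ (stateCurve N k w x) u := by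
  have hz := mem_interior_of_mem (statePar_mem (k := k) hne x hu)
  have h := (contDiffAt_strandCurve hw hx hz.1 hz.2).comp u (contDiff_statePar x).contDiffAt
  unfold stateCurve
  exact (contDiffAt_const.mul (contDiffAt_const.add (h.fst.div_const _))).prodMk h.snd

/-- A plat diagram of a knot. -/
structure IsKnotDiagram (N k : ℕ) (w : List (ℕ × Bool)) : Prop where
  plat_le : 2 * k ≤ N
  word_le : ∀ g ∈ w, g.1 + 2 ≤ N
  ne_nil : w ≠ []
  connected : IsKnotPlat N k w

namespace IsKnotDiagram

variable (h : IsKnotDiagram N k w)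
include h

theorem two_le : 2 ≤ N := by
  obtain ⟨g, hg⟩ := List.exists_mem_of_ne_nil w h.ne_nil
  have := h.word_le g hg
  omega

theorem perm_lt (a : ℕ) : braidPerm w a < N ↔ a < N := braidPerm_lt h.word_le a

theorem trav_lt (i : ℤ) : (trav k (braidPerm w) i).1 < N :=
  PlatTrace.trav_lt h.perm_lt h.plat_le (by have := h.two_le; omega) i

theorem visited {a : ℕ} (ha : a < N) : ∃ i, (trav k (braidPerm w) i).1 = a :=
  PlatTrace.visited (by have := h.two_le; omega) h.connected ha

theorem period : ∃ d, trav k (braidPerm w) N = (0, true, d) :=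
  (trav_period h.perm_lt h.plat_le (by have := h.two_le; omega) fun _ ha => h.visited ha).1

theorem dvd_of_eq {i j : ℤ} (e : (trav k (braidPerm w) i).1 = (trav k (braidPerm w) j).1) :
    (N : ℤ) ∣ j - i :=
  (trav_period h.perm_lt h.plat_le (by have := h.two_le; omega) fun _ ha => h.visited ha).2 i j e

theorem length_pos : (0 : ℝ) < sectorCount := by
  have := List.length_pos_of_ne_nil h.ne_nil
  exact_mod_cast (by omega : 0 < w.length + 2 * k)

theorem travCurve_eventuallyEq (s : ℝ) : travCurve N k w =ᶠ[𝓝 s]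
    fun s' => stateCurve N k w (trav k (braidPerm w) ⌊s⌋) (s' - ⌊s⌋) := by
  apply concat_eventuallyEq (f := fun j s' => stateCurve N k w (trav k (braidPerm w) j) (s' - j))
  intro hs
  filter_upwards [lt_mem_nhds (show s - 1 / 16 < s by linarith),
    gt_mem_nhds (show s < s + 1 / 16 by linarith)] with s' s1 s2
  have e := stateCurve_step (k := k) h.word_le h.ne_nil (h.trav_lt (⌊s⌋ - 1)) (ε := s' - ⌊s⌋)
    (by rw [abs_le]; constructor <;> linarith)
  rw [← trav_succ, sub_add_cancel] at e
  rw [← e]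
  congr 1
  push_cast
  ring

theorem travCurve_add {i : ℤ} {u : ℝ} (hu : u ∈ Icc (0 : ℝ) 1) :
    travCurve N k w (i + u) = stateCurve N k w (trav k (braidPerm w) i) u := by
  unfold travCurve
  rcases lt_or_eq_of_le hu.2 with h1 | rfl
  · have : ⌊(i : ℝ) + u⌋ = i := by
      rw [Int.floor_eq_iff]
      exact ⟨by linarith [hu.1], by linarith⟩
    rw [this, add_sub_cancel_left]
  · have : ⌊(i : ℝ) + 1⌋ = i + 1 := by
      rw [Int.floor_eq_iff]
      push_cast
      exact ⟨by linarith, by linarith⟩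
    have e := stateCurve_step (k := k) h.word_le h.ne_nil (h.trav_lt i) (ε := 0) (by norm_num)
    rw [add_zero, ← trav_succ] at e
    rw [this, e]
    congr 1
    push_cast
    ring

theorem contDiff_travCurve : ContDiff ℝ ∞ (travCurve N k w) := by
  rw [contDiff_iff_contDiffAt]
  intro s
  refine ContDiffAt.congr_of_eventuallyEq ?_ (h.travCurve_eventuallyEq s)
  have hu : s - ⌊s⌋ ∈ Icc (0 : ℝ) 1 :=
    ⟨by linarith [Int.floor_le s], by linarith [Int.lt_floor_add_one s]⟩
  exact (contDiffAt_stateCurve h.word_le h.ne_nil (h.trav_lt ⌊s⌋) hu).comp s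
    (contDiff_id.sub contDiff_const).contDiffAt

/-- The linking number of the knot with the axis. -/
def linking (_h : IsKnotDiagram N k w) : ℤ := (trav k (braidPerm w) N).2.2

theorem trav_add_period (i : ℤ) :
    trav k (braidPerm w) (i + N) = addLevel h.linking (trav k (braidPerm w) i) := by
  obtain ⟨d, hd⟩ := h.period
  have : h.linking = d := by unfold linking; rw [hd]
  rw [this, trav_add_of_eq hd]

theorem travCurve_period (s : ℝ) : travCurve N k w (s + N) =
    ((travCurve N k w s).1 + 2 * Real.pi * h.linking, (travCurve N k w s).2) := by
  unfold travCurve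
  have e : ⌊s + (N : ℝ)⌋ = ⌊s⌋ + N := Int.floor_add_natCast s N
  rw [e, h.trav_add_period]
  have e2 : s + (N : ℝ) - ((⌊s⌋ + N : ℤ) : ℝ) = s - ⌊s⌋ := by push_cast; ring
  rw [e2]
  unfold stateCurve addLevel statePar
  simp only
  rw [Prod.mk.injEq]
  refine ⟨?_, rfl⟩
  push_cast
  ring

/-- The derivatives of the curve in terms of those of its strand. -/
theorem hasDerivAt_travCurve (s : ℝ) :
    ∃ c : ℝ, 0 < c ∧
      (let x := trav k (braidPerm w) ⌊s⌋
       let z := statePar k w x (s - ⌊s⌋)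
       let e : ℝ := if x.2.1 then c else -c
       HasDerivAt (fun s => (travCurve N k w s).1)
        (e * (2 * Real.pi / sectorCount * deriv (fun z => (strandCurve N k w x.1 z).1) z)) s ∧
       HasDerivAt (fun s => (travCurve N k w s).2.1)
        (e * deriv (fun z => (strandCurve N k w x.1 z).2.1) z) s ∧
       HasDerivAt (fun s => (travCurve N k w s).2.2)
        (e * deriv (fun z => (strandCurve N k w x.1 z).2.2) z) s) := by
  set x := trav k (braidPerm w) ⌊s⌋ with hx
  have hu : s - ⌊s⌋ ∈ Icc (0 : ℝ) 1 :=
    ⟨by linarith [Int.floor_le s], by linarith [Int.lt_floor_add_one s]⟩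
  have hz := mem_interior_of_mem (statePar_mem (k := k) h.ne_nil x hu)
  obtain ⟨c, hc, hd⟩ := hasDerivAt_statePar (k := k) h.ne_nil x (s - ⌊s⌋)
  have hd' : HasDerivAt (fun s' => statePar k w x (s' - ⌊s⌋)) (if x.2.1 then c else -c) s := by
    have := hd.comp s ((hasDerivAt_id s).sub_const (⌊s⌋ : ℝ))
    exact this.congr_deriv (mul_one _)
  have hs := contDiffAt_strandCurve h.word_le (h.trav_lt ⌊s⌋) hz.1 hz.2
  have ev := h.travCurve_eventuallyEq s
  have d0 := (hs.fst.differentiableAt (by simp)).hasDerivAt.comp s hd'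
  have d1 := (hs.snd.fst.differentiableAt (by simp)).hasDerivAt.comp s hd'
  have d2 := (hs.snd.snd.differentiableAt (by simp)).hasDerivAt.comp s hd'
  refine ⟨c, hc, ?_, ?_, ?_⟩
  · have e1 : (fun s => (travCurve N k w s).1) =ᶠ[𝓝 s] fun s' => 2 * Real.pi * (x.2.2 +
        (strandCurve N k w x.1 (statePar k w x (s' - ⌊s⌋))).1 / sectorCount) := by
      filter_upwards [ev] with s' hs' using by rw [hs']; rfl
    refine HasDerivAt.congr_of_eventuallyEq ?_ e1
    refine (((d0.div_const _).const_add _).const_mul (2 * Real.pi)).congr_deriv ?_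
    simp only [hx]
    ring
  · have e1 : (fun s => (travCurve N k w s).2.1) =ᶠ[𝓝 s] fun s' =>
        (strandCurve N k w x.1 (statePar k w x (s' - ⌊s⌋))).2.1 := by
      filter_upwards [ev] with s' hs' using by rw [hs']; rfl
    refine HasDerivAt.congr_of_eventuallyEq ?_ e1
    exact d1.congr_deriv (mul_comm _ _)
  · have e1 : (fun s => (travCurve N k w s).2.2) =ᶠ[𝓝 s] fun s' =>
        (strandCurve N k w x.1 (statePar k w x (s' - ⌊s⌋))).2.2 := by
      filter_upwards [ev] with s' hs' using by rw [hs']; rfl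
    refine HasDerivAt.congr_of_eventuallyEq ?_ e1
    exact d2.congr_deriv (mul_comm _ _)

end IsKnotDiagram

end

section

variable {N k : ℕ} {w : List (ℕ × Bool)}

local notation "sectorCount" => ((w.length + 2 * k : ℕ) : ℝ)

/-! ## Coincidences of points of the strands -/

theorem stdPt_injective (N : ℕ) : Function.Injective (stdPt N) := by
  intro a b h
  have := (Prod.mk.inj h).1
  exact_mod_cast add_right_cancel this

theorem abs_oddStep_le (u : ℝ) : |oddStep u| ≤ 1 := by
  rw [abs_le]
  have := oddStep_le_one (-u)
  rw [oddStep_neg] at this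
  exact ⟨by linarith, oddStep_le_one u⟩

theorem birthCurve_range {c b : ℕ} {v : ℝ} (hv : v ∈ birthLifetime c b) :
    v ∈ Icc (0 : ℝ) 1 ∧ (birthCurve N c b v).1 ∈ Icc (0 : ℝ) 1 ∧
      ((birthCurve N c b v).1 = 0 → v = 0 ∧ (birthCurve N c b v).2 = stdPt N b) ∧
      ((birthCurve N c b v).1 = 1 → v = 1 ∧ (birthCurve N c b v).2 = stdPt N b) := by
  unfold birthLifetime at hv
  split_ifs at hv with h1 h2
  · exact absurd hv (notMem_empty v)
  · have hc : c = b / 2 := by omega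
    subst hc
    have u0 : 0 ≤ (v - 1 / 4) * (4 / 3) := by linarith [hv.1]
    have u1 : (v - 1 / 4) * (4 / 3) ≤ 1 := by linarith [hv.2]
    have e : (birthCurve N (b / 2) b v).1 = fold ((v - 1 / 4) * (4 / 3)) := by
      unfold birthCurve; rw [if_pos (by omega)]
    have hm := fold_mem_Icc u0 u1
    refine ⟨⟨by linarith [hv.1], hv.2⟩, ?_, ?_, ?_⟩
    · rw [e]; exact ⟨by linarith [hm.1], hm.2⟩
    · intro h; rw [e] at h; linarith [hm.1]
    · intro h
      rw [e] at h
      have := fold_strictMonoOn.injOn u0 (zero_le_one' ℝ) (h.trans fold_one.symm)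
      have hv1 : v = 1 := by linarith
      exact ⟨hv1, by rw [birthCurve_late (by rw [hv1]; norm_num)]⟩
  · rw [birthCurve_other v (by omega)]
    exact ⟨hv, hv, fun h => ⟨h, rfl⟩, fun h => ⟨h, rfl⟩⟩

theorem letterCurve_range {x : PlatLetter} {b : ℕ} {v : ℝ} (hv : v ∈ lifetime x b) :
    v ∈ Icc (0 : ℝ) 1 ∧ (letterCurve N x b v).1 ∈ Icc (0 : ℝ) 1 ∧
      ((letterCurve N x b v).1 = 0 → v = 0 ∧ (letterCurve N x b v).2 = stdPt N b) ∧
      ((letterCurve N x b v).1 = 1 →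
        v = 1 ∧ (letterCurve N x b v).2 = stdPt N (letterPerm x b)) := by
  cases x with
  | birth c => exact birthCurve_range hv
  | cross i s =>
    refine ⟨hv, hv, fun h => ⟨h, ?_⟩, fun h => ⟨h, ?_⟩⟩
    · exact crossCurve_of_le (by rw [show v = 0 from h]; norm_num) b
    · exact crossCurve_of_ge (by rw [show v = 1 from h]; norm_num) b
  | death c =>
    obtain ⟨h1, h2, h3, h4⟩ := birthCurve_range (N := N) (v := 1 - v) hv
    simp only [letterCurve]
    refine ⟨⟨by linarith [h1.2], by linarith [h1.1]⟩, ⟨by linarith [h2.2], by linarith [h2.1]⟩,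
      fun h => ?_, fun h => ?_⟩
    · obtain ⟨a1, a2⟩ := h4 (by linarith)
      exact ⟨by linarith, a2⟩
    · obtain ⟨a1, a2⟩ := h3 (by linarith)
      exact ⟨by linarith, a2⟩

theorem birthCurve_inj {c b b' : ℕ} {v v' : ℝ} (hv : v ∈ birthLifetime c b)
    (hv' : v' ∈ birthLifetime c b') (e : birthCurve N c b v = birthCurve N c b' v') :
    (b = b' ∧ v = v') ∨ (b' = mate b ∧ c = b / 2 ∧ v = 1 / 4 ∧ v' = 1 / 4) := by
  have mixed : ∀ d d' u u', c = d / 2 → 2 * c + 2 ≤ d' →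
      birthCurve N c d u ≠ birthCurve N c d' u' := by
    intro d d' u u' h1 h2 h3
    rw [birthCurve_other u' (by omega)] at h3
    unfold birthCurve at h3
    rw [if_pos (by omega)] at h3
    have h4 := congrArg (fun q : ℝ × ℝ × ℝ => q.2.1) h3
    have h5 : ((2 * c : ℕ) : ℝ) + 2 ≤ d' := by exact_mod_cast h2
    simp only [stdPt] at h4
    have hd : d = 2 * c ∨ d = 2 * c + 1 := by omega
    rcases hd with rfl | rfl
    · rw [(birthArc_eq N c _).1] at h4
      have := (movPt_bounds N (2 * c) (κ := 0) (by norm_num)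
        (abs_oddStep_le (-((u - 1 / 4) * (4 / 3))))).2.1
      linarith
    · rw [(birthArc_eq N c _).2] at h4
      have := (movPt_bounds N (2 * c) (κ := 0) (by norm_num)
        (abs_oddStep_le ((u - 1 / 4) * (4 / 3)))).2.1
      linarith
  have low : ∀ {d u}, u ∈ birthLifetime c d → ¬ d < 2 * c ∧ (d < 2 * c + 2 → 1 / 4 ≤ u) := by
    intro d u hu
    unfold birthLifetime at hu
    split_ifs at hu with h1 h2
    · exact absurd hu (notMem_empty u)
    · exact ⟨h1, fun _ => hu.1⟩
    · exact ⟨h1, fun h => absurd h h2⟩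
  obtain ⟨h1, h2⟩ := low hv
  obtain ⟨h1', h2'⟩ := low hv'
  rcases lt_or_ge b (2 * c + 2) with h3 | h3 <;> rcases lt_or_ge b' (2 * c + 2) with h3' | h3'
  · have e1 := congrArg Prod.fst e
    unfold birthCurve at e e1
    rw [if_pos (by omega), if_pos (by omega)] at e e1
    have u0 : 0 ≤ (v - 1 / 4) * (4 / 3) := by linarith [h2 h3]
    have u0' : 0 ≤ (v' - 1 / 4) * (4 / 3) := by linarith [h2' h3']
    have hu := fold_strictMonoOn.injOn u0 u0' e1
    have hvv : v = v' := by linarith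
    by_cases hb : b = b'
    · exact Or.inl ⟨hb, hvv⟩
    · right
      rw [← hu] at e
      have e2 := congrArg (fun q : ℝ × ℝ × ℝ => q.2.1) e
      simp only at e2
      have hz : oddStep ((v - 1 / 4) * (4 / 3)) = 0 := by
        have m1 := (birthArc_eq N c ((v - 1 / 4) * (4 / 3))).1
        have m2 := (birthArc_eq N c ((v - 1 / 4) * (4 / 3))).2
        rw [oddStep_neg] at m1
        have hd : (b = 2 * c ∧ b' = 2 * c + 1) ∨ (b = 2 * c + 1 ∧ b' = 2 * c) := by omega
        rcases hd with ⟨rfl, rfl⟩ | ⟨rfl, rfl⟩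
        · rw [m1, m2] at e2
          simp only [movPt] at e2
          linarith
        · rw [m1, m2] at e2
          simp only [movPt] at e2
          linarith
      have h0 : (v - 1 / 4) * (4 / 3) = 0 := by
        by_contra hn
        linarith [oddStep_pos (lt_of_le_of_ne u0 (Ne.symm hn))]
      refine ⟨?_, by omega, by linarith, by linarith⟩
      unfold mate
      split_ifs <;> omega
  · exact absurd e (mixed b b' v v' (by omega) (by omega))
  · exact absurd e.symm (mixed b' b v' v (by omega) (by omega))
  · left
    rw [birthCurve_other v (by omega), birthCurve_other v' (by omega), Prod.mk.injEq] at e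
    exact ⟨stdPt_injective N e.2, e.1⟩

theorem letterCurve_inj {x : PlatLetter} {b b' : ℕ} (hb : b < N) (hb' : b' < N) {v v' : ℝ}
    (hv : v ∈ lifetime x b) (hv' : v' ∈ lifetime x b')
    (e : letterCurve N x b v = letterCurve N x b' v') :
    (b = b' ∧ v = v') ∨ (b' = mate b ∧ ((x = .birth (b / 2) ∧ v = 1 / 4 ∧ v' = 1 / 4) ∨
      (x = .death (b / 2) ∧ v = 3 / 4 ∧ v' = 3 / 4))) := by
  cases x with
  | birth c =>
    rcases birthCurve_inj hv hv' e with h | ⟨h1, h2, h3, h4⟩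
    · exact Or.inl h
    · exact Or.inr ⟨h1, Or.inl ⟨by rw [h2], h3, h4⟩⟩
  | cross i s =>
    left
    have e1 : v = v' := congrArg Prod.fst e
    subst e1
    refine ⟨?_, rfl⟩
    by_contra hn
    exact crossCurve_ne hb hb' hn (congrArg Prod.snd e)
  | death c =>
    have e' : birthCurve N c b (1 - v) = birthCurve N c b' (1 - v') := by
      have e1 := congrArg Prod.fst e
      have e2 := congrArg Prod.snd e
      simp only [letterCurve] at e1 e2
      exact Prod.ext (by linarith) e2
    rcases birthCurve_inj hv hv' e' with h | ⟨h1, h2, h3, h4⟩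
    · exact Or.inl ⟨h.1, by linarith [h.2]⟩
    · exact Or.inr ⟨h1, Or.inr ⟨by rw [h2], by linarith, by linarith⟩⟩

theorem posAt_injective (k : ℕ) (w : List (ℕ × Bool)) (j : ℤ) :
    Function.Injective fun a => posAt k w a j := (braidPerm (w.take (j - k).toNat)).injective

namespace IsKnotDiagram

variable (h : IsKnotDiagram N k w)
include h

/-- Points of the strands are points of the elementary tangles. -/
theorem exists_letter {a : ℕ} (ha : a < N) {z : ℝ}
    (hz : z ∈ Icc (startPar k a) (stopPar k w (braidPerm w a))) :
    ∃ j < w.length + 2 * k, ∃ v ∈ lifetime (letterAt N k w j) (posAt k w a j), z = (j : ℝ) + v ∧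
      strandCurve N k w a z = (j + (letterCurve N (letterAt N k w j) (posAt k w a j) v).1,
        (letterCurve N (letterAt N k w j) (posAt k w a j) v).2) := by
  obtain ⟨j, hj, v, hv, rfl⟩ := exists_letterCurve h.ne_nil hz
  exact ⟨j, hj, v, (mem_lifetime_iff hj hv).2 hz, rfl, strandCurve_eq_letterCurve h.word_le ha hv hz⟩

theorem strandCurve_mem {a : ℕ} (ha : a < N) {z : ℝ}
    (hz : z ∈ Icc (startPar k a) (stopPar k w (braidPerm w a))) :
    (strandCurve N k w a z).1 ∈ Icc (0 : ℝ) sectorCount := by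
  obtain ⟨j, hj, v, hv, -, e⟩ := h.exists_letter ha hz
  rw [e]
  obtain ⟨-, h2, -⟩ := letterCurve_range (N := N) hv
  have hj' : (j : ℝ) + 1 ≤ sectorCount := by exact_mod_cast hj
  have h0 : (0 : ℝ) ≤ j := Nat.cast_nonneg j
  exact ⟨by linarith [h2.1], by linarith [h2.2]⟩

theorem strandCurve_int {a : ℕ} (ha : a < N) {z : ℝ}
    (hz : z ∈ Icc (startPar k a) (stopPar k w (braidPerm w a))) {n : ℤ}
    (hn : (strandCurve N k w a z).1 = n) :
    z = n ∧ (strandCurve N k w a z).2 = stdPt N (posAt k w a n) := by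
  obtain ⟨j, hj, v, hv, hzj, e⟩ := h.exists_letter ha hz
  obtain ⟨-, h2, h3, h4⟩ := letterCurve_range (N := N) hv
  rw [e] at hn ⊢
  simp only at hn ⊢
  have b1 : ((n - j : ℤ) : ℝ) = (letterCurve N (letterAt N k w j) (posAt k w a j) v).1 := by
    push_cast; linarith
  rw [← b1] at h2 h3 h4
  have c1 : (0 : ℤ) ≤ n - j := by exact_mod_cast h2.1
  have c2 : n - j ≤ (1 : ℤ) := by exact_mod_cast h2.2
  rcases (by omega : n = j ∨ n = j + 1) with rfl | rfl
  · obtain ⟨r1, r2⟩ := h3 (by simp)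
    exact ⟨by rw [hzj, r1]; simp, r2⟩
  · obtain ⟨r1, r2⟩ := h4 (by simp)
    refine ⟨by rw [hzj, r1]; simp, ?_⟩
    rw [r2, posAt_succ (N := N)]

/-- Different points of the strands are different points of space, except for the ends of
consecutive strands. -/
theorem strandCurve_coincide {a a' : ℕ} (ha : a < N) (ha' : a' < N) {z z' : ℝ}
    (hz : z ∈ Icc (startPar k a) (stopPar k w (braidPerm w a)))
    (hz' : z' ∈ Icc (startPar k a') (stopPar k w (braidPerm w a')))
    (hP : (strandCurve N k w a z).2 = (strandCurve N k w a' z').2) {m : ℤ}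
    (hY : (strandCurve N k w a z).1 - (strandCurve N k w a' z').1 = sectorCount * m) :
    (a = a' ∧ z = z') ∨ ∃ o, z = endPar k w a o ∧ a' = (stepFun k (braidPerm w) (a, o, 0)).1 ∧
      z' = endPar k w a' (!(stepFun k (braidPerm w) (a, o, 0)).2.1) := by
  have hM := h.length_pos
  have around : ∀ {a a' : ℕ}, a < N → a' < N → ∀ {z z' : ℝ},
      z ∈ Icc (startPar k a) (stopPar k w (braidPerm w a)) →
      z' ∈ Icc (startPar k a') (stopPar k w (braidPerm w a')) →
      (strandCurve N k w a z).2 = (strandCurve N k w a' z').2 →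
      (strandCurve N k w a z).1 = sectorCount → (strandCurve N k w a' z').1 = 0 →
      braidPerm w a = a' ∧ ¬ a' < 2 * k ∧ z = stopPar k w (braidPerm w a) ∧ z' = startPar k a' := by
    intro a a' ha ha' z z' hz hz' hP h1 h2
    obtain ⟨r1, r2⟩ := h.strandCurve_int ha hz (n := (w.length + 2 * k : ℕ)) (by rw [h1]; simp)
    obtain ⟨s1, s2⟩ := h.strandCurve_int ha' hz' (n := 0) (by rw [h2]; simp)
    have e : braidPerm w a = a' := by
      rw [r2, s2, posAt_of_ge (by push_cast; omega), posAt_of_le (by omega)] at hP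
      exact stdPt_injective N hP
    have hge : ¬ a' < 2 * k := by
      intro hlt
      have := hz'.1
      rw [s1] at this
      unfold startPar startAt at this
      rw [if_pos hlt, if_pos hlt] at this
      have h3 : ((a' / 2 : ℕ) : ℝ) + 1 ≤ k := by exact_mod_cast (by omega : a' / 2 + 1 ≤ k)
      simp only [Int.cast_sub, Int.cast_natCast, Int.cast_one, Int.cast_zero] at this
      linarith
    refine ⟨e, hge, ?_, ?_⟩
    · rw [r1]; unfold stopPar; rw [e, if_neg hge]; simp
    · rw [s1]; unfold startPar; rw [if_neg hge]; simp
  have m1 := h.strandCurve_mem ha hz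
  have m2 := h.strandCurve_mem ha' hz'
  have hm1 : m ≤ 1 := by
    by_contra hn
    have : (2 : ℝ) ≤ m := by exact_mod_cast (by omega : 2 ≤ m)
    nlinarith [m1.2, m2.1]
  have hm2 : -1 ≤ m := by
    by_contra hn
    have : (m : ℝ) ≤ -2 := by exact_mod_cast (by omega : m ≤ -2)
    nlinarith [m1.1, m2.2]
  rcases (by omega : m = 0 ∨ m = 1 ∨ m = -1) with rfl | rfl | rfl
  · simp only [Int.cast_zero, mul_zero, sub_eq_zero] at hY
    by_cases hint : ∃ n : ℤ, (strandCurve N k w a z).1 = n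
    · obtain ⟨n, hn⟩ := hint
      obtain ⟨r1, r2⟩ := h.strandCurve_int ha hz hn
      obtain ⟨s1, s2⟩ := h.strandCurve_int ha' hz' (hY ▸ hn)
      rw [r2, s2] at hP
      exact Or.inl ⟨posAt_injective k w n (stdPt_injective N hP), by rw [r1, s1]⟩
    · obtain ⟨j, hj, v, hv, hzj, e⟩ := h.exists_letter ha hz
      obtain ⟨j', hj', v', hv', hzj', e'⟩ := h.exists_letter ha' hz'
      obtain ⟨-, t2, -⟩ := letterCurve_range (N := N) hv
      obtain ⟨-, t2', -⟩ := letterCurve_range (N := N) hv'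
      rw [e] at hint hY hP
      rw [e'] at hY hP
      simp only at hint hY hP
      set X := (letterCurve N (letterAt N k w j) (posAt k w a j) v).1 with hX
      set X' := (letterCurve N (letterAt N k w j') (posAt k w a' j') v').1 with hX'
      have l1 : X < 1 := lt_of_le_of_ne t2.2 fun e1 => hint ⟨j + 1, by rw [e1]; push_cast; ring⟩
      have l1' : X' < 1 := lt_of_le_of_ne t2'.2 fun e1 =>
        hint ⟨j' + 1, by rw [hY, e1]; push_cast; ring⟩
      have hjj : j = j' := by
        have q1 : (j : ℝ) < j' + 1 := by linarith [t2.1]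
        have q2 : (j' : ℝ) < j + 1 := by linarith [t2'.1]
        have q1' : j < j' + 1 := by exact_mod_cast q1
        have q2' : j' < j + 1 := by exact_mod_cast q2
        omega
      subst hjj
      have hXX : X = X' := by linarith
      have hcur : letterCurve N (letterAt N k w j) (posAt k w a j) v =
        letterCurve N (letterAt N k w j) (posAt k w a' j) v' := Prod.ext hXX hP
      rcases letterCurve_inj ((posAt_lt h.word_le a j).2 ha) ((posAt_lt h.word_le a' j).2 ha')
        hv hv' hcur with ⟨p1, p2⟩ | ⟨p1, ⟨p2, p3, p4⟩ | ⟨p2, p3, p4⟩⟩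
      · exact Or.inl ⟨posAt_injective k w j p1, by rw [hzj, hzj', p2]⟩
      · right
        have g1 : ¬ startAt k a < (j : ℤ) := fun g => letterAt_ne_birth h.word_le ha g p2
        have hlt : a < 2 * k := by
          by_contra hn
          apply g1
          unfold startAt
          rw [if_neg hn]
          omega
        have hst : startPar k a = startAt k a + 1 / 4 := by unfold startPar; rw [if_pos hlt]
        have g2 : startAt k a ≤ j := by
          have := hz.1
          rw [hst, hzj, p3] at this
          have : (startAt k a : ℝ) ≤ j := by linarith
          exact_mod_cast this
        have g3 : (j : ℤ) = startAt k a := by omega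
        have g4 : (j : ℤ) ≤ k := by rw [g3]; unfold startAt; split_ifs; omega
        rw [posAt_of_le g4, posAt_of_le g4] at p1
        refine ⟨false, ?_, ?_, ?_⟩
        · simp only [endPar, Bool.false_eq_true, if_false]
          rw [hst, hzj, p3, ← g3]
          simp
        · simp [stepFun, hlt, p1]
        · simp only [stepFun, hlt, if_true, Bool.not_true, endPar, Bool.false_eq_true, if_false]
          rw [p1, startPar_mate, hst, hzj', p4, ← g3]
          simp
      · right
        have g1 : ¬ (j : ℤ) + 1 < stopAt k w (braidPerm w a) := fun g => letterAt_ne_death g p2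
        have hlt : braidPerm w a < 2 * k := by
          by_contra hn
          apply g1
          unfold stopAt
          rw [if_neg hn]
          omega
        have hst : stopPar k w (braidPerm w a) = stopAt k w (braidPerm w a) - 1 / 4 := by
          unfold stopPar; rw [if_pos hlt]
        have g2 : (j : ℤ) + 1 ≤ stopAt k w (braidPerm w a) := by
          have := hz.2
          rw [hst, hzj, p3] at this
          have : (j : ℝ) + 1 ≤ stopAt k w (braidPerm w a) := by linarith
          exact_mod_cast this
        have g3 : stopAt k w (braidPerm w a) = (j : ℤ) + 1 := by omega
        have g4 : (k : ℤ) + w.length ≤ j := by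
          unfold stopAt at g3; rw [if_pos hlt] at g3; omega
        rw [posAt_of_ge g4, posAt_of_ge g4] at p1
        have pa : a' = (braidPerm w).symm (mate (braidPerm w a)) := by
          rw [← p1, Equiv.symm_apply_apply]
        refine ⟨true, ?_, ?_, ?_⟩
        · simp only [endPar, if_true]
          rw [hst, hzj, p3, g3]
          push_cast
          ring
        · simp [stepFun, hlt, pa]
        · simp only [stepFun, hlt, if_true, Bool.not_false, endPar]
          rw [p1, stopPar_mate, hst, hzj', p4, g3]
          push_cast
          ring
  · right
    simp only [Int.cast_one, mul_one] at hY
    obtain ⟨r1, r2, r3, r4⟩ := around ha ha' hz hz' hP (by linarith [m1.2, m2.1])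
      (by linarith [m1.2, m2.1])
    refine ⟨true, r3, ?_, ?_⟩
    · simp only [stepFun]
      rw [if_neg (by rwa [r1]), r1]
    · simp only [stepFun]
      rw [if_neg (by rwa [r1])]
      exact r4
  · right
    simp only [Int.cast_neg, Int.cast_one] at hY
    obtain ⟨r1, r2, r3, r4⟩ := around ha' ha hz' hz hP.symm (by linarith [m1.1, m2.2])
      (by linarith [m1.1, m2.2])
    refine ⟨false, r4, ?_, ?_⟩
    · simp only [stepFun]
      rw [if_neg r2, ← r1, Equiv.symm_apply_apply]
    · simp only [stepFun]
      rw [if_neg r2]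
      exact r3

/-- The curve is injective modulo its period. -/
theorem travCurve_injective {s t : ℝ} (hP : (travCurve N k w s).2 = (travCurve N k w t).2)
    (hθ : ((travCurve N k w s).1 : Real.Angle) = ((travCurve N k w t).1 : Real.Angle)) :
    ∃ n : ℤ, s = t + N * n := by
  have hM := h.length_pos
  have hs : s - ⌊s⌋ ∈ Ico (0 : ℝ) 1 :=
    ⟨by linarith [Int.floor_le s], by linarith [Int.lt_floor_add_one s]⟩
  have ht : t - ⌊t⌋ ∈ Ico (0 : ℝ) 1 :=
    ⟨by linarith [Int.floor_le t], by linarith [Int.lt_floor_add_one t]⟩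
  obtain ⟨n, hn⟩ := Real.Angle.angle_eq_iff_two_pi_dvd_sub.1 hθ
  have es : s = ⌊s⌋ + (s - ⌊s⌋) := by ring
  have et : t = ⌊t⌋ + (t - ⌊t⌋) := by ring
  rw [es, et, h.travCurve_add ⟨hs.1, hs.2.le⟩, h.travCurve_add ⟨ht.1, ht.2.le⟩] at hP hn
  set u := s - ⌊s⌋
  set v := t - ⌊t⌋
  set i := ⌊s⌋
  set j := ⌊t⌋
  set x := trav k (braidPerm w) i with hx
  set y := trav k (braidPerm w) j with hy
  have hzx := statePar_mem (k := k) h.ne_nil x ⟨hs.1, hs.2.le⟩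
  have hzy := statePar_mem (k := k) h.ne_nil y ⟨ht.1, ht.2.le⟩
  have hY : (strandCurve N k w x.1 (statePar k w x u)).1 -
      (strandCurve N k w y.1 (statePar k w y v)).1 =
        sectorCount * ((n - x.2.2 + y.2.2 : ℤ) : ℝ) := by
    unfold stateCurve at hn
    simp only at hn
    have hpi : (2 * Real.pi) ≠ 0 := by positivity
    rw [← mul_sub] at hn
    have := mul_left_cancel₀ hpi hn
    field_simp at this
    push_cast at this ⊢
    linarith
  rcases h.strandCurve_coincide (h.trav_lt i) (h.trav_lt j) hzx hzy hP hY with ⟨e1, e2⟩ | ⟨o, e1, e2, e3⟩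
  · obtain ⟨d, hd⟩ := h.dvd_of_eq e1.symm
    have eo : x.2.1 = y.2.1 := trav_orientation_eq e1
    have hst : statePar k w y = statePar k w x := by
      funext u
      unfold statePar
      rw [e1, eo]
    rw [hst] at e2
    have huv := statePar_injective (k := k) h.ne_nil x e2
    refine ⟨d, ?_⟩
    have hd' : (i : ℝ) - j = N * d := by exact_mod_cast hd
    rw [es, et]
    change (i : ℝ) + u = (j : ℝ) + v + N * d
    linarith
  · exfalso
    have hend : ∀ (x : ℕ × Bool × ℤ), statePar k w x 1 = endPar k w x.1 x.2.1 := by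
      intro x
      have := statePar_one_add (k := k) (w := w) x (ε := 0) (by norm_num)
      simpa using this
    have ho : o = !x.2.1 := by
      by_contra hn
      have : o = x.2.1 := by
        cases o <;> cases hh : x.2.1 <;> simp_all
      rw [this, ← hend] at e1
      have := statePar_injective (k := k) h.ne_nil x e1
      linarith [hs.2]
    have hr : addLevel x.2.2 (x.1, o, 0) = reverse x := by simp [addLevel, reverse, ho]
    have hst := stepFun_addLevel k (braidPerm w) x.2.2 (x.1, o, 0)
    rw [hr] at hst
    have hpred := trav_pred k (braidPerm w) i
    rw [← hx, hst] at hpred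
    have f1 : (trav k (braidPerm w) (i - 1)).1 = y.1 := by rw [hpred, e2]; rfl
    have f2 := trav_orientation_eq f1
    rw [hpred] at f2
    have f3 : (!(stepFun k (braidPerm w) (x.1, o, 0)).2.1) = y.2.1 := f2
    rw [f3, ← hend] at e3
    have := statePar_injective (k := k) h.ne_nil y e3
    linarith [ht.2]

end IsKnotDiagram

end

section

variable {N k : ℕ} {w : List (ℕ × Bool)}

local notation "sectorCount" => ((w.length + 2 * k : ℕ) : ℝ)

/-! ## The knot of a plat diagram -/

namespace IsKnotDiagram

variable (h : IsKnotDiagram N k w)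
include h

theorem cast_pos : (0 : ℝ) < N := by
  have := h.two_le
  exact_mod_cast (by omega : 0 < N)

/-- The knot composed of the elementary tangles. -/
def knot : AxisKnot where
  rho t := (travCurve N k w (N * t)).2.1
  ell t := (travCurve N k w (N * t)).2.2
  theta t := (travCurve N k w (N * t)).1
  lk := h.linking
  smooth_rho := (h.contDiff_travCurve.comp (contDiff_const.mul contDiff_id)).snd.fst
  smooth_ell := (h.contDiff_travCurve.comp (contDiff_const.mul contDiff_id)).snd.snd
  smooth_theta := (h.contDiff_travCurve.comp (contDiff_const.mul contDiff_id)).fst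
  rho_pos t := letterCurve_fst_pos _ _ _ _
  rho_period t := by rw [mul_add, mul_one, h.travCurve_period]
  ell_period t := by rw [mul_add, mul_one, h.travCurve_period]
  theta_period t := by rw [mul_add, mul_one, h.travCurve_period]
  regular t := by
    obtain ⟨c, hc, d0, d1, d2⟩ := h.hasDerivAt_travCurve (N * t)
    have hN := h.cast_pos
    have hm : HasDerivAt (fun t : ℝ => (N : ℝ) * t) N t := by
      simpa using (hasDerivAt_id t).const_mul (N : ℝ)
    have e0 := (d0.comp t hm).deriv
    have e1 := (d1.comp t hm).deriv
    have hu : (N * t : ℝ) - ⌊(N * t : ℝ)⌋ ∈ Icc (0 : ℝ) 1 :=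
      ⟨by linarith [Int.floor_le (N * t : ℝ)], by linarith [Int.lt_floor_add_one (N * t : ℝ)]⟩
    have hz := mem_interior_of_mem (statePar_mem (k := k) h.ne_nil
      (trav k (braidPerm w) ⌊(N * t : ℝ)⌋) hu)
    have hc' : (if (trav k (braidPerm w) ⌊(N * t : ℝ)⌋).2.1 then c else -c) ≠ 0 := by
      split_ifs
      · exact hc.ne'
      · exact (neg_neg_of_pos hc).ne
    rcases strandCurve_regular h.word_le (h.trav_lt ⌊(N * t : ℝ)⌋) hz.1 hz.2 with r | r
    · refine Or.inr (Or.inr (ne_of_eq_of_ne e0 ?_))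
      have := h.length_pos
      exact mul_ne_zero (mul_ne_zero hc' (mul_ne_zero (by positivity) r)) hN.ne'
    · refine Or.inl (ne_of_eq_of_ne e1 ?_)
      exact mul_ne_zero (mul_ne_zero hc' r) hN.ne'
  injective s t h1 h2 h3 := by
    obtain ⟨n, hn⟩ := h.travCurve_injective (Prod.ext h1 h2) h3
    refine ⟨n, ?_⟩
    rw [← mul_add] at hn
    exact mul_left_cancel₀ h.cast_pos.ne' hn

end IsKnotDiagram

/-! ### Gluing -/

theorem mem_glueTangles_iff {f : PlatLetter → Set (ℝ × ℝ × ℝ)} {P : Real.Angle × ℝ × ℝ} :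
    P ∈ glueTangles ((platLetters k w).map f) ↔ ∃ j < w.length + 2 * k,
      ∃ q ∈ f (letterAt N k w j), P = (sectorAngle (w.length + 2 * k) j q.1, q.2) := by
  have hl : ((platLetters k w).map f).length = w.length + 2 * k := by
    rw [List.length_map, length_platLetters]
  constructor
  · rintro ⟨j, q, hq, rfl⟩
    refine ⟨j, by rw [← hl]; exact j.2, q, ?_, congrArg (fun M => (sectorAngle M (j : ℕ) q.1, q.2)) hl⟩
    have := platLetters_get (N := N) (k := k) (w := w) ⟨j, by simpa using j.2⟩
    rw [← this]
    simpa using hq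
  · rintro ⟨j, hj, q, hq, rfl⟩
    refine ⟨⟨j, by rw [hl]; exact hj⟩, q, ?_, congrArg (fun M => (sectorAngle M j q.1, q.2)) hl.symm⟩
    have := platLetters_get (N := N) (k := k) (w := w) ⟨j, by rw [length_platLetters]; exact hj⟩
    rw [← this] at hq
    simpa using hq

theorem mem_glueBlocks_iff {f : PlatLetter → Set (Real.Angle × ℝ × ℝ)}
    {P : Real.Angle × Real.Angle × ℝ} :
    P ∈ glueBlocks ((platLetters k w).map f) ↔ ∃ j < w.length + 2 * k,
      ∃ v ∈ f (letterAt N k w j), P = (v.1, sectorAngle (w.length + 2 * k) j v.2.1, v.2.2) := by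
  have hl : ((platLetters k w).map f).length = w.length + 2 * k := by
    rw [List.length_map, length_platLetters]
  constructor
  · rintro ⟨j, q, hq, rfl⟩
    refine ⟨j, by rw [← hl]; exact j.2, q, ?_, congrArg (fun M => (q.1, sectorAngle M (j : ℕ) q.2.1, q.2.2)) hl⟩
    have := platLetters_get (N := N) (k := k) (w := w) ⟨j, by simpa using j.2⟩
    rw [← this]
    simpa using hq
  · rintro ⟨j, hj, q, hq, rfl⟩
    refine ⟨⟨j, by rw [hl]; exact hj⟩, q, ?_, congrArg (fun M => (q.1, sectorAngle M j q.2.1, q.2.2)) hl.symm⟩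
    have := platLetters_get (N := N) (k := k) (w := w) ⟨j, by rw [length_platLetters]; exact hj⟩
    rw [← this] at hq
    simpa using hq

theorem sectorAngle_eq_iff {M j j' : ℕ} (hM : 0 < M) {x x' : ℝ} :
    sectorAngle M j x = sectorAngle M j' x' ↔ ∃ n : ℤ, ((j : ℝ) + x) - (j' + x') = M * n := by
  have hM' : (M : ℝ) ≠ 0 := by positivity
  unfold sectorAngle
  rw [Real.Angle.angle_eq_iff_two_pi_dvd_sub]
  refine exists_congr fun n => ?_
  have hpi : (2 * Real.pi) ≠ 0 := by positivity
  rw [← mul_sub]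
  constructor
  · intro h
    have := mul_left_cancel₀ hpi h
    field_simp at this
    linarith
  · intro h
    congr 1
    field_simp
    linarith

theorem angle_add_level (L : ℤ) (y : ℝ) :
    ((2 * Real.pi * (L + y) : ℝ) : Real.Angle) = ((2 * Real.pi * y : ℝ) : Real.Angle) := by
  rw [Real.Angle.angle_eq_iff_two_pi_dvd_sub]
  exact ⟨L, by ring⟩

theorem exists_sector {M : ℕ} (hM : 0 < M) (φ : Real.Angle) :
    ∃ j < M, ∃ x ∈ Ico (0 : ℝ) 1, φ = sectorAngle M j x := by
  induction φ using Real.Angle.induction_on with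
  | _ θ =>
    have hM' : (0 : ℝ) < M := by positivity
    have hpi : (2 * Real.pi) ≠ 0 := by positivity
    set y := θ / (2 * Real.pi) with hy
    have f0 := Int.fract_nonneg y
    have f1 := Int.fract_lt_one y
    set Y := M * Int.fract y with hY
    have Y0 : 0 ≤ Y := by positivity
    have Y1 : Y < M := by nlinarith
    refine ⟨⌊Y⌋₊, (Nat.floor_lt Y0).2 Y1, Y - ⌊Y⌋₊,
      ⟨by linarith [Nat.floor_le Y0], by linarith [Nat.lt_floor_add_one Y]⟩, ?_⟩
    unfold sectorAngle
    rw [Real.Angle.angle_eq_iff_two_pi_dvd_sub]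
    refine ⟨⌊y⌋, ?_⟩
    have e1 : θ = 2 * Real.pi * y := by rw [hy]; field_simp
    have e2 : ((⌊Y⌋₊ : ℝ) + (Y - ⌊Y⌋₊)) / M = Int.fract y := by
      rw [add_sub_cancel, hY]
      field_simp
    rw [e2, e1, ← mul_sub]
    congr 1
    linarith [Int.floor_add_fract y]

namespace IsKnotDiagram

variable (h : IsKnotDiagram N k w)
include h

theorem sectors_pos : 0 < w.length + 2 * k := by
  have := List.length_pos_of_ne_nil h.ne_nil
  omega

theorem point_eq {i : ℤ} {u : ℝ} (hu : u ∈ Icc (0 : ℝ) 1) {t : ℝ} (ht : N * t = i + u) :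
    (h.knot.theta t = 2 * Real.pi * ((trav k (braidPerm w) i).2.2 +
      (strandCurve N k w (trav k (braidPerm w) i).1
        (statePar k w (trav k (braidPerm w) i) u)).1 / sectorCount)) ∧
    h.knot.planePt t = (strandCurve N k w (trav k (braidPerm w) i).1
        (statePar k w (trav k (braidPerm w) i) u)).2 := by
  have e := h.travCurve_add (i := i) hu
  rw [← ht] at e
  refine ⟨?_, ?_⟩
  · change (travCurve N k w (N * t)).1 = _
    rw [e]; rfl
  · change (travCurve N k w (N * t)).2 = _
    rw [e]; rfl

theorem carrier_eq : h.knot.carrier = glueTangles ((platLetters k w).map (elemTangle N)) := by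
  ext P
  rw [mem_glueTangles_iff (N := N)]
  constructor
  · rintro ⟨t, rfl⟩
    have hu : (N * t : ℝ) - ⌊(N * t : ℝ)⌋ ∈ Icc (0 : ℝ) 1 :=
      ⟨by linarith [Int.floor_le (N * t : ℝ)], by linarith [Int.lt_floor_add_one (N * t : ℝ)]⟩
    obtain ⟨e1, e2⟩ := h.point_eq (t := t) (i := ⌊(N * t : ℝ)⌋) hu (by ring)
    set x := trav k (braidPerm w) ⌊(N * t : ℝ)⌋
    obtain ⟨j, hj, v, hv, hz, e⟩ := h.exists_letter (h.trav_lt _)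
      (statePar_mem (k := k) h.ne_nil x hu)
    rw [e] at e1 e2
    refine ⟨j, hj, _, ⟨posAt k w x.1 j, (posAt_lt h.word_le _ _).2 (h.trav_lt _), v, hv, rfl⟩, ?_⟩
    have e3 : (h.knot.rho t, h.knot.ell t) = _ := e2
    change (((h.knot.theta t : ℝ) : Real.Angle), (h.knot.rho t, h.knot.ell t)) = _
    rw [e1, e3, angle_add_level]
    rfl
  · rintro ⟨j, hj, _, ⟨b, hb, v, hv, rfl⟩, rfl⟩
    obtain ⟨a, rfl⟩ := (braidPerm (w.take ((j : ℤ) - k).toNat)).surjective b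
    change posAt k w a j < N at hb
    change v ∈ lifetime _ (posAt k w a j) at hv
    have ha := (posAt_lt h.word_le a j).1 hb
    have hv1 := (letterCurve_range (N := N) hv).1
    have hz := (mem_lifetime_iff (N := N) hj hv1).1 hv
    obtain ⟨i, rfl⟩ := h.visited ha
    obtain ⟨u, hu, eu⟩ := exists_statePar hz
    have hN := h.cast_pos.ne'
    obtain ⟨e1, e2⟩ := h.point_eq (t := (i + u) / N) hu (by field_simp)
    rw [eu, strandCurve_eq_letterCurve h.word_le ha hv1 hz] at e1 e2
    refine ⟨(i + u) / N, ?_⟩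
    change (((h.knot.theta _ : ℝ) : Real.Angle), h.knot.planePt _) = _
    rw [e1, e2, angle_add_level]
    rfl

/-- A fiber of the knot is a fiber of one of the elementary tangles. -/
theorem fiber_iff {j : ℕ} (hj : j < w.length + 2 * k) {x : ℝ} (hx : x ∈ Ico (0 : ℝ) 1) {P : ℝ × ℝ} :
    (sectorAngle (w.length + 2 * k) j x, P) ∈ h.knot.carrier ↔
      (x, P) ∈ elemTangle N (letterAt N k w j) := by
  rw [h.carrier_eq, mem_glueTangles_iff (N := N)]
  constructor
  · rintro ⟨j', hj', q, hq, e⟩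
    rw [Prod.mk.injEq] at e
    obtain ⟨e1, rfl⟩ := e
    obtain ⟨n, hn⟩ := (sectorAngle_eq_iff h.sectors_pos).1 e1
    obtain ⟨b, hb, v, hv, rfl⟩ := hq
    obtain ⟨r1, r2, -, r4⟩ := letterCurve_range (N := N) hv
    set X := (letterCurve N (letterAt N k w j') b v).1 with hX
    have hM := h.length_pos
    have hjM : (j : ℝ) + 1 ≤ ((w.length + 2 * k : ℕ) : ℝ) := by exact_mod_cast hj
    have hjM' : (j' : ℝ) + 1 ≤ ((w.length + 2 * k : ℕ) : ℝ) := by exact_mod_cast hj'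
    have j0 : (0 : ℝ) ≤ j := Nat.cast_nonneg _
    have j0' : (0 : ℝ) ≤ j' := Nat.cast_nonneg _
    have n1 : n ≤ 0 := by
      by_contra hn1
      have : (1 : ℝ) ≤ n := by exact_mod_cast (by omega : 1 ≤ n)
      nlinarith [hx.2, r2.1]
    have n2 : -1 ≤ n := by
      by_contra hn1
      have : (n : ℝ) ≤ -2 := by exact_mod_cast (by omega : n ≤ -2)
      nlinarith [hx.1, r2.2]
    rcases lt_or_eq_of_le r2.2 with hX1 | hX1
    · have hn0 : n = 0 := by
        by_contra hn0
        have : (n : ℝ) ≤ -1 := by exact_mod_cast (by omega : n ≤ -1)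
        nlinarith [hx.1]
      rw [hn0, Int.cast_zero, mul_zero] at hn
      have q1 : j < j' + 1 := by
        have : (j : ℝ) < j' + 1 := by linarith [hx.1]
        exact_mod_cast this
      have q2 : j' < j + 1 := by
        have : (j' : ℝ) < j + 1 := by linarith [hx.2, r2.1]
        exact_mod_cast this
      have hjj : j = j' := by omega
      subst hjj
      have hxX : x = X := by linarith
      exact ⟨b, hb, v, hv, Prod.ext hxX rfl⟩
    · obtain ⟨v1, hP⟩ := r4 hX1
      obtain ⟨a, rfl⟩ := (braidPerm (w.take ((j' : ℤ) - k).toNat)).surjective b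
      change posAt k w a j' < N at hb
      change v ∈ lifetime _ (posAt k w a j') at hv
      have ha := (posAt_lt h.word_le a j').1 hb
      have hz := (mem_lifetime_iff (N := N) hj' r1).1 hv
      have hP' : (letterCurve N (letterAt N k w j') (posAt k w a j') v).2 =
          stdPt N (posAt k w a (j' + 1)) := by rw [posAt_succ (N := N)]; exact hP
      change (x, (letterCurve N (letterAt N k w j') (posAt k w a j') v).2) ∈ _
      rw [hP']
      rw [v1] at hz
      rcases (by omega : n = 0 ∨ n = -1) with hn0 | hn0
      · rw [hn0, Int.cast_zero, mul_zero, hX1] at hn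
        have q1 : j < j' + 2 := by
          have : (j : ℝ) < j' + 2 := by linarith [hx.1]
          exact_mod_cast this
        have q2 : j' < j := by
          have : (j' : ℝ) < j := by linarith [hx.2]
          exact_mod_cast this
        have hjj : j = j' + 1 := by omega
        have hx0 : x = 0 := by rw [hjj] at hn; push_cast at hn; linarith
        rw [hx0]
        have hz2 : (j : ℝ) + 0 ∈ Icc (startPar k a) (stopPar k w (braidPerm w a)) := by
          rw [hjj]; push_cast; simpa using hz
        have hz3 : (j : ℝ) ∈ Icc (startPar k a) (stopPar k w (braidPerm w a)) := by simpa using hz2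
        refine ⟨posAt k w a j, (posAt_lt h.word_le _ _).2 ha, 0,
          (mem_lifetime_iff (N := N) hj ⟨le_rfl, zero_le_one⟩).2 hz2, ?_⟩
        have hs := (mem_interior_of_mem hz3).1
        rw [letterCurve_entry (letterAt_ne_birth h.word_le ha (by exact_mod_cast hs))
          (by norm_num), hjj]
        push_cast
        rfl
      · rw [hn0, hX1] at hn
        push_cast at hn
        push_cast at hjM'
        have hx0 : x = 0 := by linarith [hx.1]
        have hj0 : j = 0 := by
          have : (j : ℝ) ≤ 0 := by linarith [hx.1]
          have : j ≤ 0 := by exact_mod_cast this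
          omega
        have hj'0 : j' + 1 = w.length + 2 * k := by
          have : (j' : ℝ) + 1 = w.length + 2 * k := by linarith [hx.1]
          exact_mod_cast this
        have hge : ¬ braidPerm w a < 2 * k := by
          intro hlt
          have e3 := hz.2
          unfold stopPar stopAt at e3
          rw [if_pos hlt, if_pos hlt] at e3
          have : ((braidPerm w a / 2 : ℕ) : ℝ) + 1 ≤ k := by
            exact_mod_cast (by omega : braidPerm w a / 2 + 1 ≤ k)
          have e4 : (j' : ℝ) + 1 = w.length + 2 * k := by exact_mod_cast hj'0
          simp only [Int.cast_add, Int.cast_natCast, Int.cast_one] at e3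
          linarith
        have ha2 := (h.perm_lt a).2 ha
        rw [posAt_of_ge (by omega), hx0, hj0]
        have hst : startAt k (braidPerm w a) = -1 := by unfold startAt; rw [if_neg hge]
        have hle := one_le_strandLength (k := k) h.ne_nil (braidPerm w a)
        have hsp : startPar k (braidPerm w a) = 0 := by unfold startPar; rw [if_neg hge]
        unfold strandLength at hle
        refine ⟨posAt k w (braidPerm w a) (0 : ℕ), (posAt_lt h.word_le _ _).2 ha2, 0,
          (mem_lifetime_iff (N := N) h.sectors_pos ⟨le_rfl, zero_le_one⟩).2 ?_, ?_⟩
        · rw [hsp] at hle ⊢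
          push_cast
          constructor <;> linarith
        · rw [letterCurve_entry (letterAt_ne_birth h.word_le ha2 (by rw [hst]; simp))
            (by norm_num), posAt_of_le (by simp)]
  · intro hq
    exact ⟨j, hj, _, hq, rfl⟩

theorem exists_time {φ : Real.Angle} {P : ℝ × ℝ} (hP : (φ, P) ∈ h.knot.carrier) :
    ∃ t ∈ Ico (0 : ℝ) 1, (h.knot.theta t : Real.Angle) = φ ∧ h.knot.planePt t = P := by
  obtain ⟨t, ht⟩ := hP
  have hper : Function.Periodic (fun t => ((h.knot.theta t : Real.Angle), h.knot.rho t,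
      h.knot.ell t)) 1 := by
    intro t
    simp only
    rw [h.knot.theta_period, h.knot.rho_period, h.knot.ell_period]
    congr 1
    rw [Real.Angle.angle_eq_iff_two_pi_dvd_sub]
    exact ⟨h.knot.lk, by ring⟩
  obtain ⟨s, hs, e⟩ := hper.exists_mem_Ico₀ zero_lt_one t
  have e' := e.symm.trans ht
  exact ⟨s, hs, congrArg Prod.fst e', congrArg Prod.snd e'⟩

theorem time_unique {s t : ℝ} (hs : s ∈ Ico (0 : ℝ) 1) (ht : t ∈ Ico (0 : ℝ) 1)
    (e1 : (h.knot.theta s : Real.Angle) = h.knot.theta t) (e2 : h.knot.planePt s = h.knot.planePt t) :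
    s = t := by
  obtain ⟨z, hz⟩ := h.knot.injective s t (congrArg Prod.fst e2) (congrArg Prod.snd e2) e1
  have z1 : z < 1 := by
    have : (z : ℝ) < 1 := by linarith [hs.2, ht.1]
    exact_mod_cast this
  have z2 : -1 < z := by
    have : (-1 : ℝ) < z := by linarith [hs.1, ht.2]
    exact_mod_cast this
  have z0 : z = 0 := by omega
  rw [hz, z0]
  simp

theorem planePt_mem (t : ℝ) : ((h.knot.theta t : Real.Angle), h.knot.planePt t) ∈ h.knot.carrier :=
  ⟨t, rfl⟩

theorem traceGraph_eq : h.knot.traceGraph =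
    glueBlocks ((platLetters k w).map fun x => traceBlock (elemTangle N x)) := by
  ext V
  rw [mem_glueBlocks_iff (N := N)]
  constructor
  · rintro ⟨⟨s, t⟩, ⟨hs, ht, hne, hφ⟩, rfl⟩
    simp only at hs ht hne hφ
    obtain ⟨j, hj, x, hx, e⟩ := exists_sector h.sectors_pos (h.knot.theta s : Real.Angle)
    have m1 := h.planePt_mem s
    have m2 := h.planePt_mem t
    rw [← hφ] at m2
    rw [e, h.fiber_iff hj hx] at m1 m2
    refine ⟨j, hj, (_, _, _), ⟨_, m1, _, m2, ?_, rfl, rfl⟩, ?_⟩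
    · intro e2
      exact hne (h.time_unique hs ht hφ (Prod.mk.inj e2).2)
    · simp only [AxisKnot.tau, AxisKnot.phi, AxisKnot.height, e]
  · rintro ⟨j, hj, _, ⟨⟨x, P⟩, hp, ⟨y, Q⟩, hq, hne, e1, rfl⟩, rfl⟩
    simp only at e1
    subst e1
    have m : ∀ P, (x, P) ∈ elemTangle N (letterAt N k w j) →
        (sectorAngle (w.length + 2 * k) j x, P) ∈ h.knot.carrier := by
      intro P hP
      rw [h.carrier_eq, mem_glueTangles_iff (N := N)]
      exact ⟨j, hj, _, hP, rfl⟩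
    obtain ⟨s, hs, s1, s2⟩ := h.exists_time (m P hp)
    obtain ⟨t, ht, t1, t2⟩ := h.exists_time (m Q hq)
    refine ⟨(s, t), ⟨hs, ht, ?_, by rw [s1, t1]⟩, ?_⟩
    · rintro e
      simp only at e
      subst e
      apply hne
      rw [← s2, ← t2]
    · simp only [AxisKnot.tau, AxisKnot.phi, AxisKnot.height, s1, s2, t2]

end IsKnotDiagram

end

section

variable {N k : ℕ} {w : List (ℕ × Bool)}

local notation "sectorCount" => ((w.length + 2 * k : ℕ) : ℝ)

/-! ## The knot in the sectors of the crossings -/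

/-- The generator number `t` of a braid word. -/
def gen (w : List (ℕ × Bool)) (t : ℕ) : ℕ × Bool := w.getD t (0, true)

theorem gen_eq {t : ℕ} (ht : t < w.length) : gen w t = w[t] := List.getD_eq_getElem _ _ ht

theorem gen_le (hw : ∀ g ∈ w, g.1 + 2 ≤ N) {t : ℕ} (ht : t < w.length) : (gen w t).1 + 2 ≤ N := by
  rw [gen_eq ht]
  exact hw _ (List.getElem_mem _)

theorem letterAt_gen {t : ℕ} (ht : t < w.length) :
    letterAt N k w ((k + t : ℕ) : ℤ) = .cross (gen w t).1 (gen w t).2 := by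
  rw [Nat.cast_add, letterAt_cross ht, gen_eq ht]

theorem posAt_gen (a t : ℕ) : posAt k w a ((k + t : ℕ) : ℤ) = braidPerm (w.take t) a := by
  unfold posAt
  rw [show (((k + t : ℕ) : ℤ) - k).toNat = t by omega]

/-- The curve traced by the strand `a` in the sector of the generator number `t`. -/
def genCurve (N : ℕ) (w : List (ℕ × Bool)) (t a : ℕ) (x : ℝ) : ℝ × ℝ :=
  crossCurve N (gen w t).1 (gen w t).2 (braidPerm (w.take t) a) x

/-- The sign of an orientation. -/
def orientSign (o : Bool) : ℤ := if o then 1 else -1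

theorem letterCurve_fst_injOn (N : ℕ) (x : PlatLetter) (b : ℕ) :
    InjOn (fun v => (letterCurve N x b v).1) (lifetime x b) := by
  have hb : ∀ c, InjOn (fun v => (birthCurve N c b v).1) (birthLifetime c b) := by
    intro c v hv v' hv' e
    simp only at e
    by_cases hc : c = b / 2
    · unfold birthCurve at e
      rw [if_pos (by omega), if_pos (by omega)] at e
      unfold birthLifetime at hv hv'
      rw [if_neg (by omega), if_pos (by omega)] at hv hv'
      have := fold_strictMonoOn.injOn (x₁ := (v - 1 / 4) * (4 / 3)) (x₂ := (v' - 1 / 4) * (4 / 3))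
        (by rw [mem_Ici]; linarith [hv.1]) (by rw [mem_Ici]; linarith [hv'.1]) e
      linarith
    · rwa [birthCurve_other v hc, birthCurve_other v' hc] at e
  cases x with
  | birth c => exact hb c
  | cross i s => intro v _ v' _ e; exact e
  | death c =>
    intro v hv v' hv' e
    have := hb c (x₁ := 1 - v) hv (x₂ := 1 - v') hv' (by simp only [letterCurve] at e ⊢; linarith)
    linarith

theorem elemTangle_fiber_finite (N : ℕ) (x : PlatLetter) (y : ℝ) :
    {P | (y, P) ∈ elemTangle N x}.Finite := by
  refine ((Set.finite_lt_nat N).biUnion (t := fun b =>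
    {P | ∃ v ∈ lifetime x b, (y, P) = letterCurve N x b v}) fun b _ => ?_).subset ?_
  · apply Set.Subsingleton.finite
    rintro P ⟨v, hv, e⟩ P' ⟨v', hv', e'⟩
    have : v = v' := letterCurve_fst_injOn N x b hv hv' (by simp only [← e, ← e'])
    subst this
    exact (Prod.mk.inj (e.trans e'.symm)).2
  · rintro P ⟨b, hb, v, hv, e⟩
    exact mem_biUnion (show b ∈ {i | i < N} from hb) ⟨v, hv, e⟩

namespace IsKnotDiagram

variable (h : IsKnotDiagram N k w)
include h

theorem exists_index {a : ℕ} (ha : a < N) : ∃ i < N, (trav k (braidPerm w) (i : ℤ)).1 = a := by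
  have hinj : Function.Injective fun i : Fin N =>
      (⟨(trav k (braidPerm w) (i : ℕ)).1, h.trav_lt _⟩ : Fin N) := by
    intro i j e
    obtain ⟨d, hd⟩ := h.dvd_of_eq (Fin.mk.inj e)
    have hd0 : d = 0 := by
      have h1 := i.2
      have h2 := j.2
      by_contra hn
      rcases lt_or_gt_of_ne hn with l | l <;> nlinarith
    rw [hd0] at hd
    exact Fin.ext (by omega)
  obtain ⟨i, hi⟩ := Finite.injective_iff_surjective.1 hinj ⟨a, ha⟩
  exact ⟨i, i.2, congrArg Fin.val hi⟩

/-- The place of the strand `a` in the order of the strands along the knot. -/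
def index (a : ℕ) : ℕ := if ha : a < N then (h.exists_index ha).choose else 0

theorem index_spec {a : ℕ} (ha : a < N) :
    h.index a < N ∧ (trav k (braidPerm w) (h.index a)).1 = a := by
  unfold index
  rw [dif_pos ha]
  exact (h.exists_index ha).choose_spec

theorem index_trav {i : ℕ} (hi : i < N) : h.index (trav k (braidPerm w) i).1 = i := by
  obtain ⟨h1, h2⟩ := h.index_spec (h.trav_lt i)
  obtain ⟨d, hd⟩ := h.dvd_of_eq h2
  have hd0 : d = 0 := by
    by_contra hn
    rcases lt_or_gt_of_ne hn with l | l <;> nlinarith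
  rw [hd0] at hd
  omega

/-- The orientation of the strand `a`. -/
def orient (a : ℕ) : Bool := (trav k (braidPerm w) (h.index a)).2.1

/-- The number of turns made around the axis before the strand `a`. -/
def level (a : ℕ) : ℤ := (trav k (braidPerm w) (h.index a)).2.2

/-- The knot is at the time `s` in the point with the coordinate `x` of the strand `a` in the sector
of the generator number `t`. -/
structure IsTime (t a : ℕ) (x s : ℝ) : Prop where
  mem : s ∈ Ico (0 : ℝ) 1
  theta_eq : h.knot.theta s = 2 * Real.pi * (h.level a + (((k + t : ℕ) : ℝ) + x) / sectorCount)
  point_eq : h.knot.planePt s = genCurve N w t a x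
  velocity : ∃ c : ℝ, 0 < c ∧
    deriv h.knot.theta s = orientSign (h.orient a) * c * (2 * Real.pi / sectorCount) ∧
    deriv h.knot.rho s = orientSign (h.orient a) * c * deriv (fun x => (genCurve N w t a x).1) x ∧
    deriv h.knot.ell s = orientSign (h.orient a) * c * deriv (fun x => (genCurve N w t a x).2) x

theorem exists_isTime {t a : ℕ} (ht : t < w.length) (ha : a < N) {x : ℝ} (hx : x ∈ Ioo (0 : ℝ) 1) :
    ∃ s, h.IsTime t a x s := by
  obtain ⟨hi1, hi2⟩ := h.index_spec ha
  set i := h.index a with hi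
  set y := trav k (braidPerm w) i with hy
  have hN := h.cast_pos
  have hM := h.length_pos
  have s1 := startPar_bounds (k := k) y.1
  have s2 := stopPar_bounds (k := k) (w := w) (braidPerm w y.1)
  have ht' : ((k + t : ℕ) : ℝ) + 1 ≤ ((k + w.length : ℕ) : ℝ) := by
    exact_mod_cast (by omega : k + t + 1 ≤ k + w.length)
  have hkt : (k : ℝ) ≤ ((k + t : ℕ) : ℝ) := by exact_mod_cast (by omega : k ≤ k + t)
  set z := ((k + t : ℕ) : ℝ) + x with hz
  have z1 : startPar k y.1 < z := by linarith [hx.1]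
  have z2 : z < stopPar k w (braidPerm w y.1) := by linarith [hx.2]
  obtain ⟨u, hu, eu⟩ := exists_statePar (x := y) ⟨z1.le, z2.le⟩
  have e0 := statePar_of_small (k := k) (w := w) y (ε := 0) (by norm_num)
  have e1 := statePar_one_add (k := k) (w := w) y (ε := 0) (by norm_num)
  have hend : ∀ o, z ≠ endPar k w y.1 o := by
    intro o
    unfold endPar
    split_ifs
    · exact z2.ne
    · exact z1.ne'
  have u1 : u < 1 := by
    refine lt_of_le_of_ne hu.2 ?_
    rintro rfl
    simp only [add_zero, neg_zero, ite_self] at e1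
    exact hend _ (eu.symm.trans e1)
  have hNs : (N : ℝ) * ((i + u) / N) = ((i : ℤ) : ℝ) + u := by push_cast; field_simp
  have hfl : ⌊(N : ℝ) * ((i + u) / N)⌋ = (i : ℤ) := by
    rw [hNs, Int.floor_eq_iff]
    exact ⟨by linarith [hu.1], by linarith⟩
  have hfrac : (N : ℝ) * ((i + u) / N) - ⌊(N : ℝ) * ((i + u) / N)⌋ = u := by
    rw [hfl, hNs]; ring
  obtain ⟨p1, p2⟩ := h.point_eq (t := (i + u) / N) hu hNs
  rw [← hy, eu] at p1 p2
  have hzfl : ⌊z⌋ = ((k + t : ℕ) : ℤ) := by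
    rw [hz, Int.floor_eq_iff, Int.cast_natCast]
    exact ⟨by linarith [hx.1], by linarith [hx.2]⟩
  have hcur : strandCurve N k w y.1 z = (z, genCurve N w t a x) := by
    unfold strandCurve segCurve
    rw [hzfl, letterAt_gen ht, posAt_gen, Int.cast_natCast, hi2, hz, add_sub_cancel_left]
    rfl
  rw [hcur] at p1 p2
  have hev : strandCurve N k w y.1 =ᶠ[𝓝 z] fun z => (z, genCurve N w t a (z - ((k + t : ℕ) : ℝ))) := by
    have hint := mem_interior_of_mem (k := k) (w := w) (a := y.1) ⟨z1.le, z2.le⟩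
    refine (strandCurve_eventuallyEq h.word_le (h.trav_lt _) hint.1 hint.2).trans ?_
    refine Filter.Eventually.of_forall fun z' => ?_
    unfold segCurve
    rw [hzfl, letterAt_gen ht, posAt_gen, Int.cast_natCast, hi2]
    simp only [letterCurve, genCurve, add_sub_cancel]
  have d0 : deriv (fun z => (strandCurve N k w y.1 z).1) z = 1 := by
    have : (fun z => (strandCurve N k w y.1 z).1) =ᶠ[𝓝 z] fun z => z := by
      filter_upwards [hev] with z' hz' using by rw [hz']
    rw [this.deriv_eq, deriv_id'']
  have hzx : z - ((k + t : ℕ) : ℝ) = x := by rw [hz]; ring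
  have d1 : deriv (fun z => (strandCurve N k w y.1 z).2.1) z =
      deriv (fun x => (genCurve N w t a x).1) x := by
    have : (fun z => (strandCurve N k w y.1 z).2.1) =ᶠ[𝓝 z]
        fun z => (genCurve N w t a (z - ((k + t : ℕ) : ℝ))).1 := by
      filter_upwards [hev] with z' hz' using by rw [hz']
    rw [this.deriv_eq, deriv_comp_sub_const (f := fun x => (genCurve N w t a x).1), hzx]
  have d2 : deriv (fun z => (strandCurve N k w y.1 z).2.2) z =
      deriv (fun x => (genCurve N w t a x).2) x := by
    have : (fun z => (strandCurve N k w y.1 z).2.2) =ᶠ[𝓝 z]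
        fun z => (genCurve N w t a (z - ((k + t : ℕ) : ℝ))).2 := by
      filter_upwards [hev] with z' hz' using by rw [hz']
    rw [this.deriv_eq, deriv_comp_sub_const (f := fun x => (genCurve N w t a x).2), hzx]
  obtain ⟨c, hc, q0, q1, q2⟩ := h.hasDerivAt_travCurve ((N : ℝ) * ((i + u) / N))
  rw [hfrac, hfl, ← hy, eu] at q0 q1 q2
  rw [d0] at q0
  rw [d1] at q1
  rw [d2] at q2
  have hm : HasDerivAt (fun t : ℝ => (N : ℝ) * t) N ((i + u) / N) := by
    simpa using (hasDerivAt_id ((i + u) / (N : ℝ))).const_mul (N : ℝ)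
  have ho : (if y.2.1 = true then c else -c) = (orientSign (h.orient a) : ℝ) * c := by
    have : h.orient a = y.2.1 := rfl
    rw [this]
    unfold orientSign
    split_ifs <;> simp
  rw [ho] at q0 q1 q2
  refine ⟨(i + u) / N, ⟨div_nonneg (add_nonneg (Nat.cast_nonneg _) hu.1) hN.le, ?_⟩, p1, p2,
    c * N, by positivity, ?_, ?_, ?_⟩
  · rw [div_lt_one hN]
    have : (i : ℝ) + 1 ≤ N := by exact_mod_cast hi1
    linarith
  · have : deriv h.knot.theta ((i + u) / N) = _ := (q0.comp _ hm).deriv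
    rw [this]
    ring
  · have : deriv h.knot.rho ((i + u) / N) = _ := (q1.comp _ hm).deriv
    rw [this]
    ring
  · have : deriv h.knot.ell ((i + u) / N) = _ := (q2.comp _ hm).deriv
    rw [this]
    ring

theorem IsTime.angle_eq {t a : ℕ} {x s : ℝ} (hs : h.IsTime t a x s) :
    (h.knot.theta s : Real.Angle) = sectorAngle (w.length + 2 * k) (k + t) x := by
  rw [hs.theta_eq, angle_add_level]
  rfl

theorem IsTime.unique {t a : ℕ} {x s s' : ℝ} (hs : h.IsTime t a x s) (hs' : h.IsTime t a x s') :
    s = s' :=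
  h.time_unique hs.mem hs'.mem (by rw [hs.angle_eq, hs'.angle_eq])
    (by rw [hs.point_eq, hs'.point_eq])

theorem exists_strand {t : ℕ} (ht : t < w.length) {x : ℝ} (hx : x ∈ Ioo (0 : ℝ) 1) {s : ℝ}
    (hs : s ∈ Ico (0 : ℝ) 1)
    (e : (h.knot.theta s : Real.Angle) = sectorAngle (w.length + 2 * k) (k + t) x) :
    ∃ a < N, h.IsTime t a x s := by
  have m := h.planePt_mem s
  rw [e, h.fiber_iff (by omega) ⟨hx.1.le, hx.2⟩, letterAt_gen ht] at m
  obtain ⟨-, b, hb, eb⟩ := exists_of_mem_cross m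
  obtain ⟨a, rfl⟩ := (braidPerm (w.take t)).surjective b
  have ha : a < N := by
    rw [← posAt_gen (k := k)] at hb
    exact (posAt_lt h.word_le a _).1 hb
  obtain ⟨s', hs'⟩ := h.exists_isTime ht ha hx
  have : s = s' := h.time_unique hs hs'.mem (by rw [e, hs'.angle_eq]) (by rw [hs'.point_eq]; exact eb)
  exact ⟨a, ha, this ▸ hs'⟩

section secant

variable {t a b : ℕ} {x s s' : ℝ} (hs : h.IsTime t a x s) (hs' : h.IsTime t b x s')
include hs hs'

theorem marking_eq : h.knot.marking (s, s') = ((h.level a - h.level b : ℤ) :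
    ZMod h.knot.lk.natAbs) := by
  unfold AxisKnot.marking
  simp only
  rw [hs.theta_eq, hs'.theta_eq]
  have hpi : (2 * Real.pi) ≠ 0 := by positivity
  rw [← mul_sub, mul_div_cancel_left₀ _ hpi]
  congr 1
  rw [show (h.level a : ℝ) + (((k + t : ℕ) : ℝ) + x) / sectorCount -
    (h.level b + (((k + t : ℕ) : ℝ) + x) / sectorCount) =
    ((h.level a - h.level b : ℤ) : ℝ) by push_cast; ring, round_intCast]

theorem secant_coords : h.knot.phi (s, s') = sectorAngle (w.length + 2 * k) (k + t) x ∧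
    h.knot.tau (s, s') = secantAngle (genCurve N w t a x) (genCurve N w t b x) ∧
    h.knot.height (s, s') = secantHeight (genCurve N w t a x) (genCurve N w t b x) := by
  refine ⟨hs.angle_eq, ?_, ?_⟩
  · simp only [AxisKnot.tau, hs.point_eq, hs'.point_eq]
  · simp only [AxisKnot.height, hs.point_eq, hs'.point_eq]

end secant

end IsKnotDiagram

/-- The determinant giving the sign of a secant, for points in a common fiber. -/
theorem det_secant {r₁ l₁ r₂ l₂ u₁ v₁ u₂ v₂ p₁ p₂ c s : ℝ} (hcs : c ^ 2 + s ^ 2 = 1) :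
    Matrix.det (Matrix.of ![![u₁ * c - r₁ * (s * p₁), u₁ * s + r₁ * (c * p₁), v₁],
      ![u₂ * c - r₂ * (s * p₂), u₂ * s + r₂ * (c * p₂), v₂],
      ![r₁ * c, r₁ * s, l₁] - ![r₂ * c, r₂ * s, l₂]]) =
    (r₁ - r₂) * (r₁ * p₁ * v₂ - v₁ * (r₂ * p₂)) + (l₁ - l₂) * (u₁ * (r₂ * p₂) - r₁ * p₁ * u₂) := by
  rw [Matrix.det_fin_three]
  simp [Matrix.of_apply]
  linear_combination ((r₁ - r₂) * (r₁ * p₁ * v₂ - v₁ * (r₂ * p₂)) +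
    (l₁ - l₂) * (u₁ * (r₂ * p₂) - r₁ * p₁ * u₂)) * hcs

theorem hasDerivAt_pt (K : AxisKnot) (t : ℝ) : deriv K.pt t =
    ![deriv K.rho t * Real.cos (K.theta t) - K.rho t * (Real.sin (K.theta t) * deriv K.theta t),
      deriv K.rho t * Real.sin (K.theta t) + K.rho t * (Real.cos (K.theta t) * deriv K.theta t),
      deriv K.ell t] := by
  have h1 := (K.smooth_rho.differentiable (by simp) t).hasDerivAt
  have h2 := (K.smooth_ell.differentiable (by simp) t).hasDerivAt
  have h3 := (K.smooth_theta.differentiable (by simp) t).hasDerivAt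
  apply HasDerivAt.deriv
  rw [hasDerivAt_pi]
  intro i
  fin_cases i
  · have := h1.mul h3.cos
    refine this.congr_deriv ?_
    simp
    ring
  · have := h1.mul h3.sin
    exact this.congr_deriv (by simp)
  · exact h2

end

section

variable {N k : ℕ} {w : List (ℕ × Bool)}

local notation "sectorCount" => ((w.length + 2 * k : ℕ) : ℝ)

/-! ## Signs of secants and crossings of the knot -/

theorem orientSign_cast (o : Bool) : (orientSign o : ℝ) = 1 ∨ (orientSign o : ℝ) = -1 := by
  cases o <;> simp [orientSign]

theorem sign_orientSign (o : Bool) : (SignType.sign (orientSign o : ℝ) : ℤ) = orientSign o := by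
  cases o <;> simp [orientSign]

namespace IsKnotDiagram

variable (h : IsKnotDiagram N k w)
include h

/-- The ratio of the speeds of the diagram parameter and the angle. -/
theorem exists_velocity {t a : ℕ} {x s : ℝ} (hx : x ∈ Ioo (1 / 4 : ℝ) (3 / 4))
    (hs : h.IsTime t a x s) : ∃ c : ℝ, 0 < c ∧ deriv h.knot.theta s =
        orientSign (h.orient a) * c * (2 * Real.pi / sectorCount) ∧
      deriv h.knot.rho s = orientSign (h.orient a) * c * ((shVel N (gen w t).1 (gen w t).2
        (crossParam x) (braidPerm (w.take t) a)).1 * (2 * deriv smoothStep x)) ∧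
      deriv h.knot.ell s = orientSign (h.orient a) * c * ((shVel N (gen w t).1 (gen w t).2
        (crossParam x) (braidPerm (w.take t) a)).2 * (2 * deriv smoothStep x)) := by
  obtain ⟨c, hc, e0, e1, e2⟩ := hs.velocity
  obtain ⟨d1, d2⟩ := hasDerivAt_crossCurve_window (N := N) (i := (gen w t).1) (pos := (gen w t).2)
    (braidPerm (w.take t) a) hx
  exact ⟨c, hc, e0, e1.trans (congrArg _ d1.deriv), e2.trans (congrArg _ d2.deriv)⟩

theorem planePt_window {t a : ℕ} {x s : ℝ} (hx : x ∈ Ioo (1 / 4 : ℝ) (3 / 4))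
    (hs : h.IsTime t a x s) : h.knot.planePt s = shPt N (gen w t).1 (gen w t).2
        (crossParam x) (braidPerm (w.take t) a) :=
  hs.point_eq.trans (crossCurve_window ⟨hx.1.le, hx.2.le⟩ _)

theorem IsTime.deriv_theta_ne {t a : ℕ} {x s : ℝ} (hs : h.IsTime t a x s) :
    deriv h.knot.theta s ≠ 0 := by
  obtain ⟨c, hc, e0, -⟩ := hs.velocity
  have hM : (0 : ℝ) < sectorCount := by exact_mod_cast h.sectors_pos
  rw [e0]
  rcases orientSign_cast (h.orient a) with e | e <;> rw [e] <;>
  · have := Real.pi_pos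
    positivity

/-- The ratio of the angular velocities in the knot and in the sheared configuration. -/
def rate (w : List (ℕ × Bool)) (k : ℕ) (x : ℝ) : ℝ :=
  2 * deriv smoothStep x / (2 * Real.pi / ((w.length + 2 * k : ℕ) : ℝ))

omit h in
theorem rate_pos (hw : 0 < w.length + 2 * k) {x : ℝ} (hx : x ∈ Ioo (1 / 4 : ℝ) (3 / 4)) :
    0 < rate w k x := by
  have hM : (0 : ℝ) < sectorCount := by exact_mod_cast hw
  have := deriv_smoothStep_pos hx.1 hx.2
  have := Real.pi_pos
  unfold rate
  positivity

section secant

variable {t a b : ℕ} {x s s' : ℝ} (hx : x ∈ Ioo (1 / 4 : ℝ) (3 / 4))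
  (hs : h.IsTime t a x s) (hs' : h.IsTime t b x s')
include hx hs hs'

local notation "here" => braidPerm (List.take t w)
local notation "ptAt" => shPt N (Prod.fst (gen w t)) (Prod.snd (gen w t)) (crossParam x)
local notation "velAt" => shVel N (Prod.fst (gen w t)) (Prod.snd (gen w t)) (crossParam x)

theorem secantSign_eq : h.knot.secantSign (s, s') = orientSign (h.orient a) *
    orientSign (h.orient b) * (SignType.sign (skewDet (ptAt (here a)) (velAt (here a))
      (ptAt (here b))
      (velAt (here b))) : ℤ) := by
  obtain ⟨c, hc, e0, e1, e2⟩ := h.exists_velocity hx hs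
  obtain ⟨c', hc', e0', e1', e2'⟩ := h.exists_velocity hx hs'
  have p := h.planePt_window hx hs
  have p' := h.planePt_window hx hs'
  have ang : (h.knot.theta s' : Real.Angle) = h.knot.theta s := by rw [hs.angle_eq, hs'.angle_eq]
  have hcos : Real.cos (h.knot.theta s') = Real.cos (h.knot.theta s) := by
    rw [← Real.Angle.cos_coe, ang, Real.Angle.cos_coe]
  have hsin : Real.sin (h.knot.theta s') = Real.sin (h.knot.theta s) := by
    rw [← Real.Angle.sin_coe, ang, Real.Angle.sin_coe]
  set u := velAt (here a)
  set v := velAt (here b)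
  have hM : (0 : ℝ) < sectorCount := by exact_mod_cast h.sectors_pos
  set W := 2 * Real.pi / sectorCount
  have hW : 0 < W := by have := Real.pi_pos; positivity
  have hD := deriv_smoothStep_pos hx.1 hx.2
  set D := deriv smoothStep x
  rw [← p, ← p']
  unfold AxisKnot.secantSign
  simp only [hasDerivAt_pt, AxisKnot.pt, hcos, hsin]
  rw [det_secant (Real.cos_sq_add_sin_sq _), e0, e0', e1, e1', e2, e2']
  rw [← sign_orientSign (h.orient a), ← sign_orientSign (h.orient b), ← SignType.coe_mul,
    ← SignType.coe_mul, ← sign_mul, ← sign_mul]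
  congr 1
  have hpos : 0 < c * c' * W * (2 * D) := by positivity
  rw [← one_mul (SignType.sign (_ * skewDet _ _ _ _)), ← sign_pos hpos, ← sign_mul]
  congr 1
  simp only [skewDet, AxisKnot.planePt, sign_orientSign]
  ring

theorem slope_eq : h.knot.slope (s, s') = -(rate w k x * shTurn N (gen w t).1 (gen w t).2
    (crossParam x) (here a, here b)) := by
  obtain ⟨c, hc, e0, e1, e2⟩ := h.exists_velocity hx hs
  obtain ⟨c', hc', e0', e1', e2'⟩ := h.exists_velocity hx hs'
  have p := h.planePt_window hx hs
  have p' := h.planePt_window hx hs'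
  unfold shTurn rate
  simp only
  set u := velAt (here a)
  set v := velAt (here b)
  have hM : (0 : ℝ) < sectorCount := by exact_mod_cast h.sectors_pos
  set W := 2 * Real.pi / sectorCount
  have hW : 0 < W := by have := Real.pi_pos; positivity
  set D := deriv smoothStep x
  have q : ∀ (o : Bool) (c y : ℝ), 0 < c →
      orientSign o * c * (y * (2 * D)) / (orientSign o * c * W) = 2 * D / W * y := by
    intro o c y hc
    have : (orientSign o : ℝ) ≠ 0 := by rcases orientSign_cast o with e | e <;> rw [e] <;> norm_num
    field_simp
  rw [← p, ← p']
  unfold AxisKnot.slope turn wronskian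
  simp only
  rw [e0, e0', e1, e1', e2, e2', q _ _ _ hc, q _ _ _ hc, q _ _ _ hc', q _ _ _ hc']
  simp only [AxisKnot.planePt]
  ring

variable (hcoh : Coherent N (gen w t).1 (gen w t).2 (crossParam x)
  (braidPerm (w.take t) a, braidPerm (w.take t) b))
include hcoh

/-- The orientations of the arcs of the trace graph are those of the pairs of strands. -/
theorem arcDirection_eq : h.knot.secantSign (s, s') ≠ 0 ∧ h.knot.slope (s, s') ≠ 0 ∧
    h.knot.arcDirection (s, s') = orientSign (h.orient a) * orientSign (h.orient b) := by
  have e1 := h.secantSign_eq hx hs hs'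
  have e2 := h.slope_eq hx hs hs'
  have hr := rate_pos h.sectors_pos hx
  unfold Coherent at hcoh
  unfold shTurn turn at e2
  unfold AxisKnot.arcDirection
  simp only at hcoh e2
  set P := ptAt (here a)
  set Q := ptAt (here b)
  set u := velAt (here a)
  set v := velAt (here b)
  have hd : 0 < (Q.2 - P.2) ^ 2 + (Q.1 - P.1) ^ 2 := by
    rcases eq_or_ne (Q.1 - P.1) 0 with e | e
    · rcases eq_or_ne (Q.2 - P.2) 0 with e' | e'
      · simp [wronskian, e, e'] at hcoh
      · positivity
    · positivity
  set W := wronskian P u Q v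
  set S := skewDet P u Q v
  set d := (Q.2 - P.2) ^ 2 + (Q.1 - P.1) ^ 2
  have o1 : orientSign (h.orient a) * orientSign (h.orient b) ≠ 0 := by
    cases h.orient a <;> cases h.orient b <;> simp [orientSign]
  have hq : rate w k x * (W / d) = rate w k x / d * W := by ring
  have hrd : 0 < rate w k x / d := div_pos hr hd
  rw [hq] at e2
  rcases mul_neg_iff.1 hcoh with ⟨hW, hS⟩ | ⟨hW, hS⟩
  · have n2 : h.knot.slope (s, s') < 0 := by rw [e2]; linarith [mul_pos hrd hW]
    rw [sign_neg hS] at e1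
    refine ⟨?_, n2.ne, ?_⟩
    · rw [e1]; simpa using o1
    · rw [e1, sign_neg n2]; simp
  · have n2 : 0 < h.knot.slope (s, s') := by
      rw [e2]; linarith [mul_neg_of_pos_of_neg hrd hW]
    rw [sign_pos hS] at e1
    refine ⟨?_, n2.ne', ?_⟩
    · rw [e1]; simpa using o1
    · rw [e1, sign_pos n2]; simp

end secant

theorem sign_slope_sub {t a b c d : ℕ} {x s₁ s₂ s₃ s₄ : ℝ} (hx : x ∈ Ioo (1 / 4 : ℝ) (3 / 4))
    (h1 : h.IsTime t a x s₁) (h2 : h.IsTime t b x s₂) (h3 : h.IsTime t c x s₃)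
    (h4 : h.IsTime t d x s₄) :
    SignType.sign (h.knot.slope (s₁, s₂) - h.knot.slope (s₃, s₄)) =
      SignType.sign (shTurn N (gen w t).1 (gen w t).2 (crossParam x)
          (braidPerm (w.take t) c, braidPerm (w.take t) d) -
        shTurn N (gen w t).1 (gen w t).2 (crossParam x)
          (braidPerm (w.take t) a, braidPerm (w.take t) b)) := by
  rw [h.slope_eq hx h1 h2, h.slope_eq hx h3 h4, ← one_mul (SignType.sign (shTurn _ _ _ _ _ - _)),
    ← sign_pos (rate_pos h.sectors_pos hx), ← sign_mul]
  congr 1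
  ring

end IsKnotDiagram

end

section

variable {N k : ℕ} {w : List (ℕ × Bool)}

/-! ## The crossings of the trace graph of the knot -/

/-- The strand that is in the position `b` before the generator number `t`. -/
def strandAt (w : List (ℕ × Bool)) (t b : ℕ) : ℕ := (braidPerm (w.take t)).symm b

theorem braidPerm_strandAt (t b : ℕ) : braidPerm (w.take t) (strandAt w t b) = b :=
  Equiv.apply_symm_apply _ _

/-- The data describing a crossing of the trace graph: the number of the generator, the positions of
two strands not taking part in it, the kind of the crossing and its orientation. -/
abbrev CrossCode : Type := ℕ × ℕ × ℕ × CrossKind × Bool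

/-- The positions of the over and under secants. -/
def quad (w : List (ℕ × Bool)) (c : CrossCode) : (ℕ × ℕ) × (ℕ × ℕ) :=
  orientedQuad (gen w c.1).1 (gen w c.1).2 c.2.1 c.2.2.1 c.2.2.2.1 c.2.2.2.2

/-- The codes of the crossings. -/
def IsCode (N : ℕ) (w : List (ℕ × Bool)) (c : CrossCode) : Prop :=
  c.1 < w.length ∧ ValidCross N (gen w c.1).1 c.2.1 c.2.2.1 c.2.2.2.1

namespace IsKnotDiagram

variable (h : IsKnotDiagram N k w)
include h

theorem strandAt_lt {t b : ℕ} (hb : b < N) : strandAt w t b < N := by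
  rw [← braidPerm_strandAt (w := w) t b, ← posAt_gen (k := k)] at hb
  exact (posAt_lt h.word_le _ _).1 hb

/-- The knot is at the times `Q` in the four points of the crossing with the code `c`. -/
def Realizes (c : CrossCode) (Q : (ℝ × ℝ) × (ℝ × ℝ)) : Prop :=
  ∃ x ∈ Ioo (1 / 4 : ℝ) (3 / 4),
    crossRoot N (gen w c.1).1 (gen w c.1).2 c.2.1 c.2.2.1 c.2.2.2.1 (crossParam x) = 0 ∧
    h.IsTime c.1 (strandAt w c.1 (quad w c).1.1) x Q.1.1 ∧
    h.IsTime c.1 (strandAt w c.1 (quad w c).1.2) x Q.1.2 ∧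
    h.IsTime c.1 (strandAt w c.1 (quad w c).2.1) x Q.2.1 ∧
    h.IsTime c.1 (strandAt w c.1 (quad w c).2.2) x Q.2.2

theorem quad_mem {c : CrossCode} (hc : IsCode N w c) :
    ((quad w c).1.1 < N ∧ (quad w c).1.2 < N ∧ (quad w c).2.1 < N ∧ (quad w c).2.2 < N) ∧
      (quad w c).1.1 ≠ (quad w c).1.2 ∧ (quad w c).2.1 ≠ (quad w c).2.2 :=
  orientedQuad_mem (gen_le h.word_le hc.1) hc.2 _ _

theorem exists_realizes {c : CrossCode} (hc : IsCode N w c) : ∃ Q, h.Realizes c Q := by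
  obtain ⟨y, hy, ey⟩ := exists_crossRoot (gen w c.1).2 (gen_le h.word_le hc.1) hc.2
  obtain ⟨x, hx, rfl⟩ := exists_crossParam hy
  have hx' : x ∈ Ioo (0 : ℝ) 1 := ⟨by linarith [hx.1], by linarith [hx.2]⟩
  obtain ⟨⟨n1, n2, n3, n4⟩, -⟩ := h.quad_mem hc
  obtain ⟨s1, h1⟩ := h.exists_isTime hc.1 (h.strandAt_lt (t := c.1) n1) hx'
  obtain ⟨s2, h2⟩ := h.exists_isTime hc.1 (h.strandAt_lt (t := c.1) n2) hx'
  obtain ⟨s3, h3⟩ := h.exists_isTime hc.1 (h.strandAt_lt (t := c.1) n3) hx'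
  obtain ⟨s4, h4⟩ := h.exists_isTime hc.1 (h.strandAt_lt (t := c.1) n4) hx'
  exact ⟨((s1, s2), (s3, s4)), x, hx, ey, h1, h2, h3, h4⟩

omit h in
theorem genCurve_strandAt (t b : ℕ) (x : ℝ) :
    genCurve N w t (strandAt w t b) x = crossCurve N (gen w t).1 (gen w t).2 b x := by
  rw [genCurve, braidPerm_strandAt]

theorem mem_secants {t b b' : ℕ} {x s s' : ℝ} (hb : b < N) (hb' : b' < N) (hne : b ≠ b')
    (hs : h.IsTime t (strandAt w t b) x s) (hs' : h.IsTime t (strandAt w t b') x s') :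
    (s, s') ∈ h.knot.secants := by
  refine ⟨hs.mem, hs'.mem, ?_, hs.angle_eq.trans hs'.angle_eq.symm⟩
  rintro e
  simp only at e
  have := hs.point_eq.symm.trans (e ▸ hs'.point_eq)
  rw [genCurve_strandAt, genCurve_strandAt] at this
  exact crossCurve_ne hb hb' hne this

theorem Realizes.mem_crossings {c : CrossCode} (hc : IsCode N w c) {Q : (ℝ × ℝ) × (ℝ × ℝ)}
    (hQ : h.Realizes c Q) : Q ∈ h.knot.crossings := by
  obtain ⟨x, hx, e, h1, h2, h3, h4⟩ := hQ
  obtain ⟨⟨n1, n2, n3, n4⟩, m1, m2⟩ := h.quad_mem hc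
  obtain ⟨a1, a2, a3⟩ := h.secant_coords h1 h2
  obtain ⟨b1, b2, b3⟩ := h.secant_coords h3 h4
  have hcr := orientedQuad_crosses (shearAmount N (gen w c.1).2 x) (gen_le h.word_le hc.1) hc.2
    (crossParam_mem x) e c.2.2.2.2
  refine ⟨h.mem_secants n1 n2 m1 h1 h2, h.mem_secants n3 n4 m2 h3 h4, a1.trans b1.symm, ?_, ?_⟩
  · refine a2.trans (Eq.trans ?_ b2.symm)
    simp only [genCurve_strandAt]
    exact hcr.1
  · refine lt_of_eq_of_lt b3 (lt_of_lt_of_eq ?_ a3.symm)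
    simp only [genCurve_strandAt]
    exact hcr.2

theorem isTime_of_point {t b : ℕ} (ht : t < w.length) (hb : b < N) {x s : ℝ}
    (hx : x ∈ Ioo (0 : ℝ) 1) (hs : s ∈ Ico (0 : ℝ) 1)
    (e : (h.knot.theta s : Real.Angle) = sectorAngle (w.length + 2 * k) (k + t) x)
    (e' : h.knot.planePt s = crossCurve N (gen w t).1 (gen w t).2 b x) :
    h.IsTime t (strandAt w t b) x s := by
  obtain ⟨s', hs'⟩ := h.exists_isTime ht (h.strandAt_lt (t := t) hb) hx
  have : s = s' := h.time_unique hs hs'.mem (e.trans hs'.angle_eq.symm)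
    (by rw [e', hs'.point_eq, genCurve_strandAt])
  rwa [this]

theorem exists_code_of_mem {Q : (ℝ × ℝ) × (ℝ × ℝ)} (hQ : Q ∈ h.knot.crossings) :
    ∃ c, IsCode N w c ∧ h.Realizes c Q := by
  obtain ⟨⟨i1, i2, ne1, f1⟩, ⟨i3, i4, ne2, f2⟩, hphi, htau, hh⟩ := hQ
  unfold AxisKnot.phi at hphi
  obtain ⟨j, hj, x, hx, ex⟩ := exists_sector h.sectors_pos (h.knot.theta Q.1.1 : Real.Angle)
  have g1 := ex
  have g2 := f1.symm.trans ex
  have g3 := hphi.symm.trans ex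
  have g4 := f2.symm.trans g3
  have mem : ∀ s, (h.knot.theta s : Real.Angle) = sectorAngle (w.length + 2 * k) j x →
      (x, h.knot.planePt s) ∈ elemTangle N (letterAt N k w j) := by
    intro s e
    have m := h.planePt_mem s
    rwa [e, h.fiber_iff hj hx] at m
  have pne : ∀ s s', s ∈ Ico (0 : ℝ) 1 → s' ∈ Ico (0 : ℝ) 1 → s ≠ s' →
      (h.knot.theta s : Real.Angle) = h.knot.theta s' → h.knot.planePt s ≠ h.knot.planePt s' :=
    fun s s' hs hs' hne e e' => hne (h.time_unique hs hs' e e')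
  have noPar : ¬ NoParallel {P | (x, P) ∈ elemTangle N (letterAt N k w j)} := by
    intro np
    obtain ⟨e1, e2⟩ := np _ (mem _ g1) _ (mem _ g2) _ (mem _ g3) _ (mem _ g4)
      (pne _ _ i1 i2 ne1 f1) (pne _ _ i3 i4 ne2 f2) htau
    unfold AxisKnot.height at hh
    rw [e1, e2] at hh
    exact lt_irrefl _ hh
  have hval := letterAt_valid h.plat_le h.word_le hj
  rcases hl : letterAt N k w j with c | ⟨i, pos⟩ | c
  · rw [hl] at noPar hval
    exact absurd (noParallel_birth hval x) noPar
  swap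
  · rw [hl] at noPar hval
    exact absurd (noParallel_death hval x) noPar
  obtain ⟨t, rfl, ht⟩ : ∃ t, j = k + t ∧ t < w.length := by
    rcases Nat.lt_or_ge j k with hjk | hjk
    · rw [letterAt_birth (by omega) (by omega)] at hl
      cases hl
    · obtain ⟨t, rfl⟩ := Nat.exists_eq_add_of_le hjk
      refine ⟨t, rfl, ?_⟩
      by_contra hn
      rw [letterAt_death (by omega) (by omega)] at hl
      cases hl
  rw [letterAt_gen ht] at mem
  obtain ⟨-, b1, n1, p1⟩ := exists_of_mem_cross (mem _ g1)
  obtain ⟨-, b2, n2, p2⟩ := exists_of_mem_cross (mem _ g2)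
  obtain ⟨-, b3, n3, p3⟩ := exists_of_mem_cross (mem _ g3)
  obtain ⟨-, b4, n4, p4⟩ := exists_of_mem_cross (mem _ g4)
  simp only at p1 p2 p3 p4
  have m1 : b1 ≠ b2 := fun e => pne _ _ i1 i2 ne1 f1 (by rw [p1, p2, e])
  have m2 : b3 ≠ b4 := fun e => pne _ _ i3 i4 ne2 f2 (by rw [p3, p4, e])
  unfold AxisKnot.tau at htau
  unfold AxisKnot.height at hh
  rw [p1, p2, p3, p4] at htau hh
  have hcr : Crosses (fun b => shear (shearAmount N (gen w t).2 x)
      (config N (gen w t).1 (gen w t).2 (crossParam x) b)) ((b1, b2), (b3, b4)) := ⟨htau, hh⟩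
  obtain ⟨r, s, kd, f, hv, hq, hr⟩ := hcr.exists_code _ (gen_le h.word_le ht) (crossParam_mem x)
    ⟨n1, n2, n3, n4⟩ m1 m2
  have hx1 := mem_of_crossParam (root_mem_Ioo (gen_le h.word_le ht) hv (crossParam_mem x) hr)
  have hx2 : x ∈ Ioo (0 : ℝ) 1 := ⟨by linarith [hx1.1], by linarith [hx1.2]⟩
  refine ⟨(t, r, s, kd, f), ⟨ht, hv⟩, x, hx1, hr, ?_⟩
  have hq' : quad w (t, r, s, kd, f) = ((b1, b2), (b3, b4)) := hq
  rw [hq']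
  exact ⟨h.isTime_of_point ht n1 hx2 i1 g1 p1, h.isTime_of_point ht n2 hx2 i2 g2 p2,
    h.isTime_of_point ht n3 hx2 i3 g3 p3, h.isTime_of_point ht n4 hx2 i4 g4 p4⟩

theorem IsTime.sector_unique {t t' a a' : ℕ} (ht : t < w.length) (ht' : t' < w.length)
    {x x' s : ℝ} (hx : x ∈ Ioo (0 : ℝ) 1) (hx' : x' ∈ Ioo (0 : ℝ) 1) (hs : h.IsTime t a x s)
    (hs' : h.IsTime t' a' x' s) : t = t' ∧ x = x' := by
  have e := hs.angle_eq.symm.trans hs'.angle_eq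
  rw [sectorAngle_eq_iff h.sectors_pos] at e
  obtain ⟨n, hn⟩ := e
  push_cast at hn
  have l1 : (t : ℝ) + 1 ≤ w.length := by exact_mod_cast ht
  have l2 : (t' : ℝ) + 1 ≤ w.length := by exact_mod_cast ht'
  have c1 := hx.1
  have c2 := hx.2
  have c1' := hx'.1
  have c2' := hx'.2
  have t0 : (0 : ℝ) ≤ t := t.cast_nonneg
  have t0' : (0 : ℝ) ≤ t' := t'.cast_nonneg
  have k0 : (0 : ℝ) ≤ k := k.cast_nonneg
  have hn0 : n = 0 := by
    have u1 : n < 1 := by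
      by_contra hc
      have : (1 : ℝ) ≤ n := by exact_mod_cast not_lt.1 hc
      nlinarith
    have u2 : -1 < n := by
      by_contra hc
      have : (n : ℝ) ≤ -1 := by exact_mod_cast not_lt.1 hc
      nlinarith
    omega
  rw [hn0] at hn
  push_cast at hn
  have d1 : t < t' + 1 := by
    have : (t : ℝ) < t' + 1 := by linarith
    exact_mod_cast this
  have d2 : t' < t + 1 := by
    have : (t' : ℝ) < t + 1 := by linarith
    exact_mod_cast this
  have ett : t = t' := by omega
  subst ett
  exact ⟨rfl, by linarith⟩

theorem IsTime.position_unique {t b b' : ℕ} (hb : b < N) (hb' : b' < N) {x s : ℝ}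
    (hs : h.IsTime t (strandAt w t b) x s) (hs' : h.IsTime t (strandAt w t b') x s) : b = b' := by
  by_contra hne
  have := hs.point_eq.symm.trans hs'.point_eq
  rw [genCurve_strandAt, genCurve_strandAt] at this
  exact crossCurve_ne hb hb' hne this

theorem Realizes.code_unique {c c' : CrossCode} (hc : IsCode N w c) (hc' : IsCode N w c')
    {Q : (ℝ × ℝ) × (ℝ × ℝ)} (hQ : h.Realizes c Q) (hQ' : h.Realizes c' Q) : c = c' := by
  obtain ⟨x, hx, e, h1, h2, h3, h4⟩ := hQ
  obtain ⟨x', hx', e', h1', h2', h3', h4'⟩ := hQ'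
  obtain ⟨⟨n1, n2, n3, n4⟩, -⟩ := h.quad_mem hc
  obtain ⟨⟨n1', n2', n3', n4'⟩, -⟩ := h.quad_mem hc'
  obtain ⟨et, ex⟩ := IsTime.sector_unique h hc.1 hc'.1 ⟨by linarith [hx.1], by linarith [hx.2]⟩
    ⟨by linarith [hx'.1], by linarith [hx'.2]⟩ h1 h1'
  obtain ⟨t, r, s, kd, f⟩ := c
  obtain ⟨t', r', s', kd', f'⟩ := c'
  simp only at et
  subst et ex
  have q : quad w (t, r, s, kd, f) = quad w (t, r', s', kd', f') :=
    Prod.ext (Prod.ext (IsTime.position_unique h n1 n1' h1 h1')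
      (IsTime.position_unique h n2 n2' h2 h2')) (Prod.ext (IsTime.position_unique h n3 n3' h3 h3')
      (IsTime.position_unique h n4 n4' h4 h4'))
  obtain ⟨e1, e2, e3, e4⟩ := orientedQuad_injective hc.2 hc'.2 q
  simp only at e1 e2 e3 e4
  rw [e1, e2, e3, e4]

/-- The signs of the orientations of the four strands of a crossing, multiplied by the sign of the
crossing of the unoriented arcs. -/
def codeSign (c : CrossCode) : ℤ :=
  orientSign (h.orient (strandAt w c.1 (quad w c).1.1)) *
    orientSign (h.orient (strandAt w c.1 (quad w c).1.2)) *
    (orientSign (h.orient (strandAt w c.1 (quad w c).2.1)) *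
    orientSign (h.orient (strandAt w c.1 (quad w c).2.2))) *
    crossSgn (gen w c.1).1 (gen w c.1).2 c.2.1 c.2.2.1 c.2.2.2.1 c.2.2.2.2

/-- The markings of the two arcs, as integers. -/
def codeMarking (c : CrossCode) : ℤ × ℤ :=
  (h.level (strandAt w c.1 (quad w c).1.1) - h.level (strandAt w c.1 (quad w c).1.2),
    h.level (strandAt w c.1 (quad w c).2.1) - h.level (strandAt w c.1 (quad w c).2.2))

theorem Realizes.generic {c : CrossCode} (hc : IsCode N w c) {Q : (ℝ × ℝ) × (ℝ × ℝ)}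
    (hQ : h.Realizes c Q) :
    (h.knot.secantSign Q.1 ≠ 0 ∧ h.knot.secantSign Q.2 ≠ 0 ∧
      h.knot.slope Q.1 ≠ 0 ∧ h.knot.slope Q.2 ≠ 0) ∧
    h.knot.slope Q.1 ≠ h.knot.slope Q.2 ∧ h.knot.crossingSign Q = h.codeSign c ∧
    h.knot.marking Q.1 = ((h.codeMarking c).1 : ZMod h.knot.lk.natAbs) ∧
    h.knot.marking Q.2 = ((h.codeMarking c).2 : ZMod h.knot.lk.natAbs) := by
  obtain ⟨x, hx, e, h1, h2, h3, h4⟩ := hQ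
  obtain ⟨c1, c2, c3⟩ := orientedQuad_signs (gen_le h.word_le hc.1) hc.2 (crossParam_mem x) e
    c.2.2.2.2
  obtain ⟨a1, a2, a3⟩ := h.arcDirection_eq hx h1 h2
    (by simp only [braidPerm_strandAt]; exact c1)
  obtain ⟨b1, b2, b3⟩ := h.arcDirection_eq hx h3 h4
    (by simp only [braidPerm_strandAt]; exact c2)
  have hs := h.sign_slope_sub hx h1 h2 h3 h4
  simp only [braidPerm_strandAt] at hs
  have hs' : (SignType.sign (h.knot.slope Q.1 - h.knot.slope Q.2) : ℤ) = crossSgn (gen w c.1).1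
      (gen w c.1).2 c.2.1 c.2.2.1 c.2.2.2.1 c.2.2.2.2 := (congrArg _ hs).trans c3
  refine ⟨⟨a1, b1, a2, b2⟩, ?_, ?_, h.marking_eq h1 h2, h.marking_eq h3 h4⟩
  · intro e0
    rw [e0, sub_self, sign_zero] at hs'
    rcases crossSgn_cases (gen w c.1).1 (gen w c.1).2 c.2.1 c.2.2.1 c.2.2.2.1 c.2.2.2.2 with e | e <;>
      rw [e] at hs' <;> simp at hs'
  · unfold AxisKnot.crossingSign codeSign
    rw [hs']
    congr 1
    exact congrArg₂ _ a3 b3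

theorem secant_eq {c : CrossCode} (hc : IsCode N w c) {Q : (ℝ × ℝ) × (ℝ × ℝ)}
    (hQ : h.Realizes c Q) {A : ℝ × ℝ} (hA : A ∈ h.knot.secants)
    (hphi : h.knot.phi A = h.knot.phi Q.1) (htau : h.knot.tau A = h.knot.tau Q.1) :
    A = Q.1 ∨ A = Q.2 := by
  have hcr := hQ.mem_crossings h hc
  obtain ⟨-, -, -, htau', hh⟩ := hcr
  obtain ⟨x, hx, e, h1, h2, h3, h4⟩ := hQ
  obtain ⟨⟨n1, n2, n3, n4⟩, m1, m2⟩ := h.quad_mem hc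
  obtain ⟨i1, i2, ne1, f1⟩ := hA
  have hx' : x ∈ Ioo (0 : ℝ) 1 := ⟨by linarith [hx.1], by linarith [hx.2]⟩
  have g1 : (h.knot.theta A.1 : Real.Angle) = _ := Eq.trans hphi h1.angle_eq
  have g2 := f1.symm.trans g1
  obtain ⟨a, ha, ta⟩ := h.exists_strand hc.1 hx' i1 g1
  obtain ⟨b, hb, tb⟩ := h.exists_strand hc.1 hx' i2 g2
  obtain ⟨p, rfl⟩ : ∃ p, a = strandAt w c.1 p := ⟨_, ((braidPerm _).symm_apply_apply a).symm⟩
  obtain ⟨q, rfl⟩ : ∃ q, b = strandAt w c.1 q := ⟨_, ((braidPerm _).symm_apply_apply b).symm⟩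
  have hp : p < N := by
    rw [← braidPerm_strandAt (w := w) c.1 p, ← posAt_gen (k := k)]
    exact (posAt_lt h.word_le _ _).2 ha
  have hq : q < N := by
    rw [← braidPerm_strandAt (w := w) c.1 q, ← posAt_gen (k := k)]
    exact (posAt_lt h.word_le _ _).2 hb
  have hpq : p ≠ q := by
    rintro rfl
    exact ne1 (ta.unique h tb)
  have cr : ∀ {p q p' q' : ℕ} {A B : ℝ × ℝ}, h.IsTime c.1 (strandAt w c.1 p) x A.1 →
      h.IsTime c.1 (strandAt w c.1 q) x A.2 → h.IsTime c.1 (strandAt w c.1 p') x B.1 →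
      h.IsTime c.1 (strandAt w c.1 q') x B.2 → h.knot.tau A = h.knot.tau B →
      h.knot.height B < h.knot.height A →
      Crosses (fun b => shear (shearAmount N (gen w c.1).2 x)
        (config N (gen w c.1).1 (gen w c.1).2 (crossParam x) b)) ((p, q), (p', q')) := by
    intro p q p' q' A B t1 t2 t3 t4 et eh
    obtain ⟨-, u1, u2⟩ := h.secant_coords t1 t2
    obtain ⟨-, v1, v2⟩ := h.secant_coords t3 t4
    rw [genCurve_strandAt, genCurve_strandAt] at u1 u2 v1 v2
    exact ⟨u1.symm.trans (et.trans v1), v2.symm.trans_lt (eh.trans_eq u2)⟩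
  have key : ∀ {p' q' : ℕ} {B : ℝ × ℝ}, h.IsTime c.1 (strandAt w c.1 p') x B.1 →
      h.IsTime c.1 (strandAt w c.1 q') x B.2 → (p, q) = (p', q') → A = B := by
    intro p' q' B t1 t2 e
    obtain ⟨rfl, rfl⟩ := Prod.mk.inj e
    exact Prod.ext (ta.unique h t1) (tb.unique h t2)
  have c12 := cr h1 h2 h3 h4 htau' hh
  have hi := gen_le h.word_le hc.1
  rcases lt_trichotomy (h.knot.height A) (h.knot.height Q.1) with l | l | l
  · right
    exact key h3 h4 (Crosses.unique _ hi (crossParam_mem x) (Z := (quad w c).1) ⟨hp, hq⟩ ⟨n3, n4⟩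
      ⟨n1, n2⟩ hpq m2 m1 (Or.inr (cr h1 h2 ta tb htau.symm l)) (Or.inr c12))
  · left
    exact key h1 h2 (Crosses.unique _ hi (crossParam_mem x) (Z := (quad w c).2) ⟨hp, hq⟩ ⟨n1, n2⟩
      ⟨n3, n4⟩ hpq m1 m2 (Or.inl (cr ta tb h3 h4 (htau.trans htau') (hh.trans_eq l.symm)))
      (Or.inl c12))
  · right
    exact key h3 h4 (Crosses.unique _ hi (crossParam_mem x) (Z := (quad w c).1) ⟨hp, hq⟩ ⟨n3, n4⟩
      ⟨n1, n2⟩ hpq m2 m1 (Or.inl (cr ta tb h1 h2 htau l)) (Or.inr c12))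

end IsKnotDiagram

instance : Fintype CrossKind :=
  ⟨{.fixed, .straight, .skew}, fun x => by cases x <;> simp⟩

instance (N i r s : ℕ) (k : CrossKind) : Decidable (ValidCross N i r s k) := by
  unfold ValidCross; infer_instance

/-- All codes of crossings. -/
def codes (N : ℕ) (w : List (ℕ × Bool)) : Finset CrossCode :=
  (Finset.range w.length ×ˢ Finset.range N ×ˢ Finset.range N ×ˢ Finset.univ).filter
    fun c => ValidCross N (gen w c.1).1 c.2.1 c.2.2.1 c.2.2.2.1

theorem mem_codes {c : CrossCode} : c ∈ codes N w ↔ IsCode N w c := by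
  unfold codes IsCode
  simp only [Finset.mem_filter, Finset.mem_product, Finset.mem_range, Finset.mem_univ, and_true]
  constructor
  · rintro ⟨⟨h1, -, -⟩, h2⟩
    exact ⟨h1, h2⟩
  · rintro ⟨h1, h2⟩
    exact ⟨⟨h1, h2.1.trans h2.2.1, h2.2.1⟩, h2⟩

namespace IsKnotDiagram

variable (h : IsKnotDiagram N k w)
include h

open Classical in
/-- The crossing with a given code. -/
def crossing (c : CrossCode) : (ℝ × ℝ) × (ℝ × ℝ) :=
  if hc : IsCode N w c then (h.exists_realizes hc).choose else 0

theorem crossing_spec {c : CrossCode} (hc : IsCode N w c) : h.Realizes c (h.crossing c) := by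
  unfold crossing
  rw [dif_pos hc]
  exact (h.exists_realizes hc).choose_spec

theorem Realizes.unique {c : CrossCode} (hc : IsCode N w c) {Q Q' : (ℝ × ℝ) × (ℝ × ℝ)}
    (hQ : h.Realizes c Q) (hQ' : h.Realizes c Q') : Q = Q' := by
  obtain ⟨x, hx, e, h1, h2, h3, h4⟩ := hQ
  obtain ⟨x', hx', e', h1', h2', h3', h4'⟩ := hQ'
  have hi := gen_le h.word_le hc.1
  have r1 := root_mem_Ioo hi hc.2 (crossParam_mem x) e
  have r2 := root_mem_Ioo hi hc.2 (crossParam_mem x') e'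
  have : x = x' := crossParam_inj r1 (crossRoot_unique hi hc.2 (crossParam_mem x) r2 e e')
  subst this
  exact Prod.ext (Prod.ext (h1.unique h h1') (h2.unique h h2'))
    (Prod.ext (h3.unique h h3') (h4.unique h h4'))

theorem crossing_injOn : InjOn h.crossing {c | IsCode N w c} := by
  intro c hc c' hc' e
  exact Realizes.code_unique h hc hc' (h.crossing_spec hc) (e ▸ h.crossing_spec hc')

theorem crossings_eq (p : ZMod h.knot.lk.natAbs → ZMod h.knot.lk.natAbs → Prop)
    [DecidableRel p] :
    {Q | Q ∈ h.knot.crossings ∧ p (h.knot.marking Q.1) (h.knot.marking Q.2)} = h.crossing ''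
      ((codes N w).filter fun c => p ((h.codeMarking c).1) ((h.codeMarking c).2) : Set CrossCode) := by
  ext Q
  simp only [mem_ofPred_eq, Finset.coe_filter, mem_codes, mem_image]
  constructor
  · rintro ⟨hQ, hp⟩
    obtain ⟨c, hc, hr⟩ := h.exists_code_of_mem hQ
    obtain ⟨-, -, -, e1, e2⟩ := hr.generic h hc
    rw [e1, e2] at hp
    exact ⟨c, ⟨hc, hp⟩, Realizes.unique h hc (h.crossing_spec hc) hr⟩
  · rintro ⟨c, ⟨hc, hp⟩, rfl⟩
    have hr := h.crossing_spec hc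
    obtain ⟨-, -, -, e1, e2⟩ := hr.generic h hc
    rw [← e1, ← e2] at hp
    exact ⟨hr.mem_crossings h hc, hp⟩

theorem finsum_crossingSign (p : ZMod h.knot.lk.natAbs → ZMod h.knot.lk.natAbs → Prop)
    [DecidableRel p] :
    ∑ᶠ Q ∈ {Q | Q ∈ h.knot.crossings ∧ p (h.knot.marking Q.1) (h.knot.marking Q.2)},
      h.knot.crossingSign Q =
    ∑ c ∈ codes N w, if p ((h.codeMarking c).1) ((h.codeMarking c).2) then h.codeSign c else 0 := by
  rw [h.crossings_eq, finsum_mem_image, finsum_mem_coe_finset, Finset.sum_filter]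
  · refine Finset.sum_congr rfl fun c hc => ?_
    rw [mem_codes] at hc
    rw [((h.crossing_spec hc).generic h hc).2.2.1]
  · refine h.crossing_injOn.mono fun c hc => ?_
    rw [Finset.mem_coe, Finset.mem_filter, mem_codes] at hc
    exact hc.1

theorem inGeneralPosition : h.knot.InGeneralPosition where
  finite_fibers φ := by
    obtain ⟨j, hj, x, hx, rfl⟩ := exists_sector h.sectors_pos φ
    refine Set.Finite.of_finite_image ((elemTangle_fiber_finite N (letterAt N k w j) x).subset ?_)
      (f := h.knot.planePt) ?_
    · rintro _ ⟨s, ⟨hs, e⟩, rfl⟩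
      have m := h.planePt_mem s
      rwa [e, h.fiber_iff hj hx] at m
    · rintro s ⟨hs, e⟩ s' ⟨hs', e'⟩ ep
      exact h.time_unique hs hs' (e.trans e'.symm) ep
  finite_crossings := by
    have := h.crossings_eq fun _ _ => True
    simp only [and_true] at this
    change h.knot.crossings = _ at this
    rw [this]
    exact (Finset.finite_toSet _).image _
  transversal_to_fibers Q hQ := by
    obtain ⟨c, hc, x, hx, e, h1, h2, h3, h4⟩ := h.exists_code_of_mem hQ
    exact ⟨h1.deriv_theta_ne h, h2.deriv_theta_ne h, h3.deriv_theta_ne h, h4.deriv_theta_ne h⟩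
  not_tangent Q hQ := by
    obtain ⟨c, hc, hr⟩ := h.exists_code_of_mem hQ
    exact (hr.generic h hc).1
  transversal Q hQ := by
    obtain ⟨c, hc, hr⟩ := h.exists_code_of_mem hQ
    exact (hr.generic h hc).2.1
  double Q hQ A hA e1 e2 := by
    obtain ⟨c, hc, hr⟩ := h.exists_code_of_mem hQ
    exact h.secant_eq hc hr hA e1 e2

end IsKnotDiagram

end

section

/-! ## Reasoning about programs -/

variable {B : ℤ} {σ : Memory}

/-- The program `p`, started with `σ`, halts after at most `T` steps with a memory satisfying `Q`. -/
def Computes (B : ℤ) (p : Program) (σ : Memory) (T : ℕ) (Q : Memory → Prop) : Prop :=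
  ∃ T' σ', Runs B p σ T' σ' ∧ T' ≤ T ∧ Q σ'

theorem Computes.mono {p : Program} {T T' : ℕ} {Q Q' : Memory → Prop} (h : Computes B p σ T Q)
    (hT : T ≤ T') (hQ : ∀ σ, Q σ → Q' σ) : Computes B p σ T' Q' := by
  obtain ⟨t, σ', h1, h2, h3⟩ := h
  exact ⟨t, σ', h1, h2.trans hT, hQ _ h3⟩

theorem Computes.seq {p q : Program} {T T' : ℕ} {P Q : Memory → Prop} (hp : Computes B p σ T P)
    (hq : ∀ σ, P σ → Computes B q σ T' Q) : Computes B (.seq p q) σ (T + T') Q := by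
  obtain ⟨t, σ₁, h1, h2, h3⟩ := hp
  obtain ⟨t', σ₂, g1, g2, g3⟩ := hq _ h3
  exact ⟨t + t', σ₂, .seq h1 g1, by omega, g3⟩

/-- The effect of a program without loops. -/
def exec : Program → Memory → Memory
  | .skip, σ => σ
  | .store n i j e, σ => σ.write n (i.value σ) (j.value σ) (e.value σ)
  | .seq p q, σ => exec q (exec p σ)
  | .branch e f p q, σ => if e.value σ < f.value σ then exec p σ else exec q σ
  | .loop _ _ _, σ => σ

/-- A program without loops respects the bound on stored numbers. -/
def Fits (B : ℤ) : Program → Memory → Prop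
  | .skip, _ => True
  | .store _ i j e, σ => |i.value σ| ≤ B ∧ |j.value σ| ≤ B ∧ |e.value σ| ≤ B
  | .seq p q, σ => Fits B p σ ∧ Fits B q (exec p σ)
  | .branch e f p q, σ => if e.value σ < f.value σ then Fits B p σ else Fits B q σ
  | .loop _ _ _, _ => False

/-- A bound for the number of steps of a program without loops. -/
def weight : Program → ℕ
  | .skip => 1
  | .store _ i j e => i.cost + j.cost + e.cost + 1
  | .seq p q => weight p + weight q
  | .branch e f p q => e.cost + f.cost + 1 + (weight p + weight q)
  | .loop _ _ _ => 0

theorem computes_exec {p : Program} (h : Fits B p σ) :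
    Computes B p σ (weight p) fun σ' => σ' = exec p σ := by
  induction p generalizing σ with
  | skip => exact ⟨1, σ, .skip σ, le_rfl, rfl⟩
  | store n i j e => exact ⟨_, _, .store σ n i j e h.1 h.2.1 h.2.2, le_rfl, rfl⟩
  | seq p q hp hq => exact (hp h.1).seq fun σ' e => by subst e; exact hq h.2
  | branch e f p q hp hq =>
    unfold Fits at h
    by_cases c : e.value σ < f.value σ
    · rw [if_pos c] at h
      obtain ⟨t, σ', h1, h2, h3⟩ := hp h
      exact ⟨_, σ', .branch_true c h1, by rw [weight]; omega, by rw [h3, exec, if_pos c]⟩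
    · rw [if_neg c] at h
      obtain ⟨t, σ', h1, h2, h3⟩ := hq h
      exact ⟨_, σ', .branch_false c h1, by rw [weight]; omega, by rw [h3, exec, if_neg c]⟩
  | loop e f p hp => exact h.elim

theorem Computes.of_exec {p : Program} {T : ℕ} {Q : Memory → Prop} (h : Fits B p σ)
    (hT : weight p ≤ T) (hQ : Q (exec p σ)) : Computes B p σ T Q :=
  (computes_exec h).mono hT fun _ e => e ▸ hQ

theorem computes_loop {e f : IntExpr} {p : Program} {Inv : ℕ → Memory → Prop} {n c : ℕ}
    (hstep : ∀ i < n, ∀ σ, Inv i σ → e.value σ < f.value σ ∧ Computes B p σ c (Inv (i + 1)))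
    (hend : ∀ σ, Inv n σ → ¬ e.value σ < f.value σ) (h0 : Inv 0 σ) :
    Computes B (.loop e f p) σ (n * (c + (e.cost + f.cost + 1)) + (e.cost + f.cost + 1)) (Inv n) := by
  have key : ∀ d i, i + d = n → ∀ σ, Inv i σ → Computes B (.loop e f p) σ
      (d * (c + (e.cost + f.cost + 1)) + (e.cost + f.cost + 1)) (Inv n) := by
    intro d
    induction d with
    | zero =>
      intro i hi σ hσ
      obtain rfl : i = n := by omega
      exact ⟨_, σ, .loop_false (hend σ hσ), by omega, hσ⟩
    | succ d ih =>
      intro i hi σ hσ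
      obtain ⟨c1, t, σ₁, h1, h2, h3⟩ := hstep i (by omega) σ hσ
      obtain ⟨t', σ₂, g1, g2, g3⟩ := ih (i + 1) (by omega) σ₁ h3
      refine ⟨_, σ₂, .loop_true c1 h1 g1, ?_, g3⟩
      rw [Nat.succ_mul]
      omega
  exact key n 0 (by omega) σ h0

/-- The variable which is stored in the place `(0, 0)` of the array `n`. -/
abbrev var (n : ℕ) : IntExpr := .read n (.const 0) (.const 0)

/-- The entry `e` of the one-dimensional array `n`. -/
abbrev cell (n : ℕ) (e : IntExpr) : IntExpr := .read n (.const 0) e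

/-- Assignment of a value to a variable. -/
abbrev assign (n : ℕ) (e : IntExpr) : Program := .store n (.const 0) (.const 0) e

/-- Assignment of a value to an entry of a one-dimensional array. -/
abbrev setCell (n : ℕ) (i e : IntExpr) : Program := .store n (.const 0) i e

/-- Conditional assignment. -/
def select (n : ℕ) (e f a b : IntExpr) : Program := .branch e f (assign n a) (assign n b)

/-- Consecutive execution. -/
def block : List Program → Program
  | [] => .skip
  | p :: l => .seq p (block l)

/-- Counting the variable `x` from `0` to `b`. -/
def forLoop (x : ℕ) (b : IntExpr) (p : Program) : Program :=
  .seq (assign x (.const 0)) (.loop (var x) b (.seq p (assign x (.plus (var x) (.const 1)))))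

theorem write_apply (σ : Memory) (n a : ℕ) (i j v x y : ℤ) :
    σ.write n i j v a x y = if a = n ∧ x = i ∧ y = j then v else σ a x y := rfl

theorem write_name_ne {n a : ℕ} (h : a ≠ n) (i j v : ℤ) : σ.write n i j v a = σ a := by
  funext x y
  rw [write_apply, if_neg fun c => h c.1]

theorem exec_select (n : ℕ) (e f a b : IntExpr) : exec (select n e f a b) σ =
    σ.write n 0 0 (if e.value σ < f.value σ then a.value σ else b.value σ) := by
  unfold select
  simp only [exec, IntExpr.value]
  split_ifs <;> rfl

theorem fits_select (hB : 0 ≤ B) (n : ℕ) (e f a b : IntExpr) : Fits B (select n e f a b) σ ↔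
    |if e.value σ < f.value σ then a.value σ else b.value σ| ≤ B := by
  unfold select
  simp only [Fits, IntExpr.value, abs_zero]
  split_ifs <;> simp [hB]

theorem computes_for {x n c : ℕ} {b : IntExpr} {p : Program} {Inv : ℕ → Memory → Prop}
    (hB : (n : ℤ) ≤ B) (hframe : ∀ i σ v, Inv i σ → Inv i (σ.write x 0 0 v))
    (hb : ∀ i σ, Inv i σ → b.value σ = n)
    (hstep : ∀ i < n, ∀ σ, Inv i σ → σ x 0 0 = i →
      Computes B p σ c fun σ' => Inv (i + 1) σ' ∧ σ' x 0 0 = i) (h0 : Inv 0 σ) :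
    Computes B (forLoop x b p) σ (n * (c + b.cost + 12) + (b.cost + 12)) (Inv n) := by
  have hB0 : 0 ≤ B := (Nat.cast_nonneg n).trans hB
  have h1 : Computes B (assign x (.const 0)) σ 4 fun σ' => Inv 0 σ' ∧ σ' x 0 0 = (0 : ℕ) := by
    refine Computes.of_exec ?_ (by simp [weight, IntExpr.cost]) ⟨hframe 0 σ 0 h0, ?_⟩
    · simp [Fits, IntExpr.value, hB0]
    · simp [exec, IntExpr.value, write_apply]
  have h2 : ∀ σ, (Inv 0 σ ∧ σ x 0 0 = (0 : ℕ)) →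
      Computes B (.loop (var x) b (.seq p (assign x (.plus (var x) (.const 1))))) σ
        (n * ((c + 8) + ((var x).cost + b.cost + 1)) + ((var x).cost + b.cost + 1))
        fun σ' => Inv n σ' ∧ σ' x 0 0 = n := by
    intro σ h
    refine computes_loop (Inv := fun i σ => Inv i σ ∧ σ x 0 0 = (i : ℤ)) ?_ ?_ h
    · rintro i hi σ ⟨a1, a2⟩
      refine ⟨?_, (hstep i hi σ a1 a2).seq ?_⟩
      · rw [hb i σ a1]
        simpa [IntExpr.value, a2] using hi
      · rintro σ' ⟨b1, b2⟩
        refine Computes.of_exec ?_ (by simp [weight, IntExpr.cost]) ⟨hframe _ _ _ b1, ?_⟩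
        · simp only [Fits, IntExpr.value, abs_zero, b2, hB0, true_and]
          rw [abs_of_nonneg (by omega)]
          omega
        · simp [exec, IntExpr.value, write_apply, b2]
    · rintro σ ⟨a1, a2⟩
      rw [hb n σ a1]
      simp [IntExpr.value, a2]
  refine (h1.seq h2).mono ?_ fun _ h => h.1
  have : (var x).cost = 3 := rfl
  rw [this]
  have : n * (c + 8 + (3 + b.cost + 1)) = n * (c + b.cost + 12) := by ring
  omega

end

section

/-! ## Recording a crossing -/

variable {B : ℤ} {σ : Memory}

/-- Reduction modulo `m` of the difference of two reduced numbers. -/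
def reduced (m d : ℤ) : ℤ := if d < 0 then d + m else d

/-- The contributions of a crossing to the arrays of the writhes, if the strand in the position `b`
has the orientation `o b` and the reduced level `L b`. -/
def event (o L : ℕ → ℤ) (m : ℤ) (q : (ℕ × ℕ) × (ℕ × ℕ)) (e : ℤ) (n : ℕ) (x y : ℤ) : ℤ :=
  (if x = reduced m (L q.1.1 - L q.1.2) ∧ y = reduced m (L q.2.1 - L q.2.2) then
    o q.1.1 * o q.1.2 * (o q.2.1 * o q.2.2 * e) else 0) +
  if n = 1 ∧ x = reduced m (L q.2.1 - L q.2.2) ∧ y = reduced m (L q.1.1 - L q.1.2) then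
    o q.1.1 * o q.1.2 * (o q.2.1 * o q.2.2 * e) else 0

/-- The data by which crossings are recorded: the modulus is the entry `4`, the orientations and
levels are in the arrays `7` and `8`, and the array `31` is a multiplication table. -/
structure HasData (N : ℕ) (o L : ℕ → ℤ) (m : ℤ) (σ : Memory) : Prop where
  modulus : σ 4 0 0 = m
  orient : ∀ b < N, σ 7 0 b = o b
  level : ∀ b < N, σ 8 0 b = L b
  table : ∀ x y : ℤ, |x| ≤ 1 → |y| ≤ 1 → σ 31 x y = x * y

theorem HasData.congr {N : ℕ} {o L : ℕ → ℤ} {m : ℤ} {σ σ' : Memory} (h : HasData N o L m σ)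
    (e : ∀ n, n = 4 ∨ n = 7 ∨ n = 8 ∨ n = 31 → σ' n = σ n) : HasData N o L m σ' := by
  obtain ⟨h1, h2, h3, h4⟩ := h
  refine ⟨?_, ?_, ?_, ?_⟩
  · rwa [e 4 (by simp)]
  · rwa [e 7 (by simp)]
  · rwa [e 8 (by simp)]
  · rwa [e 31 (by simp)]

/-- Recording a crossing, the positions of which are the variables `21`, …, `24`; the sign of the
crossing is the variable `20`. -/
def record : Program := block [ select 18 (.minus (cell 8 (var 21)) (cell 8 (var 22))) (.const 0)
    (.plus (.minus (cell 8 (var 21)) (cell 8 (var 22))) (var 4))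
    (.minus (cell 8 (var 21)) (cell 8 (var 22))),
  select 19 (.minus (cell 8 (var 23)) (cell 8 (var 24))) (.const 0)
    (.plus (.minus (cell 8 (var 23)) (cell 8 (var 24))) (var 4))
    (.minus (cell 8 (var 23)) (cell 8 (var 24))),
  assign 28 (.read 31 (.read 31 (cell 7 (var 21)) (cell 7 (var 22)))
    (.read 31 (.read 31 (cell 7 (var 23)) (cell 7 (var 24))) (var 20))),
  .store 2 (var 18) (var 19) (.plus (.read 2 (var 18) (var 19)) (var 28)),
  .store 3 (var 18) (var 19) (.plus (.read 3 (var 18) (var 19)) (var 28)),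
  .store 1 (var 18) (var 19) (.plus (.read 1 (var 18) (var 19)) (var 28)),
  .store 1 (var 19) (var 18) (.plus (.read 1 (var 19) (var 18)) (var 28))]

/-- The variables hold the crossing of the secants `q` with the sign `e`. -/
def HasQuad (q : (ℕ × ℕ) × (ℕ × ℕ)) (e : ℤ) (σ : Memory) : Prop :=
  σ 21 0 0 = q.1.1 ∧ σ 22 0 0 = q.1.2 ∧ σ 23 0 0 = q.2.1 ∧ σ 24 0 0 = q.2.2 ∧ σ 20 0 0 = e

theorem abs_mul_le_one {x y : ℤ} (hx : |x| ≤ 1) (hy : |y| ≤ 1) : |x * y| ≤ 1 := by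
  rw [abs_mul]
  exact mul_le_one₀ hx (abs_nonneg _) hy

variable {N : ℕ} {o L : ℕ → ℤ} {m c : ℤ}

theorem abs_event_le (ho : ∀ b < N, |o b| ≤ 1) {q : (ℕ × ℕ) × (ℕ × ℕ)}
    (hq : q.1.1 < N ∧ q.1.2 < N ∧ q.2.1 < N ∧ q.2.2 < N) {e : ℤ} (he : |e| ≤ 1) (n : ℕ) (x y : ℤ) :
    |event o L m q e n x y| ≤ 2 := by
  obtain ⟨h1, h2, h3, h4⟩ := hq
  have hE : |o q.1.1 * o q.1.2 * (o q.2.1 * o q.2.2 * e)| ≤ 1 :=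
    abs_mul_le_one (abs_mul_le_one (ho _ h1) (ho _ h2))
      (abs_mul_le_one (abs_mul_le_one (ho _ h3) (ho _ h4)) he)
  have key : ∀ p : Prop, [Decidable p] →
      |if p then o q.1.1 * o q.1.2 * (o q.2.1 * o q.2.2 * e) else 0| ≤ 1 := by
    intro p _
    split_ifs
    · exact hE
    · simp
  unfold event
  exact (abs_add_le _ _).trans (by linarith [key (x = reduced m (L q.1.1 - L q.1.2) ∧
    y = reduced m (L q.2.1 - L q.2.2)), key (n = 1 ∧ x = reduced m (L q.2.1 - L q.2.2) ∧
    y = reduced m (L q.1.1 - L q.1.2))])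

theorem event_zero (q : (ℕ × ℕ) × (ℕ × ℕ)) (n : ℕ) (x y : ℤ) : event o L m q 0 n x y = 0 := by
  simp [event]

theorem computes_record (hd : HasData N o L m σ) (ho : ∀ b < N, |o b| ≤ 1)
    (hL : ∀ a < N, ∀ b < N, |reduced m (L a - L b)| ≤ B) (hB : 1 ≤ B) {q : (ℕ × ℕ) × (ℕ × ℕ)}
    (hq : q.1.1 < N ∧ q.1.2 < N ∧ q.2.1 < N ∧ q.2.2 < N) {e : ℤ} (he : |e| ≤ 1)
    (hσ : HasQuad q e σ) (hc : ∀ n x y, n = 1 ∨ n = 2 ∨ n = 3 → |σ n x y| ≤ c) (hcB : c + 2 ≤ B) :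
    Computes B record σ 300 fun σ' =>
      (∀ n x y, n = 1 ∨ n = 2 ∨ n = 3 → σ' n x y = σ n x y + event o L m q e n x y) ∧
      ∀ n, ¬(n = 1 ∨ n = 2 ∨ n = 3 ∨ n = 18 ∨ n = 19 ∨ n = 28) → σ' n = σ n := by
  obtain ⟨q1, q2, q3, q4, q5⟩ := hσ
  obtain ⟨h1, h2, h3, h4⟩ := hq
  have hα := hL _ h1 _ h2
  have hβ := hL _ h3 _ h4
  have hE1 := abs_mul_le_one (ho _ h1) (ho _ h2)
  have hE2 := abs_mul_le_one (ho _ h3) (ho _ h4)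
  have hE3 := abs_mul_le_one hE2 he
  have hE := abs_mul_le_one hE1 hE3
  unfold event
  unfold reduced at hα hβ ⊢
  set α := (if L q.1.1 - L q.1.2 < 0 then L q.1.1 - L q.1.2 + m else L q.1.1 - L q.1.2) with hαd
  set β := (if L q.2.1 - L q.2.2 < 0 then L q.2.1 - L q.2.2 + m else L q.2.1 - L q.2.2) with hβd
  have t1 := hd.table _ _ (ho _ h1) (ho _ h2)
  have t2 := hd.table _ _ (ho _ h3) (ho _ h4)
  have t3 := hd.table _ _ hE2 he
  have t4 := hd.table _ _ hE1 hE3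
  set E := o q.1.1 * o q.1.2 * (o q.2.1 * o q.2.2 * e)
  have c1 := hc 1 α β (by simp)
  have c1' := hc 1 β α (by simp)
  have c2 := hc 2 α β (by simp)
  have c3 := hc 3 α β (by simp)
  rw [abs_le] at hE hα hβ
  refine Computes.of_exec ?_ (by simp [record, block, select, weight, IntExpr.cost]) ⟨?_, ?_⟩
  · simp [record, block, Fits, exec, exec_select, fits_select (zero_le_one.trans hB), IntExpr.value,
      write_apply, q1, q2, q3, q4, q5, hd.modulus, hd.orient _ h1, hd.orient _ h2, hd.orient _ h3,
      hd.orient _ h4, hd.level _ h1, hd.level _ h2, hd.level _ h3, hd.level _ h4, t1, t2, t3, t4,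
      ← hαd, ← hβd, -sub_neg]
    rw [abs_le] at c1 c1' c2 c3
    simp only [abs_le]
    split_ifs <;> omega
  · intro n x y hn
    simp [record, block, exec, exec_select, IntExpr.value,
      write_apply, q1, q2, q3, q4, q5, hd.modulus, hd.orient _ h1, hd.orient _ h2, hd.orient _ h3,
      hd.orient _ h4, hd.level _ h1, hd.level _ h2, hd.level _ h3, hd.level _ h4, t1, t2, t3, t4,
      ← hαd, ← hβd, -sub_neg]
    clear_value α β E
    rcases hn with rfl | rfl | rfl <;> grind
  · intro n hn
    push Not at hn
    obtain ⟨n1, n2, n3, n4, n5, n6⟩ := hn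
    simp [record, block, exec, exec_select, write_name_ne, *]

/-- Recording a crossing and the crossing of the reversed secants. -/
def recordPair : Program := block [record, assign 25 (var 21), assign 21 (var 24),
  assign 24 (var 25), assign 25 (var 22), assign 22 (var 23), assign 23 (var 25),
  assign 20 (.minus (.const 0) (var 20)), record]

theorem Computes.block_cons {p : Program} {l : List Program} {T T' : ℕ} {P Q : Memory → Prop}
    (hp : Computes B p σ T P) (hq : ∀ σ, P σ → Computes B (block l) σ T' Q) :
    Computes B (block (p :: l)) σ (T + T') Q := hp.seq hq

theorem Computes.block_nil {P : Memory → Prop} (h : P σ) : Computes B (block []) σ 1 P :=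
  ⟨1, σ, .skip σ, le_rfl, h⟩

theorem block_append_runs {l l' : List Program} {T T' : ℕ} {P Q : Memory → Prop}
    (hp : Computes B (block l) σ T P) (hq : ∀ σ, P σ → Computes B (block l') σ T' Q) :
    Computes B (block (l ++ l')) σ (T + T') Q := by
  induction l generalizing σ T with
  | nil =>
    obtain ⟨t, σ', h1, h2, h3⟩ := hp
    cases h1
    exact (hq _ h3).mono (by omega) fun _ h => h
  | cons p l ih =>
    obtain ⟨t, σ', h1, h2, h3⟩ := hp
    cases h1 with
    | seq h1 h1' =>
      obtain ⟨s, τ, g1, g2, g3⟩ := ih ⟨_, _, h1', le_rfl, h3⟩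
      exact ⟨_, _, .seq h1 g1, by omega, g3⟩

theorem computes_recordPair (hd : HasData N o L m σ) (ho : ∀ b < N, |o b| ≤ 1)
    (hL : ∀ a < N, ∀ b < N, |reduced m (L a - L b)| ≤ B) (hB : N ≤ B) (hB1 : 1 ≤ B)
    {q : (ℕ × ℕ) × (ℕ × ℕ)} (hq : q.1.1 < N ∧ q.1.2 < N ∧ q.2.1 < N ∧ q.2.2 < N) {e : ℤ}
    (he : |e| ≤ 1) (hσ : HasQuad q e σ)
    (hc : ∀ n x y, n = 1 ∨ n = 2 ∨ n = 3 → |σ n x y| ≤ c) (hcB : c + 4 ≤ B) :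
    Computes B recordPair σ 700 fun σ' =>
      (∀ n x y, n = 1 ∨ n = 2 ∨ n = 3 → σ' n x y =
        σ n x y + (event o L m q e n x y + event o L m (flip q) (-e) n x y)) ∧
      ∀ n, ¬(n = 1 ∨ n = 2 ∨ n = 3 ∨ (18 ≤ n ∧ n ≤ 25) ∨ n = 28) → σ' n = σ n := by
  refine Computes.mono (Computes.block_cons (computes_record hd ho hL hB1 hq he hσ hc (by linarith))
    (T' := 400) ?_) (by norm_num) fun _ h => h
  rintro σ₁ ⟨a1, a2⟩
  obtain ⟨q1, q2, q3, q4, q5⟩ := hσ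
  rw [← a2 _ (by norm_num)] at q1 q2 q3 q4 q5
  have b := hq
  obtain ⟨h1, h2, h3, h4⟩ := hq
  refine Computes.mono (block_append_runs (l := [assign 25 (var 21), assign 21 (var 24),
    assign 24 (var 25), assign 25 (var 22), assign 22 (var 23), assign 23 (var 25),
    assign 20 (.minus (.const 0) (var 20))]) (l' := [record]) (T := 80) (T' := 301)
    (P := fun σ₂ => HasQuad (flip q) (-e) σ₂ ∧ ∀ n, ¬ (20 ≤ n ∧ n ≤ 25) → σ₂ n = σ₁ n) ?_ ?_)
    (by norm_num) fun _ h => h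
  · refine Computes.of_exec ?_ (by simp [block, weight, IntExpr.cost]) ⟨?_, ?_⟩
    · rw [abs_le] at he
      simp only [block, Fits, exec, IntExpr.value, write_apply]
      simp [q1, q2, q3, q4, q5, abs_le]
      omega
    · simp [HasQuad, block, exec, IntExpr.value, write_apply, q1, q2, q3, q4, q5, flip]
    · intro n hn
      simp only [block, exec]
      rw [write_name_ne (by omega), write_name_ne (by omega), write_name_ne (by omega),
        write_name_ne (by omega), write_name_ne (by omega), write_name_ne (by omega),
        write_name_ne (by omega)]
  · rintro σ₂ ⟨b1, b2⟩
    have hd' : HasData N o L m σ₂ := hd.congr fun n hn => by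
      rw [b2 n (by omega), a2 n (by omega)]
    refine Computes.block_cons (T' := 1) (Computes.mono (computes_record (c := c + 2) hd' ho hL hB1
      ⟨h4, h3, h2, h1⟩ (by rwa [abs_neg]) b1 ?_ (by linarith)) le_rfl ?_)
      fun _ h => Computes.block_nil h
    · intro n x y hn
      rw [b2 n (by omega), a1 n x y hn]
      exact (abs_add_le _ _).trans (add_le_add (hc n x y hn) (abs_event_le ho b he n x y))
    · rintro σ₃ ⟨c1, c2⟩
      refine ⟨fun n x y hn => ?_, fun n hn => ?_⟩
      · rw [c1 n x y hn, b2 n (by omega), a1 n x y hn, add_assoc]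
      · rw [c2 n (by omega), b2 n (by omega), a2 n (by omega)]

end

section

/-! ## Recording all crossings for a pair of fixed strands -/

variable {B : ℤ} {σ : Memory} {N : ℕ} {o L : ℕ → ℤ} {m c : ℤ} {i r s : ℕ} {pos : Bool}

/-- The variables hold the crossing positions, its sign, and the positions of two further strands. -/
def HasPlaces (i : ℕ) (pos : Bool) (s r : ℕ) (σ : Memory) : Prop :=
  σ 10 0 0 = i ∧ σ 11 0 0 = orientSign pos ∧ σ 16 0 0 = s ∧ σ 17 0 0 = r

/-- The successor of an expression. -/
abbrev succ (e : IntExpr) : IntExpr := .plus e (.const 1)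

/-- The variable `27` becomes `1` if the positions give a valid crossing, and `0` otherwise. -/
def validity : Program := block [ select 27 (succ (var 10)) (var 16) (.const 1) (.const 0),
  select 27 (var 16) (var 10) (.const 1) (var 27),
  select 29 (succ (var 10)) (var 17) (.const 1) (.const 0),
  select 29 (var 17) (var 10) (.const 1) (var 29),
  select 27 (var 17) (var 16) (.read 31 (var 27) (var 29)) (.const 0)]

/-- Preparing the variables for the recording of a crossing. -/
def setup : CrossKind → Program
  | .fixed => block [ select 29 (var 16) (var 10) (.const 1) (.const (-1)),
      select 25 (.const 0) (.read 31 (var 29) (var 11)) (var 10) (succ (var 10)),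
      assign 26 (.minus (succ (.plus (var 10) (var 10))) (var 25)),
      select 29 (succ (var 10)) (var 17) (.const 1) (var 29),
      select 21 (.const 0) (var 29) (var 17) (var 25),
      select 22 (.const 0) (var 29) (var 16) (var 26),
      select 23 (.const 0) (var 29) (var 25) (var 17),
      select 24 (.const 0) (var 29) (var 26) (var 16),
      assign 20 (.read 31 (var 27) (.read 31 (.minus (.const 0) (var 29)) (var 11)))]
  | .straight => block [
      assign 21 (var 16), assign 22 (succ (var 10)), assign 23 (var 17), assign 24 (var 10),
      select 20 (var 16) (var 10) (var 27) (.const 0)]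
  | .skew => block [
      assign 21 (var 16), assign 22 (var 10), assign 23 (var 17), assign 24 (succ (var 10)),
      select 20 (var 16) (var 10) (.minus (.const 0) (var 27)) (.const 0)]

theorem computes_validity (hd : HasData N o L m σ) (hB : 1 ≤ B) (hs : s < N)
    (hp : HasPlaces i pos s r σ) : Computes B validity σ 100 fun σ' =>
      σ' 27 0 0 = (if ValidCross N i r s .fixed then 1 else 0) ∧
      ∀ n, ¬(n = 27 ∨ n = 29) → σ' n = σ n := by
  obtain ⟨p1, p2, p3, p4⟩ := hp
  have t00 := hd.table 0 0 (by norm_num) (by norm_num)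
  have t01 := hd.table 0 1 (by norm_num) (by norm_num)
  have t10 := hd.table 1 0 (by norm_num) (by norm_num)
  have t11 := hd.table 1 1 (by norm_num) (by norm_num)
  have hB0 : (0 : ℤ) ≤ B := zero_le_one.trans hB
  refine Computes.of_exec ?_ (by simp [validity, block, select, weight, IntExpr.cost]) ⟨?_, ?_⟩
  · simp [validity, block, Fits, exec_select, fits_select hB0, IntExpr.value,
      write_apply, p1, p3, p4]
    split_ifs <;> simp_all
  · simp [validity, block, exec, exec_select, IntExpr.value, write_apply, p1, p3, p4, ValidCross]
    split_ifs <;> omega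
  · intro n hn
    push Not at hn
    obtain ⟨n1, n2⟩ := hn
    simp [validity, block, exec, exec_select, write_name_ne, *]

theorem validCross_iff {k : CrossKind} (hk : k ≠ .fixed) :
    ValidCross N i r s k ↔ ValidCross N i r s .fixed ∧ s < i := by
  unfold ValidCross
  constructor
  · rintro ⟨h1, h2, h3, h4, h5, h6, h7⟩
    exact ⟨⟨h1, h2, h3, h4, h5, h6, fun h => absurd rfl h⟩, h7 hk⟩
  · rintro ⟨⟨h1, h2, h3, h4, h5, h6, -⟩, h7⟩
    exact ⟨h1, h2, h3, h4, h5, h6, fun _ => h7⟩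

theorem computes_setup (hd : HasData N o L m σ) (hB : 2 * N + 2 ≤ B) (hi : i + 2 ≤ N) (hr : r < N)
    (hs : s < N) (hp : HasPlaces i pos s r σ)
    (hv : σ 27 0 0 = if ValidCross N i r s .fixed then 1 else 0) (k : CrossKind) :
    Computes B (setup k) σ 200 fun σ' =>
      HasQuad (crossQuad i pos r s k)
        (if ValidCross N i r s k then crossSgn i pos r s k false else 0) σ' ∧
      ∀ n, ¬((20 ≤ n ∧ n ≤ 26) ∨ n = 29) → σ' n = σ n := by
  obtain ⟨p1, p2, p3, p4⟩ := hp
  have t : ∀ a b : ℤ, (a = 0 ∨ a = 1 ∨ a = -1) → (b = 0 ∨ b = 1 ∨ b = -1) → σ 31 a b = a * b := by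
    intro a b ha hb
    apply hd.table
    · rcases ha with rfl | rfl | rfl <;> norm_num
    · rcases hb with rfl | rfl | rfl <;> norm_num
  have hB0 : (0 : ℤ) ≤ B := by omega
  cases k with
  | fixed =>
    refine Computes.of_exec ?_ (by simp [setup, block, select, weight, IntExpr.cost]) ⟨?_, ?_⟩
    · simp [setup, block, Fits, exec, exec_select, fits_select hB0, IntExpr.value,
        write_apply, p1, p2, p3, p4, hv]
      cases pos <;> by_cases h1 : s < i <;> by_cases h2 : (i : ℤ) + 1 < r <;>
        by_cases h3 : ValidCross N i r s .fixed <;>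
        simp [h1, h2, h3, orientSign, t, abs_le] <;> omega
    · have e2 : ((i : ℤ) + 1 < r) ↔ i + 1 < r := by omega
      simp [setup, block, exec, exec_select, IntExpr.value,
        write_apply, p1, p2, p3, p4, hv, HasQuad]
      cases pos <;> by_cases h1 : s < i <;> by_cases h2 : i + 1 < r <;>
        by_cases h3 : ValidCross N i r s .fixed <;>
        simp [h1, h2, h3, e2, orientSign, t, crossQuad, crossSgn] <;> omega
    · intro n hn
      push Not at hn
      simp only [setup, block, exec, exec_select]
      iterate 9 rw [write_name_ne (by omega)]
  | straight =>
    have hV := validCross_iff (N := N) (i := i) (r := r) (s := s) (k := .straight) (by simp)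
    refine Computes.of_exec ?_ (by simp [setup, block, select, weight, IntExpr.cost]) ⟨?_, ?_⟩
    · simp [setup, block, Fits, exec, fits_select hB0, IntExpr.value, write_apply, p1, p3, p4, hv]
      split_ifs <;> simp [abs_le] <;> omega
    · simp [setup, block, exec, exec_select, IntExpr.value,
        write_apply, p1, p3, p4, hv, HasQuad, crossQuad, crossSgn, hV]
      split_ifs <;> simp_all
    · intro n hn
      push Not at hn
      simp only [setup, block, exec, exec_select]
      iterate 5 rw [write_name_ne (by omega)]
  | skew =>
    have hV := validCross_iff (N := N) (i := i) (r := r) (s := s) (k := .skew) (by simp)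
    refine Computes.of_exec ?_ (by simp [setup, block, select, weight, IntExpr.cost]) ⟨?_, ?_⟩
    · simp [setup, block, Fits, exec, fits_select hB0, IntExpr.value, write_apply, p1, p3, p4, hv]
      split_ifs <;> simp [abs_le] <;> omega
    · simp [setup, block, exec, exec_select, IntExpr.value,
        write_apply, p1, p3, p4, hv, HasQuad, crossQuad, crossSgn, hV]
      split_ifs <;> simp_all
    · intro n hn
      push Not at hn
      simp only [setup, block, exec, exec_select]
      iterate 5 rw [write_name_ne (by omega)]

/-- The contributions of the crossings of one kind. -/
def contribution (N : ℕ) (o L : ℕ → ℤ) (m : ℤ) (i : ℕ) (pos : Bool) (r s : ℕ) (n : ℕ) (x y : ℤ)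
    (k : CrossKind) : ℤ :=
  ∑ f : Bool, if ValidCross N i r s k then
    event o L m (orientedQuad i pos r s k f) (crossSgn i pos r s k f) n x y else 0

theorem contribution_eq (n : ℕ) (x y : ℤ) (k : CrossKind) :
    contribution N o L m i pos r s n x y k = event o L m (crossQuad i pos r s k)
        (if ValidCross N i r s k then crossSgn i pos r s k false else 0) n x y +
      event o L m (flip (crossQuad i pos r s k))
        (-if ValidCross N i r s k then crossSgn i pos r s k false else 0) n x y := by
  unfold contribution
  rw [Fintype.sum_bool]
  by_cases h : ValidCross N i r s k
  · simp only [h, if_true, orientedQuad, Bool.false_eq_true, if_false]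
    rw [add_comm]
    congr 2
    simp [crossSgn]
  · simp [h, event_zero]

theorem crossQuad_lt (hi : i + 2 ≤ N) (hr : r < N) (hs : s < N) (k : CrossKind) :
    (crossQuad i pos r s k).1.1 < N ∧ (crossQuad i pos r s k).1.2 < N ∧
      (crossQuad i pos r s k).2.1 < N ∧ (crossQuad i pos r s k).2.2 < N := by
  cases k with
  | fixed =>
    unfold crossQuad
    simp only
    split_ifs <;> simp only <;> omega
  | straight => simp only [crossQuad]; omega
  | skew => simp only [crossQuad]; omega

theorem abs_signed_le (k : CrossKind) :
    |if ValidCross N i r s k then crossSgn i pos r s k false else 0| ≤ 1 := by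
  split_ifs
  · rcases crossSgn_cases i pos r s k false with h | h <;> rw [h] <;> norm_num
  · simp

theorem abs_contribution_le (ho : ∀ b < N, |o b| ≤ 1) (hi : i + 2 ≤ N) (hr : r < N) (hs : s < N)
    (n : ℕ) (x y : ℤ) (k : CrossKind) : |contribution N o L m i pos r s n x y k| ≤ 4 := by
  rw [contribution_eq]
  obtain ⟨h1, h2, h3, h4⟩ := crossQuad_lt (pos := pos) hi hr hs k
  have a := abs_event_le (L := L) (m := m) ho ⟨h1, h2, h3, h4⟩ (abs_signed_le (N := N) (i := i) (r := r) (s := s) (pos := pos) k) n x y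
  have b := abs_event_le (L := L) (m := m) ho (q := flip (crossQuad i pos r s k)) ⟨h4, h3, h2, h1⟩
    (by rw [abs_neg]; exact abs_signed_le (N := N) (i := i) (r := r) (s := s) (pos := pos) k) n x y
  exact (abs_add_le _ _).trans (add_le_add a b)

theorem computes_kind (hd : HasData N o L m σ) (ho : ∀ b < N, |o b| ≤ 1)
    (hL : ∀ a < N, ∀ b < N, |reduced m (L a - L b)| ≤ B) (hB : 2 * N + 2 ≤ B)
    (hi : i + 2 ≤ N) (hr : r < N) (hs : s < N) (hp : HasPlaces i pos s r σ)
    (hv : σ 27 0 0 = if ValidCross N i r s .fixed then 1 else 0)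
    (hc : ∀ n x y, n = 1 ∨ n = 2 ∨ n = 3 → |σ n x y| ≤ c) (hcB : c + 4 ≤ B) (k : CrossKind) :
    Computes B (.seq (setup k) recordPair) σ 900 fun σ' =>
      (∀ n x y, n = 1 ∨ n = 2 ∨ n = 3 → σ' n x y =
        σ n x y + contribution N o L m i pos r s n x y k) ∧
      ∀ n, ¬(n = 1 ∨ n = 2 ∨ n = 3 ∨ (18 ≤ n ∧ n ≤ 26) ∨ n = 28 ∨ n = 29) → σ' n = σ n := by
  refine Computes.mono (Computes.seq (computes_setup hd hB hi hr hs hp hv k) (T' := 700) ?_)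
    (by norm_num) fun _ h => h
  rintro σ₁ ⟨a1, a2⟩
  refine Computes.mono (computes_recordPair (c := c) (hd.congr fun n hn => a2 n (by omega)) ho hL
    (by omega) (by omega) (crossQuad_lt hi hr hs k) (abs_signed_le k) a1 ?_ hcB) le_rfl ?_
  · intro n x y hn
    rw [a2 n (by omega)]
    exact hc n x y hn
  · rintro σ₂ ⟨b1, b2⟩
    refine ⟨fun n x y hn => ?_, fun n hn => ?_⟩
    · rw [b1 n x y hn, a2 n (by omega), contribution_eq]
    · rw [b2 n (by omega), a2 n (by omega)]

/-- Recording all crossings for the positions in the variables `16` and `17`. -/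
def recordAll : Program := .seq validity (.seq (.seq (setup .fixed) recordPair)
  (.seq (.seq (setup .straight) recordPair) (.seq (setup .skew) recordPair)))

theorem HasPlaces.congr {σ' : Memory} (h : HasPlaces i pos s r σ)
    (e : ∀ n, n = 10 ∨ n = 11 ∨ n = 16 ∨ n = 17 → σ' n = σ n) : HasPlaces i pos s r σ' := by
  unfold HasPlaces at *
  rwa [e 10 (by simp), e 11 (by simp), e 16 (by simp), e 17 (by simp)]

theorem computes_recordAll (hd : HasData N o L m σ) (ho : ∀ b < N, |o b| ≤ 1)
    (hL : ∀ a < N, ∀ b < N, |reduced m (L a - L b)| ≤ B) (hB : 2 * N + 2 ≤ B)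
    (hi : i + 2 ≤ N) (hr : r < N) (hs : s < N) (hp : HasPlaces i pos s r σ)
    (hc : ∀ n x y, n = 1 ∨ n = 2 ∨ n = 3 → |σ n x y| ≤ c) (hcB : c + 12 ≤ B) :
    Computes B recordAll σ 2800 fun σ' =>
      (∀ n x y, n = 1 ∨ n = 2 ∨ n = 3 → σ' n x y =
        σ n x y + ∑ k, contribution N o L m i pos r s n x y k) ∧
      ∀ n, ¬(n = 1 ∨ n = 2 ∨ n = 3 ∨ (18 ≤ n ∧ n ≤ 29)) → σ' n = σ n := by
  have hab := abs_contribution_le (L := L) (m := m) (pos := pos) ho hi hr hs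
  refine Computes.mono (Computes.seq (computes_validity hd (by omega) hs hp)
    (T' := 900 + (900 + 900)) ?_) (by norm_num) fun _ h => h
  rintro σ₁ ⟨v1, a1⟩
  refine Computes.seq (computes_kind (c := c) (hd.congr fun n hn => a1 n (by omega)) ho hL hB hi hr hs
    (hp.congr fun n hn => a1 n (by omega)) v1 (fun n x y hn => by
      rw [a1 n (by omega)]; exact hc n x y hn) (by omega) .fixed) ?_
  rintro σ₂ ⟨s2, a2⟩
  have hd2 : HasData N o L m σ₂ := hd.congr fun n hn => by rw [a2 n (by omega), a1 n (by omega)]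
  have hp2 : HasPlaces i pos s r σ₂ := hp.congr fun n hn => by rw [a2 n (by omega), a1 n (by omega)]
  have v2 : σ₂ 27 0 0 = if ValidCross N i r s .fixed then 1 else 0 := by
    rw [a2 27 (by omega), v1]
  have s2' : ∀ n x y, n = 1 ∨ n = 2 ∨ n = 3 → σ₂ n x y =
      σ n x y + contribution N o L m i pos r s n x y .fixed := fun n x y hn => by
    rw [s2 n x y hn, a1 n (by omega)]
  have c2 : ∀ n x y, n = 1 ∨ n = 2 ∨ n = 3 → |σ₂ n x y| ≤ c + 4 := fun n x y hn => by
    rw [s2' n x y hn]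
    exact (abs_add_le _ _).trans (add_le_add (hc n x y hn) (hab n x y .fixed))
  refine Computes.seq (computes_kind (c := c + 4) hd2 ho hL hB hi hr hs hp2 v2 c2 (by omega)
    .straight) ?_
  rintro σ₃ ⟨s3, a3⟩
  have c3 : ∀ n x y, n = 1 ∨ n = 2 ∨ n = 3 → |σ₃ n x y| ≤ c + 4 + 4 := fun n x y hn => by
    rw [s3 n x y hn]
    exact (abs_add_le _ _).trans (add_le_add (c2 n x y hn) (hab n x y .straight))
  refine Computes.mono (computes_kind (c := c + 4 + 4) (hd2.congr fun n hn => a3 n (by omega)) ho hL hB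
    hi hr hs (hp2.congr fun n hn => a3 n (by omega)) (by rw [a3 27 (by omega), v2]) c3 (by omega)
    .skew) le_rfl ?_
  rintro σ₄ ⟨s4, a4⟩
  refine ⟨fun n x y hn => ?_, fun n hn => ?_⟩
  · have : (Finset.univ : Finset CrossKind) = {.fixed, .straight, .skew} := rfl
    rw [s4 n x y hn, s3 n x y hn, s2' n x y hn, this, Finset.sum_insert (by simp),
      Finset.sum_insert (by simp), Finset.sum_singleton]
    ring
  · rw [a4 n (by omega), a3 n (by omega), a2 n (by omega), a1 n (by omega)]

end

section

/-! ## Recording the crossings of all generators -/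

variable {B : ℤ} {σ : Memory} {N : ℕ} {o L : ℕ → ℤ} {m c : ℤ} {i r s : ℕ} {pos : Bool}
  {k : ℕ} {w : List (ℕ × Bool)}

/-- Recording the crossings of a generator with one fixed strand in the variable `16`. -/
def recordRow : Program := forLoop 17 (cell 0 (.const 0)) recordAll

/-- Recording the crossings of a generator. -/
def recordLetter : Program := forLoop 16 (cell 0 (.const 0)) recordRow

theorem abs_sum_contribution_le (ho : ∀ b < N, |o b| ≤ 1) (hi : i + 2 ≤ N) (hr : r < N) (hs : s < N)
    (n : ℕ) (x y : ℤ) : |∑ k, contribution N o L m i pos r s n x y k| ≤ 12 := by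
  refine (Finset.abs_sum_le_sum_abs _ _).trans
    ((Finset.sum_le_card_nsmul _ _ 4 fun k _ => abs_contribution_le ho hi hr hs n x y k).trans ?_)
  rw [Finset.card_univ]
  exact le_of_eq rfl

theorem abs_sum_range_le {f : ℕ → ℤ} {n : ℕ} {d : ℤ} (h : ∀ a < n, |f a| ≤ d) :
    |∑ a ∈ Finset.range n, f a| ≤ n * d := by
  refine (Finset.abs_sum_le_sum_abs _ _).trans
    ((Finset.sum_le_card_nsmul _ _ d fun a ha => h a (Finset.mem_range.1 ha)).trans ?_)
  rw [Finset.card_range, nsmul_eq_mul]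

theorem computes_recordRow (hd : HasData N o L m σ) (ho : ∀ b < N, |o b| ≤ 1)
    (hL : ∀ a < N, ∀ b < N, |reduced m (L a - L b)| ≤ B) (hB : 2 * N + 2 ≤ B)
    (hN : σ 0 0 0 = N) (hi : i + 2 ≤ N) (hs : s < N)
    (hp : σ 10 0 0 = i ∧ σ 11 0 0 = orientSign pos ∧ σ 16 0 0 = s)
    (hc : ∀ n x y, n = 1 ∨ n = 2 ∨ n = 3 → |σ n x y| ≤ c) (hcB : c + 12 * N ≤ B) :
    Computes B recordRow σ (N * 2815 + 15) fun σ' =>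
      (∀ n x y, n = 1 ∨ n = 2 ∨ n = 3 → σ' n x y =
        σ n x y + ∑ r ∈ Finset.range N, ∑ k, contribution N o L m i pos r s n x y k) ∧
      ∀ n, ¬(n = 1 ∨ n = 2 ∨ n = 3 ∨ (17 ≤ n ∧ n ≤ 29)) → σ' n = σ n := by
  refine computes_for (c := 2800) (Inv := fun j σ' => (∀ n x y, n = 1 ∨ n = 2 ∨ n = 3 → σ' n x y =
      σ n x y + ∑ r ∈ Finset.range j, ∑ k, contribution N o L m i pos r s n x y k) ∧
      ∀ n, ¬(n = 1 ∨ n = 2 ∨ n = 3 ∨ (17 ≤ n ∧ n ≤ 29)) → σ' n = σ n) (by omega) ?_ ?_ ?_ ?_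
  · rintro j σ' v ⟨a1, a2⟩
    refine ⟨fun n x y hn => ?_, fun n hn => ?_⟩
    · rw [write_name_ne (by omega), a1 n x y hn]
    · rw [write_name_ne (by omega), a2 n hn]
  · rintro j σ' ⟨a1, a2⟩
    simp only [IntExpr.value]
    rw [a2 0 (by omega), hN]
  · rintro r hr σ' ⟨a1, a2⟩ hx
    obtain ⟨p1, p2, p3⟩ := hp
    refine (computes_recordAll (pos := pos) (c := c + 12 * r) (hd.congr fun n hn => a2 n (by omega)) ho hL hB hi
      hr hs ⟨?_, ?_, ?_, hx⟩ ?_ (by nlinarith)).mono le_rfl ?_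
    · rw [a2 10 (by omega), p1]
    · rw [a2 11 (by omega), p2]
    · rw [a2 16 (by omega), p3]
    · intro n x y hn
      rw [a1 n x y hn]
      refine (abs_add_le _ _).trans (add_le_add (hc n x y hn) ?_)
      rw [mul_comm]
      exact abs_sum_range_le fun a ha => abs_sum_contribution_le ho hi (by omega) hs n x y
    · rintro σ₂ ⟨b1, b2⟩
      refine ⟨⟨fun n x y hn => ?_, fun n hn => ?_⟩, ?_⟩
      · rw [b1 n x y hn, a1 n x y hn, Finset.sum_range_succ]
        ring
      · rw [b2 n (by omega), a2 n hn]
      · rw [b2 17 (by omega), hx]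
  · exact ⟨fun n x y _ => by simp, fun _ _ => rfl⟩

theorem computes_recordLetter (hd : HasData N o L m σ) (ho : ∀ b < N, |o b| ≤ 1)
    (hL : ∀ a < N, ∀ b < N, |reduced m (L a - L b)| ≤ B) (hB : 2 * N + 2 ≤ B)
    (hN : σ 0 0 0 = N) (hi : i + 2 ≤ N)
    (hp : σ 10 0 0 = i ∧ σ 11 0 0 = orientSign pos)
    (hc : ∀ n x y, n = 1 ∨ n = 2 ∨ n = 3 → |σ n x y| ≤ c) (hcB : c + 12 * N * N ≤ B) :
    Computes B recordLetter σ (N * (N * 2815 + 30) + 15) fun σ' =>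
      (∀ n x y, n = 1 ∨ n = 2 ∨ n = 3 → σ' n x y = σ n x y + ∑ s ∈ Finset.range N,
        ∑ r ∈ Finset.range N, ∑ k, contribution N o L m i pos r s n x y k) ∧
      ∀ n, ¬(n = 1 ∨ n = 2 ∨ n = 3 ∨ (16 ≤ n ∧ n ≤ 29)) → σ' n = σ n := by
  have h := computes_for (B := B) (σ := σ) (x := 16) (n := N) (b := cell 0 (.const 0))
    (p := recordRow) (c := N * 2815 + 15)
    (Inv := fun j σ' => (∀ n x y, n = 1 ∨ n = 2 ∨ n = 3 → σ' n x y =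
      σ n x y + ∑ s ∈ Finset.range j, ∑ r ∈ Finset.range N,
        ∑ k, contribution N o L m i pos r s n x y k) ∧
      ∀ n, ¬(n = 1 ∨ n = 2 ∨ n = 3 ∨ (16 ≤ n ∧ n ≤ 29)) → σ' n = σ n) (by omega) ?_ ?_ ?_ ?_
  · refine h.mono ?_ fun _ h => h
    simp only [IntExpr.cost]
    exact le_of_eq (by ring)
  · rintro j σ' v ⟨a1, a2⟩
    refine ⟨fun n x y hn => ?_, fun n hn => ?_⟩
    · rw [write_name_ne (by omega), a1 n x y hn]
    · rw [write_name_ne (by omega), a2 n hn]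
  · rintro j σ' ⟨a1, a2⟩
    simp only [IntExpr.value]
    rw [a2 0 (by omega), hN]
  · rintro s hs σ' ⟨a1, a2⟩ hx
    obtain ⟨p1, p2⟩ := hp
    refine (computes_recordRow (pos := pos) (c := c + 12 * N * s) (s := s)
      (hd.congr fun n hn => a2 n (by omega)) ho hL hB ?_ hi hs ⟨?_, ?_, hx⟩ ?_ ?_).mono le_rfl ?_
    · rw [a2 0 (by omega), hN]
    · rw [a2 10 (by omega), p1]
    · rw [a2 11 (by omega), p2]
    · intro n x y hn
      rw [a1 n x y hn]
      refine (abs_add_le _ _).trans (add_le_add (hc n x y hn) ?_)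
      refine (abs_sum_range_le (d := N * 12) fun a ha => abs_sum_range_le fun b hb =>
        abs_sum_contribution_le ho hi hb (by omega) n x y).trans (le_of_eq (by ring))
    · have : (s : ℤ) + 1 ≤ N := by exact_mod_cast hs
      nlinarith
    · rintro σ₂ ⟨b1, b2⟩
      refine ⟨⟨fun n x y hn => ?_, fun n hn => ?_⟩, ?_⟩
      · rw [b1 n x y hn, a1 n x y hn, Finset.sum_range_succ]
        ring
      · rw [b2 n (by omega), a2 n hn]
      · rw [b2 16 (by omega), hx]
  · exact ⟨fun n x y _ => by simp, fun _ _ => rfl⟩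

/-- Reading the generator number `9` into the variables `10` and `11`. -/
def decode : Program := block [
  select 10 (.const 0) (.read 0 (.const 1) (var 9)) (.minus (.read 0 (.const 1) (var 9)) (.const 1))
    (.minus (.minus (.const 0) (.read 0 (.const 1) (var 9))) (.const 1)),
  select 11 (.const 0) (.read 0 (.const 1) (var 9)) (.const 1) (.const (-1))]

theorem platInput_word {t : ℕ} (ht : t < w.length) :
    platInput N k w 0 1 t = generatorCode (gen w t) := by
  simp [platInput, gen, ht]

theorem computes_decode (h0 : σ 0 = platInput N k w 0) {t : ℕ} (ht : t < w.length)
    (h9 : σ 9 0 0 = t) (hB : (gen w t).1 + 2 ≤ B) : Computes B decode σ 60 fun σ' =>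
      (σ' 10 0 0 = (gen w t).1 ∧ σ' 11 0 0 = orientSign (gen w t).2) ∧
      ∀ n, ¬(n = 10 ∨ n = 11) → σ' n = σ n := by
  have hw := platInput_word (N := N) (k := k) ht
  rw [← h0] at hw
  have hB0 : 0 ≤ B := by omega
  unfold generatorCode at hw
  refine Computes.of_exec ?_ (by simp [decode, block, select, weight, IntExpr.cost]) ⟨?_, ?_⟩
  · simp only [decode, block, Fits, exec_select, fits_select hB0, IntExpr.value, write_apply]
    simp only [h9]
    norm_num [h9, hw]
    split_ifs <;> norm_num [abs_le] <;> omega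
  · simp only [decode, block, exec, exec_select, IntExpr.value, write_apply]
    norm_num [h9, hw, orientSign]
    cases h : (gen w t).2
    · rw [h] at hw
      norm_num
    · norm_num
  · intro n hn
    push Not at hn
    simp only [decode, block, exec, exec_select]
    iterate 2 rw [write_name_ne (by omega)]

/-- Exchange of the entries of an array in the places given by the variable `10` and its successor. -/
def swapAt (n : ℕ) : Program := block [assign 15 (cell n (var 10)),
  setCell n (var 10) (cell n (succ (var 10))), setCell n (succ (var 10)) (var 15)]

theorem computes_swapAt {n : ℕ} (hn : n ≠ 10 ∧ n ≠ 15) {f : ℕ → ℤ} (hf : ∀ b < N, σ n 0 b = f b)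
    (hi : i + 2 ≤ N) (hB : N ≤ B) (hfB : ∀ b < N, |f b| ≤ B) (h10 : σ 10 0 0 = i) :
    Computes B (swapAt n) σ 60 fun σ' =>
      (∀ b < N, σ' n 0 b = f (Equiv.swap i (i + 1) b)) ∧ ∀ a, ¬(a = n ∨ a = 15) → σ' a = σ a := by
  obtain ⟨n1, n2⟩ := hn
  have f0 := hf i (by omega)
  have f1 := hf (i + 1) (by omega)
  have b0 := hfB i (by omega)
  have b1 := hfB (i + 1) (by omega)
  push_cast at f1
  refine Computes.of_exec ?_ (by simp [swapAt, block, weight, IntExpr.cost]) ⟨?_, ?_⟩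
  · simp [swapAt, block, Fits, exec, IntExpr.value, write_apply, h10, f0, f1, n2, n1.symm, n2.symm]
    simp only [abs_le] at b0 b1 ⊢
    omega
  · intro b hb
    simp only [swapAt, block, exec, IntExpr.value, write_apply]
    simp [h10, f0, f1, n2, n1.symm, n2.symm]
    rw [Equiv.swap_apply_def]
    by_cases e0 : b = i
    · subst e0
      simp
    · by_cases e1 : b = i + 1
      · subst e1
        simp
      · have : ¬ (b : ℤ) = i + 1 := by omega
        simp [e0, e1, this, hf b hb]
  · intro a ha
    push Not at ha
    simp only [swapAt, block, exec]
    iterate 3 rw [write_name_ne (by omega)]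

theorem strandAt_succ {t : ℕ} (ht : t < w.length) (b : ℕ) :
    strandAt w (t + 1) b = strandAt w t (Equiv.swap (gen w t).1 ((gen w t).1 + 1) b) := by
  unfold strandAt
  rw [braidPerm_take_succ w ht, gen_eq ht]
  rfl

/-- Processing all generators. -/
def recordWord : Program := forLoop 9 (cell 0 (.const 2))
  (.seq decode (.seq recordLetter (.seq (swapAt 7) (swapAt 8))))

theorem strandAt_lt_of (hw : ∀ g ∈ w, g.1 + 2 ≤ N) {t b : ℕ} (hb : b < N) : strandAt w t b < N := by
  have : ∀ g ∈ w.take t, g.1 + 2 ≤ N := fun g hg => hw g (List.mem_of_mem_take hg)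
  rwa [← braidPerm_lt this, braidPerm_strandAt]

theorem computes_recordWord (hw : ∀ g ∈ w, g.1 + 2 ≤ N) (hd : HasData N o L m σ)
    (ho : ∀ b < N, |o b| ≤ 1) (hL : ∀ a < N, ∀ b < N, |reduced m (L a - L b)| ≤ B)
    (hLB : ∀ a < N, |L a| ≤ B) (hB : 2 * N + 2 ≤ B) (hl : 12 * N * N * w.length ≤ B)
    (hlB : w.length ≤ B) (h0 : σ 0 = platInput N k w 0)
    (hc : ∀ n x y, n = 1 ∨ n = 2 ∨ n = 3 → σ n x y = 0) :
    Computes B recordWord σ (w.length * (N * (N * 2815 + 30) + 210) + 15) fun σ' =>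
      (∀ n x y, n = 1 ∨ n = 2 ∨ n = 3 → σ' n x y = ∑ t ∈ Finset.range w.length,
        ∑ s ∈ Finset.range N, ∑ r ∈ Finset.range N, ∑ k, contribution N (fun b => o (strandAt w t b))
          (fun b => L (strandAt w t b)) m (gen w t).1 (gen w t).2 r s n x y k) ∧
      σ' 4 = σ 4 := by
  have hst : ∀ t b, b < N → strandAt w t b < N := fun t b hb => strandAt_lt_of hw hb
  have h := computes_for (B := B) (σ := σ) (x := 9) (n := w.length) (b := cell 0 (.const 2))
    (p := .seq decode (.seq recordLetter (.seq (swapAt 7) (swapAt 8))))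
    (c := 60 + (N * (N * 2815 + 30) + 15 + (60 + 60)))
    (Inv := fun t σ' => (∀ n x y, n = 1 ∨ n = 2 ∨ n = 3 → σ' n x y =
      ∑ t ∈ Finset.range t, ∑ s ∈ Finset.range N, ∑ r ∈ Finset.range N, ∑ k,
        contribution N (fun b => o (strandAt w t b)) (fun b => L (strandAt w t b)) m (gen w t).1
          (gen w t).2 r s n x y k) ∧
      HasData N (fun b => o (strandAt w t b)) (fun b => L (strandAt w t b)) m σ' ∧
      σ' 0 = σ 0 ∧ σ' 4 = σ 4) hlB ?_ ?_ ?_ ?_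
  · refine h.mono ?_ fun _ h => ⟨h.1, h.2.2.2⟩
    simp only [IntExpr.cost]
    exact le_of_eq (by ring)
  · rintro t σ' v ⟨a1, a2, a3, a4⟩
    refine ⟨fun n x y hn => ?_, a2.congr fun n hn => write_name_ne (by omega) _ _ _, ?_, ?_⟩
    · rw [write_name_ne (by omega), a1 n x y hn]
    · rw [write_name_ne (by omega), a3]
    · rw [write_name_ne (by omega), a4]
  · rintro t σ' ⟨a1, a2, a3, a4⟩
    simp only [IntExpr.value]
    rw [a3, h0]
    simp [platInput]
  · rintro t ht σ' ⟨a1, a2, a3, a4⟩ hx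
    have hi := gen_le hw ht
    refine Computes.seq (computes_decode (a3.trans h0) ht hx (by omega)) ?_
    rintro σ₁ ⟨⟨b1, b2⟩, b3⟩
    refine Computes.seq (computes_recordLetter (c := 12 * N * N * t) (σ := σ₁)
      (a2.congr fun n hn => b3 n (by omega)) (fun b hb => ho _ (hst t b hb))
      (fun a ha b hb => hL _ (hst t a ha) _ (hst t b hb)) hB ?_ hi ⟨b1, b2⟩ ?_ ?_) ?_
    · rw [b3 0 (by omega), a3, h0]
      simp [platInput]
    · intro n x y hn
      rw [b3 n (by omega), a1 n x y hn]
      refine (abs_sum_range_le (d := N * (N * 12)) fun a ha => abs_sum_range_le fun b hb =>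
        abs_sum_range_le fun d hd' => abs_sum_contribution_le (fun b hb => ho _ (hst a b hb))
          (gen_le hw (by omega)) hd' hb n x y).trans (le_of_eq (by ring))
    · have h1 : (t : ℤ) + 1 ≤ w.length := by exact_mod_cast ht
      have h2 : (0 : ℤ) ≤ 12 * N * N := by positivity
      nlinarith
    rintro σ₂ ⟨c1, c2⟩
    have d2 : HasData N (fun b => o (strandAt w t b)) (fun b => L (strandAt w t b)) m σ₂ :=
      a2.congr fun n hn => by rw [c2 n (by omega), b3 n (by omega)]
    refine Computes.seq (computes_swapAt (n := 7) (by norm_num) d2.orient hi (by omega)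
      (fun b hb => (ho _ (hst t b hb)).trans (by omega)) (by rw [c2 10 (by omega), b1])) ?_
    rintro σ₃ ⟨e1, e2⟩
    have l3 : ∀ b < N, σ₃ 8 0 b = L (strandAt w t b) := fun b hb => by
      rw [e2 8 (by omega), d2.level b hb]
    refine (computes_swapAt (n := 8) (by norm_num) l3 hi (by omega)
      (fun b hb => hLB _ (hst t b hb)) (by rw [e2 10 (by omega), c2 10 (by omega), b1])).mono le_rfl ?_
    rintro σ₄ ⟨f1, f2⟩
    refine ⟨⟨fun n x y hn => ?_, ⟨?_, ?_, ?_, ?_⟩, ?_, ?_⟩, ?_⟩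
    · rw [f2 n (by omega), e2 n (by omega), c1 n x y hn, b3 n (by omega), a1 n x y hn,
        Finset.sum_range_succ]
    · rw [f2 4 (by omega), e2 4 (by omega), d2.modulus]
    · intro b hb
      rw [f2 7 (by omega), e1 b hb, strandAt_succ ht]
    · intro b hb
      rw [f1 b hb, strandAt_succ ht]
    · rw [f2 31 (by omega), e2 31 (by omega)]
      exact d2.table
    · rw [f2 0 (by omega), e2 0 (by omega), c2 0 (by omega), b3 0 (by omega), a3]
    · rw [f2 4 (by omega), e2 4 (by omega), c2 4 (by omega), b3 4 (by omega), a4]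
    · rw [f2 9 (by omega), e2 9 (by omega), c2 9 (by omega), b3 9 (by omega), hx]
  · exact ⟨fun n x y hn => by simp [hc n x y hn], hd, rfl, rfl⟩

end

section

/-! ## Preparing the data of the strands -/

variable {B : ℤ} {σ : Memory} {N k : ℕ} {w : List (ℕ × Bool)}

/-- The multiplication table of `1` and `-1`. -/
def makeTable : Program := block [
  .store 31 (.const 1) (.const 1) (.const 1), .store 31 (.const 1) (.const (-1)) (.const (-1)),
  .store 31 (.const (-1)) (.const 1) (.const (-1)), .store 31 (.const (-1)) (.const (-1)) (.const 1)]

theorem computes_makeTable (hB : 1 ≤ B) (h : ∀ x y, σ 31 x y = 0) :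
    Computes B makeTable σ 20 fun σ' =>
      (∀ x y : ℤ, |x| ≤ 1 → |y| ≤ 1 → σ' 31 x y = x * y) ∧ ∀ n, n ≠ 31 → σ' n = σ n := by
  refine Computes.of_exec ?_ (by simp [makeTable, block, weight, IntExpr.cost]) ⟨?_, ?_⟩
  · simp [makeTable, block, Fits, IntExpr.value, hB]
  · intro x y hx hy
    rw [abs_le] at hx hy
    obtain rfl | rfl | rfl : x = -1 ∨ x = 0 ∨ x = 1 := by omega
    all_goals
      obtain rfl | rfl | rfl : y = -1 ∨ y = 0 ∨ y = 1 := by omega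
      all_goals simp [makeTable, block, exec, IntExpr.value, write_apply, h]
  · intro n hn
    simp only [makeTable, block, exec]
    iterate 4 rw [write_name_ne hn]

/-- The table of the partners of the positions. -/
def makeMates : Program := forLoop 9 (cell 0 (.const 1)) (block [
  setCell 30 (.plus (var 9) (var 9)) (succ (.plus (var 9) (var 9))),
  setCell 30 (succ (.plus (var 9) (var 9))) (.plus (var 9) (var 9))])

theorem computes_makeMates (hB : 2 * k ≤ B) (hk : σ 0 0 1 = k) :
    Computes B makeMates σ (k * 65 + 15) fun σ' =>
      (∀ b < 2 * k, σ' 30 0 b = mate b) ∧ ∀ n, ¬(n = 9 ∨ n = 30) → σ' n = σ n := by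
  refine computes_for (c := 50) (Inv := fun j σ' => (∀ b < 2 * j, σ' 30 0 b = mate b) ∧
    ∀ n, ¬(n = 9 ∨ n = 30) → σ' n = σ n) (by omega) ?_ ?_ ?_ ?_
  · rintro j σ' v ⟨a1, a2⟩
    refine ⟨fun b hb => ?_, fun n hn => ?_⟩
    · rw [write_name_ne (by omega), a1 b hb]
    · rw [write_name_ne (by omega), a2 n hn]
  · rintro j σ' ⟨a1, a2⟩
    simp only [IntExpr.value]
    rw [a2 0 (by omega), hk]
  · rintro j hj σ' ⟨a1, a2⟩ hx
    refine Computes.of_exec ?_ (by simp [block, weight, IntExpr.cost]) ⟨⟨?_, ?_⟩, ?_⟩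
    · simp [block, Fits, exec, IntExpr.value, write_apply, hx, abs_le]
      omega
    · intro b hb
      simp [block, exec, IntExpr.value, write_apply, hx]
      unfold mate
      split_ifs <;> first | omega | (rw [a1 b (by omega)]; unfold mate; split_ifs; omega)
    · intro n hn
      simp only [block, exec]
      iterate 2 rw [write_name_ne (by omega)]
      exact a2 n hn
    · simp [block, exec, IntExpr.value, write_apply, hx]
  · exact ⟨fun b hb => by omega, fun _ _ => rfl⟩

/-- The identical permutation. -/
def makeStrands : Program := forLoop 9 (cell 0 (.const 0)) (setCell 5 (var 9) (var 9))

theorem computes_makeStrands (hB : N ≤ B) (hN : σ 0 0 0 = N) :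
    Computes B makeStrands σ (N * 25 + 15) fun σ' =>
      (∀ b < N, σ' 5 0 b = b) ∧ ∀ n, ¬(n = 9 ∨ n = 5) → σ' n = σ n := by
  refine computes_for (c := 10) (Inv := fun j σ' => (∀ b < j, σ' 5 0 b = b) ∧
    ∀ n, ¬(n = 9 ∨ n = 5) → σ' n = σ n) (by omega) ?_ ?_ ?_ ?_
  · rintro j σ' v ⟨a1, a2⟩
    refine ⟨fun b hb => ?_, fun n hn => ?_⟩
    · rw [write_name_ne (by omega), a1 b hb]
    · rw [write_name_ne (by omega), a2 n hn]
  · rintro j σ' ⟨a1, a2⟩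
    simp only [IntExpr.value]
    rw [a2 0 (by omega), hN]
  · rintro j hj σ' ⟨a1, a2⟩ hx
    refine Computes.of_exec ?_ (by simp [weight, IntExpr.cost]) ⟨⟨?_, ?_⟩, ?_⟩
    · simp [Fits, IntExpr.value, hx]
      omega
    · intro b hb
      simp [exec, IntExpr.value, write_apply, hx]
      split_ifs with e
      · rw [e]
      · exact a1 b (by omega)
    · intro n hn
      simp only [exec]
      rw [write_name_ne (by omega)]
      exact a2 n hn
    · simp [exec, IntExpr.value, write_apply, hx]
  · exact ⟨fun b hb => by omega, fun _ _ => rfl⟩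

/-- Permuting the strands by the braid. -/
def permute : Program := forLoop 9 (cell 0 (.const 2)) (.seq decode (swapAt 5))

theorem computes_permute (hw : ∀ g ∈ w, g.1 + 2 ≤ N) (hB : N ≤ B) (hl : w.length ≤ B)
    (h0 : σ 0 = platInput N k w 0) (h5 : ∀ b < N, σ 5 0 b = b) :
    Computes B permute σ (w.length * 135 + 15) fun σ' =>
      (∀ b < N, σ' 5 0 b = strandAt w w.length b) ∧
        ∀ n, ¬(n = 9 ∨ n = 5 ∨ n = 10 ∨ n = 11 ∨ n = 15) → σ' n = σ n := by
  refine computes_for (c := 60 + 60) (Inv := fun t σ' => (∀ b < N, σ' 5 0 b = strandAt w t b) ∧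
    ∀ n, ¬(n = 9 ∨ n = 5 ∨ n = 10 ∨ n = 11 ∨ n = 15) → σ' n = σ n) (by omega) ?_ ?_ ?_ ?_
  · rintro j σ' v ⟨a1, a2⟩
    refine ⟨fun b hb => ?_, fun n hn => ?_⟩
    · rw [write_name_ne (by omega), a1 b hb]
    · rw [write_name_ne (by omega), a2 n hn]
  · rintro j σ' ⟨a1, a2⟩
    simp only [IntExpr.value]
    rw [a2 0 (by omega), h0]
    simp [platInput]
  · rintro t ht σ' ⟨a1, a2⟩ hx
    have hi := gen_le hw ht
    refine Computes.seq (computes_decode ((a2 0 (by omega)).trans h0) ht hx (by omega)) ?_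
    rintro σ₁ ⟨⟨b1, b2⟩, b3⟩
    refine (computes_swapAt (n := 5) (f := fun b => (strandAt w t b : ℤ)) (by norm_num)
      (fun b hb => by rw [b3 5 (by omega), a1 b hb]) hi hB (fun b hb => ?_) b1).mono le_rfl ?_
    · have := strandAt_lt_of hw (t := t) hb
      rw [abs_of_nonneg (by positivity)]
      omega
    · rintro σ₂ ⟨c1, c2⟩
      refine ⟨⟨fun b hb => ?_, fun n hn => ?_⟩, ?_⟩
      · rw [c1 b hb, strandAt_succ ht]
      · rw [c2 n (by omega), b3 n (by omega), a2 n hn]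
      · rw [c2 9 (by omega), b3 9 (by omega), hx]
  · exact ⟨fun b hb => h5 b hb, fun _ _ => rfl⟩

/-- Inversion of the permutation. -/
def invert : Program := forLoop 9 (cell 0 (.const 0)) (setCell 6 (cell 5 (var 9)) (var 9))

theorem computes_invert (hw : ∀ g ∈ w, g.1 + 2 ≤ N) (hB : N ≤ B) (hN : σ 0 0 0 = N)
    (h5 : ∀ b < N, σ 5 0 b = strandAt w w.length b) :
    Computes B invert σ (N * 35 + 15) fun σ' =>
      (∀ a < N, σ' 6 0 a = braidPerm w a) ∧ ∀ n, ¬(n = 9 ∨ n = 6) → σ' n = σ n := by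
  have h := computes_for (B := B) (σ := σ) (x := 9) (n := N) (b := cell 0 (.const 0))
    (p := setCell 6 (cell 5 (var 9)) (var 9)) (c := 20)
    (Inv := fun j σ' => (∀ b < j, σ' 6 0 (strandAt w w.length b) = b) ∧
    ∀ n, ¬(n = 9 ∨ n = 6) → σ' n = σ n) (by omega) ?_ ?_ ?_ ?_
  · refine h.mono le_rfl fun σ' hσ' => ⟨fun a ha => ?_, hσ'.2⟩
    have := hσ'.1 (braidPerm w a) ((braidPerm_lt hw a).2 ha)
    rwa [strandAt, List.take_length, Equiv.symm_apply_apply] at this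
  · rintro j σ' v ⟨a1, a2⟩
    refine ⟨fun b hb => ?_, fun n hn => ?_⟩
    · rw [write_name_ne (by omega), a1 b hb]
    · rw [write_name_ne (by omega), a2 n hn]
  · rintro j σ' ⟨a1, a2⟩
    simp only [IntExpr.value]
    rw [a2 0 (by omega), hN]
  · rintro j hj σ' ⟨a1, a2⟩ hx
    have e5 := (congrArg (fun f => f 0 (j : ℤ)) (a2 5 (by omega))).trans (h5 j hj)
    have hlt := strandAt_lt_of hw (t := w.length) hj
    refine Computes.of_exec ?_ (by simp [weight, IntExpr.cost]) ⟨⟨?_, ?_⟩, ?_⟩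
    · simp [Fits, IntExpr.value, hx, e5]
      omega
    · intro b hb
      simp only [exec, IntExpr.value, write_apply, hx, e5, true_and]
      by_cases e : b = j
      · simp [e]
      · have : (strandAt w w.length b : ℤ) ≠ strandAt w w.length j := by
          intro e'
          exact e ((braidPerm (w.take w.length)).symm.injective (by exact_mod_cast e'))
        rw [if_neg this, a1 b (by omega)]
    · intro n hn
      simp only [exec]
      rw [write_name_ne (by omega)]
      exact a2 n hn
    · simp [exec, IntExpr.value, write_apply, hx]
  · exact ⟨fun b hb => by omega, fun _ _ => rfl⟩

/-- The memory holds the permutation of the braid, its inverse and the tables. -/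
structure HasPerm (N k : ℕ) (w : List (ℕ × Bool)) (σ : Memory) : Prop where
  input : σ 0 = platInput N k w 0
  perm : ∀ a < N, σ 6 0 a = braidPerm w a
  inverse : ∀ b < N, σ 5 0 b = (braidPerm w).symm b
  mates : ∀ b < 2 * k, σ 30 0 b = mate b
  table : ∀ x y : ℤ, |x| ≤ 1 → |y| ≤ 1 → σ 31 x y = x * y

theorem HasPerm.congr {σ' : Memory} (h : HasPerm N k w σ)
    (e : ∀ n, n = 0 ∨ n = 5 ∨ n = 6 ∨ n = 30 ∨ n = 31 → σ' n = σ n) : HasPerm N k w σ' := by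
  obtain ⟨h1, h2, h3, h4, h5⟩ := h
  refine ⟨?_, ?_, ?_, ?_, ?_⟩
  · rwa [e 0 (by simp)]
  · rwa [e 6 (by simp)]
  · rwa [e 5 (by simp)]
  · rwa [e 30 (by simp)]
  · rwa [e 31 (by simp)]

/-- Computation of the permutation of the braid. -/
def prepare : Program := .seq makeTable (.seq makeMates (.seq makeStrands (.seq permute invert)))

theorem computes_prepare (hw : ∀ g ∈ w, g.1 + 2 ≤ N) (hk : 2 * k ≤ N) (hB : N ≤ B) (hB1 : 1 ≤ B)
    (hl : w.length ≤ B) (h0 : σ 0 = platInput N k w 0) (h31 : ∀ x y, σ 31 x y = 0) :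
    Computes B prepare σ
      (20 + ((k * 65 + 15) + ((N * 25 + 15) + ((w.length * 135 + 15) + (N * 35 + 15)))))
      fun σ' => HasPerm N k w σ' ∧ ∀ n, n = 1 ∨ n = 2 ∨ n = 3 ∨ n = 4 → σ' n = σ n := by
  have i0 : platInput N k w 0 0 0 = N := by simp [platInput]
  have i1 : platInput N k w 0 0 1 = k := by simp [platInput]
  refine Computes.seq (computes_makeTable hB1 h31) ?_
  rintro σ₁ ⟨a1, a2⟩
  refine Computes.seq (computes_makeMates (k := k) (by omega)
    (by rw [a2 0 (by omega), h0, i1])) ?_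
  rintro σ₂ ⟨b1, b2⟩
  have z2 : σ₂ 0 = platInput N k w 0 := by rw [b2 0 (by omega), a2 0 (by omega), h0]
  refine Computes.seq (computes_makeStrands (N := N) hB (by rw [z2, i0])) ?_
  rintro σ₃ ⟨c1, c2⟩
  have z3 : σ₃ 0 = platInput N k w 0 := by rw [c2 0 (by omega), z2]
  refine Computes.seq (computes_permute hw hB hl z3 c1) ?_
  rintro σ₄ ⟨d1, d2⟩
  have z4 : σ₄ 0 = platInput N k w 0 := by rw [d2 0 (by omega), z3]
  refine (computes_invert hw hB (by rw [z4, i0]) d1).mono le_rfl ?_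
  rintro σ₅ ⟨e1, e2⟩
  refine ⟨⟨?_, e1, ?_, ?_, ?_⟩, fun n hn => ?_⟩
  · rw [e2 0 (by omega), z4]
  · intro b hb
    rw [e2 5 (by omega), d1 b hb, strandAt, List.take_length]
  · intro b hb
    rw [e2 30 (by omega), d2 30 (by omega), c2 30 (by omega), b1 b hb]
  · rw [e2 31 (by omega), d2 31 (by omega), c2 31 (by omega), b2 31 (by omega)]
    exact a1
  · rw [e2 n (by omega), d2 n (by omega), c2 n (by omega), b2 n (by omega), a2 n (by omega)]

/-! ## Running through the knot -/

/-- The passage to the next strand; the variables `12`, `13`, `14` hold the strand, its orientation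
and its level. -/
def nextStrand : Program := .branch (.const 0) (var 13)
  (.seq (assign 15 (cell 6 (var 12)))
    (.branch (var 15) (.plus (cell 0 (.const 1)) (cell 0 (.const 1)))
      (.seq (assign 12 (cell 5 (cell 30 (var 15)))) (assign 13 (.const (-1))))
      (.seq (assign 12 (var 15)) (select 14 (succ (var 14)) (var 4) (succ (var 14))
        (.minus (succ (var 14)) (var 4))))))
  (.branch (var 12) (.plus (cell 0 (.const 1)) (cell 0 (.const 1)))
    (.seq (assign 12 (cell 30 (var 12))) (assign 13 (.const 1)))
    (.seq (assign 12 (cell 5 (var 12))) (select 14 (.minus (var 14) (.const 1)) (.const 0)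
        (.plus (.minus (var 14) (.const 1)) (var 4)) (.minus (var 14) (.const 1)))))

/-- The variables hold a state, with its level reduced modulo `m`. -/
def HasState (m : ℤ) (x : ℕ × Bool × ℤ) (σ : Memory) : Prop :=
  σ 12 0 0 = x.1 ∧ σ 13 0 0 = orientSign x.2.1 ∧ σ 14 0 0 = x.2.2 % m

theorem emod_succ {m : ℤ} (hm : 0 ≤ m) (L : ℤ) :
    (L + 1) % m = if L % m + 1 < m then L % m + 1 else L % m + 1 - m := by
  rcases hm.eq_or_lt with rfl | hm
  · simp
  · have h1 := Int.emod_nonneg L hm.ne'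
    have h2 := Int.emod_lt_of_pos L hm
    rw [← Int.emod_add_emod]
    split_ifs with h
    · exact Int.emod_eq_of_lt (by omega) h
    · rw [show L % m + 1 = m by omega]
      simp

theorem emod_pred {m : ℤ} (hm : 0 ≤ m) (L : ℤ) :
    (L - 1) % m = if L % m - 1 < 0 then L % m - 1 + m else L % m - 1 := by
  rcases hm.eq_or_lt with rfl | hm
  · simp
  · have h1 := Int.emod_nonneg L hm.ne'
    have h2 := Int.emod_lt_of_pos L hm
    rw [← Int.emod_sub_emod]
    split_ifs with h
    · rw [← Int.add_emod_right]
      exact Int.emod_eq_of_lt (by omega) (by omega)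
    · exact Int.emod_eq_of_lt (by omega) (by omega)

theorem computes_nextStrand (hp : HasPerm N k w σ) (hw : ∀ g ∈ w, g.1 + 2 ≤ N) (hk : 2 * k ≤ N)
    (hB : N ≤ B) (hB1 : 1 ≤ B) {m : ℤ} (hm : 0 ≤ m) (h4 : σ 4 0 0 = m) {x : ℕ × Bool × ℤ}
    (hx : x.1 < N) (hs : HasState m x σ)
    (hL : |(stepFun k (braidPerm w) x).2.2 % m| ≤ B) : Computes B nextStrand σ 200 fun σ' =>
      HasState m (stepFun k (braidPerm w) x) σ' ∧
      ∀ n, ¬(n = 12 ∨ n = 13 ∨ n = 14 ∨ n = 15) → σ' n = σ n := by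
  have i1 : σ 0 0 1 = k := by rw [hp.input]; simp [platInput]
  obtain ⟨a, o, l⟩ := x
  obtain ⟨s1, s2, s3⟩ := hs
  simp only at s1 s2 s3 hx
  have hB0 : 0 ≤ B := by omega
  have hinv : ∀ b < N, (braidPerm w).symm b < N := fun b hb => by
    rwa [← braidPerm_lt hw, Equiv.apply_symm_apply]
  have hpa := (braidPerm_lt hw a).2 hx
  have p1 := hp.perm a hx
  have hframe : ∀ n, ¬(n = 12 ∨ n = 13 ∨ n = 14 ∨ n = 15) → exec nextStrand σ n = σ n := by
    intro n hn
    simp only [nextStrand, exec, exec_select]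
    split_ifs <;> simp (disch := omega) only [write_name_ne]
  refine Computes.of_exec ?_ (by simp [nextStrand, select, weight, IntExpr.cost]) ⟨?_, hframe⟩
  · cases o with
    | true =>
      by_cases hb : braidPerm w a < 2 * k
      · have hmt := (mate_lt (k := k)).2 hb
        have q1 := hp.mates _ hb
        have q2 := hp.inverse _ (hmt.trans_le hk)
        have q3 := hinv _ (hmt.trans_le hk)
        have hb' : ((braidPerm w a : ℕ) : ℤ) < k + k := by omega
        simp [nextStrand, Fits, exec, IntExpr.value, write_apply, s1,
          s2, orientSign, p1, i1, hb', q1, q2]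
        omega
      · have hb' : ¬ ((braidPerm w a : ℕ) : ℤ) < k + k := by omega
        have e := emod_succ hm l
        simp only [stepFun, hb, if_false] at hL
        rw [e] at hL
        simp [nextStrand, Fits, exec, fits_select hB0, IntExpr.value, write_apply, s1,
          s2, s3, orientSign, p1, i1, hb', h4]
        refine ⟨⟨hB0, ?_⟩, hL⟩
        omega
    | false =>
      by_cases hb : a < 2 * k
      · have hmt := (mate_lt (k := k)).2 hb
        have q1 := hp.mates _ hb
        have hb' : (a : ℤ) < k + k := by omega
        simp [nextStrand, Fits, IntExpr.value, s1, s2, orientSign, i1, hb', q1]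
        omega
      · have hb' : ¬ (a : ℤ) < k + k := by omega
        have q2 := hp.inverse _ hx
        have q3 := hinv _ hx
        have e := emod_pred hm l
        simp only [stepFun, hb, if_false] at hL
        rw [e] at hL
        simp [nextStrand, Fits, exec, fits_select hB0, IntExpr.value, write_apply, s1,
          s2, s3, orientSign, i1, hb', q2, h4, -sub_neg]
        refine ⟨⟨hB0, ?_⟩, by simpa [-sub_neg] using hL⟩
        omega
  · cases o with
    | true =>
      by_cases hb : braidPerm w a < 2 * k
      · have hmt := (mate_lt (k := k)).2 hb
        have q1 := hp.mates _ hb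
        have q2 := hp.inverse _ (hmt.trans_le hk)
        have hb' : ((braidPerm w a : ℕ) : ℤ) < k + k := by omega
        simp [nextStrand, HasState, exec, IntExpr.value, write_apply, s1,
          s2, s3, orientSign, p1, i1, hb', hb, q1, q2, stepFun]
      · have hb' : ¬ ((braidPerm w a : ℕ) : ℤ) < k + k := by omega
        have e := emod_succ hm l
        simp [nextStrand, HasState, exec, exec_select, IntExpr.value, write_apply, s1,
          s2, s3, orientSign, p1, i1, hb', hb, h4, stepFun, e]
    | false =>
      by_cases hb : a < 2 * k
      · have q1 := hp.mates _ hb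
        have hb' : (a : ℤ) < k + k := by omega
        simp [nextStrand, HasState, exec, IntExpr.value, write_apply, s1,
          s2, s3, orientSign, i1, hb', hb, q1, stepFun]
      · have hb' : ¬ (a : ℤ) < k + k := by omega
        have q2 := hp.inverse _ hx
        have e := emod_pred hm l
        simp [nextStrand, HasState, exec, exec_select, IntExpr.value, write_apply, s1,
          s2, s3, orientSign, i1, hb', hb, q2, h4, stepFun, e, -sub_neg]

end

section

/-! ## The program computing the writhes -/

variable {B : ℤ} {σ : Memory} {N k : ℕ} {w : List (ℕ × Bool)}

theorem abs_level_le (k : ℕ) (p : Equiv.Perm ℕ) (i : ℕ) : |(trav k p i).2.2| ≤ i := by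
  induction i with
  | zero => simp [trav_zero]
  | succ i ih =>
    rw [Nat.cast_succ, trav_succ]
    generalize trav k p (i : ℤ) = x at ih ⊢
    obtain ⟨a, o, l⟩ := x
    simp only at ih
    rw [abs_le] at *
    cases o
    · by_cases h : a < 2 * k <;> simp [stepFun, h] <;> omega
    · by_cases h : p a < 2 * k <;> simp [stepFun, h] <;> omega

theorem abs_emod_le {m L : ℤ} (hm : 0 ≤ m) (hmN : m ≤ N) (hL : |L| ≤ N) : |L % m| ≤ N := by
  rcases hm.eq_or_lt with rfl | hm
  · simpa using hL
  · have h1 := Int.emod_nonneg L hm.ne'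
    have h2 := Int.emod_lt_of_pos L hm
    rw [abs_le]
    omega

/-- Running through the knot once, and storing the orientations and the reduced levels. -/
def traverse : Program := .seq (.seq (assign 12 (.const 0)) (.seq (assign 13 (.const 1))
    (assign 14 (.const 0)))) (forLoop 9 (cell 0 (.const 0))
  (.seq (.seq (setCell 7 (var 12) (var 13)) (setCell 8 (var 12) (var 14))) nextStrand))

theorem IsKnotDiagram.trav_injOn (h : IsKnotDiagram N k w) {i j : ℕ} (hi : i < N) (hj : j < N)
    (e : (trav k (braidPerm w) i).1 = (trav k (braidPerm w) j).1) : i = j := by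
  rw [← h.index_trav hi, e, h.index_trav hj]

theorem computes_traverse (h : IsKnotDiagram N k w) (hp : HasPerm N k w σ) (hB : N ≤ B) {m : ℤ}
    (hm : 0 ≤ m) (hmN : m ≤ N) (h4 : σ 4 0 0 = m) :
    Computes B traverse σ (20 + (N * 315 + 15)) fun σ' =>
      (∀ a < N, σ' 7 0 a = orientSign (h.orient a)) ∧ (∀ a < N, σ' 8 0 a = h.level a % m) ∧
      σ' 14 0 0 = h.linking % m ∧
      ∀ n, ¬(n = 7 ∨ n = 8 ∨ n = 9 ∨ n = 12 ∨ n = 13 ∨ n = 14 ∨ n = 15) → σ' n = σ n := by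
  have hN2 := h.two_le
  have hB0 : 0 ≤ B := by omega
  have hB1 : 1 ≤ B := by omega
  have hlev : ∀ i : ℕ, i ≤ N → |(trav k (braidPerm w) i).2.2 % m| ≤ N := fun i hi =>
    abs_emod_le hm hmN ((abs_level_le k _ i).trans (by exact_mod_cast hi))
  have h1 : Computes B (.seq (assign 12 (.const 0)) (.seq (assign 13 (.const 1))
      (assign 14 (.const 0)))) σ 20 fun σ' => HasState m (trav k (braidPerm w) (0 : ℕ)) σ' ∧
      ∀ n, ¬(n = 12 ∨ n = 13 ∨ n = 14) → σ' n = σ n := by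
    refine Computes.of_exec ?_ (by simp [weight, IntExpr.cost]) ⟨?_, ?_⟩
    · simp [Fits, IntExpr.value, hB0, hB1]
    · simp [HasState, trav_zero, exec, IntExpr.value, write_apply, orientSign]
    · intro n hn
      simp only [exec]
      iterate 3 rw [write_name_ne (by omega)]
  refine Computes.seq h1 ?_
  rintro σ₁ ⟨a1, a2⟩
  have key := computes_for (B := B) (σ := σ₁) (x := 9) (n := N) (b := cell 0 (.const 0))
    (p := .seq (.seq (setCell 7 (var 12) (var 13)) (setCell 8 (var 12) (var 14))) nextStrand)
    (c := 100 + 200) (Inv := fun i σ' => HasState m (trav k (braidPerm w) i) σ' ∧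
      (∀ j < i, σ' 7 0 (trav k (braidPerm w) j).1 = orientSign (trav k (braidPerm w) j).2.1 ∧
        σ' 8 0 (trav k (braidPerm w) j).1 = (trav k (braidPerm w) j).2.2 % m) ∧
      ∀ n, ¬(n = 7 ∨ n = 8 ∨ n = 9 ∨ n = 12 ∨ n = 13 ∨ n = 14 ∨ n = 15) → σ' n = σ n) hB ?_ ?_ ?_ ?_
  · refine key.mono le_rfl ?_
    rintro σ' ⟨b1, b2, b3⟩
    refine ⟨fun a ha => ?_, fun a ha => ?_, b1.2.2, b3⟩
    · obtain ⟨i1, i2⟩ := h.index_spec ha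
      have := (b2 _ i1).1
      rwa [i2] at this
    · obtain ⟨i1, i2⟩ := h.index_spec ha
      have := (b2 _ i1).2
      rwa [i2] at this
  · rintro i σ' v ⟨b1, b2, b3⟩
    refine ⟨?_, fun j hj => ?_, fun n hn => ?_⟩
    · unfold HasState at *
      simpa [write_apply] using b1
    · simpa [write_apply] using b2 j hj
    · rw [write_name_ne (by omega), b3 n hn]
  · rintro i σ' ⟨b1, b2, b3⟩
    simp only [IntExpr.value]
    rw [b3 0 (by omega), hp.input]
    simp [platInput]
  · rintro i hi σ' ⟨⟨s1, s2, s3⟩, b2, b3⟩ hx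
    have hlt := h.trav_lt i
    have hst : Computes B (.seq (setCell 7 (var 12) (var 13)) (setCell 8 (var 12) (var 14))) σ' 100
        fun σ₂ => (∀ j < i + 1,
          σ₂ 7 0 (trav k (braidPerm w) j).1 = orientSign (trav k (braidPerm w) j).2.1 ∧
          σ₂ 8 0 (trav k (braidPerm w) j).1 = (trav k (braidPerm w) j).2.2 % m) ∧
          ∀ n, ¬(n = 7 ∨ n = 8) → σ₂ n = σ' n := by
      refine Computes.of_exec ?_ (by simp [weight, IntExpr.cost]) ⟨?_, ?_⟩
      · have h2 := (hlev i hi.le).trans hB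
        have h3 : |orientSign (trav k (braidPerm w) i).2.1| ≤ B := by
          refine le_trans ?_ hB1
          cases (trav k (braidPerm w) i).2.1 <;> simp [orientSign]
        have h4 : |((trav k (braidPerm w) i).1 : ℤ)| ≤ B := by
          rw [abs_of_nonneg (by positivity)]
          omega
        simp [Fits, exec, IntExpr.value, write_apply, s1, s2, s3, hB0, h2, h3]
        omega
      · intro j hj
        simp only [exec, IntExpr.value, write_apply, s1, s2, s3]
        norm_num
        rcases Nat.lt_succ_iff_lt_or_eq.1 hj with hj | rfl
        · have hne : (trav k (braidPerm w) j).1 ≠ (trav k (braidPerm w) i).1 := fun e =>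
            absurd (h.trav_injOn (hj.trans hi) hi e) hj.ne
          simp only [hne, if_false]
          exact b2 j hj
        · simp
      · intro n hn
        simp only [exec]
        iterate 2 rw [write_name_ne (by omega)]
    refine Computes.seq hst ?_
    rintro σ₂ ⟨c1, c2⟩
    have hnext : stepFun k (braidPerm w) (trav k (braidPerm w) i) =
        trav k (braidPerm w) ((i + 1 : ℕ) : ℤ) := by rw [Nat.cast_succ, trav_succ]
    refine (computes_nextStrand (m := m) (hp.congr (σ' := σ₂) fun n hn => by
      rw [c2 n (by omega), b3 n (by omega)]) h.word_le h.plat_le hB hB1 hm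
      (by rw [c2 4 (by omega), b3 4 (by omega), h4]) hlt
      ⟨by rw [c2 12 (by omega), s1], by rw [c2 13 (by omega), s2], by rw [c2 14 (by omega), s3]⟩
      (by rw [hnext]; exact (hlev _ hi).trans hB)).mono le_rfl ?_
    rintro σ₃ ⟨d1, d2⟩
    rw [hnext] at d1
    refine ⟨⟨d1, fun j hj => ?_, fun n hn => ?_⟩, ?_⟩
    · rw [d2 7 (by omega), d2 8 (by omega)]
      exact c1 j hj
    · rw [d2 n (by omega), c2 n (by omega), b3 n hn]
    · rw [d2 9 (by omega), c2 9 (by omega), hx]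
  · refine ⟨a1, fun j hj => absurd hj (Nat.not_lt_zero j), fun n hn => a2 n (by omega)⟩

/-- The program computing the writhes. -/
def writheProgram : Program := .seq prepare (.seq traverse
  (.seq (select 4 (var 14) (.const 0) (.minus (.const 0) (var 14)) (var 14))
    (.seq traverse recordWord)))

/-! ### The sums of the signs of the crossings -/

theorem reduced_emod {m : ℤ} (hm : 0 ≤ m) (a b : ℤ) : reduced m (a % m - b % m) = (a - b) % m := by
  unfold reduced
  rcases hm.eq_or_lt with rfl | hm
  · simp
  · have h1 := Int.emod_nonneg a hm.ne'
    have h2 := Int.emod_lt_of_pos a hm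
    have h3 := Int.emod_nonneg b hm.ne'
    have h4 := Int.emod_lt_of_pos b hm
    rw [Int.sub_emod a b]
    split_ifs with h
    · rw [← Int.add_emod_right (a % m - b % m)]
      exact (Int.emod_eq_of_lt (by omega) (by omega)).symm
    · exact (Int.emod_eq_of_lt (by omega) (by omega)).symm

theorem eq_emod_iff {l x y : ℤ} (hx : l ≠ 0 → 0 ≤ x ∧ x < |l|) :
    x = y % |l| ↔ (y : ZMod l.natAbs) = x := by
  have e : ((l.natAbs : ℕ) : ℤ) = |l| := Int.natCast_natAbs l
  rw [ZMod.intCast_eq_intCast_iff, Int.ModEq, e]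
  have hxx : x % |l| = x := by
    rcases eq_or_ne l 0 with rfl | hl
    · simp
    · exact Int.emod_eq_of_lt (hx hl).1 (hx hl).2
  rw [hxx]
  exact eq_comm

theorem sum_codes (F : CrossCode → ℤ) : ∑ c ∈ codes N w, F c = ∑ t ∈ Finset.range w.length,
    ∑ s ∈ Finset.range N, ∑ r ∈ Finset.range N, ∑ k : CrossKind, ∑ f : Bool,
      if ValidCross N (gen w t).1 r s k then F (t, r, s, k, f) else 0 := by
  unfold codes
  rw [Finset.sum_filter, Finset.sum_product]
  refine Finset.sum_congr rfl fun t _ => ?_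
  simp only [Finset.sum_product, Fintype.sum_prod_type]
  exact Finset.sum_comm

variable (h : IsKnotDiagram N k w)
include h

/-- The result of the program. -/
theorem IsKnotDiagram.holdsWrithes (hm : σ 4 0 0 = |h.linking|)
    (hσ : ∀ n x y, n = 1 ∨ n = 2 ∨ n = 3 → σ n x y = ∑ t ∈ Finset.range w.length,
      ∑ s ∈ Finset.range N, ∑ r ∈ Finset.range N, ∑ k,
        contribution N (fun b => orientSign (h.orient (strandAt w t b)))
          (fun b => h.level (strandAt w t b) % |h.linking|) |h.linking| (gen w t).1 (gen w t).2 r s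
            n x y k) : HoldsWrithes h.knot σ := by
  have hlk : h.knot.lk = h.linking := rfl
  set p : ℤ → ℤ → CrossCode → Prop := fun x y c =>
    ((h.codeMarking c).1 : ZMod h.knot.lk.natAbs) = x ∧ ((h.codeMarking c).2 : ZMod h.knot.lk.natAbs) = y
    with hp
  have key : ∀ n x y, n = 1 ∨ n = 2 ∨ n = 3 →
      (h.knot.lk ≠ 0 → (0 ≤ x ∧ x < |h.knot.lk|) ∧ (0 ≤ y ∧ y < |h.knot.lk|)) →
      σ n x y = ∑ c ∈ codes N w, ((if p x y c then h.codeSign c else 0) +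
        if n = 1 ∧ p y x c then h.codeSign c else 0) := by
    intro n x y hn hxy
    rw [hσ n x y hn, sum_codes]
    refine Finset.sum_congr rfl fun t _ => Finset.sum_congr rfl fun s _ =>
      Finset.sum_congr rfl fun r _ => Finset.sum_congr rfl fun kd _ => ?_
    unfold contribution
    refine Finset.sum_congr rfl fun f _ => ?_
    congr 1
    have hs : ∀ a b c d e : ℤ, a * b * (c * d * e) = a * b * (c * d) * e := fun _ _ _ _ _ => by ring
    unfold event
    simp only [reduced_emod (abs_nonneg _), hs]
    rw [← hlk]
    simp only [eq_emod_iff fun hl => (hxy hl).1, eq_emod_iff fun hl => (hxy hl).2]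
    have e1 : (n = 1 ∧ p y x (t, r, s, kd, f)) ↔ (n = 1 ∧
        ((h.codeMarking (t, r, s, kd, f)).2 : ZMod h.knot.lk.natAbs) = x ∧
        ((h.codeMarking (t, r, s, kd, f)).1 : ZMod h.knot.lk.natAbs) = y) := by
      simp only [hp]
      tauto
    rw [if_congr e1 rfl rfl]
    rfl
  have ordered : ∀ n x y, n = 2 ∨ n = 3 →
      (h.knot.lk ≠ 0 → (0 ≤ x ∧ x < |h.knot.lk|) ∧ (0 ≤ y ∧ y < |h.knot.lk|)) →
      σ n x y = h.knot.orderedWrithe x y := by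
    intro n x y hn hxy
    unfold AxisKnot.orderedWrithe
    have := h.finsum_crossingSign fun α β => α = x ∧ β = y
    rw [this, key n x y (Or.inr hn) hxy]
    refine Finset.sum_congr rfl fun c _ => ?_
    rw [if_neg (c := n = 1 ∧ _) (by omega), add_zero]
  refine ⟨hm, fun x y hxy hne => ⟨?_, ordered 2 x y (by simp) hxy⟩, fun x hx =>
    ordered 3 x x (by simp) fun hl => ⟨hx hl, hx hl⟩⟩
  unfold AxisKnot.unorderedWrithe
  have := h.finsum_crossingSign fun α β => (α = x ∧ β = y) ∨ (α = y ∧ β = x)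
  rw [this, key 1 x y (by simp) hxy]
  refine Finset.sum_congr rfl fun c _ => ?_
  have hxy' : (x : ZMod h.knot.lk.natAbs) ≠ y := by
    intro e
    have hx' : x = x % |h.knot.lk| := (eq_emod_iff fun hl => (hxy hl).1).2 rfl
    have hy' : x = y % |h.knot.lk| := (eq_emod_iff fun hl => (hxy hl).1).2 e.symm
    have hy'' : y = y % |h.knot.lk| := (eq_emod_iff fun hl => (hxy hl).2).2 rfl
    exact hne (hy'.trans hy''.symm)
  simp only [hp, true_and]
  by_cases h1 : ((h.codeMarking c).1 : ZMod h.knot.lk.natAbs) = x ∧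
      ((h.codeMarking c).2 : ZMod h.knot.lk.natAbs) = y
  · have h2 : ¬(((h.codeMarking c).1 : ZMod h.knot.lk.natAbs) = y ∧
        ((h.codeMarking c).2 : ZMod h.knot.lk.natAbs) = x) := fun h2 => hxy' (h1.1.symm.trans h2.1)
    rw [if_pos h1, if_neg h2, if_pos (Or.inl h1), add_zero]
  · by_cases h2 : ((h.codeMarking c).1 : ZMod h.knot.lk.natAbs) = y ∧
        ((h.codeMarking c).2 : ZMod h.knot.lk.natAbs) = x
    · rw [if_neg h1, if_pos h2, if_pos (Or.inr h2), zero_add]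
    · rw [if_neg h1, if_neg h2, if_neg (by tauto), add_zero]

theorem IsKnotDiagram.computes_writheProgram (hB : 2 * N + 2 ≤ B) (hl : 12 * N * N * w.length ≤ B)
    (hlB : w.length ≤ B) : Computes B writheProgram (platInput N k w)
      ((20 + ((k * 65 + 15) + ((N * 25 + 15) + ((w.length * 135 + 15) + (N * 35 + 15))))) +
        ((20 + (N * 315 + 15)) + (50 + ((20 + (N * 315 + 15)) +
          (w.length * (N * (N * 2815 + 30) + 210) + 15))))) (HoldsWrithes h.knot) := by
  have hN2 := h.two_le
  have hB0 : 0 ≤ B := by omega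
  have hlk : |h.linking| ≤ N := abs_level_le k _ N
  have zero : ∀ n x y, n ≠ 0 → platInput N k w n x y = 0 := by
    intro n x y hn
    simp [platInput, hn]
  refine Computes.seq (computes_prepare h.word_le h.plat_le (by omega) (by omega) hlB rfl
    fun x y => zero 31 x y (by norm_num)) ?_
  rintro σ₁ ⟨a1, a2⟩
  refine Computes.seq (computes_traverse h a1 (by omega) (m := 0) le_rfl (by omega)
    (by rw [a2 4 (by simp), zero 4 _ _ (by norm_num)])) ?_
  rintro σ₂ ⟨-, -, b3, b4⟩
  rw [Int.emod_zero] at b3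
  have hsel : Computes B (select 4 (var 14) (.const 0) (.minus (.const 0) (var 14)) (var 14)) σ₂ 50
      fun σ' => σ' 4 0 0 = |h.linking| ∧ ∀ n, n ≠ 4 → σ' n = σ₂ n := by
    have e : (if h.linking < 0 then 0 - h.linking else h.linking) = |h.linking| := by
      split_ifs with c
      · rw [abs_of_neg c]; ring
      · rw [abs_of_nonneg (not_lt.1 c)]
    refine Computes.of_exec ?_ (by simp [select, weight, IntExpr.cost]) ⟨?_, ?_⟩
    · rw [fits_select hB0]
      simp only [IntExpr.value, b3, e, abs_abs]
      omega
    · rw [exec_select]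
      simp only [IntExpr.value, b3, e, write_apply]
      simp
    · intro n hn
      rw [exec_select, write_name_ne hn]
  refine Computes.seq hsel ?_
  rintro σ₃ ⟨c1, c2⟩
  have p3 : HasPerm N k w σ₃ := a1.congr fun n hn => by rw [c2 n (by omega), b4 n (by omega)]
  refine Computes.seq (computes_traverse h p3 (by omega) (abs_nonneg _) hlk c1) ?_
  rintro σ₄ ⟨d1, d2, -, d4⟩
  have hlev : ∀ a < N, |h.level a % (|h.linking|)| ≤ N := by
    intro a ha
    have hi := (h.index_spec ha).1
    exact abs_emod_le (abs_nonneg _) hlk ((abs_level_le k _ _).trans (by exact_mod_cast hi.le))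
  refine (computes_recordWord (k := k) (o := fun a => orientSign (h.orient a))
    (L := fun a => h.level a % |h.linking|) (m := |h.linking|) h.word_le
    ⟨by rw [d4 4 (by omega), c1], d1, d2, by rw [d4 31 (by omega)]; exact p3.table⟩ ?_ ?_ ?_ hB hl
    hlB ?_ ?_).mono le_rfl ?_
  · intro b _
    cases h.orient b <;> simp [orientSign]
  · intro a ha b hb
    rw [reduced_emod (abs_nonneg _)]
    have h1 := hlev a ha
    have h2 := hlev b hb
    rcases eq_or_ne h.linking 0 with e | e
    · rw [e] at h1 h2 ⊢
      simp only [abs_zero, Int.emod_zero] at h1 h2 ⊢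
      rw [abs_le] at *
      omega
    · have h3 := Int.emod_nonneg (h.level a - h.level b) (abs_pos.2 e).ne'
      have h4 := Int.emod_lt_of_pos (h.level a - h.level b) (abs_pos.2 e)
      rw [abs_of_nonneg h3]
      omega
  · intro a ha
    exact (hlev a ha).trans (by omega)
  · rw [d4 0 (by omega)]
    exact p3.input
  · intro n x y hn
    rw [d4 n (by omega), c2 n (by omega), b4 n (by omega), a2 n (by omega), zero n x y (by omega)]
  · rintro σ₅ ⟨e1, e2⟩
    exact h.holdsWrithes (by rw [e2, d4 4 (by omega), c1]) e1

end

end PlatTrace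

end

/-- There are an elementary tangle for each letter, a program and a constant `C` such that the
following holds for each braid word on `N = 2n + 1` (or `2n`) strands of length `l ≥ 1` whose plat
diagram with `k` minima and `k` maxima is the diagram of a knot (`k = n` is the usual plat, `k = 0` is
the closed braid). The tangles of the letters of the diagram glue to a knot in general position, its
trace graph is glued of the trace graphs of these tangles, and the program computes all writhes of
this knot in at most `C l n²` steps. -/
theorem lemma2p4 :
    ∃ (tangle : ℕ → PlatLetter → Set (ℝ × ℝ × ℝ)) (program : Program) (C : ℕ),
      (∀ (N : ℕ) (x : PlatLetter), x.Valid N → IsElementaryTangle N x (tangle N x)) ∧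
      (∀ (N i : ℕ) (s : Bool), i + 2 ≤ N →
        (tripleVertices (tangle N (.cross i s))).encard = ((2 * (N - 2) : ℕ) : ℕ∞)) ∧
      (∀ N c : ℕ, 2 * c + 2 ≤ N →
        tripleVertices (tangle N (.birth c)) = ∅ ∧ tripleVertices (tangle N (.death c)) = ∅) ∧
      ∀ (n N k : ℕ) (w : List (ℕ × Bool)),
        N = 2 * n + 1 ∨ N = 2 * n →
        2 * k ≤ N →
        w ≠ [] →
        (∀ g ∈ w, g.1 + 2 ≤ N) →
        IsKnotPlat N k w →
        ∃ K : AxisKnot,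
          K.carrier = glueTangles ((platLetters k w).map (tangle N)) ∧
          K.InGeneralPosition ∧
          K.traceGraph =
            glueBlocks ((platLetters k w).map fun x => traceBlock (tangle N x)) ∧
          ∃ (T : ℕ) (σ : Memory),
            Runs ((C * w.length * n ^ 2 : ℕ) : ℤ) program (platInput N k w) T σ ∧
            T ≤ C * w.length * n ^ 2 ∧
            HoldsWrithes K σ := by
  refine ⟨PlatTrace.elemTangle, PlatTrace.writheProgram, 100000,
    PlatTrace.isElementaryTangle_elemTangle, fun N i s hi => PlatTrace.tripleVertices_cross hi s,
    fun N c hc => ⟨PlatTrace.tripleVertices_eq_empty (PlatTrace.noParallel_birth hc),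
      PlatTrace.tripleVertices_eq_empty (PlatTrace.noParallel_death hc)⟩, ?_⟩
  intro n N k w hn hk hne hw hconn
  have h : PlatTrace.IsKnotDiagram N k w := ⟨hk, hw, hne, hconn⟩
  refine ⟨h.knot, h.carrier_eq, h.inGeneralPosition, h.traceGraph_eq, ?_⟩
  have hN2 := h.two_le
  have hn1 : 1 ≤ n := by omega
  have hN3 : N ≤ 3 * n := by omega
  have hl1 : 1 ≤ w.length := List.length_pos_of_ne_nil hne
  have e1 : w.length ≤ w.length * n ^ 2 := Nat.le_mul_of_pos_right _ (by positivity)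
  have e2 : n ≤ w.length * n ^ 2 := (Nat.le_self_pow two_ne_zero n).trans (Nat.le_mul_of_pos_left _ hl1)
  have e3 : w.length * (N * N) ≤ 9 * (w.length * n ^ 2) := by
    calc w.length * (N * N) ≤ w.length * (3 * n * (3 * n)) := by gcongr
      _ = _ := by ring
  have e4 : w.length * N ≤ w.length * (N * N) := by
    gcongr
    nlinarith
  have e5 : 1 ≤ w.length * n ^ 2 := hl1.trans e1
  obtain ⟨T, σ, h1, h2, h3⟩ := h.computes_writheProgram (B := ((100000 * w.length * n ^ 2 : ℕ) : ℤ))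
    (by norm_cast; rw [mul_assoc 100000]; omega)
    (by
      norm_cast
      calc 12 * N * N * w.length = 12 * (w.length * (N * N)) := by ring
        _ ≤ 100000 * (w.length * n ^ 2) := by omega
        _ = _ := by ring)
    (by norm_cast; rw [mul_assoc 100000]; omega)
  refine ⟨T, σ, h1, h2.trans ?_, h3⟩
  have e6 : w.length * (N * (N * 2815 + 30) + 210) =
      2815 * (w.length * (N * N)) + 30 * (w.length * N) + 210 * w.length := by ring
  rw [e6, mul_assoc 100000]
  omega
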